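/- Work with $\mathbb Z$-graded vector spaces over a field $k$ of characteristic zero. Let $(V,m)$ be an $L_\infty$ algebra: $V$ is homologically graded and carries graded symmetric brackets $\ell_n:(\Sigma V)^{\otimes n}\to\Sigma V$, $n\ge 1$, of degree $-1$ ($\ell_1$ is the differential of $\Sigma V$, $\ell_n=m_n$ for $n\ge2$) satisfying the generalized Jacobi identities; equivalently, $m+d$ is a square-zero continuous derivation of $\hat S\Sigma^{-1}V^*$ without constant term. Let $A=\varprojlim A_j$ be a formal cdga, i.e. an inverse limit of finite-dimensional nilpotent (non-unital, cohomologically graded) cdgas, and let $\tilde A=A\oplus k$ be obtained from $A$ by adjoining a unit. Tensor products are completed, $A\otimes V=\varprojlim A_j\otimes V$ and $\tilde A\otimes V=\varprojlim \tilde A_j\otimes V$, and carry the $A$-linear, respectively $\tilde A$-linear, extension of the brackets of $V$, again denoted $\ell_n$. An MC element $\xi\in \mathrm{MC}(V,A)$ is an element $\xi\in(A\otimes\Sigma V)_0$ with $\sum_{i\ge1}\frac1{i!}\ell_i(\xi,\dots,\xi)=0$. Two elements $\xi,\eta\in\mathrm{MC}(V,A)$ are homotopic if there is an MC element $h$ of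 $V$ with coefficients in $A[z,dz]=A\otimes k[z,dz]$, where $|z|=0$ and $|dz|=1$, such that $h|_{z=0}=\xi$ and $h|_{z=1}=\eta$. The twistings $(A\otimes V)^\xi$ and $(\tilde A\otimes V)^\xi$ are $A\otimes V$ and $\tilde A\otimes V$ with the brackets $$\ell^\xi_n(x_1,\dots,x_n)=\sum_{i\ge0}\frac1{i!}\,\ell_{n+i}(\xi,\dots,\xi,x_1,\dots,x_n).$$ **Proposition.** Let $(V,m)$ be an $L_\infty$ algebra, $A$ a formal cdga, and $\xi,\eta$ two homotopic elements of $\mathrm{MC}(V,A)$. Then: 1. $(\tilde A\otimes V)^\xi$ and $(\tilde A\otimes V)^\eta$ are $L_\infty$ algebras, and they are $L_\infty$ isomorphic. 2. $(A\otimes V)^\xi$ and $(A\otimes V)^\eta$ are $L_\infty$ algebras, and they are $L_\infty$ isomorphic. Here an $L_\infty$ isomorphism is an $L_\infty$ morphism whose linear component is bijective in each degree. In both cases it can be chosen such that its components are $\tilde A$-multilinear and continuous, and the inverse of its linear component is continuous. -/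

import Mathlib

open scoped TensorProduct

universe u v w x y

namespace MCTwist

noncomputable section

/-! ## Signs and graded vector spaces

A graded vector space is a vector space `M` with a family `𝒲 : ℤ → Submodule K M` of homogeneous
components.  All laws below are laws about homogeneous elements. -/

section Signs

/-- The Koszul sign of the stable sorting of a product `x₀ x₁ ⋯ xₙ₋₁` of homogeneous elements of
degrees `d` by increasing value of the label `b`: every pair of factors that changes its order
contributes `(-1) ^ (d i * d j)`. -/
def koszulSign {α : Type*} [LinearOrder α] {n : ℕ} (d : Fin n → ℤ) (b : Fin n → α) : ℤ :=
  ∏ i, ∏ j, if i < j ∧ b j < b i then ((d i * d j).negOnePow : ℤ) else 1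

/-- The subfamily `(xᵢ)`, `i ∈ S`, in increasing order of the indices. -/
def subfamily {X : Type*} {n : ℕ} (x : Fin n → X) (S : Finset (Fin n)) : Fin S.card → X :=
  fun i => x (S.orderEmbOfFin rfl i)

variable {K : Type u} [Field K] {M : Type v} [AddCommGroup M] [Module K M]

/-- The linear map that multiplies the component of degree `i` by `ε i`. -/
def signMap (𝒲 : ℤ → Submodule K M) [DirectSum.Decomposition 𝒲] (ε : ℤ → ℤˣ) : M →ₗ[K] M :=
  DirectSum.toModule K ℤ M (fun i => (ε i : ℤ) • (𝒲 i).subtype) ∘ₗ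
    (DirectSum.decomposeLinearEquiv 𝒲).toLinearMap

/-- The even part of a vector with respect to a parity involution `s`. -/
def evenPart (s : M →ₗ[K] M) : M →ₗ[K] M := (2 : K)⁻¹ • (LinearMap.id + s)

/-- The odd part of a vector with respect to a parity involution `s`. -/
def oddPart (s : M →ₗ[K] M) : M →ₗ[K] M := (2 : K)⁻¹ • (LinearMap.id - s)

/-- The suspension of a homologically graded space, `(ΣV)_i = V_{i-1}`. -/
def susp (𝒱 : ℤ → Submodule K M) : ℤ → Submodule K M := fun i => 𝒱 (i - 1)

end Signs

/-! ## `L∞` algebras -/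

section LInfty

variable {K : Type u} [Field K]
variable {W : Type v} [AddCommGroup W] [Module K W] {W' : Type w} [AddCommGroup W'] [Module K W']

/-- The `n`-ary brackets of an `L∞` structure, as operations on the suspension `W = ΣV`.
The unary one is the differential. -/
abbrev Brackets (K : Type u) [Field K] (W : Type v) [AddCommGroup W] [Module K W] :=
  ∀ n : ℕ, MultilinearMap K (fun _ : Fin n => W) W

/-- The brackets `ℓ` form an `L∞` structure on `V`, where `𝒲` is the grading of `W = ΣV`: they are
graded symmetric of degree `-1`, there is no bracket without arguments, and the generalized Jacobi
identities hold (the sum over `S` is the sum over unshuffles). -/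
structure IsLInfty (𝒲 : ℤ → Submodule K W) (ℓ : Brackets K W) : Prop where
  zero : ∀ x : Fin 0 → W, ℓ 0 x = 0
  degree : ∀ (n : ℕ) (d : Fin n → ℤ) (x : Fin n → W), (∀ i, x i ∈ 𝒲 (d i)) →
    ℓ n x ∈ 𝒲 ((∑ i, d i) - 1)
  symm : ∀ (n : ℕ) (d : Fin n → ℤ) (x : Fin n → W), (∀ i, x i ∈ 𝒲 (d i)) →
    ∀ σ : Equiv.Perm (Fin n), ℓ n x = koszulSign d σ.symm • ℓ n (x ∘ σ)
  jacobi : ∀ (n : ℕ) (d : Fin n → ℤ) (x : Fin n → W), (∀ i, x i ∈ 𝒲 (d i)) →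
    ∑ S : Finset (Fin n), koszulSign d (fun i => if i ∈ S then 0 else 1) •
      ℓ (Sᶜ.card + 1) (Fin.cons (ℓ S.card (subfamily x S)) (subfamily x Sᶜ)) = 0

/-- The components of an `L∞` morphism, as operations from `W = ΣV` to `W' = ΣV'`. -/
abbrev Components (K : Type u) [Field K] (W : Type v) [AddCommGroup W] [Module K W]
    (W' : Type w) [AddCommGroup W'] [Module K W'] :=
  ∀ n : ℕ, MultilinearMap K (fun _ : Fin n => W) W'

/-- The `φ n` are the components of an `L∞` morphism.  In `compat` the label `b` runs over the
ordered partitions of the arguments into `k` blocks; empty blocks contribute `0` by `zero`. -/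
structure IsLInftyHom (𝒲 : ℤ → Submodule K W) (ℓ : Brackets K W)
    (𝒲' : ℤ → Submodule K W') (ℓ' : Brackets K W') (φ : Components K W W') : Prop where
  zero : ∀ x : Fin 0 → W, φ 0 x = 0
  degree : ∀ (n : ℕ) (d : Fin n → ℤ) (x : Fin n → W), (∀ i, x i ∈ 𝒲 (d i)) →
    φ n x ∈ 𝒲' (∑ i, d i)
  symm : ∀ (n : ℕ) (d : Fin n → ℤ) (x : Fin n → W), (∀ i, x i ∈ 𝒲 (d i)) →
    ∀ σ : Equiv.Perm (Fin n), φ n x = koszulSign d σ.symm • φ n (x ∘ σ)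
  compat : ∀ (n : ℕ) (d : Fin n → ℤ) (x : Fin n → W), (∀ i, x i ∈ 𝒲 (d i)) →
    ∑ S : Finset (Fin n), koszulSign d (fun i => if i ∈ S then 0 else 1) •
      φ (Sᶜ.card + 1) (Fin.cons (ℓ S.card (subfamily x S)) (subfamily x Sᶜ)) =
    ∑ k ∈ Finset.range (n + 1), ((k.factorial : K))⁻¹ • ∑ b : Fin n → Fin k,
      koszulSign d b • ℓ' k (fun a => φ (Finset.univ.filter (fun i => b i = a)).card
        (subfamily x (Finset.univ.filter (fun i => b i = a))))

/-- An `L∞` isomorphism: an `L∞` morphism whose linear component is bijective in each degree. -/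
structure IsLInftyIso (𝒲 : ℤ → Submodule K W) (ℓ : Brackets K W)
    (𝒲' : ℤ → Submodule K W') (ℓ' : Brackets K W') (φ : Components K W W') : Prop where
  hom : IsLInftyHom 𝒲 ℓ 𝒲' ℓ' φ
  bijOn : ∀ i, Set.BijOn (fun t => φ 1 (fun _ => t)) (𝒲 i) (𝒲' i)

/-- An `L∞` structure on the homologically graded vector space `V`. -/
structure LInftyAlgebra (K : Type u) [Field K] (V : Type v) [AddCommGroup V] [Module K V] where
  /-- the grading `V_i` of `V` -/
  grading : ℤ → Submodule K V
  [decomposition : DirectSum.Decomposition grading]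
  /-- the brackets on `ΣV` -/
  bracket : Brackets K V
  isLInfty : IsLInfty (susp grading) bracket

attribute [instance] LInftyAlgebra.decomposition

/-- The parity involution of `ΣV`. -/
def LInftyAlgebra.parity {V : Type v} [AddCommGroup V] [Module K V] (L : LInftyAlgebra K V) :
    V →ₗ[K] V :=
  signMap L.grading (fun i => (i + 1).negOnePow)

end LInfty

/-! ## Commutative differential graded algebras -/

/-- A unital cohomologically graded cdga. -/
structure CDGA (K : Type u) [Field K] where
  carrier : Type w
  [ring : Ring carrier]
  [algebra : Algebra K carrier]
  grading : ℤ → Submodule K carrier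
  [graded : GradedAlgebra grading]
  d : carrier →ₗ[K] carrier
  d_mem : ∀ (i : ℤ) (a : carrier), a ∈ grading i → d a ∈ grading (i + 1)
  d_d : ∀ a, d (d a) = 0
  graded_comm : ∀ (i j : ℤ) (a b : carrier), a ∈ grading i → b ∈ grading j →
    a * b = ((i * j).negOnePow : ℤ) • (b * a)
  leibniz : ∀ (i : ℤ) (a b : carrier), a ∈ grading i →
    d (a * b) = d a * b + (i.negOnePow : ℤ) • (a * d b)

attribute [instance] CDGA.ring CDGA.algebra CDGA.graded

/-- The parity involution of a cdga. -/
def CDGA.parity {K : Type u} [Field K] (B : CDGA.{u, w} K) : B.carrier →ₗ[K] B.carrier :=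
  signMap B.grading Int.negOnePow

/-! ## Extension of scalars -/

section Extension

variable {K : Type u} [Field K] {W : Type v} [AddCommGroup W] [Module K W]

/-- The grading of `B ⊗ W`, for `B` cohomologically and `W` homologically graded. -/
def tensorGrading {B : Type w} [AddCommGroup B] [Module K B] (ℬ : ℤ → Submodule K B)
    (𝒲 : ℤ → Submodule K W) (n : ℤ) : Submodule K (B ⊗[K] W) :=
  ⨆ i : ℤ, Submodule.map₂ (TensorProduct.mk K B W) (ℬ i) (𝒲 (n + i))

/-- For a map `F : W → X` to a space with an operation `m` of `B` and an involution `σ`, the map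
`B ⊗ W → X` that sends `a ⊗ w` to `m a (F w)` for even `w` and to `m a (σ (F w))` for odd `w`;
`t` is the parity involution of `W`. -/
def koszulStep {B : Type w} [AddCommMonoid B] [Module K B] {X : Type y}
    [AddCommMonoid X] [Module K X] (m : B →ₗ[K] X →ₗ[K] X) (σ : X →ₗ[K] X) (t : W →ₗ[K] W) :
    (W →ₗ[K] X) →ₗ[K] (B ⊗[K] W →ₗ[K] X) where
  toFun F := TensorProduct.lift (m.flip ∘ₗ (F ∘ₗ evenPart t + σ ∘ₗ F ∘ₗ oddPart t)).flip
  map_add' F G := by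
    refine TensorProduct.ext' fun a w => ?_
    simp [add_add_add_comm]
  map_smul' c F := by
    refine TensorProduct.ext' fun a w => ?_
    simp

/-- Left multiplication by `B` on multilinear maps with values in `B ⊗ U`. -/
def leftMul {B : Type w} [Ring B] [Algebra K B] (T : Type x) [AddCommGroup T] [Module K T]
    (U : Type y) [AddCommGroup U] [Module K U] (n : ℕ) :
    B →ₗ[K] MultilinearMap K (fun _ : Fin n => T) (B ⊗[K] U) →ₗ[K]
      MultilinearMap K (fun _ : Fin n => T) (B ⊗[K] U) where
  toFun a := ((LinearMap.mulLeft K a).rTensor U).compMultilinearMapₗ K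
  map_add' a b := by
    ext f v
    simp only [LinearMap.compMultilinearMapₗ_apply, LinearMap.compMultilinearMap_apply,
      LinearMap.add_apply, add_apply]
    rw [← LinearMap.add_apply, ← LinearMap.rTensor_add]
    congr 2
    ext; simp [add_mul]
  map_smul' c a := by
    ext f v
    simp only [LinearMap.compMultilinearMapₗ_apply, LinearMap.compMultilinearMap_apply,
      LinearMap.smul_apply, smul_apply, RingHom.id_apply]
    rw [← LinearMap.smul_apply, ← LinearMap.rTensor_smul]
    congr 2
    ext; simp

/-- The multilinear map `(a₁ ⊗ w₁, …, aₙ ⊗ wₙ) ↦ ± a₁ ⋯ aₙ ⊗ ℓ (w₁, …, wₙ)`, where the sign comes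
from moving each `aⱼ` to the left past the `wᵢ` with `i < j`; `s` and `t` are the parity
involutions of `B` and `W`. -/
def extendMultilinear {B : Type w} [Ring B] [Algebra K B] (s : B →ₗ[K] B) (t : W →ₗ[K] W)
    (U : Type y) [AddCommGroup U] [Module K U] : ∀ n : ℕ,
    MultilinearMap K (fun _ : Fin n => W) U →ₗ[K]
      MultilinearMap K (fun _ : Fin n => B ⊗[K] W) (B ⊗[K] U)
  | 0 =>
    { toFun := fun ℓ => MultilinearMap.constOfIsEmpty K _ (1 ⊗ₜ[K] ℓ ![])
      map_add' := fun ℓ ℓ' => by ext; simp [TensorProduct.tmul_add]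
      map_smul' := fun c ℓ => by ext; simp }
  | n + 1 =>
    (multilinearCurryLeftEquiv K (fun _ : Fin (n + 1) => B ⊗[K] W) (B ⊗[K] U)).symm.toLinearMap ∘ₗ
      koszulStep (leftMul (B ⊗[K] W) U n) ((s.rTensor U).compMultilinearMapₗ K) t ∘ₗ
      LinearMap.compRight K (extendMultilinear s t U n) ∘ₗ
      (multilinearCurryLeftEquiv K (fun _ : Fin (n + 1) => W) U).toLinearMap

/-- The brackets that consist of a unary operation only. -/
def unaryBracket (f : W →ₗ[K] W) : Brackets K W
  | 1 => MultilinearMap.ofSubsingleton K W W (0 : Fin 1) f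
  | _ => 0

/-- Extension of scalars of the brackets `ℓ` on `W` to `B ⊗ W`:
`(a₁ ⊗ w₁, …, aₙ ⊗ wₙ) ↦ ± a₁ ⋯ aₙ ⊗ ℓₙ (w₁, …, wₙ)` with the Koszul sign, where also `ℓₙ`, of
degree `-1`, moves past `a₁ ⋯ aₙ`; the differential of `B` is added to the unary bracket. -/
def extendBrackets (B : CDGA.{u, w} K) (t : W →ₗ[K] W) (ℓ : Brackets K W) :
    Brackets K (B.carrier ⊗[K] W) := fun n =>
  (B.parity.rTensor W).compMultilinearMap (extendMultilinear B.parity t W n (ℓ n)) +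
    unaryBracket (B.d.rTensor W) n

end Extension

/-! ## The cdga `K[z, dz]` -/

section Interval

open Polynomial

/-- The underlying space `K[z] ⊕ K[z] dz`; the square of `K[z] dz` is zero. -/
abbrev Forms (K : Type u) [Field K] := TrivSqZeroExt K[X] K[X]

variable (K : Type u) [Field K]

/-- `K[z]` in degree `0`, `K[z] dz` in degree `1`, and `0` in all other degrees. -/
def formsGrading (i : ℤ) : Submodule K (Forms K) where
  carrier := {f | (i ≠ 0 → f.fst = 0) ∧ (i ≠ 1 → f.snd = 0)}
  add_mem' := by
    rintro f g ⟨h1, h2⟩ ⟨h3, h4⟩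
    exact ⟨fun h => by simp [h1 h, h3 h], fun h => by simp [h2 h, h4 h]⟩
  zero_mem' := by simp
  smul_mem' := by
    rintro c f ⟨h1, h2⟩
    exact ⟨fun h => by simp [h1 h], fun h => by simp [h2 h]⟩

/-- The component of degree `0` of a form. -/
def formsZero : Forms K →ₗ[K] formsGrading K 0 where
  toFun f := ⟨TrivSqZeroExt.inl f.fst, fun h => absurd rfl h, fun _ => TrivSqZeroExt.snd_inl _ _⟩
  map_add' _ _ := Subtype.ext (TrivSqZeroExt.inl_add _ _ _)
  map_smul' _ _ := Subtype.ext (TrivSqZeroExt.inl_smul _ _ _)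

/-- The component of degree `1` of a form. -/
def formsOne : Forms K →ₗ[K] formsGrading K 1 where
  toFun f := ⟨TrivSqZeroExt.inr f.snd, fun _ => TrivSqZeroExt.fst_inr _ _, fun h => absurd rfl h⟩
  map_add' _ _ := Subtype.ext (TrivSqZeroExt.inr_add _ _ _)
  map_smul' _ _ := Subtype.ext (TrivSqZeroExt.inr_smul _ _ _)

instance formsDecomposition : DirectSum.Decomposition (formsGrading K) :=
  DirectSum.Decomposition.ofLinearMap _
    (DirectSum.lof K ℤ (fun i => formsGrading K i) 0 ∘ₗ formsZero K +
      DirectSum.lof K ℤ (fun i => formsGrading K i) 1 ∘ₗ formsOne K)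
    (by
      refine LinearMap.ext fun f => ?_
      simp only [LinearMap.comp_apply, LinearMap.add_apply, map_add, DirectSum.coeLinearMap_lof,
        LinearMap.id_apply]
      exact TrivSqZeroExt.inl_fst_add_inr_snd_eq f)
    (by
      refine DirectSum.linearMap_ext _ fun i => LinearMap.ext fun f => ?_
      obtain ⟨f, hf⟩ := f
      simp only [LinearMap.comp_apply, LinearMap.add_apply, DirectSum.coeLinearMap_lof,
        LinearMap.id_apply]
      have h0 : f.fst = 0 → formsZero K f = 0 := fun h => Subtype.ext
        ((congrArg TrivSqZeroExt.inl h).trans (TrivSqZeroExt.inl_zero _))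
      have h1 : f.snd = 0 → formsOne K f = 0 := fun h => Subtype.ext
        ((congrArg TrivSqZeroExt.inr h).trans (TrivSqZeroExt.inr_zero _))
      by_cases hi : i = 0
      · subst hi
        have h : formsZero K f = ⟨f, hf⟩ :=
          Subtype.ext (TrivSqZeroExt.ext rfl (hf.2 (by decide)).symm)
        rw [h1 (hf.2 (by decide)), h, map_zero, add_zero]
      by_cases hi' : i = 1
      · subst hi'
        have h : formsOne K f = ⟨f, hf⟩ :=
          Subtype.ext (TrivSqZeroExt.ext (hf.1 (by decide)).symm rfl)
        rw [h0 (hf.1 (by decide)), h, map_zero, zero_add]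
      · have h : (⟨f, hf⟩ : formsGrading K i) = 0 :=
          Subtype.ext (TrivSqZeroExt.ext (hf.1 hi) (hf.2 hi'))
        rw [h0 (hf.1 hi), h1 (hf.2 hi'), h, map_zero, map_zero, map_zero, add_zero])

instance formsGradedAlgebra : GradedAlgebra (formsGrading K) where
  one_mem := ⟨fun h => absurd rfl h, fun _ => by simp⟩
  mul_mem := by
    rintro i j f g ⟨h1, h2⟩ ⟨h3, h4⟩
    refine ⟨fun h => ?_, fun h => ?_⟩
    · by_cases hi : i = 0
      · have hj : j ≠ 0 := by omega
        simp [h3 hj]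
      · simp [h1 hi]
    · by_cases hi : i = 0
      · have hj : j ≠ 1 := by omega
        have hi' : i ≠ 1 := by omega
        simp [h4 hj, h2 hi']
      · by_cases hj : j = 0
        · have hi' : i ≠ 1 := by omega
          simp [h1 hi, h2 hi']
        · simp [h1 hi, h3 hj]
/-- The de Rham differential `f + g dz ↦ f' dz`. -/
def formsD : Forms K →ₗ[K] Forms K where
  toFun f := TrivSqZeroExt.inr (derivative f.fst)
  map_add' f g := by ext <;> simp
  map_smul' c f := by ext <;> simp

/-- The de Rham algebra `K[z, dz]` of the interval. -/
def interval : CDGA.{u, u} K where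
  carrier := Forms K
  grading := formsGrading K
  d := formsD K
  d_mem := by
    rintro i a ⟨h1, h2⟩
    refine ⟨fun h => by simp [formsD], fun h => ?_⟩
    have hi : i ≠ 0 := by omega
    simp [formsD, h1 hi]
  d_d a := by ext <;> simp [formsD]
  graded_comm := by
    rintro i j a b ⟨h1, h2⟩ ⟨h3, h4⟩
    by_cases hi : i = 0
    · simp [hi, mul_comm]
    by_cases hj : j = 0
    · simp [hj, mul_comm]
    have : a * b = 0 := by ext1 <;> simp [h1 hi, h3 hj]
    rw [mul_comm b a, this, smul_zero]
  leibniz := by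
    rintro i a b ⟨h1, h2⟩
    by_cases hi : i = 0
    · subst hi
      ext1 <;> simp [formsD, h2 (by decide)]
      ring
    · ext1 <;> simp [formsD, h1 hi]

/-- The evaluation `K[z, dz] → K` at `z = c`, `dz = 0`. -/
def evalForms (c : K) : Forms K →ₗ[K] K where
  toFun f := f.fst.eval c
  map_add' f g := by simp
  map_smul' r f := by simp

variable {K} in
/-- The evaluation `K[z, dz] ⊗ W → W` at `z = c`, `dz = 0`. -/
def evalTensor (W : Type v) [AddCommGroup W] [Module K W] (c : K) :
    (interval K).carrier ⊗[K] W →ₗ[K] W :=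
  (TensorProduct.lid K W).toLinearMap ∘ₗ LinearMap.rTensor W (evalForms K c)

end Interval

/-! ## Formal cdgas -/

/-- A formal (non-unital) cdga `A`, given as an inverse limit of finite-dimensional nilpotent
cdgas `A_j`.  As usual, `A_j` is recorded through the augmented unital cdga `Ã_j = A_j ⊕ K` obtained
from it by adjoining a unit: `A_j` is the augmentation ideal of `level j`. -/
structure FormalCDGA (K : Type u) [Field K] where
  Index : Type x
  [preorder : Preorder Index]
  [directed : IsDirectedOrder Index]
  [nonempty : Nonempty Index]
  level : Index → CDGA.{u, w} K
  finite : ∀ j, FiniteDimensional K (level j).carrier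
  /-- the augmentation `Ã_j → K`, a morphism of cdgas -/
  aug : ∀ j, (level j).carrier →ₐ[K] K
  aug_grading : ∀ (j : Index) (i : ℤ) (a : (level j).carrier), i ≠ 0 → a ∈ (level j).grading i →
    aug j a = 0
  aug_d : ∀ (j : Index) (a : (level j).carrier), aug j ((level j).d a) = 0
  /-- a number `N` such that all `N`-fold products in `A_j` vanish -/
  nilp : Index → ℕ
  nilpotent : ∀ (j : Index) (a : Fin (nilp j) → (level j).carrier), (∀ r, aug j (a r) = 0) →
    (List.ofFn a).prod = 0
  /-- the transition morphisms -/
  trans : ∀ {i j : Index}, i ≤ j → (level j).carrier →ₐ[K] (level i).carrier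
  trans_refl : ∀ (j : Index) (a : (level j).carrier), trans (le_refl j) a = a
  trans_trans : ∀ {i j k : Index} (hij : i ≤ j) (hjk : j ≤ k) (a : (level k).carrier),
    trans hij (trans hjk a) = trans (hij.trans hjk) a
  trans_grading : ∀ {i j : Index} (hij : i ≤ j) (m : ℤ) (a : (level j).carrier),
    a ∈ (level j).grading m → trans hij a ∈ (level i).grading m
  trans_d : ∀ {i j : Index} (hij : i ≤ j) (a : (level j).carrier),
    trans hij ((level j).d a) = (level i).d (trans hij a)
  aug_trans : ∀ {i j : Index} (hij : i ≤ j) (a : (level j).carrier), aug i (trans hij a) = aug j a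

attribute [instance] FormalCDGA.preorder FormalCDGA.directed FormalCDGA.nonempty

namespace FormalCDGA

variable {K : Type u} [Field K] (A : FormalCDGA.{u, w, x} K)

/-- The component `Ã^m` of `Ã = lim Ã_j`: compatible families of elements of degree `m`. -/
def unital (m : ℤ) : Submodule K (∀ j, (A.level j).carrier) where
  carrier := {a | (∀ j, a j ∈ (A.level j).grading m) ∧
    ∀ (i j : A.Index) (h : i ≤ j), A.trans h (a j) = a i}
  add_mem' := fun {a b} ha hb =>
    ⟨fun j => add_mem (ha.1 j) (hb.1 j), fun i j h => by simp [ha.2 i j h, hb.2 i j h]⟩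
  zero_mem' := ⟨fun j => zero_mem _, fun i j h => by simp⟩
  smul_mem' := fun c {a} ha =>
    ⟨fun j => Submodule.smul_mem _ c (ha.1 j), fun i j h => by simp [ha.2 i j h]⟩

variable {W : Type v} [AddCommGroup W] [Module K W]

variable (W) in
/-- Families of elements of the `Ã_j ⊗ W`; the completed tensor product `Ã ⊗ W = lim Ã_j ⊗ W`
consists of the compatible ones. -/
abbrev Tensor := ∀ j, (A.level j).carrier ⊗[K] W

/-- The homogeneous components of the completed tensor product `Ã ⊗ W = lim Ã_j ⊗ W`. -/
def unitalTensor (𝒲 : ℤ → Submodule K W) (n : ℤ) : Submodule K (A.Tensor W) where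
  carrier := {t | (∀ j, t j ∈ tensorGrading (A.level j).grading 𝒲 n) ∧
    ∀ (i j : A.Index) (h : i ≤ j), (A.trans h).toLinearMap.rTensor W (t j) = t i}
  add_mem' := fun {a b} ha hb =>
    ⟨fun j => add_mem (ha.1 j) (hb.1 j), fun i j h => by simp [ha.2 i j h, hb.2 i j h]⟩
  zero_mem' := ⟨fun j => zero_mem _, fun i j h => by simp⟩
  smul_mem' := fun c {a} ha =>
    ⟨fun j => Submodule.smul_mem _ c (ha.1 j), fun i j h => by simp [ha.2 i j h]⟩

/-- The homogeneous components of the completed tensor product `A ⊗ W = lim A_j ⊗ W`, as subspaces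
of those of `Ã ⊗ W`: over a field, `A_j ⊗ W` is the kernel of `Ã_j ⊗ W → K ⊗ W`. -/
def tensor (𝒲 : ℤ → Submodule K W) (n : ℤ) : Submodule K (A.Tensor W) :=
  A.unitalTensor 𝒲 n ⊓
    ⨅ j, LinearMap.ker ((A.aug j).toLinearMap.rTensor W ∘ₗ LinearMap.proj j)

/-- Extension of scalars of the brackets `ℓ` on `W` to `Ã ⊗ W`, level by level; `t` is the parity
involution of `W`. The brackets of `A ⊗ W` are their restrictions. -/
def brackets (t : W →ₗ[K] W) (ℓ : Brackets K W) : Brackets K (A.Tensor W) := fun n =>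
  MultilinearMap.pi fun j =>
    (extendBrackets (A.level j) t ℓ n).compLinearMap fun _ => LinearMap.proj j

/-- `ξ` is a Maurer-Cartan element: an element of degree `0` of `A ⊗ W`, where `W = ΣV`, with
`∑ i, ℓ_i (ξ, …, ξ) / i! = 0`.  In `A_j ⊗ W` the terms with `i ≥ nilp j` vanish. -/
def IsMC (𝒲 : ℤ → Submodule K W) (t : W →ₗ[K] W) (ℓ : Brackets K W) (ξ : A.Tensor W) : Prop :=
  ξ ∈ A.tensor 𝒲 0 ∧ ∀ j, ∑ i ∈ Finset.range (A.nilp j),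
    ((i.factorial : K))⁻¹ • A.brackets t ℓ i (fun _ => ξ) j = 0

/-- The brackets twisted by `ξ`: the `n`-th one is
`(x₁, …, xₙ) ↦ ∑ i, ℓ_{i+n} (ξ, …, ξ, x₁, …, xₙ) / i!`.
In `Ã_j ⊗ W` the terms with `i ≥ nilp j` vanish. -/
def twist (t : W →ₗ[K] W) (ℓ : Brackets K W) (ξ : A.Tensor W) : Brackets K (A.Tensor W) := fun n =>
  MultilinearMap.pi fun j => ∑ i ∈ Finset.range (A.nilp j), ((i.factorial : K))⁻¹ •
    (LinearMap.proj j : A.Tensor W →ₗ[K] _).compMultilinearMap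
      (((A.brackets t ℓ (i + n)).domDomCongr finSumFinEquiv.symm).currySum fun _ => ξ)

/-- `φ` is `Ã`-multilinear.  For graded symmetric components of degree `0` it suffices to say so
for the first argument, where no sign occurs. -/
def IsLinear (𝒯 : ℤ → Submodule K (A.Tensor W)) (φ : Components K (A.Tensor W) (A.Tensor W)) :
    Prop :=
  ∀ (n : ℕ) (m : ℤ) (a : ∀ j, (A.level j).carrier), a ∈ A.unital m →
    ∀ (d : Fin (n + 1) → ℤ) (x : Fin (n + 1) → A.Tensor W), (∀ r, x r ∈ 𝒯 (d r)) →
      φ (n + 1) (Function.update x 0 (fun j => a j • x 0 j)) = fun j => a j • φ (n + 1) x j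

/-- `φ` is continuous, and so is the inverse of its linear component, in the inverse limit topology
in which the kernels of the projections to the levels are a basis of neighbourhoods of `0`. -/
def IsBicontinuous (𝒯 : ℤ → Submodule K (A.Tensor W))
    (φ : Components K (A.Tensor W) (A.Tensor W)) : Prop :=
  (∀ (n : ℕ) (j : A.Index), ∃ i : A.Index, ∀ (d : Fin n → ℤ) (x : Fin n → A.Tensor W),
    (∀ r, x r ∈ 𝒯 (d r)) → (∃ r, x r i = 0) → φ n x j = 0) ∧
  ∀ j : A.Index, ∃ i : A.Index, ∀ (d : ℤ) (x : A.Tensor W), x ∈ 𝒯 d →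
    φ 1 (fun _ => x) i = 0 → x j = 0

/-- The brackets `ℓ` and `ℓ'` are `L∞` structures with the same underlying graded space `𝒯`, and
there is an `Ã`-linear continuous `L∞` isomorphism between them. -/
def AreIsomorphic (𝒯 : ℤ → Submodule K (A.Tensor W)) (ℓ ℓ' : Brackets K (A.Tensor W)) : Prop :=
  IsLInfty 𝒯 ℓ ∧ IsLInfty 𝒯 ℓ' ∧ ∃ φ : Components K (A.Tensor W) (A.Tensor W),
    IsLInftyIso 𝒯 ℓ 𝒯 ℓ' φ ∧ A.IsLinear 𝒯 φ ∧ A.IsBicontinuous 𝒯 φ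

end FormalCDGA

/-! ## Maurer-Cartan elements and twistings of an `L∞` algebra -/

namespace LInftyAlgebra

variable {K : Type u} [Field K] {V : Type v} [AddCommGroup V] [Module K V]
variable (L : LInftyAlgebra K V) (A : FormalCDGA.{u, w, x} K)

/-- The set `MC(V, A)`. -/
def MC : Set (A.Tensor V) :=
  {ξ | A.IsMC (susp L.grading) L.parity L.bracket ξ}

/-- The set `MC(V, A[z, dz])`, where `A[z, dz] ⊗ ΣV = lim A_j ⊗ (K[z, dz] ⊗ ΣV)`. -/
def MCInterval : Set (A.Tensor ((interval K).carrier ⊗[K] V)) :=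
  {h | A.IsMC (tensorGrading (interval K).grading (susp L.grading))
    (TensorProduct.map (interval K).parity L.parity)
    (extendBrackets (interval K) L.parity L.bracket) h}

/-- `ξ` and `η` are homotopic: there is an MC element with coefficients in `A[z, dz]` that
specializes to `ξ` at `z = 0` and to `η` at `z = 1`. -/
def Homotopic (ξ η : A.Tensor V) : Prop :=
  ∃ h ∈ L.MCInterval A, (∀ j, (evalTensor V (0 : K)).lTensor _ (h j) = ξ j) ∧
    ∀ j, (evalTensor V (1 : K)).lTensor _ (h j) = η j

/-- The brackets of `(Ã ⊗ V)^ξ`; those of `(A ⊗ V)^ξ` are their restrictions. -/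
def twisted (ξ : A.Tensor V) : Brackets K (A.Tensor V) :=
  A.twist L.parity L.bracket ξ

end LInftyAlgebra

end

end MCTwist

/-!
# Twistings of `L∞` algebras by homotopic Maurer-Cartan elements

In a level `B = Ã_j` of the formal cdga, write the homotopy as `h = p(z) + q(z) dz`. Evaluation at
`z = c`, `dz = 0` is a strict morphism, and the coefficient of `dz` is a derivation over it. So the
Maurer-Cartan equation of `h` says that each `p(z)` is a Maurer-Cartan element, and that
`p' = ℓ₁^p (q)`: the path `p` moves along the gauge vector field of `q` (`IsMC.isMCPath`).

The contraction of the twisted brackets `ℓ^p` with `q` is a coderivation `θ` of degree `0` and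
without constant term (`gaugeField`). The Jacobi identities with one argument equal to `q` state that
the derivative of `ℓ^p` in `z` is the commutator of `ℓ^p` with `θ` (`IsLInfty.bracket_contract`,
`IsMCPath.exists_deriv_bracket`). The isomorphism is the flow of `θ`, `f' = θ ∘ f` with `f(0) = id`,
at time `1`. Since `q` has coefficients in the augmentation ideal, `θ` raises the finite filtration
by the powers of this ideal; hence Picard iteration ends after finitely many steps with a polynomial
solution (`exists_flow`). No analysis is involved: derivatives are formal derivatives of polynomial
functions `K → X` (`HasPolyDeriv`), which determine the function up to a constant in characteristic
zero.

The flow consists of `L∞` morphisms from `ℓ^{p(0)}` to `ℓ^{p(z)}` because both sides of the equation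
for a morphism solve the same linear differential equation, whose polynomial solutions are unique
(`HasPolyDeriv.eq_zero_of_linear`). To differentiate without Koszul signs, scalars are extended to a
graded commutative algebra with generators of square zero (`Cube`). A graded symmetric operation is
determined by its exponential series on formal arguments of degree `0` over this algebra
(`eq_zero_of_expSum`), and there composition along partitions becomes composition of functions, and
insertion becomes a directional derivative (`expSum_comp`, `expSum_insert`). The comparison of the
two sides is then the calculation in `IsFlow.expSum_eq`, from which `IsFlow.compat` follows.

The remaining properties come from the differential equation as well. The linear component of the
flow is the identity on the associated graded space, hence bijective (`flow_one_sub_mem`,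
`bijOn_of_sub_mem`). The flow is linear over the scalars, since the iterates are
(`IsSlotLinear.comp`). Uniqueness gives compatibility with the transition maps between the levels
(`flow_natural`), so that the flows pass to the inverse limit (`IsLevelIso.areIsomorphic`). Finally
the flow is the identity modulo the augmentation ideal (`flow_sub_mem`), so the isomorphism of
`(Ã ⊗ V)^ξ` with `(Ã ⊗ V)^η` restricts to one of `(A ⊗ V)^ξ` with `(A ⊗ V)^η`.
-/

set_option linter.unusedSectionVars false

namespace MCTwist

noncomputable section

/-! ### Koszul signs -/

/-- The sign `(-1) ^ m`, as an integer. -/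
def sg (m : ℤ) : ℤ := (m.negOnePow : ℤ)

@[simp] theorem sg_zero : sg 0 = 1 := rfl

@[simp] theorem sg_one : sg 1 = -1 := rfl

theorem sg_add (m n : ℤ) : sg (m + n) = sg m * sg n := by
  simp [sg, Int.negOnePow_add]

theorem sg_sub (m n : ℤ) : sg (m - n) = sg m * sg n := by
  simp [sg, Int.negOnePow_sub]

@[simp] theorem sg_neg (m : ℤ) : sg (-m) = sg m := by
  simp [sg]

theorem sg_even {m : ℤ} (h : Even m) : sg m = 1 := by
  simp [sg, Int.negOnePow_even m h]

theorem sg_odd {m : ℤ} (h : Odd m) : sg m = -1 := by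
  simp [sg, Int.negOnePow_odd m h]

@[simp] theorem sg_mul_self (m : ℤ) : sg m * sg m = 1 := by
  rw [← sg_add]; exact sg_even ⟨m, rfl⟩

theorem sg_congr {m n : ℤ} (h : Even (m - n)) : sg m = sg n := by
  have := sg_even h
  rw [sg_sub] at this
  calc sg m = sg m * (sg n * sg n) := by simp
    _ = (sg m * sg n) * sg n := by ring
    _ = sg n := by rw [this, one_mul]

theorem sg_sum {ι : Type*} (s : Finset ι) (f : ι → ℤ) : sg (∑ i ∈ s, f i) = ∏ i ∈ s, sg (f i) := by
  classical
  induction s using Finset.induction_on with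
  | empty => simp
  | insert a s ha ih => rw [Finset.sum_insert ha, Finset.prod_insert ha, sg_add, ih]

theorem koszulSign_eq {α : Type*} [LinearOrder α] {n : ℕ} (d : Fin n → ℤ) (b : Fin n → α) :
    koszulSign d b = ∏ i, ∏ j, if i < j ∧ b j < b i then sg (d i * d j) else 1 := rfl

theorem koszulSign_succ {α : Type*} [LinearOrder α] {n : ℕ} (d : Fin (n + 1) → ℤ)
    (b : Fin (n + 1) → α) :
    koszulSign d b = (∏ j : Fin n, if b j.succ < b 0 then sg (d 0 * d j.succ) else 1) *
      koszulSign (fun i => d i.succ) (fun i => b i.succ) := by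
  simp only [koszulSign_eq, Fin.prod_univ_succ, Fin.succ_pos, true_and, false_and,
    if_false, one_mul, Fin.not_lt_zero, Fin.succ_lt_succ_iff]

theorem koszulSign_congr_label {α β : Type*} [LinearOrder α] [LinearOrder β] {n : ℕ}
    (d : Fin n → ℤ) {b : Fin n → α} {b' : Fin n → β} (h : ∀ i j, b i < b j ↔ b' i < b' j) :
    koszulSign d b = koszulSign d b' := by
  simp only [koszulSign_eq, h]

theorem koszulSign_congr_degree {α : Type*} [LinearOrder α] {n : ℕ} {d d' : Fin n → ℤ}
    (b : Fin n → α) (h : ∀ i, sg (d i) = sg (d' i)) : koszulSign d b = koszulSign d' b := by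
  have key : ∀ i, Even (d i - d' i) := fun i => by
    by_contra hi
    rw [Int.not_even_iff_odd] at hi
    have h1 := sg_odd hi
    rw [sg_sub, h i, sg_mul_self] at h1
    norm_num at h1
  simp only [koszulSign_eq]
  refine Finset.prod_congr rfl fun i _ => Finset.prod_congr rfl fun j _ => ?_
  congr 1
  apply sg_congr
  have : d i * d j - d' i * d' j = (d i - d' i) * d j + d' i * (d j - d' j) := by ring
  rw [this]
  exact ((key i).mul_right _).add ((key j).mul_left _)

/-- The Koszul sign is trivial if every pair that changes its order has a factor of even degree. -/
theorem koszulSign_eq_one {α : Type*} [LinearOrder α] {n : ℕ} {d : Fin n → ℤ} {b : Fin n → α}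
    (h : ∀ i j, i < j → b j < b i → Even (d i * d j)) : koszulSign d b = 1 := by
  rw [koszulSign_eq]
  refine Finset.prod_eq_one fun i _ => Finset.prod_eq_one fun j _ => ?_
  split_ifs with hij
  · exact sg_even (h i j hij.1 hij.2)
  · rfl

theorem koszulSign_mul_self {α : Type*} [LinearOrder α] {n : ℕ} (d : Fin n → ℤ) (b : Fin n → α) :
    koszulSign d b * koszulSign d b = 1 := by
  simp only [koszulSign_eq, ← Finset.prod_mul_distrib]
  refine Finset.prod_eq_one fun i _ => Finset.prod_eq_one fun j _ => ?_
  split_ifs <;> simp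

/-- The sign of moving each factor `aⱼ` of degree `α j` in `a₀ w₀ a₁ w₁ ⋯` to the left past the
`wᵢ` of degree `ω i` with `i < j`. -/
def extSign {n : ℕ} (α ω : Fin n → ℤ) : ℤ := ∏ i, ∏ j, if i < j then sg (ω i * α j) else 1

theorem extSign_succ {n : ℕ} (α ω : Fin (n + 1) → ℤ) :
    extSign α ω = sg (ω 0 * ∑ j : Fin n, α j.succ) *
      extSign (fun i => α i.succ) (fun i => ω i.succ) := by
  simp only [extSign, Fin.prod_univ_succ, Fin.succ_pos, if_true,
    if_false, one_mul, Fin.not_lt_zero, Fin.succ_lt_succ_iff, Finset.mul_sum, sg_sum]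

theorem extSign_mul_self {n : ℕ} (α ω : Fin n → ℤ) : extSign α ω * extSign α ω = 1 := by
  simp only [extSign, ← Finset.prod_mul_distrib]
  refine Finset.prod_eq_one fun i _ => Finset.prod_eq_one fun j _ => ?_
  split_ifs <;> simp

/-- The set of indices with label `c`. -/
abbrev fiber {n : ℕ} {κ : Type*} [DecidableEq κ] (b : Fin n → κ) (c : κ) : Finset (Fin n) :=
  Finset.univ.filter fun i => b i = c

theorem prod_subfamily {M : Type*} [CommMonoid M] {n : ℕ} (S : Finset (Fin n)) (g : Fin n → M) :
    ∏ p, subfamily g S p = ∏ i ∈ S, g i := by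
  rw [← Finset.prod_coe_sort S g]
  exact (S.orderIsoOfFin rfl).toEquiv.prod_comp fun i : S => g i

theorem sum_subfamily {M : Type*} [AddCommMonoid M] {n : ℕ} (S : Finset (Fin n)) (g : Fin n → M) :
    ∑ p, subfamily g S p = ∑ i ∈ S, g i := by
  rw [← Finset.sum_coe_sort S g]
  exact (S.orderIsoOfFin rfl).toEquiv.sum_comp fun i : S => g i

theorem extSign_subfamily {n : ℕ} (α ω : Fin n → ℤ) (S : Finset (Fin n)) :
    extSign (subfamily α S) (subfamily ω S) =
      ∏ i ∈ S, ∏ j ∈ S, if i < j then sg (ω i * α j) else 1 := by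
  rw [← prod_subfamily S fun i => ∏ j ∈ S, if i < j then sg (ω i * α j) else 1]
  refine Finset.prod_congr rfl fun p _ => ?_
  simp only [subfamily]
  rw [← prod_subfamily S fun j => if S.orderEmbOfFin rfl p < j then
    sg (ω (S.orderEmbOfFin rfl p) * α j) else 1]
  simp [subfamily]

/-- Sorting the pairs `aᵢ wᵢ` by their labels, and moving the `a`'s to the left afterwards, is the
same as moving the `a`'s to the left and sorting the `a`'s and the `w`'s separately. -/
theorem extSign_fiber {n k : ℕ} (α ω : Fin n → ℤ) (b : Fin n → Fin k) :
    koszulSign (fun i => ω i - α i) b * koszulSign α b *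
      ((∏ c, extSign (subfamily α (fiber b c)) (subfamily ω (fiber b c))) *
      extSign (fun c => ∑ i ∈ fiber b c, α i) (fun c => ∑ i ∈ fiber b c, ω i)) =
    extSign α ω * koszulSign ω b := by
  have h1 : (∏ c, extSign (subfamily α (fiber b c)) (subfamily ω (fiber b c))) =
      ∏ i, ∏ j, if i < j ∧ b i = b j then sg (ω i * α j) else 1 := by
    simp only [extSign_subfamily]
    rw [← Finset.prod_fiberwise (s := Finset.univ) (g := b)]
    refine Finset.prod_congr rfl fun c _ => Finset.prod_congr rfl fun i hi => ?_
    simp only [Finset.mem_filter, Finset.mem_univ, true_and] at hi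
    rw [Finset.prod_filter]
    refine Finset.prod_congr rfl fun j _ => ?_
    subst hi
    by_cases h : b j = b i
    · simp [h]
    · simp [h, Ne.symm h]
  have h2 : extSign (fun c => ∑ i ∈ fiber b c, α i) (fun c => ∑ i ∈ fiber b c, ω i) =
      ∏ i, ∏ j, if b i < b j then sg (ω i * α j) else 1 := by
    simp only [extSign]
    rw [← Finset.prod_fiberwise (s := Finset.univ) (g := b)]
    refine Finset.prod_congr rfl fun c _ => ?_
    rw [Finset.prod_comm]
    rw [← Finset.prod_fiberwise (s := Finset.univ) (g := b)]
    refine Finset.prod_congr rfl fun c' _ => ?_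
    split_ifs with h
    · rw [Finset.sum_mul_sum, Finset.sum_comm, sg_sum]
      refine Finset.prod_congr rfl fun j hj => ?_
      rw [sg_sum]
      refine Finset.prod_congr rfl fun i hi => ?_
      simp only [Finset.mem_filter, Finset.mem_univ, true_and] at hi hj
      rw [if_pos (by rw [hi, hj]; exact h)]
    · symm
      refine Finset.prod_eq_one fun j hj => Finset.prod_eq_one fun i hi => ?_
      simp only [Finset.mem_filter, Finset.mem_univ, true_and] at hi hj
      rw [if_neg (by rw [hi, hj]; exact h)]
  -- the pairs `(i, j)` with `b i < b j` and `j < i` are rewritten as inversions `(j, i)`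
  have h3 : (∏ i, ∏ j, if b i < b j then sg (ω i * α j) else 1) =
      (∏ i, ∏ j, if i < j ∧ b i < b j then sg (ω i * α j) else 1) *
      ∏ i, ∏ j, if i < j ∧ b j < b i then sg (α i * ω j) else 1 := by
    rw [Finset.prod_comm (f := fun i j => if i < j ∧ b j < b i then sg (α i * ω j) else 1)]
    simp only [← Finset.prod_mul_distrib]
    refine Finset.prod_congr rfl fun i _ => Finset.prod_congr rfl fun j _ => ?_
    rcases lt_trichotomy i j with h | h | h
    · simp [h, h.not_gt]
    · simp [h]
    · simp [h, h.not_gt, mul_comm]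
  rw [h1, h2, h3]
  simp only [extSign, koszulSign_eq, ← Finset.prod_mul_distrib]
  refine Finset.prod_congr rfl fun i _ => Finset.prod_congr rfl fun j _ => ?_
  by_cases hij : i < j
  · rcases lt_trichotomy (b i) (b j) with h | h | h
    · simp [hij, h, h.not_gt, h.ne]
    · simp [hij, h]
    · simp only [hij, h, h.not_gt, h.ne', true_and, if_true, if_false, one_mul]
      simp only [← sg_add]
      apply sg_congr
      exact ⟨α i * α j - ω i * α j, by ring⟩
  · simp [hij]

theorem koszulSign_subset {n : ℕ} (d : Fin n → ℤ) (S : Finset (Fin n)) :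
    koszulSign d (fun i => if i ∈ S then 0 else 1) =
      koszulSign d (fun i => if i ∈ S then (0 : Fin 2) else 1) := by
  refine koszulSign_congr_label d fun i j => ?_
  split_ifs <;> simp

theorem fiber_subset_zero {n : ℕ} (S : Finset (Fin n)) :
    fiber (fun i => if i ∈ S then (0 : Fin 2) else 1) 0 = S := by
  ext i; simp

theorem fiber_subset_one {n : ℕ} (S : Finset (Fin n)) :
    fiber (fun i => if i ∈ S then (0 : Fin 2) else 1) 1 = Sᶜ := by
  ext i; simp

/-- The variant of `extSign_fiber` for a partition into a set `S` and its complement; the elements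
of `S` are combined by an operation of degree `p`. -/
theorem extSign_subset {n : ℕ} (α ω : Fin n → ℤ) (S : Finset (Fin n)) (p : ℤ) :
    koszulSign (fun i => ω i - α i) (fun i => if i ∈ S then 0 else 1) *
      koszulSign α (fun i => if i ∈ S then 0 else 1) *
      (extSign (subfamily α S) (subfamily ω S) *
        extSign (Fin.cons (∑ i ∈ S, α i) (subfamily α Sᶜ) : Fin (Sᶜ.card + 1) → ℤ)
          (Fin.cons (∑ i ∈ S, ω i + p) (subfamily ω Sᶜ) : Fin (Sᶜ.card + 1) → ℤ)) =
    sg (p * ∑ i ∈ Sᶜ, α i) *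
      (extSign α ω * koszulSign ω (fun i => if i ∈ S then 0 else 1)) := by
  have key := extSign_fiber α ω (fun i => if i ∈ S then (0 : Fin 2) else 1)
  simp only [← koszulSign_subset, Fin.prod_univ_two] at key
  rw [← key]
  have e2 : extSign (fun c : Fin 2 => ∑ i ∈ fiber (fun i => if i ∈ S then (0 : Fin 2) else 1) c, α i)
      (fun c => ∑ i ∈ fiber (fun i => if i ∈ S then (0 : Fin 2) else 1) c, ω i) =
      sg ((∑ i ∈ S, ω i) * ∑ i ∈ Sᶜ, α i) := by
    rw [extSign_succ, extSign_succ]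
    simp only [extSign, Finset.univ_eq_empty, Finset.prod_empty, Finset.sum_empty, mul_zero,
      sg_zero, mul_one, Fin.sum_univ_one, Fin.succ_zero_eq_one, fiber_subset_zero,
      fiber_subset_one]
  have e3 : ∀ T T' : Finset (Fin n), T = T' → extSign (subfamily α T) (subfamily ω T) =
      extSign (subfamily α T') (subfamily ω T') := by rintro T _ rfl; rfl
  rw [e2, e3 _ _ (fiber_subset_zero S), e3 _ _ (fiber_subset_one S), extSign_succ]
  simp only [Fin.cons_zero, Fin.cons_succ, sum_subfamily]
  rw [add_mul, sg_add]
  ring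

/-! ### Reordering products in graded commutative algebras -/

/-- A graded commutative algebra; `s` is its parity involution.  The family `ℛ` need not be
independent. -/
structure IsGradedComm {K : Type u} [Field K] {R : Type w} [Ring R] [Algebra K R]
    (ℛ : ℤ → Submodule K R) (s : R →ₗ[K] R) : Prop where
  one_mem : 1 ∈ ℛ 0
  mul_mem : ∀ {i j : ℤ} {a b : R}, a ∈ ℛ i → b ∈ ℛ j → a * b ∈ ℛ (i + j)
  comm : ∀ {i j : ℤ} {a b : R}, a ∈ ℛ i → b ∈ ℛ j → a * b = sg (i * j) • (b * a)
  parity : ∀ {i : ℤ} {a : R}, a ∈ ℛ i → s a = sg i • a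

/-- The linear map `t` is the parity involution on the homogeneous components `𝒲 i`. -/
def IsParity {K : Type u} [Field K] {W : Type v} [AddCommGroup W] [Module K W]
    (𝒲 : ℤ → Submodule K W) (t : W →ₗ[K] W) : Prop :=
  ∀ ⦃i : ℤ⦄ ⦃a : W⦄, a ∈ 𝒲 i → t a = sg i • a

section Reorder

variable {K : Type u} [Field K] {R : Type w} [Ring R] [Algebra K R]
  {ℛ : ℤ → Submodule K R} {s : R →ₗ[K] R}

/-- The product of a finite family in the order of the indices. -/
def oprod {n : ℕ} (a : Fin n → R) : R := (List.ofFn a).prod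

theorem oprod_zero (a : Fin 0 → R) : oprod a = 1 := by simp [oprod]

theorem oprod_succ {n : ℕ} (a : Fin (n + 1) → R) : oprod a = a 0 * oprod fun i => a i.succ := by
  simp [oprod, List.ofFn_succ]

theorem IsGradedComm.oprod_mem (hR : IsGradedComm ℛ s) : ∀ {n : ℕ} {a : Fin n → R} {α : Fin n → ℤ},
    (∀ i, a i ∈ ℛ (α i)) → oprod a ∈ ℛ (∑ i, α i)
  | 0, a, α, _ => by simpa [oprod_zero] using hR.one_mem
  | n + 1, a, α, h => by
    rw [oprod_succ, Fin.sum_univ_succ]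
    exact hR.mul_mem (h 0) (hR.oprod_mem fun i => h i.succ)

theorem sort_eq_filter {n : ℕ} (S : Finset (Fin n)) :
    S.sort (· ≤ ·) = (List.finRange n).filter (· ∈ S) := by
  apply List.Perm.eq_of_pairwise (le := (· ≤ ·))
  · intro a b _ _ h1 h2; exact le_antisymm h1 h2
  · exact Finset.pairwise_sort _ _
  · refine List.Pairwise.filter _ ?_
    exact (List.pairwise_lt_finRange n).imp le_of_lt
  · rw [List.perm_ext_iff_of_nodup (Finset.sort_nodup _ _) ((List.nodup_finRange n).filter _)]
    intro a; simp

theorem ofFn_subfamily {X : Type*} {n : ℕ} (a : Fin n → X) (S : Finset (Fin n)) :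
    List.ofFn (subfamily a S) = ((List.finRange n).filter (· ∈ S)).map a := by
  rw [← sort_eq_filter, ← Finset.listMap_orderEmbOfFin_finRange S rfl, List.map_map,
    List.ofFn_eq_map]
  rfl

theorem oprod_subfamily_succ {n : ℕ} (a : Fin (n + 1) → R) (S : Finset (Fin (n + 1))) :
    oprod (subfamily a S) = (if 0 ∈ S then a 0 else 1) *
      oprod (subfamily (fun i => a i.succ) (Finset.univ.filter fun i => i.succ ∈ S)) := by
  simp only [oprod, ofFn_subfamily, List.finRange_succ, List.filter_cons, List.filter_map]
  split_ifs with h <;> simp_all [Function.comp_def]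

theorem IsGradedComm.oprod_insert (hR : IsGradedComm ℛ s) {a₀ : R} {α₀ : ℤ} (h₀ : a₀ ∈ ℛ α₀) :
    ∀ {k : ℕ} (r : Fin k) {p : Fin k → R} {δ : Fin k → ℤ}, (∀ c, p c ∈ ℛ (δ c)) →
      oprod (fun c => (if c = r then a₀ else 1) * p c) =
        (∏ c, if c < r then sg (α₀ * δ c) else 1) • (a₀ * oprod p)
  | k + 1, r, p, δ, hp => by
    rw [oprod_succ, Fin.prod_univ_succ, oprod_succ p]
    refine Fin.cases ?_ (fun r => ?_) r
    · simp [mul_assoc]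
    · have ih := hR.oprod_insert h₀ r (fun c => hp c.succ)
      simp only [Fin.succ_inj, (Fin.succ_ne_zero r).symm, if_false, one_mul, ih, Fin.succ_pos,
        if_true, Fin.succ_lt_succ_iff]
      rw [mul_smul_comm, ← mul_assoc, hR.comm (hp 0) h₀, smul_mul_assoc, smul_smul, mul_assoc,
        mul_comm (δ 0), mul_comm (sg _)]

/-- Sorting a product of homogeneous elements by labels produces the Koszul sign. -/
theorem IsGradedComm.oprod_fiber (hR : IsGradedComm ℛ s) {k : ℕ} :
    ∀ {n : ℕ} {a : Fin n → R} {α : Fin n → ℤ} (_ : ∀ i, a i ∈ ℛ (α i)) (b : Fin n → Fin k),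
      oprod (fun c => oprod (subfamily a (fiber b c))) = koszulSign α b • oprod a
  | 0, a, α, _, b => by
    have h1 : ∀ c, oprod (subfamily a (fiber b c)) = 1 := fun c => by
      simp [oprod, ofFn_subfamily]
    have h2 : ∀ k, oprod (fun _ : Fin k => (1 : R)) = 1 := fun k => by simp [oprod]
    simp only [h1, h2, oprod_zero]
    simp [koszulSign]
  | n + 1, a, α, h, b => by
    have h1 : ∀ c, oprod (subfamily a (fiber b c)) = (if c = b 0 then a 0 else 1) *
        oprod (subfamily (fun i => a i.succ) (fiber (fun i => b i.succ) c)) := fun c => by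
      have e : (Finset.univ.filter fun i : Fin n => i.succ ∈ fiber b c) =
          fiber (fun i => b i.succ) c := by ext i; simp
      rw [oprod_subfamily_succ, e]
      simp [eq_comm]
    simp only [h1]
    have h2 : ∀ c, oprod (subfamily (fun i => a i.succ) (fiber (fun i => b i.succ) c)) ∈
        ℛ (∑ i ∈ fiber (fun i => b i.succ) c, α i.succ) := fun c => by
      rw [← sum_subfamily]
      exact hR.oprod_mem fun i => h _
    rw [hR.oprod_insert (h 0) (b 0) h2, hR.oprod_fiber (fun i => h i.succ), oprod_succ a,
      mul_smul_comm, smul_smul, koszulSign_succ]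
    congr 2
    rw [← Finset.prod_fiberwise (s := Finset.univ) (g := fun i : Fin n => b i.succ)]
    refine Finset.prod_congr rfl fun c _ => ?_
    rw [Finset.mul_sum, sg_sum]
    split_ifs with hc
    · refine Finset.prod_congr rfl fun i hi => ?_
      simp only [Finset.mem_filter, Finset.mem_univ, true_and] at hi
      rw [if_pos (by rw [hi]; exact hc)]
    · symm
      refine Finset.prod_eq_one fun i hi => ?_
      simp only [Finset.mem_filter, Finset.mem_univ, true_and] at hi
      rw [if_neg (by rw [hi]; exact hc)]

theorem IsGradedComm.oprod_subset (hR : IsGradedComm ℛ s) {n : ℕ} {a : Fin n → R}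
    {α : Fin n → ℤ} (h : ∀ i, a i ∈ ℛ (α i)) (S : Finset (Fin n)) :
    oprod (subfamily a S) * oprod (subfamily a Sᶜ) =
      koszulSign α (fun i => if i ∈ S then 0 else 1) • oprod a := by
  have key := hR.oprod_fiber h (fun i => if i ∈ S then (0 : Fin 2) else 1)
  rw [koszulSign_subset, ← key, oprod_succ, oprod_succ, oprod_zero, mul_one, Fin.succ_zero_eq_one,
    fiber_subset_zero, fiber_subset_one]

theorem IsGradedComm.oprod_perm (hR : IsGradedComm ℛ s) {n : ℕ} {a : Fin n → R}
    {α : Fin n → ℤ} (h : ∀ i, a i ∈ ℛ (α i)) (σ : Equiv.Perm (Fin n)) :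
    oprod (a ∘ σ) = koszulSign α σ.symm • oprod a := by
  rw [← hR.oprod_fiber h σ.symm]
  congr 1
  funext c
  have : fiber σ.symm c = {σ c} := by
    ext i; simp [Equiv.symm_apply_eq]
  rw [this, oprod, ofFn_subfamily, ← sort_eq_filter]
  simp

theorem IsGradedComm.map_oprod (hR : IsGradedComm ℛ s) {n : ℕ} {a : Fin n → R}
    {α : Fin n → ℤ} (h : ∀ i, a i ∈ ℛ (α i)) : s (oprod a) = sg (∑ i, α i) • oprod a :=
  hR.parity (hR.oprod_mem h)

theorem IsGradedComm.parity_odd (hR : IsGradedComm ℛ s) ⦃i : ℤ⦄ ⦃a : R⦄ (ha : a ∈ ℛ i) :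
    s a = sg (-1 * i) • a := by
  rw [hR.parity ha, neg_one_mul, sg_neg]

end Reorder

/-! ### Multilinear maps on spans and on tensor products -/

section Span

variable {K : Type u} [Field K] {X : Type v} [AddCommGroup X] [Module K X]
  {Y : Type w} [AddCommGroup Y] [Module K Y]

theorem multilinear_eq_on_span : ∀ {n : ℕ} {M N : MultilinearMap K (fun _ : Fin n => X) Y}
    {S : Fin n → Set X} (_ : ∀ x, (∀ i, x i ∈ S i) → M x = N x) {x : Fin n → X}
    (_ : ∀ i, x i ∈ Submodule.span K (S i)), M x = N x
  | 0, _, _, _, h, x, _ => h x fun i => i.elim0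
  | n + 1, M, N, S, h, x, hx => by
    have key : ∀ v ∈ Submodule.span K (S 0), M.curryLeft v (Fin.tail x) =
        N.curryLeft v (Fin.tail x) := by
      intro v hv
      induction hv using Submodule.span_induction with
      | mem v hv =>
        refine multilinear_eq_on_span (S := fun i => S i.succ) (fun x' hx' => ?_) fun i => hx i.succ
        exact h _ (Fin.cases hv hx')
      | zero => simp
      | add v v' _ _ h1 h2 => simp only [map_add, add_apply, h1, h2]
      | smul c v _ h1 => simp only [map_smul, smul_apply, h1]
    have := key _ (hx 0)
    simpa only [MultilinearMap.curryLeft_apply, Fin.cons_self_tail] using this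

end Span

section TensorGrading

variable {K : Type u} [Field K] {R : Type w} [AddCommGroup R] [Module K R]
  {W : Type v} [AddCommGroup W] [Module K W]

theorem tensorGrading_eq_span (ℛ : ℤ → Submodule K R) (𝒲 : ℤ → Submodule K W) (n : ℤ) :
    tensorGrading ℛ 𝒲 n =
      Submodule.span K {x | ∃ i, ∃ a ∈ ℛ i, ∃ w ∈ 𝒲 (n + i), x = a ⊗ₜ[K] w} := by
  apply le_antisymm
  · refine iSup_le fun i => Submodule.map₂_le.2 fun a ha w hw => ?_
    exact Submodule.subset_span ⟨i, a, ha, w, hw, rfl⟩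
  · rw [Submodule.span_le]
    rintro _ ⟨i, a, ha, w, hw, rfl⟩
    exact Submodule.mem_iSup_of_mem i (Submodule.apply_mem_map₂ _ ha hw)

theorem tmul_mem_tensorGrading {ℛ : ℤ → Submodule K R} {𝒲 : ℤ → Submodule K W} {i j n : ℤ} {a : R}
    {w : W} (ha : a ∈ ℛ i) (hw : w ∈ 𝒲 j) (h : j = n + i) : a ⊗ₜ[K] w ∈ tensorGrading ℛ 𝒲 n := by
  subst h
  exact Submodule.mem_iSup_of_mem i (Submodule.apply_mem_map₂ _ ha hw)

variable {Y : Type y} [AddCommGroup Y] [Module K Y]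

theorem tensorGrading_multilinear_eq {n : ℕ} {ℛ : ℤ → Submodule K R} {𝒲 : ℤ → Submodule K W}
    {M N : MultilinearMap K (fun _ : Fin n => R ⊗[K] W) Y} {D : Fin n → ℤ}
    (h : ∀ (α ω : Fin n → ℤ) (a : Fin n → R) (w : Fin n → W), (∀ i, a i ∈ ℛ (α i)) →
      (∀ i, w i ∈ 𝒲 (ω i)) → (∀ i, D i = ω i - α i) →
      M (fun i => a i ⊗ₜ[K] w i) = N (fun i => a i ⊗ₜ[K] w i))
    {x : Fin n → R ⊗[K] W} (hx : ∀ i, x i ∈ tensorGrading ℛ 𝒲 (D i)) : M x = N x := by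
  simp only [tensorGrading_eq_span] at hx
  refine multilinear_eq_on_span (fun x hx => ?_) hx
  choose α a ha w hw e using hx
  rw [funext e]
  exact h α (fun i => D i + α i) a w ha hw fun i => by ring

theorem tensorGrading_multilinear_mem {n : ℕ} {ℛ : ℤ → Submodule K R} {𝒲 : ℤ → Submodule K W}
    {M : MultilinearMap K (fun _ : Fin n => R ⊗[K] W) Y} {P : Submodule K Y} {D : Fin n → ℤ}
    (h : ∀ (α ω : Fin n → ℤ) (a : Fin n → R) (w : Fin n → W), (∀ i, a i ∈ ℛ (α i)) →
      (∀ i, w i ∈ 𝒲 (ω i)) → (∀ i, D i = ω i - α i) → M (fun i => a i ⊗ₜ[K] w i) ∈ P)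
    {x : Fin n → R ⊗[K] W} (hx : ∀ i, x i ∈ tensorGrading ℛ 𝒲 (D i)) : M x ∈ P := by
  rw [← Submodule.Quotient.mk_eq_zero, ← Submodule.mkQ_apply]
  refine tensorGrading_multilinear_eq (M := P.mkQ.compMultilinearMap M) (N := 0)
    (fun α ω a w h1 h2 h3 => ?_) hx
  simpa using h α ω a w h1 h2 h3

theorem tensorGrading_linear_eq {ℛ : ℤ → Submodule K R} {𝒲 : ℤ → Submodule K W}
    {f g : R ⊗[K] W →ₗ[K] Y} {D : ℤ} (h : ∀ (α ω : ℤ) (a : R) (w : W), a ∈ ℛ α → w ∈ 𝒲 ω →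
      D = ω - α → f (a ⊗ₜ[K] w) = g (a ⊗ₜ[K] w))
    {x : R ⊗[K] W} (hx : x ∈ tensorGrading ℛ 𝒲 D) : f x = g x := by
  rw [tensorGrading_eq_span] at hx
  induction hx using Submodule.span_induction with
  | mem x hx =>
    obtain ⟨i, a, ha, w, hw, rfl⟩ := hx
    exact h i (D + i) a w ha hw (by ring)
  | zero => simp
  | add x y _ _ h1 h2 => rw [map_add, map_add, h1, h2]
  | smul c x _ h1 => rw [map_smul, map_smul, h1]

theorem tensorGrading_linear_mem {ℛ : ℤ → Submodule K R} {𝒲 : ℤ → Submodule K W}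
    {f : R ⊗[K] W →ₗ[K] Y} {P : Submodule K Y} {D : ℤ} (h : ∀ (α ω : ℤ) (a : R) (w : W),
      a ∈ ℛ α → w ∈ 𝒲 ω → D = ω - α → f (a ⊗ₜ[K] w) ∈ P)
    {x : R ⊗[K] W} (hx : x ∈ tensorGrading ℛ 𝒲 D) : f x ∈ P := by
  rw [← Submodule.Quotient.mk_eq_zero, ← Submodule.mkQ_apply]
  refine tensorGrading_linear_eq (f := P.mkQ ∘ₗ f) (g := 0) (fun α ω a w h1 h2 h3 => ?_) hx
  simpa using h α ω a w h1 h2 h3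

theorem tensorGrading_parity {ℛ : ℤ → Submodule K R} {𝒲 : ℤ → Submodule K W} {s : R →ₗ[K] R}
    {t : W →ₗ[K] W} (hs : IsParity ℛ s) (ht : IsParity 𝒲 t) :
    IsParity (tensorGrading ℛ 𝒲) (TensorProduct.map s t) := by
  intro D x hx
  refine tensorGrading_linear_eq (f := TensorProduct.map s t) (g := sg D • LinearMap.id)
    (fun α ω a w ha hw h => ?_) hx
  simp only [TensorProduct.map_tmul, hs ha, ht hw, LinearMap.smul_apply, LinearMap.id_apply]
  rw [← TensorProduct.smul_tmul', TensorProduct.tmul_smul, smul_smul, h, sg_sub, mul_comm]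

end TensorGrading

/-! ### Extension of scalars of multilinear maps -/

section Ext

variable {K : Type u} [Field K] {R : Type w} [Ring R] [Algebra K R]
  {W : Type v} [AddCommGroup W] [Module K W] {U : Type y} [AddCommGroup U] [Module K U]
  {ℛ : ℤ → Submodule K R} {s : R →ₗ[K] R} {t : W →ₗ[K] W}

theorem extendMultilinear_zero (s : R →ₗ[K] R) (t : W →ₗ[K] W)
    (φ : MultilinearMap K (fun _ : Fin 0 => W) U) (x : Fin 0 → R ⊗[K] W) :
    extendMultilinear s t U 0 φ x = 1 ⊗ₜ[K] φ ![] := rfl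

theorem extendMultilinear_succ_cons_tmul (s : R →ₗ[K] R) (t : W →ₗ[K] W) {n : ℕ}
    (φ : MultilinearMap K (fun _ : Fin (n + 1) => W) U) (a : R) (w : W) (x : Fin n → R ⊗[K] W) :
    extendMultilinear s t U (n + 1) φ (Fin.cons (a ⊗ₜ[K] w) x) =
      (LinearMap.mulLeft K a).rTensor U
        (extendMultilinear s t U n (φ.curryLeft (evenPart t w)) x +
          s.rTensor U (extendMultilinear s t U n (φ.curryLeft (oddPart t w)) x)) := rfl

theorem evenPart_of_odd {m : ℤ} {w : W} (h : t w = sg m • w) (hm : Odd m) :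
    evenPart t w = 0 := by
  simp [evenPart, h, sg_odd hm]

theorem oddPart_of_even {m : ℤ} {w : W} (h : t w = sg m • w) (hm : Even m) :
    oddPart t w = 0 := by
  simp [oddPart, h, sg_even hm]

/-- Extension of scalars of multilinear maps is natural in the algebra and in the modules. -/
theorem extendMultilinear_natural {R' : Type w} [Ring R'] [Algebra K R'] {s' : R' →ₗ[K] R'}
    {W' : Type x} [AddCommGroup W'] [Module K W'] {t' : W' →ₗ[K] W'}
    {U' : Type*} [AddCommGroup U'] [Module K U'] (f : R →ₐ[K] R') (hf : ∀ a, f (s a) = s' (f a))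
    (g : W →ₗ[K] W') (hg : ∀ w, g (t w) = t' (g w)) : ∀ {n : ℕ} {h : U →ₗ[K] U'}
    {φ : MultilinearMap K (fun _ : Fin n => W) U} {φ' : MultilinearMap K (fun _ : Fin n => W') U'}
    (_ : ∀ w, h (φ w) = φ' (fun i => g (w i))) (x : Fin n → R ⊗[K] W),
    TensorProduct.map f.toLinearMap h (extendMultilinear s t U n φ x) =
      extendMultilinear s' t' U' n φ' (fun i => TensorProduct.map f.toLinearMap g (x i))
  | 0, h, φ, φ', hφ, x => by
    rw [extendMultilinear_zero, extendMultilinear_zero, TensorProduct.map_tmul, hφ]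
    simp only [AlgHom.toLinearMap_apply, map_one]
    congr 2
    exact Subsingleton.elim _ _
  | n + 1, h, φ, φ', hφ, x => by
    have hev : ∀ w, g (evenPart t w) = evenPart t' (g w) := fun w => by simp [evenPart, hg]
    have hod : ∀ w, g (oddPart t w) = oddPart t' (g w) := fun w => by simp [oddPart, hg]
    have key : ∀ v, TensorProduct.map f.toLinearMap h
        (extendMultilinear s t U (n + 1) φ (Fin.cons v (Fin.tail x))) =
        extendMultilinear s' t' U' (n + 1) φ' (Fin.cons (TensorProduct.map f.toLinearMap g v)
          (fun i => TensorProduct.map f.toLinearMap g (Fin.tail x i))) := by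
      intro v
      induction v using TensorProduct.induction_on with
      | zero =>
        rw [map_zero, ← MultilinearMap.curryLeft_apply, ← MultilinearMap.curryLeft_apply]
        simp
      | add v v' h1 h2 =>
        rw [map_add, MultilinearMap.cons_add, MultilinearMap.cons_add, map_add, h1, h2]
      | tmul a w =>
        rw [TensorProduct.map_tmul, extendMultilinear_succ_cons_tmul,
          extendMultilinear_succ_cons_tmul]
        have ih : ∀ w, TensorProduct.map f.toLinearMap h
            (extendMultilinear s t U n (φ.curryLeft w) (Fin.tail x)) =
            extendMultilinear s' t' U' n (φ'.curryLeft (g w))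
              (fun i => TensorProduct.map f.toLinearMap g (Fin.tail x i)) := by
          intro w
          refine extendMultilinear_natural f hf g hg (fun w' => ?_) _
          rw [MultilinearMap.curryLeft_apply, MultilinearMap.curryLeft_apply, hφ]
          congr 1
          funext i; refine Fin.cases rfl (fun i => rfl) i
        have h1 : ∀ u, TensorProduct.map f.toLinearMap h ((LinearMap.mulLeft K a).rTensor U u) =
            (LinearMap.mulLeft K (f a)).rTensor U' (TensorProduct.map f.toLinearMap h u) := by
          intro u
          induction u using TensorProduct.induction_on with
          | zero => simp
          | add u u' h1 h2 => simp only [map_add, h1, h2]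
          | tmul b u => simp
        have h2 : ∀ u, TensorProduct.map f.toLinearMap h (s.rTensor U u) =
            s'.rTensor U' (TensorProduct.map f.toLinearMap h u) := by
          intro u
          induction u using TensorProduct.induction_on with
          | zero => simp
          | add u u' h1 h2 => simp only [map_add, h1, h2]
          | tmul b u => simp [hf]
        rw [h1, map_add, h2, ih, ih, hev, hod, AlgHom.toLinearMap_apply]
    have := key (x 0)
    rw [Fin.cons_self_tail] at this
    rw [this]
    congr 1
    funext i; refine Fin.cases rfl (fun i => rfl) i

/-- The span of the pure tensors with first factor in `P`. -/
def tensorFil (P : Submodule K R) (W : Type v) [AddCommGroup W] [Module K W] :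
    Submodule K (R ⊗[K] W) :=
  Submodule.span K {x | ∃ a ∈ P, ∃ w : W, x = a ⊗ₜ[K] w}

theorem tmul_mem_tensorFil {P : Submodule K R} {a : R} (ha : a ∈ P) (w : W) :
    a ⊗ₜ[K] w ∈ tensorFil P W := Submodule.subset_span ⟨a, ha, w, rfl⟩

theorem tensorFil_map {P Q : Submodule K R} {f : R →ₗ[K] R} (h : ∀ a ∈ P, f a ∈ Q)
    {x : R ⊗[K] W} (hx : x ∈ tensorFil P W) : f.rTensor W x ∈ tensorFil Q W := by
  induction hx using Submodule.span_induction with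
  | mem x hx =>
    obtain ⟨a, ha, w, rfl⟩ := hx
    exact tmul_mem_tensorFil (h a ha) w
  | zero => simp
  | add x y _ _ h1 h2 => rw [map_add]; exact add_mem h1 h2
  | smul c x _ h1 => rw [map_smul]; exact Submodule.smul_mem _ _ h1

/-- Extension of scalars is compatible with multiplicative filtrations of the algebra. -/
theorem extendMultilinear_mem_tensorFil {P : ℕ → Submodule K R} (h1 : 1 ∈ P 0)
    (hmul : ∀ {i j a b}, a ∈ P i → b ∈ P j → a * b ∈ P (i + j)) (hs : ∀ {i a}, a ∈ P i → s a ∈ P i) :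
    ∀ {n : ℕ} (φ : MultilinearMap K (fun _ : Fin n => W) U) {m : Fin n → ℕ} {x : Fin n → R ⊗[K] W}
      (_ : ∀ i, x i ∈ tensorFil (P (m i)) W),
      extendMultilinear s t U n φ x ∈ tensorFil (P (∑ i, m i)) U
  | 0, φ, m, x, _ => by
    rw [extendMultilinear_zero]
    exact tmul_mem_tensorFil (by simpa using h1) _
  | n + 1, φ, m, x, hx => by
    have key : ∀ v ∈ tensorFil (P (m 0)) W,
        extendMultilinear s t U (n + 1) φ (Fin.cons v (Fin.tail x)) ∈
          tensorFil (P (∑ i, m i)) U := by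
      intro v hv
      induction hv using Submodule.span_induction with
      | mem v hv =>
        obtain ⟨a, ha, w, rfl⟩ := hv
        have ih := fun v => extendMultilinear_mem_tensorFil h1 hmul hs (φ.curryLeft v)
          (x := Fin.tail x) (fun i => hx i.succ)
        rw [extendMultilinear_succ_cons_tmul, Fin.sum_univ_succ]
        refine tensorFil_map (P := P (∑ i : Fin n, m i.succ)) (fun b hb => hmul ha hb) ?_
        exact add_mem (ih _) (tensorFil_map (fun b hb => hs hb) (ih _))
      | zero => rw [← MultilinearMap.curryLeft_apply]; simp
      | add v v' _ _ h1 h2 => rw [MultilinearMap.cons_add]; exact add_mem h1 h2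
      | smul c v _ h1 => rw [MultilinearMap.cons_smul]; exact Submodule.smul_mem _ _ h1
    have := key _ (hx 0)
    rwa [Fin.cons_self_tail] at this

variable [CharZero K]

theorem evenPart_of_even {m : ℤ} {w : W} (h : t w = sg m • w) (hm : Even m) :
    evenPart t w = w := by
  simp only [evenPart, LinearMap.smul_apply, LinearMap.add_apply, LinearMap.id_apply, h,
    sg_even hm, one_smul, ← two_smul K w, smul_smul]
  rw [inv_mul_cancel₀ two_ne_zero, one_smul]

theorem oddPart_of_odd {m : ℤ} {w : W} (h : t w = sg m • w) (hm : Odd m) :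
    oddPart t w = w := by
  simp only [oddPart, LinearMap.smul_apply, LinearMap.sub_apply, LinearMap.id_apply, h,
    sg_odd hm, neg_smul, one_smul, sub_neg_eq_add, ← two_smul K w, smul_smul]
  rw [inv_mul_cancel₀ two_ne_zero, one_smul]

/-- The extension of scalars of a multilinear map, on homogeneous pure tensors. -/
theorem extendMultilinear_tmul (hR : IsGradedComm ℛ s) : ∀ {n : ℕ}
    (φ : MultilinearMap K (fun _ : Fin n => W) U) {α ω : Fin n → ℤ} {a : Fin n → R} {w : Fin n → W}
    (_ : ∀ i, a i ∈ ℛ (α i)) (_ : ∀ i, t (w i) = sg (ω i) • w i),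
    extendMultilinear s t U n φ (fun i => a i ⊗ₜ[K] w i) = extSign α ω • (oprod a ⊗ₜ[K] φ w)
  | 0, φ, α, ω, a, w, _, _ => by
    rw [extendMultilinear_zero, oprod_zero]
    simp only [extSign, Finset.univ_eq_empty, Finset.prod_empty, one_smul]
    congr 2
    exact Subsingleton.elim _ _
  | n + 1, φ, α, ω, a, w, ha, hw => by
    have ih := fun v => extendMultilinear_tmul hR (φ.curryLeft v) (fun i => ha i.succ)
      (fun i => hw i.succ)
    have e : (fun i => a i ⊗ₜ[K] w i) = (Fin.cons (a 0 ⊗ₜ[K] w 0)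
        (fun i : Fin n => a i.succ ⊗ₜ[K] w i.succ) : Fin (n + 1) → R ⊗[K] W) := by
      funext i; refine Fin.cases rfl (fun i => rfl) i
    have hc : (Fin.cons (w 0) (fun i : Fin n => w i.succ) : Fin (n + 1) → W) = w := by
      funext i; refine Fin.cases rfl (fun i => rfl) i
    rw [e, extendMultilinear_succ_cons_tmul, ih, ih, extSign_succ, oprod_succ, mul_smul]
    rcases Int.even_or_odd (ω 0) with h | h
    · rw [evenPart_of_even (hw 0) h, oddPart_of_even (hw 0) h, sg_even (h.mul_right _)]
      simp only [map_zero, zero_apply, TensorProduct.tmul_zero, smul_zero, add_zero,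
        map_zsmul, LinearMap.rTensor_tmul, LinearMap.mulLeft_apply, MultilinearMap.curryLeft_apply,
        hc, one_smul]
    · rw [evenPart_of_odd (hw 0) h, oddPart_of_odd (hw 0) h]
      simp only [map_zero, zero_apply, TensorProduct.tmul_zero, smul_zero, zero_add,
        map_zsmul, LinearMap.rTensor_tmul, LinearMap.mulLeft_apply, MultilinearMap.curryLeft_apply,
        hc]
      rw [hR.map_oprod (fun i => ha i.succ), mul_smul_comm, ← TensorProduct.smul_tmul', smul_comm]
      congr 1
      apply sg_congr
      obtain ⟨m, hm⟩ := h
      rw [hm]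
      exact ⟨-m * ∑ j : Fin n, α j.succ, by ring⟩

variable {𝒲 : ℤ → Submodule K W}

theorem extendMultilinear_congr (hR : IsGradedComm ℛ s) (ht : IsParity 𝒲 t) {n : ℕ}
    {φ ψ : MultilinearMap K (fun _ : Fin n => W) U}
    (h : ∀ (d : Fin n → ℤ) (w : Fin n → W), (∀ i, w i ∈ 𝒲 (d i)) → φ w = ψ w) {D : Fin n → ℤ}
    {x : Fin n → R ⊗[K] W} (hx : ∀ i, x i ∈ tensorGrading ℛ 𝒲 (D i)) :
    extendMultilinear s t U n φ x = extendMultilinear s t U n ψ x := by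
  refine tensorGrading_multilinear_eq (fun α ω a w ha hw _ => ?_) hx
  rw [extendMultilinear_tmul hR φ ha (fun i => ht (hw i)),
    extendMultilinear_tmul hR ψ ha (fun i => ht (hw i)), h ω w hw]

theorem extendMultilinear_mem (hR : IsGradedComm ℛ s) (ht : IsParity 𝒲 t)
    {𝒰 : ℤ → Submodule K U} {n : ℕ} {p : ℤ} {φ : MultilinearMap K (fun _ : Fin n => W) U}
    (h : ∀ (d : Fin n → ℤ) (w : Fin n → W), (∀ i, w i ∈ 𝒲 (d i)) → φ w ∈ 𝒰 (∑ i, d i + p))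
    {D : Fin n → ℤ} {x : Fin n → R ⊗[K] W} (hx : ∀ i, x i ∈ tensorGrading ℛ 𝒲 (D i)) :
    extendMultilinear s t U n φ x ∈ tensorGrading ℛ 𝒰 (∑ i, D i + p) := by
  refine tensorGrading_multilinear_mem (fun α ω a w ha hw hD => ?_) hx
  rw [extendMultilinear_tmul hR φ ha (fun i => ht (hw i))]
  refine zsmul_mem (tmul_mem_tensorGrading (hR.oprod_mem ha) (h ω w hw) ?_) _
  simp only [hD, Finset.sum_sub_distrib]
  ring

end Ext

/-! ### Composition of multilinear maps along partitions -/

section Compose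

variable {K : Type u} [Field K] {X : Type v} [AddCommGroup X] [Module K X]
  {Y : Type w} [AddCommGroup Y] [Module K Y] {Z : Type x} [AddCommGroup Z] [Module K Z]

/-- The decomposition of `Fin n` into the fibers of a label `b`, each of them ordered. -/
def fiberEquiv {n k : ℕ} (b : Fin n → Fin k) : (Σ c, Fin (fiber b c).card) ≃ Fin n :=
  (Equiv.sigmaCongrRight fun c => ((fiber b c).orderIsoOfFin rfl).toEquiv.trans
    (Equiv.subtypeEquivRight fun i => by simp)).trans (Equiv.sigmaFiberEquiv b)

/-- The multilinear map that applies `φ` to the blocks of the arguments with equal label, and `ψ`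
to the results; no sign is involved. -/
def blockComp {n k : ℕ} (b : Fin n → Fin k) (ψ : MultilinearMap K (fun _ : Fin k => Y) Z)
    (φ : Components K X Y) : MultilinearMap K (fun _ : Fin n => X) Z :=
  (ψ.compMultilinearMap fun c => φ (fiber b c).card).domDomCongr (fiberEquiv b)

theorem blockComp_apply {n k : ℕ} (b : Fin n → Fin k) (ψ : MultilinearMap K (fun _ : Fin k => Y) Z)
    (φ : Components K X Y) (x : Fin n → X) :
    blockComp b ψ φ x = ψ fun c => φ (fiber b c).card (subfamily x (fiber b c)) := rfl

/-- The multilinear map that applies `φ` to the arguments in `S`, and `ψ` to the result and the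
remaining arguments; no sign is involved. -/
def insComp {n : ℕ} (S : Finset (Fin n)) (ψ : MultilinearMap K (fun _ : Fin (Sᶜ.card + 1) => Y) Z)
    (φ : MultilinearMap K (fun _ : Fin S.card => Y) Y) : MultilinearMap K (fun _ : Fin n => Y) Z :=
  (MultilinearMap.uncurrySum (N := fun _ : Fin S.card ⊕ Fin Sᶜ.card => Y)
    (ψ.curryLeft.compMultilinearMap φ)).domDomCongr (finSumEquivOfFinset rfl rfl)

theorem insComp_apply {n : ℕ} (S : Finset (Fin n))
    (ψ : MultilinearMap K (fun _ : Fin (Sᶜ.card + 1) => Y) Z)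
    (φ : MultilinearMap K (fun _ : Fin S.card => Y) Y) (x : Fin n → Y) :
    insComp S ψ φ x = ψ (Fin.cons (φ (subfamily x S)) (subfamily x Sᶜ)) := by
  simp [insComp, MultilinearMap.uncurrySum_apply, finSumEquivOfFinset_inl,
    finSumEquivOfFinset_inr]
  rfl

/-- The multilinear map that is `M`, multiplied by the Koszul sign of sorting the arguments by
their labels, on homogeneous arguments. -/
def signTwist (t : X →ₗ[K] X) {n : ℕ} {κ : Type*} [LinearOrder κ] (b : Fin n → κ)
    (M : MultilinearMap K (fun _ : Fin n => X) Z) : MultilinearMap K (fun _ : Fin n => X) Z :=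
  ∑ p : Fin n → Bool, koszulSign (fun i => if p i then 1 else 0) b •
    M.compLinearMap fun i => if p i then oddPart t else evenPart t

theorem signTwist_apply [CharZero K] {t : X →ₗ[K] X} {n : ℕ} {κ : Type*} [LinearOrder κ]
    (b : Fin n → κ) (M : MultilinearMap K (fun _ : Fin n => X) Z) {d : Fin n → ℤ} {x : Fin n → X}
    (hx : ∀ i, t (x i) = sg (d i) • x i) : signTwist t b M x = koszulSign d b • M x := by
  classical
  rw [signTwist, sum_apply, Finset.sum_eq_single fun i => decide (Odd (d i))]
  · rw [smul_apply, MultilinearMap.compLinearMap_apply]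
    congr 1
    · apply koszulSign_congr_degree
      intro i
      by_cases h : Odd (d i)
      · simp [h, sg_odd]
      · rw [sg_even (Int.not_odd_iff_even.1 h)]; simp [h]
    · congr 1
      funext i
      by_cases h : Odd (d i)
      · simp [h, oddPart_of_odd (hx i) h]
      · simp [h, evenPart_of_even (hx i) (Int.not_odd_iff_even.1 h)]
  · intro p _ hp
    obtain ⟨i, hi⟩ := Function.ne_iff.1 hp
    rw [smul_apply, MultilinearMap.compLinearMap_apply,
      M.map_coord_zero i, smul_zero]
    by_cases h : Odd (d i)
    · have : p i = false := by simpa [h] using hi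
      simp [this, evenPart_of_odd (hx i) h]
    · have : p i = true := by simpa [h] using hi
      simp [this, oddPart_of_even (hx i) (Int.not_odd_iff_even.1 h)]
  · intro h; exact absurd (Finset.mem_univ _) h

theorem map_zsmul_univ {n : ℕ} (M : MultilinearMap K (fun _ : Fin n => X) Z) (c : Fin n → ℤ)
    (x : Fin n → X) : M (fun i => c i • x i) = (∏ i, c i) • M x :=
  (M.restrictScalars ℤ).map_smul_univ c x

theorem map_cons_zsmul {n : ℕ} (M : MultilinearMap K (fun _ : Fin (n + 1) => X) Z) (c : ℤ) (v : X)
    (x : Fin n → X) : M (Fin.cons (c • v) x) = c • M (Fin.cons v x) := by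
  rw [← MultilinearMap.curryLeft_apply, map_zsmul, smul_apply, MultilinearMap.curryLeft_apply]

end Compose

section Transfer

variable {K : Type u} [Field K] [CharZero K] {R : Type w} [Ring R] [Algebra K R]
  {ℛ : ℤ → Submodule K R} {s : R →ₗ[K] R}
  {X : Type v} [AddCommGroup X] [Module K X] {Y : Type x} [AddCommGroup Y] [Module K Y]
  {Z : Type y} [AddCommGroup Z] [Module K Z]
  {𝒳 : ℤ → Submodule K X} {𝒴 : ℤ → Submodule K Y} {t : X →ₗ[K] X} {t' : Y →ₗ[K] Y}

/-- Extension of scalars is compatible with composition along a partition into blocks. -/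
theorem extendMultilinear_blockComp (hR : IsGradedComm ℛ s) (ht : IsParity 𝒳 t)
    (ht' : IsParity 𝒴 t') {n k : ℕ} (b : Fin n → Fin k)
    (ψ : MultilinearMap K (fun _ : Fin k => Y) Z) {φ : Components K X Y}
    (hφ : ∀ (m : ℕ) (d : Fin m → ℤ) (x : Fin m → X), (∀ i, x i ∈ 𝒳 (d i)) →
      φ m x ∈ 𝒴 (∑ i, d i)) {D : Fin n → ℤ} {x : Fin n → R ⊗[K] X}
    (hx : ∀ i, x i ∈ tensorGrading ℛ 𝒳 (D i)) :
    extendMultilinear s t Z n (signTwist t b (blockComp b ψ φ)) x = koszulSign D b •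
      blockComp b (extendMultilinear s t' Z k ψ) (fun m => extendMultilinear s t Y m (φ m)) x := by
  refine tensorGrading_multilinear_eq (M := extendMultilinear s t Z n _)
    (N := koszulSign D b • blockComp b _ _) (fun α ω a w ha hw hD => ?_) hx
  rw [extendMultilinear_tmul hR _ ha (fun i => ht (hw i)), signTwist_apply b _ (fun i => ht (hw i)),
    smul_apply, blockComp_apply, blockComp_apply]
  have h1 : ∀ c, extendMultilinear s t Y (fiber b c).card (φ (fiber b c).card)
      (subfamily (fun i => a i ⊗ₜ[K] w i) (fiber b c)) =
      extSign (subfamily α (fiber b c)) (subfamily ω (fiber b c)) •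
        (oprod (subfamily a (fiber b c)) ⊗ₜ[K] φ _ (subfamily w (fiber b c))) := fun c =>
    extendMultilinear_tmul hR (φ (fiber b c).card) (a := subfamily a (fiber b c))
      (w := subfamily w (fiber b c)) (fun i => ha _) (fun i => ht (hw _))
  simp only [h1]
  rw [map_zsmul_univ, extendMultilinear_tmul hR ψ (α := fun c => ∑ i ∈ fiber b c, α i)
    (ω := fun c => ∑ i ∈ fiber b c, ω i) (a := fun c => oprod (subfamily a (fiber b c)))
    (w := fun c => φ _ (subfamily w (fiber b c))), hR.oprod_fiber ha, TensorProduct.tmul_smul,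
    ← TensorProduct.smul_tmul', smul_smul, smul_smul, smul_smul, smul_smul]
  · congr 1
    rw [← extSign_fiber, funext hD]
    ring
  · intro c
    rw [← sum_subfamily]
    exact hR.oprod_mem fun i => ha _
  · intro c
    rw [← sum_subfamily]
    exact ht' (hφ _ _ _ fun i => hw _)

/-- Extension of scalars is compatible with inserting an operation of degree `p`; the involution
`σ` is the sign of moving this operation past the scalars. -/
theorem extendMultilinear_insComp (hR : IsGradedComm ℛ s) (ht : IsParity 𝒳 t)
    {p : ℤ} {σ : R →ₗ[K] R} (hσ : ∀ ⦃i : ℤ⦄ ⦃a : R⦄, a ∈ ℛ i → σ a = sg (p * i) • a) {n : ℕ}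
    (S : Finset (Fin n)) (ψ : MultilinearMap K (fun _ : Fin (Sᶜ.card + 1) => X) Z)
    {φ : MultilinearMap K (fun _ : Fin S.card => X) X}
    (hφ : ∀ (d : Fin S.card → ℤ) (x : Fin S.card → X), (∀ i, x i ∈ 𝒳 (d i)) →
      φ x ∈ 𝒳 (∑ i, d i + p)) {D : Fin n → ℤ} {x : Fin n → R ⊗[K] X}
    (hx : ∀ i, x i ∈ tensorGrading ℛ 𝒳 (D i)) :
    σ.rTensor Z (extendMultilinear s t Z n
      (signTwist t (fun i => if i ∈ S then 0 else 1) (insComp S ψ φ)) x) =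
      koszulSign D (fun i => if i ∈ S then 0 else 1) • insComp S (extendMultilinear s t Z _ ψ)
        ((σ.rTensor X).compMultilinearMap (extendMultilinear s t X _ φ)) x := by
  refine tensorGrading_multilinear_eq (M := (σ.rTensor Z).compMultilinearMap
    (extendMultilinear s t Z n _)) (N := koszulSign D _ • insComp S _ _)
    (fun α ω a w ha hw hD => ?_) hx
  have h1 : extendMultilinear s t X S.card φ (subfamily (fun i => a i ⊗ₜ[K] w i) S) =
      extSign (subfamily α S) (subfamily ω S) •
        (oprod (subfamily a S) ⊗ₜ[K] φ (subfamily w S)) :=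
    extendMultilinear_tmul hR φ (a := subfamily a S) (w := subfamily w S) (fun i => ha _)
      (fun i => ht (hw _))
  have h2 : (Fin.cons (oprod (subfamily a S) ⊗ₜ[K] φ (subfamily w S))
      (subfamily (fun i => a i ⊗ₜ[K] w i) Sᶜ) : Fin (Sᶜ.card + 1) → R ⊗[K] X) = fun i =>
      (Fin.cons (oprod (subfamily a S)) (subfamily a Sᶜ) : Fin (Sᶜ.card + 1) → R) i ⊗ₜ[K]
        (Fin.cons (φ (subfamily w S)) (subfamily w Sᶜ) : Fin (Sᶜ.card + 1) → X) i := by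
    funext i; refine Fin.cases rfl (fun i => rfl) i
  rw [LinearMap.compMultilinearMap_apply, extendMultilinear_tmul hR _ ha (fun i => ht (hw i)),
    signTwist_apply _ _ (fun i => ht (hw i)),
    smul_apply, insComp_apply, insComp_apply, LinearMap.compMultilinearMap_apply, h1, map_zsmul,
    LinearMap.rTensor_tmul, map_zsmul, LinearMap.rTensor_tmul,
    hσ (hR.oprod_mem ha), hσ (hR.oprod_mem (a := subfamily a S) (α := subfamily α S) fun i => ha _),
    ← TensorProduct.smul_tmul', ← TensorProduct.smul_tmul', smul_smul, smul_smul, map_cons_zsmul, h2,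
    extendMultilinear_tmul hR ψ
    (α := (Fin.cons (∑ i ∈ S, α i) (subfamily α Sᶜ) : Fin (Sᶜ.card + 1) → ℤ))
    (ω := (Fin.cons (∑ i ∈ S, ω i + p) (subfamily ω Sᶜ) : Fin (Sᶜ.card + 1) → ℤ))]
  · have h3 : oprod (Fin.cons (oprod (subfamily a S)) (subfamily a Sᶜ) :
        Fin (Sᶜ.card + 1) → R) = koszulSign α (fun i => if i ∈ S then 0 else 1) • oprod a := by
      rw [oprod_succ, ← hR.oprod_subset ha]
      simp
    rw [h3, TensorProduct.tmul_smul, ← TensorProduct.smul_tmul']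
    simp only [smul_smul]
    congr 1
    have key := extSign_subset α ω S p
    have h4 : sg (p * ∑ i, α i) = sg (p * ∑ i ∈ S, α i) * sg (p * ∑ i ∈ Sᶜ, α i) := by
      rw [← sg_add, ← mul_add, Finset.sum_add_sum_compl]
    rw [funext hD, h4, sum_subfamily]
    calc _ = sg (p * ∑ i ∈ S, α i) * (sg (p * ∑ i ∈ Sᶜ, α i) *
          (extSign α ω * koszulSign ω (fun i => if i ∈ S then 0 else 1))) := by ring
      _ = _ := by rw [← key]; ring
  · intro i
    refine Fin.cases ?_ (fun i => ha _) i
    simp only [Fin.cons_zero]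
    rw [← sum_subfamily]
    exact hR.oprod_mem fun i => ha _
  · intro i
    refine Fin.cases ?_ (fun i => ht (hw _)) i
    simp only [Fin.cons_zero]
    rw [← sum_subfamily]
    exact ht (hφ _ _ fun i => hw _)

end Transfer

/-! ### The compositions in the definition of an `L∞` morphism -/

section Comp

variable {K : Type u} [Field K] {X : Type v} [AddCommGroup X] [Module K X]
  {Y : Type w} [AddCommGroup Y] [Module K Y] {Z : Type x} [AddCommGroup Z] [Module K Z]
  {𝒳 : ℤ → Submodule K X}

/-- The components of the composite of the morphism of coalgebras with components `φ` with the
linear map with components `ψ`. -/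
def comp (t : X →ₗ[K] X) (ψ : Components K Y Z) (φ : Components K X Y) : Components K X Z :=
  fun n => ∑ k ∈ Finset.range (n + 1), ((k.factorial : K))⁻¹ • ∑ b : Fin n → Fin k,
    signTwist t b (blockComp b (ψ k) φ)

/-- The components of the composite of the coderivation with components `φ` with the linear map
with components `ψ`. -/
def insertion (t : X →ₗ[K] X) (ψ : Components K X Z) (φ : Components K X X) : Components K X Z :=
  fun _ => ∑ S, signTwist t (fun i => if i ∈ S then 0 else 1) (insComp S (ψ _) (φ _))

theorem comp_apply [CharZero K] {t : X →ₗ[K] X} (ht : IsParity 𝒳 t) (ψ : Components K Y Z)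
    (φ : Components K X Y) {n : ℕ} {d : Fin n → ℤ} {x : Fin n → X} (hx : ∀ i, x i ∈ 𝒳 (d i)) :
    comp t ψ φ n x = ∑ k ∈ Finset.range (n + 1), ((k.factorial : K))⁻¹ • ∑ b : Fin n → Fin k,
      koszulSign d b • ψ k (fun a => φ (fiber b a).card (subfamily x (fiber b a))) := by
  simp only [comp, sum_apply, smul_apply]
  refine Finset.sum_congr rfl fun k _ => ?_
  congr 1
  refine Finset.sum_congr rfl fun b _ => ?_
  rw [signTwist_apply b _ (fun i => ht (hx i)), blockComp_apply]

theorem insertion_apply [CharZero K] {t : X →ₗ[K] X} (ht : IsParity 𝒳 t) (ψ : Components K X Z)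
    (φ : Components K X X) {n : ℕ} {d : Fin n → ℤ} {x : Fin n → X} (hx : ∀ i, x i ∈ 𝒳 (d i)) :
    insertion t ψ φ n x = ∑ S : Finset (Fin n), koszulSign d (fun i => if i ∈ S then 0 else 1) •
      ψ (Sᶜ.card + 1) (Fin.cons (φ S.card (subfamily x S)) (subfamily x Sᶜ)) := by
  simp only [insertion, sum_apply]
  refine Finset.sum_congr rfl fun S _ => ?_
  rw [signTwist_apply _ _ (fun i => ht (hx i)), insComp_apply]

variable [CharZero K] {R : Type y} [Ring R] [Algebra K R] {ℛ : ℤ → Submodule K R} {s : R →ₗ[K] R}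
  {𝒴 : ℤ → Submodule K Y} {t : X →ₗ[K] X} {t' : Y →ₗ[K] Y}

theorem extendMultilinear_comp (hR : IsGradedComm ℛ s) (ht : IsParity 𝒳 t)
    (ht' : IsParity 𝒴 t') (ψ : Components K Y Z) {φ : Components K X Y}
    (hφ : ∀ (m : ℕ) (d : Fin m → ℤ) (x : Fin m → X), (∀ i, x i ∈ 𝒳 (d i)) →
      φ m x ∈ 𝒴 (∑ i, d i)) {n : ℕ} {D : Fin n → ℤ} {x : Fin n → R ⊗[K] X}
    (hx : ∀ i, x i ∈ tensorGrading ℛ 𝒳 (D i)) :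
    extendMultilinear s t Z n (comp t ψ φ n) x = ∑ k ∈ Finset.range (n + 1),
      ((k.factorial : K))⁻¹ • ∑ b : Fin n → Fin k, koszulSign D b •
      extendMultilinear s t' Z k (ψ k) (fun a => extendMultilinear s t Y (fiber b a).card
        (φ (fiber b a).card) (subfamily x (fiber b a))) := by
  simp only [comp, map_sum, map_smul, sum_apply, smul_apply]
  refine Finset.sum_congr rfl fun k _ => ?_
  congr 1
  refine Finset.sum_congr rfl fun b _ => ?_
  rw [extendMultilinear_blockComp hR ht ht' b (ψ k) hφ hx]
  rfl

theorem extendMultilinear_insert (hR : IsGradedComm ℛ s) (ht : IsParity 𝒳 t)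
    {p : ℤ} {σ : R →ₗ[K] R} (hσ : ∀ ⦃i : ℤ⦄ ⦃a : R⦄, a ∈ ℛ i → σ a = sg (p * i) • a)
    (ψ : Components K X Z) {φ : Components K X X}
    (hφ : ∀ (m : ℕ) (d : Fin m → ℤ) (x : Fin m → X), (∀ i, x i ∈ 𝒳 (d i)) →
      φ m x ∈ 𝒳 (∑ i, d i + p)) {n : ℕ} {D : Fin n → ℤ} {x : Fin n → R ⊗[K] X}
    (hx : ∀ i, x i ∈ tensorGrading ℛ 𝒳 (D i)) :
    σ.rTensor Z (extendMultilinear s t Z n (insertion t ψ φ n) x) = ∑ S : Finset (Fin n),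
      koszulSign D (fun i => if i ∈ S then 0 else 1) •
      extendMultilinear s t Z (Sᶜ.card + 1) (ψ (Sᶜ.card + 1)) (Fin.cons (σ.rTensor X
        (extendMultilinear s t X S.card (φ S.card) (subfamily x S))) (subfamily x Sᶜ)) := by
  simp only [insertion, map_sum, sum_apply]
  refine Finset.sum_congr rfl fun S _ => ?_
  rw [extendMultilinear_insComp hR ht hσ S (ψ _) (hφ _) hx, insComp_apply]
  rfl

end Comp

/-! ### Graded symmetric operations -/

section Symm

variable {K : Type u} [Field K] {X : Type v} [AddCommGroup X] [Module K X]
  {Y : Type w} [AddCommGroup Y] [Module K Y] {𝒳 : ℤ → Submodule K X}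

/-- Graded symmetry of a family of operations. -/
def IsGradedSymm (𝒳 : ℤ → Submodule K X) (φ : Components K X Y) : Prop :=
  ∀ (n : ℕ) (d : Fin n → ℤ) (x : Fin n → X), (∀ i, x i ∈ 𝒳 (d i)) →
    ∀ σ : Equiv.Perm (Fin n), φ n x = koszulSign d σ.symm • φ n (x ∘ σ)

theorem IsGradedSymm.equiv {φ : Components K X Y} (h : IsGradedSymm 𝒳 φ) {m n : ℕ}
    (τ : Fin m ≃ Fin n) {d : Fin n → ℤ} {x : Fin n → X} (hx : ∀ i, x i ∈ 𝒳 (d i)) :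
    φ n x = koszulSign d τ.symm • φ m (x ∘ τ) := by
  obtain rfl : m = n := by simpa using Fintype.card_congr τ
  exact h m d x hx τ

/-- No sign occurs if every transposed pair has a factor of even degree. -/
theorem IsGradedSymm.equiv_of_even {φ : Components K X Y} (h : IsGradedSymm 𝒳 φ) {m n : ℕ}
    (τ : Fin m ≃ Fin n) {d : Fin n → ℤ} {x : Fin n → X} (hx : ∀ i, x i ∈ 𝒳 (d i))
    (hd : ∀ i j, i < j → τ.symm j < τ.symm i → Even (d i * d j)) :
    φ n x = φ m (x ∘ τ) := by
  rw [h.equiv τ hx, koszulSign_eq_one hd, one_smul]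

/-- The bijection that lists `i` first, and the other indices in increasing order afterwards. -/
def consCompl {n : ℕ} (i : Fin n) : Fin (({i}ᶜ : Finset (Fin n)).card + 1) ≃ Fin n :=
  Equiv.ofBijective (Fin.cons i (({i}ᶜ : Finset (Fin n)).orderEmbOfFin rfl)) (by
    constructor
    · rw [Fin.cons_injective_iff]
      refine ⟨?_, (Finset.orderEmbOfFin _ rfl).injective⟩
      rintro ⟨p, hp⟩
      have := Finset.orderEmbOfFin_mem ({i}ᶜ : Finset (Fin n)) rfl p
      rw [hp] at this
      simp at this
    · intro j
      by_cases hj : j = i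
      · exact ⟨0, by simp [hj]⟩
      · have : j ∈ Set.range (({i}ᶜ : Finset (Fin n)).orderEmbOfFin rfl) := by
          rw [Finset.range_orderEmbOfFin]; simpa using hj
        obtain ⟨p, hp⟩ := this
        exact ⟨p.succ, by simpa using hp⟩)

@[simp] theorem consCompl_zero {n : ℕ} (i : Fin n) : consCompl i 0 = i := rfl

@[simp] theorem consCompl_succ {n : ℕ} (i : Fin n) (p : Fin ({i}ᶜ : Finset (Fin n)).card) :
    consCompl i p.succ = ({i}ᶜ : Finset (Fin n)).orderEmbOfFin rfl p := rfl

theorem consCompl_symm_inversion {n : ℕ} (i j k : Fin n) (hjk : j < k) :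
    (consCompl i).symm k < (consCompl i).symm j ↔ k = i ∧ j ≠ i := by
  obtain ⟨p, rfl⟩ := (consCompl i).surjective j
  obtain ⟨q, rfl⟩ := (consCompl i).surjective k
  simp only [Equiv.symm_apply_apply]
  revert hjk
  refine Fin.cases ?_ (fun q => ?_) q <;> refine Fin.cases ?_ (fun p => ?_) p
  · simp
  · have h1 := Finset.orderEmbOfFin_mem ({i}ᶜ : Finset (Fin n)) rfl p
    rw [Finset.mem_compl, Finset.mem_singleton] at h1
    simp [h1]
  · simp
  · have h1 := Finset.orderEmbOfFin_mem ({i}ᶜ : Finset (Fin n)) rfl q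
    simp only [Finset.mem_compl, Finset.mem_singleton] at h1
    simp only [consCompl_succ, OrderEmbedding.lt_iff_lt, h1, false_and, iff_false, not_lt]
    intro h
    exact (Fin.succ_lt_succ_iff.2 h).le

theorem koszulSign_consCompl {n : ℕ} (d : Fin n → ℤ) (i : Fin n) :
    koszulSign d (consCompl i).symm = ∏ j, if j < i then sg (d j * d i) else 1 := by
  rw [koszulSign_eq]
  refine Finset.prod_congr rfl fun j _ => ?_
  rw [Finset.prod_eq_single i]
  · by_cases h : j < i
    · rw [if_pos h, if_pos ⟨h, (consCompl_symm_inversion i j i h).2 ⟨rfl, h.ne⟩⟩]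
    · rw [if_neg h, if_neg fun h' => h h'.1]
  · intro k _ hk
    rw [if_neg]
    rintro ⟨h1, h2⟩
    exact hk ((consCompl_symm_inversion i j k h1).1 h2).1
  · intro h; exact absurd (Finset.mem_univ _) h

theorem koszulSign_singleton {n : ℕ} (d : Fin n → ℤ) (i : Fin n) :
    koszulSign d (fun j => if j ∈ ({i} : Finset (Fin n)) then 0 else 1) =
      ∏ j, if j < i then sg (d j * d i) else 1 := by
  rw [← koszulSign_consCompl, koszulSign_eq, koszulSign_eq]
  refine Finset.prod_congr rfl fun j _ => Finset.prod_congr rfl fun k _ => ?_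
  by_cases h : j < k
  · simp only [h, true_and, consCompl_symm_inversion i j k h, Finset.mem_singleton]
    by_cases hk : k = i <;> by_cases hj : j = i <;> simp [hk, hj]
  · simp [h]

theorem cons_subfamily_compl {T : Type*} {n : ℕ} (i : Fin n) (x : Fin n → T) :
    (Fin.cons (x i) (subfamily x ({i}ᶜ : Finset (Fin n))) :
      Fin (({i}ᶜ : Finset (Fin n)).card + 1) → T) = x ∘ consCompl i := by
  funext p
  refine Fin.cases rfl (fun p => rfl) p

end Symm

/-! ### Extension of scalars of `L∞` structures -/

section ExtSymm

variable {K : Type u} [Field K] [CharZero K] {R : Type w} [Ring R] [Algebra K R]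
  {ℛ : ℤ → Submodule K R} {s : R →ₗ[K] R}
  {X : Type v} [AddCommGroup X] [Module K X] {Y : Type x} [AddCommGroup Y] [Module K Y]
  {𝒳 : ℤ → Submodule K X} {t : X →ₗ[K] X}

theorem extSign_perm {n : ℕ} (α ω : Fin n → ℤ) (σ : Equiv.Perm (Fin n)) :
    koszulSign (fun i => ω i - α i) σ.symm * koszulSign α σ.symm *
      extSign (α ∘ σ) (ω ∘ σ) = extSign α ω * koszulSign ω σ.symm := by
  rw [← extSign_fiber]
  have hf : ∀ c, fiber σ.symm c = {σ c} := fun c => by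
    ext i; simp [Equiv.symm_apply_eq]
  have h1 : ∀ c, extSign (subfamily α (fiber σ.symm c)) (subfamily ω (fiber σ.symm c)) = 1 := by
    intro c
    rw [extSign_subfamily, hf]
    simp
  simp only [h1, Finset.prod_const_one, one_mul, hf, Finset.sum_singleton]
  rfl

theorem extendMultilinear_symm (hR : IsGradedComm ℛ s) (ht : IsParity 𝒳 t) {φ : Components K X Y}
    (hφ : IsGradedSymm 𝒳 φ) :
    IsGradedSymm (tensorGrading ℛ 𝒳) (fun n => extendMultilinear s t Y n (φ n)) := by
  intro n D x hx σ
  refine tensorGrading_multilinear_eq (M := extendMultilinear s t Y n (φ n))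
    (N := koszulSign D σ.symm • (extendMultilinear s t Y n (φ n)).domDomCongr σ)
    (fun α ω a w ha hw hD => ?_) hx
  have e := extendMultilinear_tmul hR (φ n) (a := a ∘ σ) (w := w ∘ σ) (α := α ∘ σ) (ω := ω ∘ σ)
      (t := t) (fun i => ha (σ i)) (fun i => ht (hw (σ i)))
  simp only [Function.comp_apply] at e
  rw [smul_apply, MultilinearMap.domDomCongr_apply,
    extendMultilinear_tmul hR _ ha (fun i => ht (hw i)), e, hR.oprod_perm ha, hφ n ω w hw σ,
    TensorProduct.tmul_smul, ← TensorProduct.smul_tmul', smul_smul, smul_smul, smul_smul,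
    ← extSign_perm, funext hD]
  congr 1
  ring

/-- Extension of scalars of brackets to `R ⊗ X`, where `d` is the differential of `R`. -/
def extBrackets (s d : R →ₗ[K] R) (t : X →ₗ[K] X) (ℓ : Brackets K X) : Brackets K (R ⊗[K] X) :=
  fun n => (s.rTensor X).compMultilinearMap (extendMultilinear s t X n (ℓ n)) +
    unaryBracket (d.rTensor X) n

/-- The linear map `d` is a differential of degree `1` of the graded algebra `R`. -/
structure IsDifferential (ℛ : ℤ → Submodule K R) (d : R →ₗ[K] R) : Prop where
  mem : ∀ {i : ℤ} {a : R}, a ∈ ℛ i → d a ∈ ℛ (i + 1)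
  sq : ∀ a, d (d a) = 0
  leibniz : ∀ {i : ℤ} {a : R} (b : R), a ∈ ℛ i → d (a * b) = d a * b + sg i • (a * d b)

theorem IsDifferential.one {d : R →ₗ[K] R} (hd : IsDifferential ℛ d) (hR : IsGradedComm ℛ s) :
    d 1 = 0 := by
  have := hd.leibniz 1 hR.one_mem
  simpa using this

theorem IsDifferential.oprod {d : R →ₗ[K] R} (hd : IsDifferential ℛ d) (hR : IsGradedComm ℛ s) :
    ∀ {n : ℕ} {a : Fin n → R} {α : Fin n → ℤ}, (∀ i, a i ∈ ℛ (α i)) →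
      d (oprod a) = ∑ i, sg (∑ j, if j < i then α j else 0) •
        oprod (Function.update a i (d (a i)))
  | 0, a, α, _ => by simp [oprod_zero, hd.one hR]
  | n + 1, a, α, h => by
    rw [oprod_succ, hd.leibniz _ (h 0), hd.oprod hR (fun i => h i.succ), Fin.sum_univ_succ]
    congr 1
    · rw [oprod_succ]
      simp [Function.update_of_ne, Fin.succ_ne_zero]
    · rw [Finset.mul_sum, Finset.smul_sum]
      refine Finset.sum_congr rfl fun i _ => ?_
      rw [oprod_succ, Fin.sum_univ_succ, mul_smul_comm, smul_smul, ← sg_add]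
      have e : (fun j : Fin n => Function.update a i.succ (d (a i.succ)) j.succ) =
          Function.update (fun j : Fin n => a j.succ) i (d (a i.succ)) := by
        funext j
        by_cases hj : j = i
        · subst hj; simp
        · rw [Function.update_of_ne hj, Function.update_of_ne (fun h => hj (Fin.succ_injective _ h))]
      simp [e, Fin.succ_lt_succ_iff, Function.update_of_ne (Fin.succ_ne_zero i).symm]

theorem extSign_update {n : ℕ} (α ω : Fin n → ℤ) (i : Fin n) :
    extSign (Function.update α i (α i + 1)) ω =
      extSign α ω * sg (∑ j, if j < i then ω j else 0) := by
  rw [sg_sum]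
  simp only [extSign]
  rw [← Finset.prod_mul_distrib]
  refine Finset.prod_congr rfl fun j _ => ?_
  have h : (sg (if j < i then ω j else 0)) =
      ∏ k, if k = i then (if j < k then sg (ω j) else 1) else 1 := by
    rw [Finset.prod_ite_eq' Finset.univ i]
    simp only [Finset.mem_univ, if_true]
    split_ifs <;> simp
  rw [h, ← Finset.prod_mul_distrib]
  refine Finset.prod_congr rfl fun k _ => ?_
  by_cases hk : k = i
  · subst hk
    simp only [Function.update_self, if_true]
    split_ifs
    · rw [mul_add, sg_add, mul_one]
    · simp
  · simp [hk]

theorem unaryBracket_one (f : X →ₗ[K] X) (x : Fin 1 → X) : unaryBracket f 1 x = f (x 0) := rfl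

theorem unaryBracket_of_ne (f : X →ₗ[K] X) {n : ℕ} (h : n ≠ 1) (x : Fin n → X) :
    unaryBracket f n x = 0 := by
  match n with
  | 0 => rfl
  | 1 => exact absurd rfl h
  | n + 2 => rfl

theorem unaryBracket_singleton (f : X →ₗ[K] X) {n : ℕ} (i : Fin n) (x : Fin n → X) :
    unaryBracket f ({i} : Finset (Fin n)).card (subfamily x {i}) = f (x i) := by
  have key : ∀ (m : ℕ) (h : m = 1) (y : Fin m → X), unaryBracket f m y = f (y (Fin.cast h.symm 0)) := by
    rintro m rfl y; rfl
  rw [key _ (Finset.card_singleton i)]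
  congr 2
  have h1 := Finset.orderEmbOfFin_mem ({i} : Finset (Fin n)) rfl
    (Fin.cast (Finset.card_singleton i).symm 0)
  rw [Finset.mem_singleton] at h1
  exact congrArg x h1

theorem sum_eq_sum_singleton {Y : Type*} [AddCommMonoid Y] {n : ℕ} {F : Finset (Fin n) → Y}
    (h : ∀ S, S.card ≠ 1 → F S = 0) : ∑ S, F S = ∑ i, F {i} := by
  have e := Finset.sum_map Finset.univ
    ⟨fun i => ({i} : Finset (Fin n)), Finset.singleton_injective⟩ F
  simp only [Function.Embedding.coeFn_mk] at e
  rw [← e]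
  symm
  refine Finset.sum_subset (Finset.subset_univ _) fun S _ hS => h S fun hc => hS ?_
  obtain ⟨i, rfl⟩ := Finset.card_eq_one.1 hc
  simp

theorem IsLInfty.gradedSymm {ℓ : Brackets K X} (h : IsLInfty 𝒳 ℓ) : IsGradedSymm 𝒳 ℓ := h.symm

/-- The part of the extended brackets without the differential of the algebra. -/
abbrev oddExt (s : R →ₗ[K] R) (t : X →ₗ[K] X) (ℓ : Components K X Y) : Components K (R ⊗[K] X)
    (R ⊗[K] Y) := fun n => (s.rTensor Y).compMultilinearMap (extendMultilinear s t Y n (ℓ n))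

theorem oddExt_symm (hR : IsGradedComm ℛ s) (ht : IsParity 𝒳 t) {ℓ : Components K X Y}
    (hℓ : IsGradedSymm 𝒳 ℓ) : IsGradedSymm (tensorGrading ℛ 𝒳) (oddExt s t ℓ) := by
  intro n D x hx σ
  simp only [oddExt, LinearMap.compMultilinearMap_apply]
  rw [extendMultilinear_symm hR ht hℓ n D x hx σ, map_zsmul]

theorem rTensor_parity_mem {𝒴 : ℤ → Submodule K Y} (hR : IsGradedComm ℛ s) {D : ℤ}
    {y : R ⊗[K] Y} (hy : y ∈ tensorGrading ℛ 𝒴 D) : s.rTensor Y y ∈ tensorGrading ℛ 𝒴 D := by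
  refine tensorGrading_linear_mem (fun α ω a w ha hw h => ?_) hy
  rw [LinearMap.rTensor_tmul, hR.parity ha, ← TensorProduct.smul_tmul']
  exact zsmul_mem (tmul_mem_tensorGrading ha hw (by rw [h]; ring)) _

theorem rTensor_parity_sq {𝒴 : ℤ → Submodule K Y} (hR : IsGradedComm ℛ s) {D : ℤ}
    {y : R ⊗[K] Y} (hy : y ∈ tensorGrading ℛ 𝒴 D) : s.rTensor Y (s.rTensor Y y) = y := by
  refine tensorGrading_linear_eq (f := s.rTensor Y ∘ₗ s.rTensor Y) (g := LinearMap.id)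
    (fun α ω a w ha hw h => ?_) hy
  simp only [LinearMap.comp_apply, LinearMap.rTensor_tmul, hR.parity ha, map_zsmul, smul_smul,
    sg_mul_self, one_smul, LinearMap.id_apply]

theorem differential_mem {d : R →ₗ[K] R} (hd : IsDifferential ℛ d) {D : ℤ} {x : R ⊗[K] X}
    (hx : x ∈ tensorGrading ℛ 𝒳 D) : d.rTensor X x ∈ tensorGrading ℛ 𝒳 (D - 1) := by
  refine tensorGrading_linear_mem (fun α ω a w ha hw h => ?_) hx
  rw [LinearMap.rTensor_tmul]
  exact tmul_mem_tensorGrading (hd.mem ha) hw (by rw [h]; ring)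

theorem oddExt_mem (hR : IsGradedComm ℛ s) (ht : IsParity 𝒳 t) {𝒴 : ℤ → Submodule K Y}
    {ℓ : Components K X Y} {n : ℕ} {p : ℤ} (h : ∀ (d : Fin n → ℤ) (x : Fin n → X),
      (∀ i, x i ∈ 𝒳 (d i)) → ℓ n x ∈ 𝒴 (∑ i, d i + p)) {D : Fin n → ℤ} {x : Fin n → R ⊗[K] X}
    (hx : ∀ i, x i ∈ tensorGrading ℛ 𝒳 (D i)) :
    oddExt s t ℓ n x ∈ tensorGrading ℛ 𝒴 (∑ i, D i + p) :=
  rTensor_parity_mem hR (extendMultilinear_mem hR ht h hx)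

/-- The differential of the algebra is a derivation of the extended brackets. -/
theorem differential_oddExt {d : R →ₗ[K] R} (hd : IsDifferential ℛ d) (hR : IsGradedComm ℛ s)
    (ht : IsParity 𝒳 t) (ℓ : Components K X X) {n : ℕ} {D : Fin n → ℤ} {x : Fin n → R ⊗[K] X}
    (hx : ∀ i, x i ∈ tensorGrading ℛ 𝒳 (D i)) :
    d.rTensor X (oddExt s t ℓ n x) + ∑ i, sg (∑ j, if j < i then D j else 0) •
      oddExt s t ℓ n (Function.update x i (d.rTensor X (x i))) = 0 := by
  have e : ∀ (i : Fin n) (x : Fin n → R ⊗[K] X), Function.update x i (d.rTensor X (x i)) =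
      fun j => (if j = i then d.rTensor X else LinearMap.id) (x j) := by
    intro i x
    funext j
    by_cases hj : j = i
    · subst hj; simp
    · simp [hj]
  simp only [e]
  have hM : ∀ x, ((d.rTensor X).compMultilinearMap (oddExt s t ℓ n) +
      ∑ i, sg (∑ j, if j < i then D j else 0) • (oddExt s t ℓ n).compLinearMap
        (fun j => if j = i then d.rTensor X else LinearMap.id) :
        MultilinearMap K (fun _ : Fin n => R ⊗[K] X) (R ⊗[K] X)) x =
      d.rTensor X (oddExt s t ℓ n x) + ∑ i, sg (∑ j, if j < i then D j else 0) •
        oddExt s t ℓ n (fun j => (if j = i then d.rTensor X else LinearMap.id) (x j)) := by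
    intro x
    rw [add_apply, sum_apply]
    rfl
  rw [← hM]
  refine tensorGrading_multilinear_eq (N := 0) (fun α ω a w ha hw hD => ?_) hx
  rw [hM, zero_apply]
  simp only [← e]
  have h1 : ∀ i, Function.update (fun i => a i ⊗ₜ[K] w i) i (d.rTensor X (a i ⊗ₜ[K] w i)) =
      fun j => Function.update a i (d (a i)) j ⊗ₜ[K] w j := by
    intro i
    funext j
    by_cases hj : j = i
    · subst hj; simp
    · simp [hj]
  have h2 : ∀ i j, Function.update a i (d (a i)) j ∈ ℛ (Function.update α i (α i + 1) j) := by
    intro i j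
    by_cases hj : j = i
    · subst hj; simpa using hd.mem (ha j)
    · simpa [hj] using ha j
  have h3 : ∀ i, s (oprod (Function.update a i (d (a i)))) =
      -(sg (∑ i, α i) • oprod (Function.update a i (d (a i)))) := by
    intro i
    rw [hR.map_oprod (h2 i), Finset.sum_update_of_mem (Finset.mem_univ i),
      ← Finset.add_sum_erase _ α (Finset.mem_univ i), Finset.sdiff_singleton_eq_erase,
      add_right_comm, sg_add _ 1]
    simp
  simp only [h1, LinearMap.compMultilinearMap_apply]
  rw [extendMultilinear_tmul hR _ ha (fun i => ht (hw i))]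
  simp only [extendMultilinear_tmul hR _ (h2 _) (fun i => ht (hw i)), map_zsmul,
    LinearMap.rTensor_tmul, h3, hR.map_oprod ha, hd.oprod hR ha, extSign_update,
    TensorProduct.sum_tmul, Finset.smul_sum, TensorProduct.neg_tmul, ← TensorProduct.smul_tmul',
    smul_neg, ← Finset.sum_add_distrib, smul_smul]
  refine Finset.sum_eq_zero fun i _ => ?_
  have h4 : sg (∑ j, if j < i then D j else 0) = sg (∑ j, if j < i then ω j else 0) *
      sg (∑ j, if j < i then α j else 0) := by
    rw [← sg_sub, ← Finset.sum_sub_distrib]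
    congr 1
    refine Finset.sum_congr rfl fun j _ => ?_
    split_ifs <;> simp [hD]
  have h5 := sg_mul_self (∑ j, if j < i then ω j else 0)
  rw [h4, ← sub_eq_add_neg, ← sub_smul]
  convert zero_smul ℤ _
  linear_combination (-(extSign α ω * sg (∑ i, α i) * sg (∑ j, if j < i then α j else 0))) * h5

/-- Extension of scalars preserves `L∞` structures. -/
theorem IsLInfty.extBrackets {d : R →ₗ[K] R} (hR : IsGradedComm ℛ s) (hd : IsDifferential ℛ d)
    (ht : IsParity 𝒳 t) {ℓ : Brackets K X} (hℓ : IsLInfty 𝒳 ℓ) :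
    IsLInfty (tensorGrading ℛ 𝒳) (extBrackets s d t ℓ) := by
  have hsymm := oddExt_symm hR ht hℓ.gradedSymm
  have hdeg : ∀ (n : ℕ) (D : Fin n → ℤ) (x : Fin n → R ⊗[K] X),
      (∀ i, x i ∈ tensorGrading ℛ 𝒳 (D i)) →
      oddExt s t ℓ n x ∈ tensorGrading ℛ 𝒳 (∑ i, D i - 1) := fun n D x hx =>
    oddExt_mem hR ht (hℓ.degree n) hx
  have happ : ∀ n (x : Fin n → R ⊗[K] X), MCTwist.extBrackets s d t ℓ n x =
    oddExt s t ℓ n x + unaryBracket (d.rTensor X) n x := fun n x => rfl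
  refine ⟨fun x => ?_, fun n D x hx => ?_, fun n D x hx σ => ?_, fun n D x hx => ?_⟩
  · rw [happ, LinearMap.compMultilinearMap_apply, extendMultilinear_zero, hℓ.zero]
    simp [unaryBracket]
  · refine add_mem (hdeg n D x hx) ?_
    by_cases hn : n = 1
    · subst hn
      rw [unaryBracket_one]
      simpa using differential_mem hd (hx 0)
    · rw [unaryBracket_of_ne _ hn]
      exact zero_mem _
  · rw [happ, happ, smul_add, ← hsymm n D x hx σ]
    congr 1
    by_cases hn : n = 1
    · subst hn
      have : σ = 1 := Subsingleton.elim _ _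
      subst this
      simp [koszulSign]
    · rw [unaryBracket_of_ne _ hn, unaryBracket_of_ne _ hn, smul_zero]
  · have hcons : ∀ (S : Finset (Fin n)) (u v : R ⊗[K] X), MCTwist.extBrackets s d t ℓ (Sᶜ.card + 1)
        (Fin.cons (u + v) (subfamily x Sᶜ)) =
        oddExt s t ℓ (Sᶜ.card + 1) (Fin.cons u (subfamily x Sᶜ)) +
        oddExt s t ℓ (Sᶜ.card + 1) (Fin.cons v (subfamily x Sᶜ)) +
        unaryBracket (d.rTensor X) (Sᶜ.card + 1) (Fin.cons (u + v) (subfamily x Sᶜ)) := by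
      intro S u v
      rw [happ, MultilinearMap.cons_add]
    simp only [happ _ (subfamily x _), hcons, smul_add, Finset.sum_add_distrib]
    -- The Jacobi identity of `ℓ`.
    have hA : ∑ S : Finset (Fin n), koszulSign D (fun i => if i ∈ S then 0 else 1) •
        oddExt s t ℓ (Sᶜ.card + 1) (Fin.cons (oddExt s t ℓ S.card (subfamily x S))
          (subfamily x Sᶜ)) = 0 := by
      have h1 : s.rTensor X (s.rTensor X (extendMultilinear s t X n (insertion t ℓ ℓ n) x)) = 0 := by
        rw [extendMultilinear_congr hR ht (ψ := 0) _ hx]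
        · simp
        · intro e w hw
          rw [insertion_apply ht ℓ ℓ hw, hℓ.jacobi n e w hw]
          rfl
      rw [extendMultilinear_insert hR ht hR.parity_odd ℓ (fun m => hℓ.degree m) hx, map_sum] at h1
      rw [← h1]
      refine Finset.sum_congr rfl fun S _ => ?_
      rw [map_zsmul]
      rfl
    -- The differential of the algebra in the inner position acts on one argument of the outer bracket.
    have hB : ∑ S : Finset (Fin n), koszulSign D (fun i => if i ∈ S then 0 else 1) •
        oddExt s t ℓ (Sᶜ.card + 1) (Fin.cons (unaryBracket (d.rTensor X) S.card (subfamily x S))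
          (subfamily x Sᶜ)) = ∑ i, sg (∑ j, if j < i then D j else 0) •
      oddExt s t ℓ n (Function.update x i (d.rTensor X (x i))) := by
      rw [sum_eq_sum_singleton]
      · refine Finset.sum_congr rfl fun i _ => ?_
        have hmem : ∀ j, Function.update x i (d.rTensor X (x i)) j ∈
            tensorGrading ℛ 𝒳 (Function.update D i (D i - 1) j) := by
          intro j
          by_cases hj : j = i
          · subst hj; simpa using differential_mem hd (hx j)
          · simpa [hj] using hx j
        have hsub : subfamily x ({i}ᶜ : Finset (Fin n)) =
            subfamily (Function.update x i (d.rTensor X (x i))) {i}ᶜ := by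
          funext p
          have := Finset.orderEmbOfFin_mem ({i}ᶜ : Finset (Fin n)) rfl p
          rw [Finset.mem_compl, Finset.mem_singleton] at this
          simp only [subfamily]
          rw [Function.update_of_ne this]
        have hcc := cons_subfamily_compl i (Function.update x i (d.rTensor X (x i)))
        rw [Function.update_self] at hcc
        rw [unaryBracket_singleton, hsub, hcc, hsymm.equiv (consCompl i) hmem, smul_smul,
          koszulSign_singleton, koszulSign_consCompl]
        congr 1
        rw [sg_sum, ← Finset.prod_mul_distrib]
        refine Finset.prod_congr rfl fun j _ => ?_
        split_ifs with hj
        · rw [Function.update_self, Function.update_of_ne hj.ne, ← sg_add]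
          exact sg_congr ⟨D j * D i - D j * D i + D j * (D i - D i) + 0, by ring⟩
        · simp
      · intro S hS
        rw [unaryBracket_of_ne _ hS, ← MultilinearMap.curryLeft_apply]
        simp
    -- The differential of the algebra in the outer position, where its square vanishes.
    have hC : ∑ S : Finset (Fin n), koszulSign D (fun i => if i ∈ S then 0 else 1) •
        unaryBracket (d.rTensor X) (Sᶜ.card + 1) (Fin.cons (oddExt s t ℓ S.card (subfamily x S) +
          unaryBracket (d.rTensor X) S.card (subfamily x S)) (subfamily x Sᶜ)) =
        d.rTensor X (oddExt s t ℓ n x) := by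
      rw [Finset.sum_eq_single Finset.univ]
      · have hcard : ((Finset.univ : Finset (Fin n))ᶜ).card + 1 = 1 := by simp
        have key : ∀ (m : ℕ) (h : m + 1 = 1) (v : R ⊗[K] X) (y : Fin m → R ⊗[K] X),
            unaryBracket (d.rTensor X) (m + 1) (Fin.cons v y) = d.rTensor X v := by
          intro m h v y
          obtain rfl : m = 0 := by omega
          rfl
        have key2 : ∀ (m : ℕ) (y : Fin m → R ⊗[K] X),
            d.rTensor X (unaryBracket (d.rTensor X) m y) = 0 := by
          intro m y
          by_cases hm : m = 1
          · subst hm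
            rw [unaryBracket_one, ← LinearMap.comp_apply, ← LinearMap.rTensor_comp]
            have : d ∘ₗ d = 0 := LinearMap.ext hd.sq
            simp [this]
          · rw [unaryBracket_of_ne _ hm, map_zero]
        have key3 : ∀ (S : Finset (Fin n)), S = Finset.univ →
            oddExt s t ℓ S.card (subfamily x S) = oddExt s t ℓ n x := by
          intro S hS
          have e := hsymm.equiv_of_even
            ((S.orderIsoOfFin rfl).toEquiv.trans (Equiv.subtypeUnivEquiv (by simp [hS]))) hx
            (fun i j hij h => by
              exfalso
              have h' : (S.orderIsoOfFin rfl).symm ⟨j, by simp [hS]⟩ <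
                  (S.orderIsoOfFin rfl).symm ⟨i, by simp [hS]⟩ := h
              rw [OrderIso.lt_iff_lt] at h'
              exact absurd hij (not_lt_of_gt h'))
          rw [e]
          rfl
        rw [key _ hcard, map_add, key2, add_zero, key3 _ rfl, koszulSign_eq_one, one_smul]
        simp
      · intro S _ hS
        rw [unaryBracket_of_ne, smul_zero]
        intro h
        apply hS
        have : Sᶜ = ∅ := Finset.card_eq_zero.1 (by omega)
        simpa using this
      · intro h; exact absurd (Finset.mem_univ _) h
    rw [hA, hB, hC, zero_add, add_comm, differential_oddExt hd hR ht ℓ hx]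

end ExtSymm

/-! ### The graded commutative algebra on generators with square zero -/

section Cube

variable (K : Type u) [Field K] {n : ℕ} (d : Fin n → ℤ)

/-- The free graded commutative algebra on generators `e₀, …, eₙ₋₁` of degrees `d`, modulo the
squares of all generators; an element is given by its coefficients with respect to the products
`e_S` of the generators in increasing order. -/
def Cube (_ : Fin n → ℤ) : Type u := Finset (Fin n) → K

namespace Cube

instance : AddCommGroup (Cube K d) := inferInstanceAs (AddCommGroup (Finset (Fin n) → K))

instance : Module K (Cube K d) := inferInstanceAs (Module K (Finset (Fin n) → K))

variable {K} {d}

theorem ext {g h : Cube K d} (H : ∀ S, g S = h S) : g = h := funext H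

@[simp] theorem add_apply (g h : Cube K d) (S : Finset (Fin n)) : (g + h) S = g S + h S := rfl

@[simp] theorem zero_apply (S : Finset (Fin n)) : (0 : Cube K d) S = 0 := rfl

@[simp] theorem smul_apply (c : K) (g : Cube K d) (S : Finset (Fin n)) : (c • g) S = c * g S := rfl

@[simp] theorem zsmul_apply (c : ℤ) (g : Cube K d) (S : Finset (Fin n)) : (c • g) S = c • g S := rfl

variable (d) in
/-- The sign in `e_S e_T = ± e_{S ∪ T}`, for disjoint sets `S` and `T`. -/
def mulSign (S T : Finset (Fin n)) : ℤ := ∏ i ∈ S, ∏ j ∈ T, if j < i then sg (d i * d j) else 1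

theorem mulSign_union_left {S T : Finset (Fin n)} (h : Disjoint S T) (U : Finset (Fin n)) :
    mulSign d (S ∪ T) U = mulSign d S U * mulSign d T U := Finset.prod_union h

theorem mulSign_union_right {T U : Finset (Fin n)} (h : Disjoint T U) (S : Finset (Fin n)) :
    mulSign d S (T ∪ U) = mulSign d S T * mulSign d S U := by
  simp only [mulSign, Finset.prod_union h, Finset.prod_mul_distrib]

theorem mulSign_comm {S T : Finset (Fin n)} (h : Disjoint S T) :
    mulSign d S T = sg ((∑ i ∈ S, d i) * ∑ j ∈ T, d j) * mulSign d T S := by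
  rw [mulSign, mulSign, Finset.prod_comm, Finset.sum_mul_sum, Finset.sum_comm, sg_sum,
    ← Finset.prod_mul_distrib]
  refine Finset.prod_congr rfl fun j hj => ?_
  rw [sg_sum, ← Finset.prod_mul_distrib]
  refine Finset.prod_congr rfl fun i hi => ?_
  rcases lt_trichotomy i j with h1 | h1 | h1
  · simp [h1, h1.not_gt, mul_comm (d j)]
  · subst h1; exact absurd hj (Finset.disjoint_left.1 h hi)
  · simp [h1, h1.not_gt]

instance : Mul (Cube K d) :=
  ⟨fun g h U => ∑ S ∈ U.powerset, mulSign d S (U \ S) • (g S * h (U \ S))⟩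

instance : One (Cube K d) := ⟨fun U => if U = ∅ then 1 else 0⟩

theorem mul_apply (g h : Cube K d) (U : Finset (Fin n)) :
    (g * h) U = ∑ S ∈ U.powerset, mulSign d S (U \ S) • (g S * h (U \ S)) := rfl

theorem one_apply (U : Finset (Fin n)) : (1 : Cube K d) U = if U = ∅ then 1 else 0 := rfl

protected theorem one_mul (g : Cube K d) : 1 * g = g := by
  refine ext fun U => ?_
  rw [mul_apply, Finset.sum_eq_single ∅]
  · simp [one_apply, mulSign]
  · intro S _ hS
    simp [one_apply, hS]
  · simp

protected theorem mul_one (g : Cube K d) : g * 1 = g := by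
  refine ext fun U => ?_
  rw [mul_apply, Finset.sum_eq_single U]
  · simp [one_apply, mulSign]
  · intro S hS hSU
    have : U \ S ≠ ∅ := fun h => hSU
      (Finset.Subset.antisymm (Finset.mem_powerset.1 hS) (Finset.sdiff_eq_empty_iff_subset.1 h))
    simp [one_apply, this]
  · simp

protected theorem mul_assoc (g h k : Cube K d) : g * h * k = g * (h * k) := by
  refine ext fun U => ?_
  simp only [mul_apply, Finset.sum_mul, Finset.mul_sum, Finset.smul_sum]
  rw [Finset.sum_sigma', Finset.sum_sigma']
  refine Finset.sum_bij' (fun p _ => ⟨p.2, p.1 \ p.2⟩) (fun p _ => ⟨p.1 ∪ p.2, p.1⟩) ?_ ?_ ?_ ?_ ?_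
  · rintro ⟨S, T⟩ h
    simp only [Finset.mem_sigma, Finset.mem_powerset] at h ⊢
    exact ⟨h.2.trans h.1, Finset.sdiff_subset_sdiff h.1 le_rfl⟩
  · rintro ⟨S, T⟩ h
    simp only [Finset.mem_sigma, Finset.mem_powerset] at h ⊢
    exact ⟨Finset.union_subset h.1 (h.2.trans Finset.sdiff_subset), Finset.subset_union_left⟩
  · rintro ⟨S, T⟩ h
    simp only [Finset.mem_sigma, Finset.mem_powerset] at h
    simp [Finset.union_sdiff_of_subset h.2]
  · rintro ⟨S, T⟩ h
    simp only [Finset.mem_sigma, Finset.mem_powerset] at h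
    have : Disjoint S T := Finset.disjoint_of_subset_right h.2 Finset.disjoint_sdiff
    simp [Finset.union_sdiff_cancel_left this]
  · rintro ⟨S, T⟩ hST
    simp only [Finset.mem_sigma, Finset.mem_powerset] at hST
    obtain ⟨h1, h2⟩ := hST
    have e1 : (U \ T) \ (S \ T) = U \ S := by
      rw [sdiff_sdiff_left, Finset.sup_eq_union, Finset.union_sdiff_of_subset h2]
    have e2 : mulSign d S (U \ S) = mulSign d T (U \ S) * mulSign d (S \ T) (U \ S) := by
      rw [← mulSign_union_left Finset.disjoint_sdiff, Finset.union_sdiff_of_subset h2]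
    have e3 : mulSign d T (U \ T) = mulSign d T (S \ T) * mulSign d T (U \ S) := by
      have hd : Disjoint (S \ T) (U \ S) :=
        Finset.disjoint_of_subset_left Finset.sdiff_subset Finset.disjoint_sdiff
      rw [← mulSign_union_right hd]
      congr 1
      ext i
      simp only [Finset.mem_sdiff, Finset.mem_union]
      constructor
      · rintro ⟨hU, hT⟩
        by_cases hS : i ∈ S <;> tauto
      · rintro (⟨hS, hT⟩ | ⟨hU, hS⟩)
        · exact ⟨h1 hS, hT⟩
        · exact ⟨hU, fun hT => hS (h2 hT)⟩
    simp only [e1, e2, e3, zsmul_eq_mul, Int.cast_mul]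
    ring

instance : Ring (Cube K d) where
  left_distrib g h k := ext fun U => by
    simp only [mul_apply, add_apply, mul_add, smul_add, Finset.sum_add_distrib]
  right_distrib g h k := ext fun U => by
    simp only [mul_apply, add_apply, add_mul, smul_add, Finset.sum_add_distrib]
  zero_mul g := ext fun U => by simp [mul_apply]
  mul_zero g := ext fun U => by simp [mul_apply]
  mul_assoc := Cube.mul_assoc
  one_mul := Cube.one_mul
  mul_one := Cube.mul_one
  zsmul := fun c g => c • g
  neg_add_cancel := neg_add_cancel
  sub_eq_add_neg := sub_eq_add_neg
  zsmul_zero' := SubNegMonoid.zsmul_zero'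
  zsmul_succ' := SubNegMonoid.zsmul_succ'
  zsmul_neg' := SubNegMonoid.zsmul_neg'
  nsmul := fun c g => c • g
  nsmul_zero := AddMonoid.nsmul_zero
  nsmul_succ := AddMonoid.nsmul_succ

instance : Algebra K (Cube K d) :=
  Algebra.ofModule
    (fun c g h => ext fun U => by
      simp only [mul_apply, smul_apply, Finset.mul_sum]
      refine Finset.sum_congr rfl fun S _ => ?_
      simp only [zsmul_eq_mul]; ring)
    (fun c g h => ext fun U => by
      simp only [mul_apply, smul_apply, Finset.mul_sum]
      refine Finset.sum_congr rfl fun S _ => ?_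
      simp only [zsmul_eq_mul]; ring)

variable (K d)

/-- The homogeneous components: `e_S` has degree `∑ i ∈ S, d i`. -/
def grading (i : ℤ) : Submodule K (Cube K d) where
  carrier := {g | ∀ S, ∑ j ∈ S, d j ≠ i → g S = 0}
  add_mem' := fun hg hh S hS => by rw [add_apply, hg S hS, hh S hS, add_zero]
  zero_mem' := fun S _ => rfl
  smul_mem' := fun c g hg S hS => by rw [smul_apply, hg S hS, mul_zero]

/-- The parity involution. -/
def parity : Cube K d →ₗ[K] Cube K d where
  toFun g := fun S => sg (∑ j ∈ S, d j) • g S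
  map_add' g h := funext fun S => smul_add (sg (∑ j ∈ S, d j)) (g S) (h S)
  map_smul' c g := funext fun S => (mul_smul_comm (sg (∑ j ∈ S, d j)) c (g S)).symm

/-- The `m`-th power of the augmentation ideal: the span of the `e_S` with at least `m` factors. -/
def fil (m : ℕ) : Submodule K (Cube K d) where
  carrier := {g | ∀ S, S.card < m → g S = 0}
  add_mem' := fun hg hh S hS => by rw [add_apply, hg S hS, hh S hS, add_zero]
  zero_mem' := fun S _ => rfl
  smul_mem' := fun c g hg S hS => by rw [smul_apply, hg S hS, mul_zero]

theorem isGradedComm : IsGradedComm (grading K d) (parity K d) where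
  one_mem := fun S hS => by
    rw [one_apply, if_neg]
    rintro rfl
    simp at hS
  mul_mem := by
    intro i j g h hg hh U hU
    rw [mul_apply]
    refine Finset.sum_eq_zero fun S hS => ?_
    by_cases h1 : ∑ j ∈ S, d j = i
    · by_cases h2 : ∑ j ∈ U \ S, d j = j
      · exfalso
        apply hU
        rw [← Finset.sum_sdiff (Finset.mem_powerset.1 hS), h1, h2, add_comm]
      · rw [hh _ h2, mul_zero, smul_zero]
    · rw [hg _ h1, zero_mul, smul_zero]
  comm := by
    intro i j g h hg hh
    refine ext fun U => ?_
    rw [zsmul_apply, mul_apply, mul_apply, Finset.smul_sum]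
    refine Finset.sum_bij' (fun S _ => U \ S) (fun S _ => U \ S)
      (fun S _ => Finset.mem_powerset.2 Finset.sdiff_subset)
      (fun S _ => Finset.mem_powerset.2 Finset.sdiff_subset)
      (fun S hS => Finset.sdiff_sdiff_eq_self (Finset.mem_powerset.1 hS))
      (fun S hS => Finset.sdiff_sdiff_eq_self (Finset.mem_powerset.1 hS)) fun S hS => ?_
    rw [Finset.sdiff_sdiff_eq_self (Finset.mem_powerset.1 hS)]
    by_cases h1 : ∑ j ∈ S, d j = i
    · by_cases h2 : ∑ j ∈ U \ S, d j = j
      · rw [mulSign_comm Finset.disjoint_sdiff, h1, h2, mul_smul, mul_comm (g S)]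
      · rw [hh _ h2]; simp
    · rw [hg _ h1]; simp
  parity := by
    intro i g hg
    refine ext fun S => ?_
    rw [zsmul_apply]
    change sg (∑ j ∈ S, d j) • g S = _
    by_cases h1 : ∑ j ∈ S, d j = i
    · rw [h1]
    · rw [hg _ h1]; simp

variable {K d}

theorem one_mem_fil : (1 : Cube K d) ∈ fil K d 0 := fun _ h => absurd h (Nat.not_lt_zero _)

theorem mul_mem_fil {i j : ℕ} {g h : Cube K d} (hg : g ∈ fil K d i) (hh : h ∈ fil K d j) :
    g * h ∈ fil K d (i + j) := by
  intro U hU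
  rw [mul_apply]
  refine Finset.sum_eq_zero fun S hS => ?_
  have hc := Finset.card_sdiff_add_card_eq_card (Finset.mem_powerset.1 hS)
  by_cases h1 : S.card < i
  · rw [hg _ h1, zero_mul, smul_zero]
  · rw [hh (U \ S) (by omega), mul_zero, smul_zero]

theorem parity_mem_fil {i : ℕ} {g : Cube K d} (hg : g ∈ fil K d i) :
    parity K d g ∈ fil K d i := by
  intro S hS
  change sg (∑ j ∈ S, d j) • g S = 0
  rw [hg S hS, smul_zero]

theorem eq_zero_of_mem_fil {m : ℕ} (hm : n < m) {g : Cube K d} (hg : g ∈ fil K d m) : g = 0 := by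
  refine ext fun S => hg S (lt_of_le_of_lt ?_ hm)
  simpa using Finset.card_le_univ S

theorem fil_anti {i j : ℕ} (h : i ≤ j) : fil K d j ≤ fil K d i :=
  fun _ hg S hS => hg S (hS.trans_le h)

variable (K d)

/-- The generator `eᵢ`. -/
def gen (i : Fin n) : Cube K d := fun S => if S = {i} then 1 else 0

theorem gen_mem (i : Fin n) : gen K d i ∈ grading K d (d i) := by
  intro S hS
  rw [gen, if_neg]
  rintro rfl
  simp at hS

theorem gen_mem_fil (i : Fin n) : gen K d i ∈ fil K d 1 := by
  intro S hS
  rw [gen, if_neg]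
  rintro rfl
  simp at hS

/-- The coefficient of the product of all generators. -/
def topCoeff : Cube K d →ₗ[K] K where
  toFun g := g Finset.univ
  map_add' _ _ := rfl
  map_smul' _ _ := rfl

variable {K d}

theorem gen_mul_apply (i : Fin n) (g : Cube K d) (U : Finset (Fin n)) :
    (gen K d i * g) U = if i ∈ U then mulSign d {i} (U \ {i}) • g (U \ {i}) else 0 := by
  rw [mul_apply]
  split_ifs with hi
  · rw [Finset.sum_eq_single {i}]
    · simp [gen]
    · intro S _ hS
      simp [gen, hS]
    · intro h
      simp [hi] at h
  · refine Finset.sum_eq_zero fun S hS => ?_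
    have : S ≠ {i} := by
      rintro rfl
      simp [hi] at hS
    simp [gen, this]

theorem oprod_gen_apply_of_ne : ∀ {m : ℕ} (c : Fin m → Fin n) (U : Finset (Fin n)),
    U ≠ Finset.univ.image c → oprod (fun p => gen K d (c p)) U = 0
  | 0, c, U, h => by
    rw [oprod_zero, one_apply, if_neg]
    simpa using h
  | m + 1, c, U, h => by
    rw [oprod_succ, gen_mul_apply]
    split_ifs with h0
    · rw [oprod_gen_apply_of_ne (fun p => c p.succ), smul_zero]
      intro h'
      apply h
      ext j
      by_cases hj : j = c 0
      · subst hj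
        simp [h0]
      · have h2 : j ∈ U ↔ j ∈ U \ {c 0} := by simp [hj]
        rw [h2, h']
        simp only [Finset.mem_image, Finset.mem_univ, true_and, Fin.exists_fin_succ]
        constructor
        · intro h3; exact Or.inr h3
        · rintro (h3 | h3)
          · exact absurd h3.symm hj
          · exact h3
    · rfl

theorem oprod_gen_apply_image : ∀ {m : ℕ} (c : Fin m → Fin n), StrictMono c →
    oprod (fun p => gen K d (c p)) (Finset.univ.image c) = 1
  | 0, c, _ => by
    rw [oprod_zero, one_apply, if_pos]
    simp
  | m + 1, c, hc => by
    have e : Finset.univ.image c \ {c 0} = Finset.univ.image fun p : Fin m => c p.succ := by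
      ext j
      simp only [Finset.mem_sdiff, Finset.mem_image, Finset.mem_univ, true_and,
        Finset.mem_singleton, Fin.exists_fin_succ]
      constructor
      · rintro ⟨h | h, h'⟩
        · exact absurd h.symm h'
        · exact h
      · rintro ⟨p, rfl⟩
        exact ⟨Or.inr ⟨p, rfl⟩, (hc (Fin.succ_pos p)).ne'⟩
    rw [oprod_succ, gen_mul_apply, if_pos (by simp), e, oprod_gen_apply_image (fun p => c p.succ)
      (fun p q h => hc (Fin.succ_lt_succ_iff.2 h))]
    have : mulSign d {c 0} (Finset.univ.image fun p : Fin m => c p.succ) = 1 := by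
      rw [mulSign, Finset.prod_singleton]
      refine Finset.prod_eq_one fun j hj => ?_
      obtain ⟨p, _, rfl⟩ := Finset.mem_image.1 hj
      rw [if_neg (hc (Fin.succ_pos p)).not_gt]
    rw [this, one_smul]

theorem topCoeff_oprod_gen : topCoeff K d (oprod (gen K d)) = 1 := by
  have := oprod_gen_apply_image (K := K) (d := d) (fun p : Fin n => p) strictMono_id
  rw [Finset.image_id'] at this
  exact this

theorem topCoeff_oprod_gen_of_not_surjective {m : ℕ} {c : Fin m → Fin n}
    (hc : ¬ Function.Surjective c) : topCoeff K d (oprod fun p => gen K d (c p)) = 0 := by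
  refine oprod_gen_apply_of_ne c Finset.univ fun h => hc fun j => ?_
  have : j ∈ Finset.univ.image c := h ▸ Finset.mem_univ j
  simpa using this

end Cube

end Cube

/-! ### Polynomial functions of one variable -/

section PolyFun

open Polynomial

variable {K : Type u} [Field K] {X : Type v} [AddCommGroup X] [Module K X]
  {Y : Type w} [AddCommGroup Y] [Module K Y] {Z : Type x} [AddCommGroup Z] [Module K Z]

/-- The function `f : K → X` is polynomial, and `f'` is its formal derivative: the pair is a linear
combination of the pairs `(z ^ r • x, r z ^ (r - 1) • x)`. For `r = 0` the coefficient `r` vanishes,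
and the truncated subtraction does no harm. -/
def HasPolyDeriv (f f' : K → X) : Prop :=
  (f, f') ∈ Submodule.span K {p : (K → X) × (K → X) |
    ∃ (r : ℕ) (x : X), p = (fun z : K => z ^ r • x, fun z : K => ((r : K) * z ^ (r - 1)) • x)}

/-- Polynomial functions `K → X`. -/
def IsPolyFun (f : K → X) : Prop := ∃ f', HasPolyDeriv f f'

theorem HasPolyDeriv.isPolyFun {f f' : K → X} (h : HasPolyDeriv f f') : IsPolyFun f := ⟨f', h⟩

theorem HasPolyDeriv.induction {p : (K → X) → (K → X) → Prop}
    (mono : ∀ (r : ℕ) (x : X), p (fun z : K => z ^ r • x) (fun z : K => ((r : K) * z ^ (r - 1)) • x))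
    (zero : p 0 0) (add : ∀ f f' g g', p f f' → p g g' → p (f + g) (f' + g'))
    (smul : ∀ (c : K) f f', p f f' → p (c • f) (c • f')) {f f' : K → X} (h : HasPolyDeriv f f') :
    p f f' := by
  have key : ∀ q : (K → X) × (K → X), q ∈ Submodule.span K {p : (K → X) × (K → X) |
      ∃ (r : ℕ) (x : X), p = (fun z : K => z ^ r • x, fun z : K => ((r : K) * z ^ (r - 1)) • x)} → p q.1 q.2 := by
    intro q hq
    induction hq using Submodule.span_induction with
    | mem q hq => obtain ⟨r, x, rfl⟩ := hq; exact mono r x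
    | zero => exact zero
    | add q q' _ _ h1 h2 => exact add _ _ _ _ h1 h2
    | smul c q _ h1 => exact smul c _ _ h1
  exact key (f, f') h

theorem HasPolyDeriv.mono (r : ℕ) (x : X) :
    HasPolyDeriv (fun z : K => z ^ r • x) (fun z => ((r : K) * z ^ (r - 1)) • x) :=
  Submodule.subset_span ⟨r, x, rfl⟩

theorem HasPolyDeriv.const (x : X) : HasPolyDeriv (fun _ : K => x) (fun _ => 0) := by
  have := HasPolyDeriv.mono (K := K) 0 x
  convert this using 1
  · funext z; simp
  · funext z; simp

theorem HasPolyDeriv.add {f f' g g' : K → X} (hf : HasPolyDeriv f f') (hg : HasPolyDeriv g g') :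
    HasPolyDeriv (fun z => f z + g z) (fun z => f' z + g' z) := add_mem hf hg

theorem HasPolyDeriv.smul (c : K) {f f' : K → X} (hf : HasPolyDeriv f f') :
    HasPolyDeriv (fun z => c • f z) (fun z => c • f' z) := Submodule.smul_mem _ c hf

theorem HasPolyDeriv.sub {f f' g g' : K → X} (hf : HasPolyDeriv f f') (hg : HasPolyDeriv g g') :
    HasPolyDeriv (fun z => f z - g z) (fun z => f' z - g' z) := sub_mem hf hg

theorem HasPolyDeriv.sum {ι : Type*} (s : Finset ι) {f f' : ι → K → X}
    (h : ∀ i ∈ s, HasPolyDeriv (f i) (f' i)) :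
    HasPolyDeriv (fun z => ∑ i ∈ s, f i z) (fun z => ∑ i ∈ s, f' i z) := by
  have := Submodule.sum_mem (t := s) _ h
  unfold HasPolyDeriv
  convert this using 1
  refine Prod.ext ?_ ?_
  · funext z; simp [Prod.fst_sum]
  · funext z; simp [Prod.snd_sum]

theorem HasPolyDeriv.map (L : X →ₗ[K] Y) {f f' : K → X} (h : HasPolyDeriv f f') :
    HasPolyDeriv (fun z => L (f z)) (fun z => L (f' z)) := by
  refine h.induction (p := fun f f' => HasPolyDeriv (fun z => L (f z)) (fun z => L (f' z)))
    (fun r x => ?_) ?_ (fun f f' g g' h1 h2 => ?_) (fun c f f' h1 => ?_)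
  · simpa only [map_smul] using HasPolyDeriv.mono (K := K) r (L x)
  · simpa only [Pi.zero_apply, map_zero, LinearMap.zero_apply, add_zero, smul_zero] using
      HasPolyDeriv.const (K := K) (0 : Y)
  · simpa using h1.add h2
  · simpa using h1.smul c

theorem HasPolyDeriv.bilin (β : X →ₗ[K] Y →ₗ[K] Z) {f f' : K → X} {g g' : K → Y}
    (hf : HasPolyDeriv f f') (hg : HasPolyDeriv g g') :
    HasPolyDeriv (fun z => β (f z) (g z)) (fun z => β (f' z) (g z) + β (f z) (g' z)) := by
  refine hf.induction (p := fun f f' => HasPolyDeriv (fun z => β (f z) (g z))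
    (fun z => β (f' z) (g z) + β (f z) (g' z)))
    (fun r x => ?_) ?_ (fun f f' k k' h1 h2 => ?_) (fun c f f' h1 => ?_)
  · refine hg.induction (p := fun g g' => HasPolyDeriv (fun z => β (z ^ r • x) (g z))
      (fun z => β (((r : K) * z ^ (r - 1)) • x) (g z) + β (z ^ r • x) (g' z)))
      (fun q y => ?_) ?_ (fun g g' k k' h1 h2 => ?_) (fun c g g' h1 => ?_)
    · have := HasPolyDeriv.mono (K := K) (r + q) (β x y)
      convert this using 1
      · funext z
        simp [pow_add, smul_smul, mul_comm]
      · funext z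
        simp only [map_smul, LinearMap.smul_apply, smul_smul, ← add_smul]
        congr 1
        rcases r with _ | r <;> rcases q with _ | q
        · simp
        · simp
        · simp
        · simp only [Nat.add_sub_cancel, Nat.cast_add, Nat.cast_one, pow_succ,
            show r + 1 + (q + 1) - 1 = r + q + 1 by omega, pow_add]
          ring
    · simpa only [Pi.zero_apply, map_zero, LinearMap.zero_apply, add_zero, smul_zero] using
      HasPolyDeriv.const (K := K) (0 : Z)
    · have := h1.add h2
      convert this using 1
      · funext z; simp
      · funext z; simp only [Pi.add_apply, map_add]; abel
    · have := h1.smul c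
      convert this using 1
      · funext z; simp
      · funext z; simp [smul_add]
  · simpa only [Pi.zero_apply, map_zero, LinearMap.zero_apply, add_zero, smul_zero] using
      HasPolyDeriv.const (K := K) (0 : Z)
  · have := h1.add h2
    convert this using 1
    · funext z; simp
    · funext z; simp only [Pi.add_apply, map_add, LinearMap.add_apply]; abel
  · have := h1.smul c
    convert this using 1
    · funext z; simp
    · funext z; simp [smul_add]

/-- The product rule for a multilinear map that depends polynomially on the variable. -/
theorem HasPolyDeriv.multilinear : ∀ {n : ℕ} {N N' : K → MultilinearMap K (fun _ : Fin n => X) Y}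
    {g g' : Fin n → K → X} (_ : HasPolyDeriv N N') (_ : ∀ i, HasPolyDeriv (g i) (g' i)),
    HasPolyDeriv (fun z => N z fun i => g i z) (fun z => N' z (fun i => g i z) +
      ∑ i, N z (Function.update (fun i => g i z) i (g' i z)))
  | 0, N, N', g, g', hN, _ => by
    have := hN.map (X := MultilinearMap K (fun _ : Fin 0 => X) Y) (Y := Y)
      { toFun := fun M => M ![], map_add' := fun _ _ => rfl, map_smul' := fun _ _ => rfl }
    convert this using 1
    · funext z
      change N z _ = N z _
      congr 1
      exact Subsingleton.elim _ _
    · funext z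
      simp only [Finset.univ_eq_empty, Finset.sum_empty, add_zero]
      change N' z _ = N' z _
      congr 1
      exact Subsingleton.elim _ _
  | n + 1, N, N', g, g', hN, hg => by
    have h1 := HasPolyDeriv.bilin
      ((multilinearCurryLeftEquiv K (fun _ : Fin (n + 1) => X) Y).toLinearMap) hN (hg 0)
    have h2 := HasPolyDeriv.multilinear h1 fun i : Fin n => hg i.succ
    have e : ∀ z, (fun i => g i z) = (Fin.cons (g 0 z) (fun i : Fin n => g i.succ z) :
        Fin (n + 1) → X) := by
      intro z; funext i; refine Fin.cases rfl (fun i => rfl) i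
    have e1 : ∀ z, Function.update (fun i => g i z) 0 (g' 0 z) =
        (Fin.cons (g' 0 z) (fun i : Fin n => g i.succ z) : Fin (n + 1) → X) := by
      intro z; rw [e, Fin.update_cons_zero]
    have e2 : ∀ z (i : Fin n), Function.update (fun i => g i z) i.succ (g' i.succ z) =
        (Fin.cons (g 0 z) (Function.update (fun i : Fin n => g i.succ z) i (g' i.succ z)) :
          Fin (n + 1) → X) := by
      intro z i; rw [e, ← Fin.cons_update]
    convert h2 using 1
    · funext z
      rw [e]; rfl
    · funext z
      rw [Fin.sum_univ_succ, e1]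
      simp only [e2]
      rw [e, ← add_assoc]
      rfl

variable [CharZero K]

theorem HasPolyDeriv.exists_polynomial {f f' : K → K} (h : HasPolyDeriv f f') :
    ∃ p : K[X], (∀ z, f z = p.eval z) ∧ ∀ z, f' z = (derivative p).eval z := by
  refine h.induction (p := fun f f' => ∃ p : K[X], (∀ z, f z = p.eval z) ∧
    ∀ z, f' z = (derivative p).eval z) (fun r x => ?_) ⟨0, by simp, by simp⟩
    (fun f f' g g' h1 h2 => ?_) (fun c f f' h1 => ?_)
  · refine ⟨C x * Polynomial.X ^ r, fun z => ?_, fun z => ?_⟩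
    · simp only [eval_mul, eval_C, eval_pow, eval_X, smul_eq_mul]
      ring
    rw [derivative_C_mul, derivative_X_pow]
    simp only [eval_mul, eval_C, eval_pow, eval_X, smul_eq_mul]
    ring
  · obtain ⟨p, hp, hp'⟩ := h1
    obtain ⟨q, hq, hq'⟩ := h2
    exact ⟨p + q, by simp [hp, hq], by simp [hp', hq']⟩
  · obtain ⟨p, hp, hp'⟩ := h1
    exact ⟨C c * p, by simp [hp], by simp [hp']⟩

/-- The field is infinite, so that a polynomial function determines its coefficients, and thereby its
derivative. -/
theorem HasPolyDeriv.deriv_unique {f f' g g' : K → X} (hf : HasPolyDeriv f f')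
    (hg : HasPolyDeriv g g') (h : ∀ z, f z = g z) (z : K) : f' z = g' z := by
  rw [← sub_eq_zero, ← Module.forall_dual_apply_eq_zero_iff K]
  intro χ
  obtain ⟨p, hp, hp'⟩ := ((hf.sub hg).map χ).exists_polynomial
  have h1 : p = 0 := Polynomial.funext fun z => by rw [← hp, h]; simp
  rw [hp', h1]
  simp

theorem HasPolyDeriv.eq_of_deriv_zero {f f' : K → X} (h : HasPolyDeriv f f') (hf' : ∀ z, f' z = 0)
    (z : K) : f z = f 0 := by
  rw [← sub_eq_zero, ← Module.forall_dual_apply_eq_zero_iff K]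
  intro χ
  obtain ⟨p, hp, hp'⟩ := (h.map χ).exists_polynomial
  have h1 : derivative p = 0 := Polynomial.funext fun z => by rw [← hp', hf']; simp
  obtain ⟨c, rfl⟩ := natDegree_eq_zero.1 (derivative_eq_zero.1 h1)
  rw [map_sub, hp, hp]
  simp

theorem HasPolyDeriv.mem_of_deriv_mem {f f' : K → X} (h : HasPolyDeriv f f') {P : Submodule K X}
    (h0 : f 0 ∈ P) (hf' : ∀ z, f' z ∈ P) (z : K) : f z ∈ P := by
  have := (h.map P.mkQ).eq_of_deriv_zero (fun z => by simpa using hf' z) z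
  rw [← Submodule.Quotient.mk_eq_zero, ← Submodule.mkQ_apply, this]
  simpa using h0

/-- Division by powers of the variable is compatible with integration. -/
theorem IsPolyFun.exists_integral_mul_pow {v : K → X} (h : IsPolyFun v) (r : ℕ) :
    ∃ w : K → X, IsPolyFun w ∧
      HasPolyDeriv (fun z => z ^ (r + 1) • w z) (fun z => z ^ r • v z) := by
  obtain ⟨v', h⟩ := h
  refine h.induction (p := fun v _ => ∃ w : K → X, IsPolyFun w ∧
      HasPolyDeriv (fun z => z ^ (r + 1) • w z) (fun z => z ^ r • v z)) (fun i x => ?_) ?_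
      (fun f f' g g' h1 h2 => ?_) (fun c f f' h1 => ?_)
  · refine ⟨_, (HasPolyDeriv.mono i (((r + i + 1 : ℕ) : K)⁻¹ • x)).isPolyFun, ?_⟩
    convert HasPolyDeriv.mono (r + i + 1) (((r + i + 1 : ℕ) : K)⁻¹ • x) using 1
    · funext z
      rw [smul_smul, ← pow_add]
      congr 2
      ring
    · funext z
      have : ((r + i + 1 : ℕ) : K) ≠ 0 := Nat.cast_ne_zero.2 (by omega)
      rw [smul_smul, smul_smul, ← pow_add, Nat.add_sub_cancel]
      congr 1
      field_simp
  · exact ⟨0, ⟨_, HasPolyDeriv.const (K := K) (0 : X)⟩,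
      by simpa only [Pi.zero_apply, map_zero, LinearMap.zero_apply, add_zero, smul_zero] using
      HasPolyDeriv.const (K := K) (0 : X)⟩
  · obtain ⟨w1, ⟨_, h1⟩, h1'⟩ := h1
    obtain ⟨w2, ⟨_, h2⟩, h2'⟩ := h2
    refine ⟨_, (h1.add h2).isPolyFun, ?_⟩
    simpa only [smul_add, Pi.add_apply] using h1'.add h2'
  · obtain ⟨w1, ⟨_, h1⟩, h1'⟩ := h1
    refine ⟨_, (h1.smul c).isPolyFun, ?_⟩
    simpa only [smul_comm _ c, Pi.smul_apply] using h1'.smul c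

theorem IsPolyFun.exists_integral {v : K → X} (h : IsPolyFun v) :
    ∃ f : K → X, HasPolyDeriv f v ∧ f 0 = 0 := by
  obtain ⟨w, _, h⟩ := h.exists_integral_mul_pow 0
  exact ⟨_, by simpa using h, by simp⟩

/-- A linear differential equation with polynomial coefficients has at most one polynomial
solution with given initial value: a solution that vanishes at `0` is divisible by all powers of
the variable. -/
theorem HasPolyDeriv.eq_zero_of_linear {f : K → X} {M : K → X →ₗ[K] X}
    (hM : ∀ w : K → X, IsPolyFun w → IsPolyFun fun z => M z (w z))
    (hf : HasPolyDeriv f fun z => M z (f z)) (h0 : f 0 = 0) (z : K) : f z = 0 := by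
  have key : ∀ r : ℕ, ∃ w : K → X, IsPolyFun w ∧ ∀ z, f z = z ^ r • w z := by
    intro r
    induction r with
    | zero => exact ⟨f, hf.isPolyFun, by simp⟩
    | succ r ih =>
      obtain ⟨w, ⟨w', hw⟩, e⟩ := ih
      obtain ⟨w1, hw1, h1⟩ := (hM w hw.isPolyFun).exists_integral_mul_pow r
      refine ⟨w1, hw1, fun z => ?_⟩
      have h2 := (hf.sub h1).eq_of_deriv_zero (fun z => by
        rw [e]; simp) z
      rw [h0] at h2
      simpa [sub_eq_zero] using h2
  rw [← Module.forall_dual_apply_eq_zero_iff K]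
  intro χ
  obtain ⟨p, hp, _⟩ := (hf.map χ).exists_polynomial
  suffices p = 0 by rw [hp, this]; simp
  by_contra hne
  obtain ⟨w, ⟨w', hw⟩, e⟩ := key (p.natDegree + 1)
  obtain ⟨q, hq, _⟩ := (hw.map χ).exists_polynomial
  have h1 : p = Polynomial.X ^ (p.natDegree + 1) * q := Polynomial.funext fun z => by
    rw [← hp, e]; simp [hq]
  have h2 : q ≠ 0 := by rintro rfl; rw [mul_zero] at h1; exact hne h1
  have h3 := congrArg natDegree h1
  rw [natDegree_X_pow_mul _ h2] at h3
  omega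

end PolyFun

/-! ### Exponential series of multilinear maps -/

section Series

/-- The number of maps with prescribed cardinalities of the fibers, read off from the coefficients of
`(∑ c, X c) ^ n`. -/
theorem card_fiber_eq_multinomial {n k : ℕ} {m : Fin k → ℕ} (hm : ∑ c, m c = n) :
    (Finset.univ.filter fun b : Fin n → Fin k => (fun c => (fiber b c).card) = m).card =
      Nat.multinomial Finset.univ m := by
  classical
  have key := congrArg (MvPolynomial.coeff (Finsupp.equivFunOnFinite.symm m))
    (Finset.sum_pow_eq_sum_piAntidiag (Finset.univ : Finset (Fin k))
      (fun c => (MvPolynomial.X c : MvPolynomial (Fin k) ℕ)) n)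
  have h1 : (∑ c, (MvPolynomial.X c : MvPolynomial (Fin k) ℕ)) ^ n = ∑ b : Fin n → Fin k,
      MvPolynomial.monomial (Finsupp.equivFunOnFinite.symm fun c => (fiber b c).card) 1 := by
    rw [← Fin.prod_const, Finset.prod_univ_sum, Fintype.piFinset_univ]
    refine Finset.sum_congr rfl fun b _ => ?_
    rw [← Finset.prod_fiberwise Finset.univ b, MvPolynomial.monomial_eq, MvPolynomial.C_1, one_mul,
      Finsupp.prod_fintype _ _ (by simp)]
    refine Finset.prod_congr rfl fun c _ => ?_
    rw [Finset.prod_congr rfl (g := fun _ => MvPolynomial.X c)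
      (fun i hi => by rw [(Finset.mem_filter.1 hi).2]), Finset.prod_const]
    rfl
  have h2 : ∀ m' : Fin k → ℕ, ∏ c, (MvPolynomial.X c : MvPolynomial (Fin k) ℕ) ^ m' c =
      MvPolynomial.monomial (Finsupp.equivFunOnFinite.symm m') 1 := fun m' => by
    rw [MvPolynomial.monomial_eq, MvPolynomial.C_1, one_mul, Finsupp.prod_fintype _ _ (by simp)]
    rfl
  rw [h1, MvPolynomial.coeff_sum, MvPolynomial.coeff_sum] at key
  simp only [h2, MvPolynomial.coeff_monomial, EmbeddingLike.apply_eq_iff_eq] at key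
  rw [Finset.card_filter, key, Finset.sum_eq_single m]
  · rw [← nsmul_eq_mul, MvPolynomial.coeff_smul, MvPolynomial.coeff_monomial, if_pos rfl]
    simp
  · intro m' _ hne
    rw [← nsmul_eq_mul, MvPolynomial.coeff_smul, MvPolynomial.coeff_monomial, if_neg (by simpa)]
    simp
  · intro h
    exact absurd (Finset.mem_piAntidiag.2 ⟨hm, fun i _ => Finset.mem_univ i⟩) h

theorem sum_fiber_card {M : Type*} [AddCommMonoid M] {n k : ℕ} (G : (Fin k → ℕ) → M) :
    ∑ b : Fin n → Fin k, G (fun c => (fiber b c).card) =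
      ∑ m ∈ Finset.piAntidiag Finset.univ n, Nat.multinomial Finset.univ m • G m := by
  classical
  rw [← Finset.sum_fiberwise_of_maps_to (t := Finset.piAntidiag Finset.univ n)
    (g := fun b : Fin n → Fin k => fun c => (fiber b c).card)]
  · refine Finset.sum_congr rfl fun m hm => ?_
    rw [Finset.sum_congr rfl (g := fun _ => G m), Finset.sum_const, card_fiber_eq_multinomial]
    · exact (Finset.mem_piAntidiag.1 hm).1
    · intro b hb
      rw [(Finset.mem_filter.1 hb).2]
  · intro b _
    refine Finset.mem_piAntidiag.2 ⟨?_, fun i _ => Finset.mem_univ i⟩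
    rw [← Finset.card_eq_sum_card_fiberwise fun i _ => Finset.mem_univ (b i)]
    simp

variable {K : Type u} [Field K] [CharZero K] {X : Type v} [AddCommGroup X] [Module K X]
  {Y : Type w} [AddCommGroup Y] [Module K Y] {Z : Type x} [AddCommGroup Z] [Module K Z]

/-- The truncated exponential series `∑ m ≤ N, φ_m (y, …, y) / m!`. -/
def expSum (N : ℕ) (φ : Components K X Y) (y : X) : Y :=
  ∑ m ∈ Finset.range (N + 1), ((m.factorial : K))⁻¹ • φ m (fun _ => y)

/-- The derivative of the exponential series at `y` in the direction `u`. -/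
def expDeriv (N : ℕ) (φ : Components K X Y) (u y : X) : Y :=
  ∑ j ∈ Finset.range N, ((j.factorial : K))⁻¹ • φ (j + 1) (Fin.cons u fun _ => y)

/-- The sum over all partitions into `k` blocks, some of which may be empty, is the `k`-fold product of
the exponential series, provided that the terms of order larger than `N` vanish. -/
theorem sum_blocks (N : ℕ) {k : ℕ} (ψ : MultilinearMap K (fun _ : Fin k => Y) Z)
    (φ : Components K X Y) (y : X)
    (hN : ∀ m : Fin k → ℕ, N < ∑ c, m c → ψ (fun c => φ (m c) fun _ => y) = 0) :
    ∑ n ∈ Finset.range (N + 1), ((n.factorial : K))⁻¹ • ∑ b : Fin n → Fin k,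
      ψ (fun c => φ (fiber b c).card fun _ => y) = ψ (fun _ => expSum N φ y) := by
  classical
  simp only [expSum]
  rw [MultilinearMap.map_sum_finset]
  simp only [MultilinearMap.map_smul_univ]
  have h1 : ∀ n, ((n.factorial : K))⁻¹ • ∑ b : Fin n → Fin k,
      ψ (fun c => φ (fiber b c).card fun _ => y) = ∑ m ∈ Finset.piAntidiag Finset.univ n,
        (∏ c, (((m c).factorial : K))⁻¹) • ψ (fun c => φ (m c) fun _ => y) := by
    intro n
    rw [sum_fiber_card fun m => ψ (fun c => φ (m c) fun _ => y), Finset.smul_sum]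
    refine Finset.sum_congr rfl fun m hm => ?_
    rw [← Nat.cast_smul_eq_nsmul K, smul_smul]
    congr 1
    have h2 := Nat.multinomial_spec Finset.univ m
    rw [(Finset.mem_piAntidiag.1 hm).1] at h2
    rw [← h2, Nat.cast_mul, Nat.cast_prod, mul_inv, ← Finset.prod_inv_distrib, mul_assoc,
      inv_mul_cancel₀, mul_one]
    exact Nat.cast_ne_zero.2 (Nat.multinomial_pos Finset.univ m).ne'
  simp only [h1]
  rw [Finset.sum_sigma', ← Finset.sum_filter_add_sum_filter_not (Fintype.piFinset _)
    fun m : Fin k → ℕ => ∑ c, m c ≤ N]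
  rw [Finset.sum_eq_zero (s := Finset.filter (fun m : Fin k → ℕ => ¬ ∑ c, m c ≤ N) _), add_zero]
  · refine Finset.sum_bij' (fun p _ => p.2) (fun m _ => ⟨∑ c, m c, m⟩) ?_ ?_ ?_ ?_ ?_
    · rintro ⟨n, m⟩ h
      simp only [Finset.mem_sigma, Finset.mem_range, Finset.mem_piAntidiag] at h
      simp only [Finset.mem_filter, Fintype.mem_piFinset, Finset.mem_range]
      refine ⟨fun c => ?_, by rw [h.2.1]; omega⟩
      have h2 : m c ≤ ∑ c, m c := Finset.single_le_sum (f := m) (fun _ _ => Nat.zero_le _)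
        (Finset.mem_univ c)
      rw [h.2.1] at h2
      omega
    · intro m h
      simp only [Finset.mem_filter] at h
      simp only [Finset.mem_sigma, Finset.mem_range, Finset.mem_piAntidiag, Finset.mem_univ,
        implies_true, and_true]
      exact Nat.lt_succ_of_le h.2
    · rintro ⟨n, m⟩ h
      simp only [Finset.mem_sigma, Finset.mem_piAntidiag] at h
      rw [h.2.1]
    · intro m _; rfl
    · intro p _; rfl
  · intro m hm
    rw [hN m (not_le.1 (Finset.mem_filter.1 hm).2), smul_zero]

/-- The exponential series of a composition along partitions. -/
theorem expSum_comp {N : ℕ} {ψ : Components K Y Z} {φ : Components K X Y} {χ : Components K X Z}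
    {y : X} (h0 : φ 0 (fun _ => y) = 0) (hχ : ∀ n, χ n (fun _ => y) = ∑ k ∈ Finset.range (n + 1),
      ((k.factorial : K))⁻¹ • ∑ b : Fin n → Fin k, ψ k (fun c => φ (fiber b c).card fun _ => y))
    (hN : ∀ (k : ℕ) (m : Fin k → ℕ), N < ∑ c, m c → ψ k (fun c => φ (m c) fun _ => y) = 0) :
    expSum N χ y = expSum N ψ (expSum N φ y) := by
  rw [expSum, expSum]
  simp only [hχ]
  have h1 : ∀ n ∈ Finset.range (N + 1), (∑ k ∈ Finset.range (n + 1),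
      ((k.factorial : K))⁻¹ • ∑ b : Fin n → Fin k, ψ k (fun c => φ (fiber b c).card fun _ => y)) =
      ∑ k ∈ Finset.range (N + 1), ((k.factorial : K))⁻¹ • ∑ b : Fin n → Fin k,
        ψ k (fun c => φ (fiber b c).card fun _ => y) := by
    intro n hn
    refine Finset.sum_subset (Finset.range_mono (Finset.mem_range.1 hn)) fun k _ hk => ?_
    rw [Finset.sum_eq_zero, smul_zero]
    intro b _
    -- A partition into more than `n` blocks has an empty block, on which `φ` vanishes.
    have : ∃ c, ∀ i, b i ≠ c := by
      by_contra! h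
      have := Fintype.card_le_of_surjective b h
      simp at this hk
      omega
    obtain ⟨c, hc⟩ := this
    refine (ψ k).map_coord_zero c ?_
    have : ∀ S : Finset (Fin n), S = ∅ → φ S.card (fun _ => y) = 0 := by
      rintro _ rfl; exact h0
    exact this _ (by ext i; simp [hc])
  rw [Finset.sum_congr rfl fun n hn => by rw [h1 n hn]]
  simp only [Finset.smul_sum (s := Finset.range (N + 1))]
  rw [Finset.sum_comm]
  refine Finset.sum_congr rfl fun k _ => ?_
  rw [← sum_blocks N (ψ k) φ y (hN k), Finset.smul_sum]
  refine Finset.sum_congr rfl fun n _ => ?_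
  rw [smul_comm]

/-- The exponential series of an insertion. -/
theorem expSum_insert {N : ℕ} {ψ : Components K X Z} {φ : Components K X X} {χ : Components K X Z}
    {y : X} (h0 : φ 0 (fun _ => y) = 0) (hχ : ∀ n, χ n (fun _ => y) = ∑ S : Finset (Fin n),
      ψ (Sᶜ.card + 1) (Fin.cons (φ S.card fun _ => y) fun _ => y))
    (hN : ∀ a b : ℕ, N < a + b → ψ (b + 1) (Fin.cons (φ a fun _ => y) fun _ => y) = 0) :
    expSum N χ y = expDeriv N ψ (expSum N φ y) y := by
  have hz : ∀ b, ψ (b + 1) (Fin.cons (φ 0 fun _ => y) fun _ => y) = 0 := fun b =>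
    (ψ (b + 1)).map_coord_zero 0 (by simpa using h0)
  have h1 : ∀ n, ((n.factorial : K))⁻¹ • χ n (fun _ => y) = ∑ p ∈ Finset.HasAntidiagonal.antidiagonal n,
      (((p.1.factorial : K))⁻¹ * ((p.2.factorial : K))⁻¹) •
        ψ (p.2 + 1) (Fin.cons (φ p.1 fun _ => y) fun _ => y) := by
    intro n
    rw [hχ]
    have h2 : ∀ S : Finset (Fin n), ψ (Sᶜ.card + 1) (Fin.cons (φ S.card fun _ => y) fun _ => y) =
        (fun a => ψ (n - a + 1) (Fin.cons (φ a fun _ => y) fun _ => y)) S.card := by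
      intro S
      have key : ∀ b c, b = c → ψ (b + 1) (Fin.cons (φ S.card fun _ => y) fun _ => y) =
          ψ (c + 1) (Fin.cons (φ S.card fun _ => y) fun _ => y) := by rintro b _ rfl; rfl
      exact key _ _ (by rw [Finset.card_compl, Fintype.card_fin])
    rw [Finset.sum_congr rfl fun S _ => h2 S, ← Finset.powerset_univ, Finset.sum_powerset_apply_card
      (fun a => ψ (n - a + 1) (Fin.cons (φ a fun _ => y) fun _ => y)),
      Finset.Nat.sum_antidiagonal_eq_sum_range_succ_mk, Finset.card_univ, Fintype.card_fin,
      Finset.smul_sum]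
    refine Finset.sum_congr rfl fun a ha => ?_
    rw [← Nat.cast_smul_eq_nsmul K, smul_smul]
    congr 1
    have ha' : a ≤ n := Nat.lt_succ_iff.1 (Finset.mem_range.1 ha)
    rw [Nat.cast_choose K ha']
    have : (n.factorial : K) ≠ 0 := Nat.cast_ne_zero.2 n.factorial_ne_zero
    field_simp
  rw [expSum, Finset.sum_congr rfl fun n _ => h1 n, expDeriv]
  have h3 : ∀ b, ((b.factorial : K))⁻¹ • ψ (b + 1) (Fin.cons (expSum N φ y) fun _ => y) =
      ∑ a ∈ Finset.range (N + 1), (((a.factorial : K))⁻¹ * ((b.factorial : K))⁻¹) •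
        ψ (b + 1) (Fin.cons (φ a fun _ => y) fun _ => y) := by
    intro b
    rw [expSum, ← MultilinearMap.curryLeft_apply, map_sum, sum_apply, Finset.smul_sum]
    refine Finset.sum_congr rfl fun a _ => ?_
    rw [map_smul, smul_apply, smul_smul, MultilinearMap.curryLeft_apply, mul_comm]
  rw [Finset.sum_congr rfl fun b _ => h3 b, Finset.sum_sigma', Finset.sum_sigma']
  symm
  rw [← Finset.sum_filter_of_ne (s := Finset.sigma (Finset.range N) _)
    (p := fun p => p.1 + p.2 ≤ N ∧ p.2 ≠ 0)]
  · rw [← Finset.sum_filter_of_ne (s := Finset.sigma (Finset.range (N + 1)) _)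
      (p := fun p : (_ : ℕ) × ℕ × ℕ => p.2.1 ≠ 0)]
    · refine Finset.sum_bij' (fun p _ => ⟨p.1 + p.2, p.2, p.1⟩) (fun p _ => ⟨p.2.2, p.2.1⟩)
        ?_ ?_ ?_ ?_ ?_
      · rintro ⟨b, a⟩ h
        simp only [Finset.mem_filter, Finset.mem_sigma, Finset.mem_range,
          Finset.HasAntidiagonal.mem_antidiagonal] at h ⊢
        omega
      · rintro ⟨n, a, b⟩ h
        simp only [Finset.mem_filter, Finset.mem_sigma, Finset.mem_range,
          Finset.HasAntidiagonal.mem_antidiagonal] at h ⊢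
        omega
      · rintro ⟨b, a⟩ h
        rfl
      · rintro ⟨n, a, b⟩ h
        simp only [Finset.mem_filter, Finset.mem_sigma, Finset.mem_range,
          Finset.HasAntidiagonal.mem_antidiagonal] at h ⊢
        obtain ⟨⟨_, rfl⟩, _⟩ := h
        rw [add_comm]
      · rintro ⟨b, a⟩ h
        rfl
    · rintro ⟨n, a, b⟩ _ h rfl
      exact h (by simp [hz])
  · rintro ⟨b, a⟩ _ h
    refine ⟨?_, ?_⟩
    · by_contra hab
      exact h (by simp [hN a b (by simpa [add_comm] using hab)])
    · rintro rfl
      exact h (by simp [hz])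

/-- Symmetry of a family of operations on the arguments in `P`. -/
def IsSymmOn (P : Submodule K X) (φ : Components K X Y) : Prop :=
  ∀ (n : ℕ) (x : Fin n → X), (∀ i, x i ∈ P) → ∀ σ : Equiv.Perm (Fin n), φ n (x ∘ σ) = φ n x

theorem IsSymmOn.update {P : Submodule K X} {φ : Components K X Y} (h : IsSymmOn P φ) {u y : X}
    (hu : u ∈ P) (hy : y ∈ P) {n : ℕ} (i : Fin (n + 1)) :
    φ (n + 1) (Function.update (fun _ => y) i u) = φ (n + 1) (Fin.cons u fun _ => y) := by
  rw [← h (n + 1) (Fin.cons u fun _ => y) (fun j => Fin.cases hu (fun _ => hy) j)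
    (Equiv.swap 0 i)]
  congr 1
  funext j
  rw [Function.comp_apply]
  by_cases hj : j = i
  · subst hj
    simp
  · rw [Function.update_of_ne hj]
    have : Equiv.swap 0 i j ≠ 0 := fun h' => hj (by
      rw [Equiv.swap_apply_eq_iff, Equiv.swap_apply_left] at h'
      exact h')
    obtain ⟨q, hq⟩ := Fin.exists_succ_eq.2 this
    rw [← hq, Fin.cons_succ]

/-- The derivative of an exponential series whose operations and argument vary. By symmetry the
derivatives in the directions of the `m` arguments agree, which turns `1 / m!` into `1 / (m - 1)!`. -/
theorem HasPolyDeriv.expSum {P : Submodule K X} (N : ℕ) {φ φ' : K → Components K X Y} {y y' : K → X}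
    (hs : ∀ z, IsSymmOn P (φ z)) (hφ : ∀ n, HasPolyDeriv (fun z => φ z n) (fun z => φ' z n))
    (hy : HasPolyDeriv y y') (hP : ∀ z, y z ∈ P) (hP' : ∀ z, y' z ∈ P) :
    HasPolyDeriv (fun z => expSum N (φ z) (y z))
      (fun z => MCTwist.expSum N (φ' z) (y z) + expDeriv N (φ z) (y' z) (y z)) := by
  have h := HasPolyDeriv.sum (Finset.range (N + 1)) fun m _ =>
    (HasPolyDeriv.multilinear (hφ m) (fun _ : Fin m => hy)).smul ((m.factorial : K))⁻¹
  refine (congrArg (HasPolyDeriv _) (funext fun z => ?_)).mpr h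
  simp only [smul_add, Finset.sum_add_distrib, MCTwist.expSum]
  congr 1
  rw [Finset.sum_range_succ']
  simp only [Finset.univ_eq_empty, Finset.sum_empty, smul_zero, add_zero, expDeriv]
  refine Finset.sum_congr rfl fun j _ => ?_
  rw [Finset.sum_congr rfl fun i _ => (hs z).update (hP' z) (hP z) i, Finset.sum_const,
    Finset.card_univ, Fintype.card_fin, ← Nat.cast_smul_eq_nsmul K, smul_smul]
  congr 1
  have h1 : (j.factorial : K) ≠ 0 := Nat.cast_ne_zero.2 j.factorial_ne_zero
  have h2 : ((j + 1 : ℕ) : K) ≠ 0 := Nat.cast_ne_zero.2 (by omega)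
  rw [Nat.factorial_succ, Nat.cast_mul]
  field_simp

/-- The chain rule for exponential series. -/
theorem expDeriv_comp {N : ℕ} {P : Submodule K X} {Q : Submodule K Y} {ψ : Components K Y Z}
    {φ : Components K X Y} {χ : Components K X Z} (hψ : IsSymmOn Q ψ) (hφ : IsSymmOn P φ)
    (hχ : IsSymmOn P χ) {u y : X} (hu : u ∈ P) (hy : y ∈ P) (hQ : ∀ x ∈ P, expSum N φ x ∈ Q)
    (hQ' : ∀ x ∈ P, expDeriv N φ u x ∈ Q)
    (h : ∀ c : K, expSum N χ (y + c • u) = expSum N ψ (expSum N φ (y + c • u))) :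
    expDeriv N χ u y = expDeriv N ψ (expDeriv N φ u y) (expSum N φ y) := by
  have hP : ∀ c : K, y + c • u ∈ P := fun c => add_mem hy (P.smul_mem c hu)
  have hl : HasPolyDeriv (fun c : K => y + c • u) (fun _ => u) := by
    have := (HasPolyDeriv.const (K := K) y).add (HasPolyDeriv.mono (K := K) 1 u)
    simpa using this
  -- Both sides of `h` are differentiated along the line through `y` in the direction `u`.
  have h1 := HasPolyDeriv.expSum N (fun _ : K => hχ) (φ' := fun _ _ => 0)
    (fun n => HasPolyDeriv.const (χ n)) hl hP fun _ => hu
  have h2 := HasPolyDeriv.expSum N (fun _ : K => hφ) (φ' := fun _ _ => 0)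
    (fun n => HasPolyDeriv.const (φ n)) hl hP fun _ => hu
  have hz : ∀ x : X, expSum N (fun _ => 0 : Components K X Y) x = 0 := fun x => by simp [expSum]
  simp only [hz, zero_add] at h2
  have h3 := HasPolyDeriv.expSum N (fun _ : K => hψ) (φ' := fun _ _ => 0)
    (fun n => HasPolyDeriv.const (ψ n)) h2 (fun c => hQ _ (hP c)) fun c => hQ' _ (hP c)
  have h4 := h1.deriv_unique h3 h 0
  simpa [expSum] using h4

end Series

/-! ### Exponential series after extension of scalars -/

section ExtSeries

/-- A multiplicative filtration of a ring with involution that ends after `N` steps. -/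
structure IsFiltration {K : Type u} [Field K] {R : Type w} [Ring R] [Algebra K R]
    (s : R →ₗ[K] R) (P : ℕ → Submodule K R) (N : ℕ) : Prop where
  one_mem : 1 ∈ P 0
  mul_mem : ∀ {i j : ℕ} {a b : R}, a ∈ P i → b ∈ P j → a * b ∈ P (i + j)
  parity_mem : ∀ {i : ℕ} {a : R}, a ∈ P i → s a ∈ P i
  anti : ∀ {i j : ℕ}, i ≤ j → P j ≤ P i
  eq_zero : ∀ {m : ℕ}, N < m → ∀ {a : R}, a ∈ P m → a = 0

variable {K : Type u} [Field K] {R : Type w} [Ring R] [Algebra K R] {s : R →ₗ[K] R}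
  {P : ℕ → Submodule K R} {N : ℕ}
  {X : Type v} [AddCommGroup X] [Module K X] {Y : Type x} [AddCommGroup Y] [Module K Y]
  {Z : Type y} [AddCommGroup Z] [Module K Z]

theorem tensorFil_mono {P Q : Submodule K R} (h : P ≤ Q) : tensorFil P X ≤ tensorFil Q X :=
  Submodule.span_mono fun _ ⟨a, ha, w, hw⟩ => ⟨a, h ha, w, hw⟩

theorem IsFiltration.eq_zero_of_mem (hP : IsFiltration s P N) {m : ℕ} (hm : N < m) {x : R ⊗[K] X}
    (hx : x ∈ tensorFil (P m) X) : x = 0 := by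
  have : tensorFil (P m) X ≤ ⊥ := Submodule.span_le.2 fun _ ⟨a, ha, w, hw⟩ => by
    rw [hw, hP.eq_zero hm ha, TensorProduct.zero_tmul]
    exact zero_mem _
  simpa using this hx

/-- Extension of scalars of a family of operations. -/
abbrev extend (s : R →ₗ[K] R) (t : X →ₗ[K] X) (φ : Components K X Y) :
    Components K (R ⊗[K] X) (R ⊗[K] Y) := fun n => extendMultilinear s t Y n (φ n)

theorem extend_mem_tensorFil (hP : IsFiltration s P N) {t : X →ₗ[K] X} (φ : Components K X Y)
    {n : ℕ} {m : Fin n → ℕ} {x : Fin n → R ⊗[K] X} (hx : ∀ i, x i ∈ tensorFil (P (m i)) X) :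
    extend s t φ n x ∈ tensorFil (P (∑ i, m i)) Y :=
  extendMultilinear_mem_tensorFil hP.one_mem hP.mul_mem hP.parity_mem (φ n) hx

theorem extend_const_mem_tensorFil (hP : IsFiltration s P N) {t : X →ₗ[K] X} (φ : Components K X Y)
    {n : ℕ} {x : R ⊗[K] X} (hx : x ∈ tensorFil (P 1) X) :
    extend s t φ n (fun _ => x) ∈ tensorFil (P n) Y := by
  simpa using extend_mem_tensorFil hP φ (m := fun _ : Fin n => 1) fun _ => hx

theorem extend_zero {t : X →ₗ[K] X} {φ : Components K X Y} (h0 : ∀ x, φ 0 x = 0)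
    (x : Fin 0 → R ⊗[K] X) : extend s t φ 0 x = 0 := by
  rw [extend, extendMultilinear_zero, h0, TensorProduct.tmul_zero]

theorem expSum_mem {φ : Components K X Y} {Q : Submodule K Y} {y : X}
    (h : ∀ n, φ n (fun _ => y) ∈ Q) : expSum N φ y ∈ Q :=
  Submodule.sum_mem _ fun n _ => Q.smul_mem _ (h n)

theorem expDeriv_mem {φ : Components K X Y} {Q : Submodule K Y} {u y : X}
    (h : ∀ n, φ (n + 1) (Fin.cons u fun _ => y) ∈ Q) : expDeriv N φ u y ∈ Q :=
  Submodule.sum_mem _ fun n _ => Q.smul_mem _ (h n)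

theorem map_expSum (g : Y →ₗ[K] Z) (φ : Components K X Y) (y : X) :
    g (expSum N φ y) = expSum N (fun n => g.compMultilinearMap (φ n)) y := by
  simp [expSum, map_sum]

theorem expSum_extend_mem_fil (hP : IsFiltration s P N) {t : X →ₗ[K] X} {φ : Components K X Y}
    (h0 : ∀ x, φ 0 x = 0) {y : R ⊗[K] X} (hy : y ∈ tensorFil (P 1) X) :
    expSum N (extend s t φ) y ∈ tensorFil (P 1) Y := by
  refine expSum_mem fun n => ?_
  rcases Nat.eq_zero_or_pos n with rfl | hn
  · rw [extend_zero h0]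
    exact zero_mem _
  · exact tensorFil_mono (hP.anti hn) (extend_const_mem_tensorFil hP φ hy)

/-- The derivative of an exponential series, as a linear map. -/
def expDerivₗ (N : ℕ) (φ : Components K X Y) (y : X) : X →ₗ[K] Y where
  toFun u := expDeriv N φ u y
  map_add' u u' := by
    simp only [expDeriv, MultilinearMap.cons_add, smul_add, Finset.sum_add_distrib]
  map_smul' c u := by
    simp only [expDeriv, MultilinearMap.cons_smul, Finset.smul_sum, smul_comm c, RingHom.id_apply]

variable [CharZero K] {ℛ : ℤ → Submodule K R} {𝒳 : ℤ → Submodule K X} {𝒴 : ℤ → Submodule K Y}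
  {t : X →ₗ[K] X} {t' : Y →ₗ[K] Y}

/-- The operations in the family `φ` have degree `p`. -/
def HasDegree (𝒳 : ℤ → Submodule K X) (𝒴 : ℤ → Submodule K Y) (p : ℤ) (φ : Components K X Y) :
    Prop := ∀ (n : ℕ) (d : Fin n → ℤ) (x : Fin n → X), (∀ i, x i ∈ 𝒳 (d i)) →
      φ n x ∈ 𝒴 (∑ i, d i + p)

theorem HasDegree.extend (hR : IsGradedComm ℛ s) (ht : IsParity 𝒳 t) {p : ℤ} {φ : Components K X Y}
    (h : HasDegree 𝒳 𝒴 p φ) : HasDegree (tensorGrading ℛ 𝒳) (tensorGrading ℛ 𝒴) p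
      (extend s t φ) := fun n _ _ hx => extendMultilinear_mem hR ht (h n) hx

theorem HasDegree.const_mem {p : ℤ} {φ : Components K X Y} (h : HasDegree 𝒳 𝒴 p φ) {y : X}
    (hy : y ∈ 𝒳 0) (n : ℕ) : φ n (fun _ => y) ∈ 𝒴 p := by
  simpa using h n (fun _ => 0) (fun _ => y) fun _ => hy

theorem HasDegree.cons_mem {p q : ℤ} {φ : Components K X Y} (h : HasDegree 𝒳 𝒴 p φ) {u y : X}
    (hu : u ∈ 𝒳 q) (hy : y ∈ 𝒳 0) (n : ℕ) : φ (n + 1) (Fin.cons u fun _ => y) ∈ 𝒴 (q + p) := by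
  have := h (n + 1) (Fin.cons q fun _ => 0) (Fin.cons u fun _ => y)
    fun i => Fin.cases hu (fun _ => hy) i
  simpa [Fin.sum_univ_succ] using this

theorem IsGradedSymm.isSymmOn {φ : Components K X Y} (h : IsGradedSymm 𝒳 φ) :
    IsSymmOn (𝒳 0) φ := by
  intro n x hx σ
  rw [h n (fun _ => 0) x hx σ, koszulSign_eq_one (by simp), one_smul]

theorem IsGradedSymm.extend (hR : IsGradedComm ℛ s) (ht : IsParity 𝒳 t) {φ : Components K X Y}
    (h : IsGradedSymm 𝒳 φ) : IsGradedSymm (tensorGrading ℛ 𝒳) (extend s t φ) :=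
  extendMultilinear_symm hR ht h

/-- On formal arguments of degree `0`, the exponential series turns composition along partitions into
composition of functions. -/
theorem expSum_extend_comp (hR : IsGradedComm ℛ s) (hP : IsFiltration s P N) (ht : IsParity 𝒳 t)
    (ht' : IsParity 𝒴 t') (ψ : Components K Y Z) {φ : Components K X Y} (h0 : ∀ x, φ 0 x = 0)
    (hφ : HasDegree 𝒳 𝒴 0 φ) {y : R ⊗[K] X} (hy : y ∈ tensorGrading ℛ 𝒳 0)
    (hy' : y ∈ tensorFil (P 1) X) :
    expSum N (extend s t (comp t ψ φ)) y =
      expSum N (extend s t' ψ) (expSum N (extend s t φ) y) := by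
  refine expSum_comp (extend_zero h0 _) (fun n => ?_) fun k m hm => ?_
  · rw [extend, extendMultilinear_comp hR ht ht' ψ (fun m d x hx => by simpa using hφ m d x hx)
      fun _ => hy]
    refine Finset.sum_congr rfl fun k _ => congrArg _ (Finset.sum_congr rfl fun b _ => ?_)
    rw [koszulSign_eq_one (by simp), one_smul]
    rfl
  · exact hP.eq_zero_of_mem hm (extend_mem_tensorFil hP ψ fun c =>
      extend_const_mem_tensorFil hP φ hy')

/-- On formal arguments of degree `0`, the exponential series turns insertion into the directional
derivative. The sign of moving an operation of degree `p` past the ring of scalars is absorbed in the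
operator `σ = (-1) ^ (p * degree)`. -/
theorem expSum_extend_insert (hR : IsGradedComm ℛ s) (hP : IsFiltration s P N)
    (ht : IsParity 𝒳 t) {p : ℤ} {σ : R →ₗ[K] R}
    (hσ : ∀ ⦃i : ℤ⦄ ⦃a : R⦄, a ∈ ℛ i → σ a = sg (p * i) • a) (hσP : ∀ i, ∀ a ∈ P i, σ a ∈ P i)
    (ψ : Components K X Z) {φ : Components K X X} (h0 : ∀ x, φ 0 x = 0)
    (hφ : HasDegree 𝒳 𝒳 p φ) {y : R ⊗[K] X} (hy : y ∈ tensorGrading ℛ 𝒳 0)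
    (hy' : y ∈ tensorFil (P 1) X) :
    σ.rTensor Z (expSum N (extend s t (insertion t ψ φ)) y) =
      expDeriv N (extend s t ψ) (σ.rTensor X (expSum N (extend s t φ) y)) y := by
  rw [map_expSum, map_expSum]
  refine expSum_insert (by rw [LinearMap.compMultilinearMap_apply, extend_zero h0, map_zero])
    (fun n => ?_) fun a b hab => ?_
  · rw [LinearMap.compMultilinearMap_apply, extend, extendMultilinear_insert hR ht hσ ψ hφ
      fun _ => hy]
    refine Finset.sum_congr rfl fun S _ => ?_
    rw [koszulSign_eq_one (by simp), one_smul]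
    rfl
  · refine hP.eq_zero_of_mem (m := ∑ i, (Fin.cons a fun _ => 1 : Fin (b + 1) → ℕ) i)
      (by simpa [Fin.sum_univ_succ] using hab) (extend_mem_tensorFil hP ψ fun i => ?_)
    refine Fin.cases ?_ (fun i => hy') i
    exact tensorFil_map (hσP a) (extend_const_mem_tensorFil hP φ hy')

/-- The chain rule on formal arguments of degree `0`. -/
theorem expDeriv_extend_comp (hR : IsGradedComm ℛ s) (hP : IsFiltration s P N) (ht : IsParity 𝒳 t)
    (ht' : IsParity 𝒴 t') {ψ : Components K Y Z} {φ : Components K X Y} (h0 : ∀ x, φ 0 x = 0)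
    (hφ : HasDegree 𝒳 𝒴 0 φ) (hψs : IsGradedSymm 𝒴 ψ) (hφs : IsGradedSymm 𝒳 φ)
    (hs : IsGradedSymm 𝒳 (comp t ψ φ)) {u y : R ⊗[K] X}
    (hu : u ∈ tensorGrading ℛ 𝒳 0) (hu' : u ∈ tensorFil (P 1) X) (hy : y ∈ tensorGrading ℛ 𝒳 0)
    (hy' : y ∈ tensorFil (P 1) X) :
    expDeriv N (extend s t (comp t ψ φ)) u y =
      expDeriv N (extend s t' ψ) (expDeriv N (extend s t φ) u y) (expSum N (extend s t φ) y) := by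
  have hφe := hφ.extend hR ht
  refine expDeriv_comp ((hψs.extend hR ht').isSymmOn) ((hφs.extend hR ht).isSymmOn)
    ((hs.extend hR ht).isSymmOn) hu hy (fun x hx => expSum_mem (hφe.const_mem hx))
    (fun x hx => expDeriv_mem fun n => by simpa using hφe.cons_mem hu hx n) fun c => ?_
  exact expSum_extend_comp hR hP ht ht' ψ h0 hφ (add_mem hy (Submodule.smul_mem _ c hu))
    (add_mem hy' (Submodule.smul_mem _ c hu'))

theorem mulLeft_extend (t : X →ₗ[K] X) {n : ℕ} (φ : MultilinearMap K (fun _ : Fin (n + 1) => X) Y)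
    (e : R) (u : R ⊗[K] X) (x : Fin n → R ⊗[K] X) :
    extendMultilinear s t Y (n + 1) φ (Fin.cons ((LinearMap.mulLeft K e).rTensor X u) x) =
      (LinearMap.mulLeft K e).rTensor Y (extendMultilinear s t Y (n + 1) φ (Fin.cons u x)) := by
  induction u using TensorProduct.induction_on with
  | zero =>
    have h : extendMultilinear s t Y (n + 1) φ (Fin.cons 0 x) = 0 :=
      MultilinearMap.map_coord_zero _ 0 (Fin.cons_zero _ _)
    rw [map_zero, h, map_zero]
  | tmul a w =>
    have h : ∀ v : R ⊗[K] Y, (LinearMap.mulLeft K (e * a)).rTensor Y v =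
        (LinearMap.mulLeft K e).rTensor Y ((LinearMap.mulLeft K a).rTensor Y v) := fun v => by
      rw [← LinearMap.comp_apply, ← LinearMap.rTensor_comp]
      congr 2
      ext b; simp
    rw [LinearMap.rTensor_tmul, extendMultilinear_succ_cons_tmul, extendMultilinear_succ_cons_tmul]
    exact h _
  | add u v h1 h2 => rw [map_add, MultilinearMap.cons_add, MultilinearMap.cons_add, map_add, h1, h2]

theorem mulLeft_expDeriv (t : X →ₗ[K] X) (φ : Components K X Y) (e : R) (u y : R ⊗[K] X) :
    expDeriv N (extend s t φ) ((LinearMap.mulLeft K e).rTensor X u) y =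
      (LinearMap.mulLeft K e).rTensor Y (expDeriv N (extend s t φ) u y) := by
  simp only [expDeriv, map_sum, map_smul, extend, mulLeft_extend]

theorem extendMultilinear_one (hR : IsGradedComm ℛ s) {t : X →ₗ[K] X}
    {φ : MultilinearMap K (fun _ : Fin 1 => X) X} (h : ∀ x, φ x = x 0) (x : Fin 1 → R ⊗[K] X) :
    extendMultilinear s t X 1 φ x = x 0 := by
  obtain ⟨u, rfl⟩ : ∃ u, x = Fin.cons u ![] :=
    ⟨x 0, funext fun i => by rw [Subsingleton.elim i 0]; rfl⟩
  rw [Fin.cons_zero]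
  induction u using TensorProduct.induction_on with
  | zero => exact MultilinearMap.map_coord_zero _ 0 (Fin.cons_zero _ _)
  | tmul a w =>
    have h1 : s 1 = 1 := by simpa using hR.parity hR.one_mem
    rw [extendMultilinear_succ_cons_tmul, extendMultilinear_zero, extendMultilinear_zero,
      MultilinearMap.curryLeft_apply, MultilinearMap.curryLeft_apply, h, h, LinearMap.rTensor_tmul,
      h1, ← TensorProduct.tmul_add, LinearMap.rTensor_tmul, LinearMap.mulLeft_apply, mul_one]
    congr 1
    simp only [Fin.cons_zero, evenPart, oddPart, LinearMap.smul_apply, LinearMap.add_apply,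
      LinearMap.sub_apply, LinearMap.id_apply, ← smul_add]
    rw [add_add_sub_cancel, ← two_smul K w, smul_smul, inv_mul_cancel₀ two_ne_zero, one_smul]
  | add u v h1 h2 => rw [MultilinearMap.cons_add, h1, h2]

end ExtSeries

/-! ### Flows of `L∞` structures -/

section Flow

variable {K : Type u} [Field K] [CharZero K] {T : Type v} [AddCommGroup T] [Module K T]

/-- The evaluation of multilinear maps. -/
def evalAt {n : ℕ} {X : Type v} [AddCommGroup X] [Module K X] {Y : Type w} [AddCommGroup Y]
    [Module K Y] (x : Fin n → X) : MultilinearMap K (fun _ : Fin n => X) Y →ₗ[K] Y where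
  toFun M := M x
  map_add' _ _ := rfl
  map_smul' _ _ := rfl

/-- A polynomial family `ℓ` of `L∞` structures whose derivative `ℓ'` is the commutator of `ℓ` with
the coderivation of degree `0` with components `θ`, together with the flow `f` of `θ`. -/
structure IsFlow (𝒯 : ℤ → Submodule K T) (t : T →ₗ[K] T) (ℓ ℓ' θ f : K → Components K T T) :
    Prop where
  isLInfty : ∀ z, IsLInfty 𝒯 (ℓ z)
  deriv_bracket : ∀ n, HasPolyDeriv (fun z => ℓ z n) (fun z => ℓ' z n)
  bracket : ∀ (z : K) (n : ℕ) (d : Fin n → ℤ) (x : Fin n → T), (∀ i, x i ∈ 𝒯 (d i)) →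
    ℓ' z n x + insertion t (ℓ z) (θ z) n x = insertion t (θ z) (ℓ z) n x
  field_zero : ∀ (z : K) (x : Fin 0 → T), θ z 0 x = 0
  field_degree : ∀ z, HasDegree 𝒯 𝒯 0 (θ z)
  field_symm : ∀ z, IsGradedSymm 𝒯 (θ z)
  field_isPolyFun : ∀ n, IsPolyFun (fun z => θ z n)
  zero : ∀ (z : K) (x : Fin 0 → T), f z 0 x = 0
  degree : ∀ z, HasDegree 𝒯 𝒯 0 (f z)
  symm : ∀ z, IsGradedSymm 𝒯 (f z)
  comp_symm : ∀ z, IsGradedSymm 𝒯 (comp t (θ z) (f z))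
  deriv : ∀ n, HasPolyDeriv (fun z => f z n) (fun z => comp t (θ z) (f z) n)
  initial_one : ∀ x, f 0 1 x = x 0
  initial_of_ne : ∀ n, n ≠ 1 → f 0 n = 0

variable {R : Type w} [Ring R] [Algebra K R] {s : R →ₗ[K] R} {ℛ : ℤ → Submodule K R}
  {P : ℕ → Submodule K R} {N : ℕ}

variable {𝒯 : ℤ → Submodule K T} {t : T →ₗ[K] T} {ℓ ℓ' θ f : K → Components K T T}

theorem IsPolyFun.expDeriv {X : Type v} [AddCommGroup X] [Module K X] {Y : Type w} [AddCommGroup Y]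
    [Module K Y] {φ : K → Components K X Y} (hφ : ∀ n, IsPolyFun fun z => φ z n) {u y : K → X}
    (hu : IsPolyFun u) (hy : IsPolyFun y) : IsPolyFun fun z => expDeriv N (φ z) (u z) (y z) := by
  choose φ' hφ using hφ
  obtain ⟨u', hu⟩ := hu
  obtain ⟨y', hy⟩ := hy
  have h := HasPolyDeriv.sum (Finset.range N) fun j _ =>
    (HasPolyDeriv.multilinear (hφ (j + 1))
      (g := fun i z => (Fin.cons (u z) fun _ => y z : Fin (j + 1) → X) i)
      (g' := fun i z => (Fin.cons (u' z) fun _ => y' z : Fin (j + 1) → X) i)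
      fun i => Fin.cases hu (fun _ => hy) i).smul ((j.factorial : K))⁻¹
  exact h.isPolyFun

/-- The comparison of the two sides of the equation for an `L∞` morphism along a flow, on a formal
argument `y` of degree `0`: both solve the same linear differential equation. The element `e` of odd
degree makes the values of the brackets even, so that no signs are needed. -/
theorem IsFlow.expSum_eq (hf : IsFlow 𝒯 t ℓ ℓ' θ f) (ht : IsParity 𝒯 t) (hR : IsGradedComm ℛ s)
    (hP : IsFiltration s P N) (hN : 1 ≤ N) {e : R} (he : e ∈ ℛ (-1)) (he' : e ∈ P 0)
    {y : R ⊗[K] T} (hy : y ∈ tensorGrading ℛ 𝒯 0) (hy' : y ∈ tensorFil (P 1) T) (z : K) :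
    (LinearMap.mulLeft K e).rTensor T (s.rTensor T
      (expSum N (extend s t (comp t (ℓ z) (f z))) y)) =
    (LinearMap.mulLeft K e).rTensor T (s.rTensor T
      (expSum N (extend s t (insertion t (f z) (ℓ 0))) y)) := by
  set E : R ⊗[K] T →ₗ[K] R ⊗[K] T := (LinearMap.mulLeft K e).rTensor T with hE
  have hσ : ∀ ⦃i : ℤ⦄ ⦃a : R⦄, a ∈ ℛ i → (LinearMap.id : R →ₗ[K] R) a = sg (0 * i) • a :=
    fun i a _ => by simp
  have hEdeg : ∀ {u : R ⊗[K] T}, u ∈ tensorGrading ℛ 𝒯 (-1) →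
      E (s.rTensor T u) ∈ tensorGrading ℛ 𝒯 0 := fun hu => by
    refine tensorGrading_linear_mem (fun α ω a w ha hw h => ?_) (rTensor_parity_mem hR hu)
    rw [hE, LinearMap.rTensor_tmul]
    exact tmul_mem_tensorGrading (hR.mul_mem he ha) hw (by omega)
  have hEfil : ∀ {u : R ⊗[K] T}, u ∈ tensorFil (P 1) T → E (s.rTensor T u) ∈ tensorFil (P 1) T :=
    fun hu => tensorFil_map (fun a ha => by simpa using hP.mul_mem he' ha)
      (tensorFil_map (fun a ha => hP.parity_mem ha) hu)
  set Y : K → R ⊗[K] T := fun z => expSum N (extend s t (f z)) y with hYdef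
  have hYd : ∀ z, Y z ∈ tensorGrading ℛ 𝒯 0 := fun z =>
    expSum_mem (((hf.degree z).extend hR ht).const_mem hy)
  have hYf : ∀ z, Y z ∈ tensorFil (P 1) T := fun z => expSum_extend_mem_fil hP (hf.zero z) hy'
  have hℓd : ∀ z, HasDegree 𝒯 𝒯 (-1) (ℓ z) := fun z => (hf.isLInfty z).degree
  have hF : ∀ n, HasPolyDeriv (fun z => extend s t (f z) n)
      (fun z => extend s t (comp t (θ z) (f z)) n) := fun n => (hf.deriv n).map _
  have hY : HasPolyDeriv Y fun z => expSum N (extend s t (θ z)) (Y z) := by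
    have h := HasPolyDeriv.expSum N (fun z => ((hf.symm z).extend (ℛ := ℛ) hR ht).isSymmOn) hF
      (HasPolyDeriv.const y) (fun _ => hy) fun _ => zero_mem _
    refine (congrArg (HasPolyDeriv _) (funext fun z => ?_)).mpr h
    rw [show expDeriv N (extend s t (f z)) 0 y = 0 from (expDerivₗ N (extend s t (f z)) y).map_zero,
      add_zero, expSum_extend_comp hR hP ht ht (θ z) (hf.zero z) (hf.degree z) hy hy']
  -- `p` and `r` are the two sides of the equation for an `L∞` morphism, multiplied by `e`.
  set p : K → R ⊗[K] T := fun z => E (s.rTensor T (expSum N (extend s t (ℓ z)) (Y z))) with hp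
  set q : R ⊗[K] T := E (s.rTensor T (expSum N (extend s t (ℓ 0)) y)) with hq
  have hqd : q ∈ tensorGrading ℛ 𝒯 0 :=
    hEdeg (expSum_mem (((hℓd 0).extend hR ht).const_mem hy))
  have hqf : q ∈ tensorFil (P 1) T := hEfil (expSum_extend_mem_fil hP (hf.isLInfty 0).zero hy')
  set r : K → R ⊗[K] T := fun z => expDeriv N (extend s t (f z)) q y with hr
  have hp' : HasPolyDeriv p fun z => expDeriv N (extend s t (θ z)) (p z) (Y z) := by
    have h := ((HasPolyDeriv.expSum N
      (fun z => ((hf.isLInfty z).gradedSymm.extend (ℛ := ℛ) hR ht).isSymmOn)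
      (φ' := fun z => extend s t (ℓ' z)) (fun n => (hf.deriv_bracket n).map _) hY hYd fun z =>
        expSum_mem (((hf.field_degree z).extend hR ht).const_mem (hYd z))).map (s.rTensor T)).map E
    refine (congrArg (HasPolyDeriv _) (funext fun z => ?_)).mpr h
    have h1 := expSum_extend_insert hR hP ht hσ (fun i a ha => ha) (ℓ z) (hf.field_zero z)
      (hf.field_degree z) (hYd z) (hYf z)
    rw [LinearMap.rTensor_id, LinearMap.id_apply, LinearMap.id_apply] at h1
    have h2 := expSum_extend_insert hR hP ht hR.parity_odd (fun i a ha => hP.parity_mem ha) (θ z)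
      (hf.isLInfty z).zero (hℓd z) (hYd z) (hYf z)
    -- The two terms in which `ℓ` is differentiated cancel, since `ℓ'` is the commutator.
    have h3 : expSum N (extend s t (ℓ' z)) (Y z) + expSum N (extend s t (insertion t (ℓ z) (θ z))) (Y z)
        = expSum N (extend s t (insertion t (θ z) (ℓ z))) (Y z) := by
      simp only [expSum, ← Finset.sum_add_distrib, ← smul_add]
      refine Finset.sum_congr rfl fun n _ => ?_
      rw [extend, extend, ← add_apply, ← map_add, extendMultilinear_congr hR ht _ fun _ => hYd z]
      exact fun d x hx => hf.bracket z n d x hx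
    rw [← h1, h3, h2, hE, ← mulLeft_expDeriv]
  have hr' : HasPolyDeriv r fun z => expDeriv N (extend s t (θ z)) (r z) (Y z) := by
    have h := HasPolyDeriv.sum (Finset.range N) fun j _ =>
      ((hF (j + 1)).map (evalAt (Fin.cons q fun _ => y))).smul ((j.factorial : K))⁻¹
    refine (congrArg (HasPolyDeriv _) (funext fun z => ?_)).mpr h
    exact (expDeriv_extend_comp hR hP ht ht (hf.zero z) (hf.degree z) (hf.field_symm z) (hf.symm z)
      (hf.comp_symm z) hqd hqf hy hy').symm
  have hne : ∀ n, n ≠ 1 → extend s t (f 0) n = 0 := fun n hn => by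
    rw [extend, hf.initial_of_ne n hn, map_zero]
  have hY0 : Y 0 = y := by
    rw [hYdef]
    simp only [expSum]
    rw [Finset.sum_eq_single 1]
    · simp [extend, extendMultilinear_one hR hf.initial_one]
    · intro n _ hn
      simp only [hne n hn, zero_apply, smul_zero]
    · intro h
      simp at h
      omega
  have hr0 : r 0 = q := by
    rw [hr]
    simp only [expDeriv]
    rw [Finset.sum_eq_single 0]
    · simp [extend, extendMultilinear_one hR hf.initial_one]
    · intro n _ hn
      simp only [hne (n + 1) (by omega), zero_apply, smul_zero]
    · intro h
      simp at h
      omega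
  have hpr : ∀ z, p z - r z = 0 := HasPolyDeriv.eq_zero_of_linear
    (M := fun z => expDerivₗ N (extend s t (θ z)) (Y z))
    (fun w hw => IsPolyFun.expDeriv (fun n => by
      obtain ⟨_, h⟩ := hf.field_isPolyFun n
      exact (h.map _).isPolyFun) hw hY.isPolyFun)
    (by
      simp only [map_sub]
      exact hp'.sub hr')
    (by rw [hr0, hp, hq]; simp only [hY0, sub_self])
  have key := sub_eq_zero.1 (hpr z)
  rw [expSum_extend_comp hR hP ht ht (ℓ z) (hf.zero z) (hf.degree z) hy hy',
    expSum_extend_insert hR hP ht hR.parity_odd (fun i a ha => hP.parity_mem ha) (f z)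
      (hf.isLInfty 0).zero (hℓd 0) hy hy', hE, ← mulLeft_expDeriv]
  exact key

end Flow

/-! ### Reduction of graded symmetric identities to formal arguments of degree zero -/

section Reduction

variable {K : Type u} [Field K] {X : Type v} [AddCommGroup X] [Module K X]
  {Y : Type w} [AddCommGroup Y] [Module K Y] {Z : Type x} [AddCommGroup Z] [Module K Z]
  {𝒳 : ℤ → Submodule K X} {𝒴 : ℤ → Submodule K Y}

theorem IsSymmOn.equiv {Q : Submodule K X} {φ : Components K X Y} (h : IsSymmOn Q φ) {m n : ℕ}
    (τ : Fin m ≃ Fin n) {x : Fin n → X} (hx : ∀ i, x i ∈ Q) : φ m (x ∘ τ) = φ n x := by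
  obtain rfl : m = n := by simpa using Fintype.card_congr τ
  exact h m x hx τ

theorem IsSymmOn.subfamily {Q : Submodule K X} {φ : Components K X Y} (h : IsSymmOn Q φ) {n : ℕ}
    {x : Fin n → X} (hx : ∀ i, x i ∈ Q) (σ : Equiv.Perm (Fin n)) {S S' : Finset (Fin n)}
    (hS : ∀ i, i ∈ S ↔ σ i ∈ S') :
    φ S.card (subfamily (x ∘ σ) S) = φ S'.card (subfamily x S') := by
  have e := h.equiv (((S.orderIsoOfFin rfl).toEquiv.trans (σ.subtypeEquiv hS)).trans
    (S'.orderIsoOfFin rfl).toEquiv.symm) (x := MCTwist.subfamily x S') fun i => hx _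
  rw [← e]
  congr 1
  funext p
  simp only [MCTwist.subfamily, Function.comp_apply, Equiv.trans_apply]
  have : ∀ q : S', S'.orderEmbOfFin rfl ((S'.orderIsoOfFin rfl).toEquiv.symm q) = q := fun q =>
    congrArg Subtype.val ((S'.orderIsoOfFin rfl).apply_symm_apply q)
  rw [this]
  rfl

theorem IsGradedSymm.curryLeft {ψ : Components K X Y} (h : IsGradedSymm 𝒳 ψ) {p : ℤ} {v : X}
    (hv : v ∈ 𝒳 p) : IsGradedSymm 𝒳 fun n => (ψ (n + 1)).curryLeft v := by
  intro n d x hx σ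
  have hx' : ∀ i, (Fin.cons v x : Fin (n + 1) → X) i ∈ 𝒳 ((Fin.cons p d : Fin (n + 1) → ℤ) i) :=
    fun i => Fin.cases hv hx i
  set τ := Equiv.Perm.decomposeFin.symm (0, σ) with hτ
  have h0 : τ 0 = 0 := by simp [hτ]
  have h1 : ∀ i : Fin n, τ i.succ = (σ i).succ := fun i => by simp [hτ]
  have h0' : τ.symm 0 = 0 := by rw [Equiv.symm_apply_eq, h0]
  have h1' : ∀ i : Fin n, τ.symm i.succ = (σ.symm i).succ := fun i => by
    rw [Equiv.symm_apply_eq, h1, Equiv.apply_symm_apply]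
  have e := h (n + 1) _ _ hx' τ
  rw [koszulSign_succ] at e
  simp only [h0', h1', Fin.not_lt_zero, if_false, Finset.prod_const_one, one_mul,
    Fin.cons_succ] at e
  rw [MultilinearMap.curryLeft_apply, MultilinearMap.curryLeft_apply, e]
  congr 1
  · exact koszulSign_congr_label d fun i j => Fin.succ_lt_succ_iff
  · congr 1
    funext i
    refine Fin.cases ?_ (fun i => ?_) i
    · rw [Function.comp_apply, h0]; rfl
    · rw [Function.comp_apply, h1]; rfl

variable [CharZero K]

theorem Cube.isFiltration {n : ℕ} (d : Fin n → ℤ) :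
    IsFiltration (Cube.parity K d) (Cube.fil K d) n :=
  ⟨Cube.one_mem_fil, Cube.mul_mem_fil, Cube.parity_mem_fil, Cube.fil_anti,
    fun h _ => Cube.eq_zero_of_mem_fil h⟩

/-- The formal argument `eᵢ ⊗ x` of degree `0`. -/
theorem gen_tmul_mem {n : ℕ} (d : Fin n → ℤ) (i : Fin n) {x : X} (hx : x ∈ 𝒳 (d i)) :
    Cube.gen K d i ⊗ₜ[K] x ∈ tensorGrading (Cube.grading K d) 𝒳 0 :=
  tmul_mem_tensorGrading (Cube.gen_mem K d i) hx (by simp)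

/-- Graded symmetry follows from symmetry on formal arguments of degree `0`. -/
theorem isGradedSymm_of_cube {t : X →ₗ[K] X} (ht : IsParity 𝒳 t) {φ : Components K X Y}
    (h : ∀ (n : ℕ) (d : Fin n → ℤ), IsSymmOn (tensorGrading (Cube.grading K d) 𝒳 0)
      (extend (Cube.parity K d) t φ)) : IsGradedSymm 𝒳 φ := by
  intro n d x hx σ
  have hR := Cube.isGradedComm K d
  have e := h n d n (fun i => Cube.gen K d i ⊗ₜ[K] x i) (fun i => gen_tmul_mem d i (hx i)) σ
  have e1 := extendMultilinear_tmul hR (φ n) (fun i => Cube.gen_mem K d i) (fun i => ht (hx i))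
  have e2 := extendMultilinear_tmul hR (φ n) (a := Cube.gen K d ∘ σ) (w := x ∘ σ) (α := d ∘ σ)
    (ω := d ∘ σ) (fun i => Cube.gen_mem K d (σ i)) (fun i => ht (hx (σ i)))
  have e3 : extSign (d ∘ σ) (d ∘ σ) = extSign d d := by
    have := extSign_perm d d σ
    rw [koszulSign_eq_one (by simp), one_mul, mul_comm] at this
    calc _ = extSign (d ∘ σ) (d ∘ σ) * (koszulSign d σ.symm * koszulSign d σ.symm) := by
          rw [koszulSign_mul_self, mul_one]
      _ = _ := by rw [← mul_assoc, this, mul_assoc, koszulSign_mul_self, mul_one]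
  have e4 : extSign d d • (Cube.topCoeff K d (oprod (Cube.gen K d ∘ σ)) • φ n (x ∘ σ)) =
      extSign d d • (Cube.topCoeff K d (oprod (Cube.gen K d)) • φ n x) := by
    have := congrArg (TensorProduct.lid K Y ∘ (Cube.topCoeff K d).rTensor Y) (e2.symm.trans
      ((show _ = _ from e).trans e1))
    simpa only [Function.comp_apply, map_zsmul, LinearMap.rTensor_tmul, TensorProduct.lid_tmul, e3]
      using this
  rw [hR.oprod_perm (fun i => Cube.gen_mem K d i), map_zsmul, Cube.topCoeff_oprod_gen, one_smul] at e4
  have e5 := congrArg (fun v => extSign d d • v) e4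
  simp only [smul_smul, extSign_mul_self, one_smul] at e5
  rw [← e5, smul_assoc, one_smul]

/-- Graded symmetry of a composition: on formal arguments of degree `0` a permutation of the arguments
only permutes the partitions. -/
theorem isGradedSymm_comp {t : X →ₗ[K] X} {t' : Y →ₗ[K] Y} (ht : IsParity 𝒳 t)
    (ht' : IsParity 𝒴 t') (ψ : Components K Y Z) {φ : Components K X Y}
    (hφ : HasDegree 𝒳 𝒴 0 φ) (hφs : IsGradedSymm 𝒳 φ) : IsGradedSymm 𝒳 (comp t ψ φ) := by
  refine isGradedSymm_of_cube ht fun n₀ d m x hx σ => ?_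
  have hR := Cube.isGradedComm K d
  have hs := (hφs.extend hR ht).isSymmOn
  have hφ' := fun m d x hx => by simpa using hφ m d x hx
  rw [extend, extendMultilinear_comp hR ht ht' ψ hφ' (x := x ∘ σ) fun i => hx (σ i),
    extendMultilinear_comp hR ht ht' ψ hφ' hx]
  refine Finset.sum_congr rfl fun k _ => congrArg _ ?_
  refine Fintype.sum_equiv (σ.arrowCongr (Equiv.refl _)) _ _ fun b => ?_
  rw [koszulSign_eq_one (by simp), koszulSign_eq_one (by simp), one_smul, one_smul]
  congr 1
  funext c
  exact hs.subfamily hx σ fun i => by simp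

theorem isGradedSymm_insert {t : X →ₗ[K] X} (ht : IsParity 𝒳 t) {ψ : Components K X Z}
    {φ : Components K X X} (hψs : IsGradedSymm 𝒳 ψ) (hφ : HasDegree 𝒳 𝒳 (-1) φ)
    (hφs : IsGradedSymm 𝒳 φ) : IsGradedSymm 𝒳 (insertion t ψ φ) := by
  refine isGradedSymm_of_cube ht fun n₀ d m x hx σ => ?_
  have hR := Cube.isGradedComm K d
  have hs := (hφs.extend hR ht).isSymmOn
  have hmem : ∀ {p : ℤ} {y : Cube K d ⊗[K] Z}, y ∈ tensorGrading (Cube.grading K d) (fun _ => ⊤) p →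
    (Cube.parity K d).rTensor Z ((Cube.parity K d).rTensor Z y) = y := rTensor_parity_sq hR
  have hext : ∀ x : Fin m → Cube K d ⊗[K] X,
      (∀ i, x i ∈ tensorGrading (Cube.grading K d) 𝒳 0) →
      extend (Cube.parity K d) t (insertion t ψ φ) m x ∈
        tensorGrading (Cube.grading K d) (fun _ => (⊤ : Submodule K Z)) (∑ _ : Fin m, 0 + 0) :=
    fun x hx => extendMultilinear_mem hR ht (fun _ _ _ => Submodule.mem_top) hx
  rw [← hmem (hext (x ∘ σ) fun i => hx (σ i)), ← hmem (hext x hx)]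
  congr 1
  rw [extend, extendMultilinear_insert hR ht hR.parity_odd ψ hφ (x := x ∘ σ) fun i => hx (σ i),
    extendMultilinear_insert hR ht hR.parity_odd ψ hφ hx]
  refine Fintype.sum_equiv (Equiv.finsetCongr σ) _ _ fun S => ?_
  rw [koszulSign_eq_one (by simp), koszulSign_eq_one (by simp), one_smul, one_smul]
  have h1 := hs.subfamily hx σ (S := S) (S' := Equiv.finsetCongr σ S) fun i => by simp
  have hu : (Cube.parity K d).rTensor X (extend (Cube.parity K d) t φ _
      (subfamily x (Equiv.finsetCongr σ S))) ∈ tensorGrading (Cube.grading K d) 𝒳 _ :=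
    rTensor_parity_mem hR (hφ.extend hR ht _ (fun _ => 0) _ fun i => hx _)
  have h2 := ((hψs.extend hR ht).curryLeft hu).isSymmOn.subfamily hx σ (S := Sᶜ)
    (S' := (Equiv.finsetCongr σ S)ᶜ) fun i => by simp
  rw [← h1] at h2
  simp only [MultilinearMap.curryLeft_apply] at h2
  rw [← h1]
  exact h2

/-- A graded symmetric operation is determined by the top coefficient of its exponential series on
formal arguments of degree `0`. -/
theorem eq_zero_of_expSum {t : X →ₗ[K] X} (ht : IsParity 𝒳 t) {φ : Components K X Y}
    (hφ : IsGradedSymm 𝒳 φ) {n : ℕ} {d : Fin n → ℤ} {x : Fin n → X} (hx : ∀ i, x i ∈ 𝒳 (d i))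
    (h : ∀ y ∈ tensorGrading (Cube.grading K (Fin.cons (-1) d : Fin (n + 1) → ℤ)) 𝒳 0,
      y ∈ tensorFil (Cube.fil K (Fin.cons (-1) d : Fin (n + 1) → ℤ) 1) X →
      (LinearMap.mulLeft K (Cube.gen K (Fin.cons (-1) d : Fin (n + 1) → ℤ) 0)).rTensor Y
        ((Cube.parity K (Fin.cons (-1) d : Fin (n + 1) → ℤ)).rTensor Y
          (expSum (n + 1) (extend (Cube.parity K _) t φ) y)) = 0) : φ n x = 0 := by
  classical
  set D : Fin (n + 1) → ℤ := Fin.cons (-1) d with hD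
  have hR := Cube.isGradedComm K D
  have hP := Cube.isFiltration (K := K) D
  -- The generator `0` of degree `-1` is the odd scalar; the others carry the arguments `x i`.
  set z : Fin n → Cube K D ⊗[K] X := fun i => Cube.gen K D i.succ ⊗ₜ[K] x i with hz
  have hzd : ∀ i, z i ∈ tensorGrading (Cube.grading K D) 𝒳 0 := fun i =>
    gen_tmul_mem D i.succ (by simpa [hD] using hx i)
  have hzf : ∀ i, z i ∈ tensorFil (Cube.fil K D 1) X := fun i =>
    tmul_mem_tensorFil (Cube.gen_mem_fil K D _) _
  -- The functional `H` reads off the coefficient of the product of all generators.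
  set H : Cube K D ⊗[K] Y →ₗ[K] Y := (TensorProduct.lid K Y).toLinearMap ∘ₗ
    (Cube.topCoeff K D).rTensor Y ∘ₗ (LinearMap.mulLeft K (Cube.gen K D 0)).rTensor Y ∘ₗ
      (Cube.parity K D).rTensor Y with hH
  have hHz : ∀ {m : ℕ} (c : Fin m → Fin n), H (extend (Cube.parity K D) t φ m (z ∘ c)) =
      extSign (d ∘ c) (d ∘ c) • sg (∑ i, d (c i)) • Cube.topCoeff K D
        (oprod fun p => Cube.gen K D ((Fin.cons 0 fun i => (c i).succ : Fin (m + 1) → Fin (n + 1)) p))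
        • φ m (x ∘ c) := by
    intro m c
    have hg : ∀ i, Cube.gen K D (c i).succ ∈ Cube.grading K D (d (c i)) := fun i => by
      simpa [hD] using Cube.gen_mem K D (c i).succ
    have e := extendMultilinear_tmul hR (φ m) (a := fun i => Cube.gen K D (c i).succ) (w := x ∘ c)
      (α := d ∘ c) (ω := d ∘ c) hg (fun i => ht (hx (c i)))
    change H (extendMultilinear _ _ _ _ _ fun i => Cube.gen K D (c i).succ ⊗ₜ[K] (x ∘ c) i) = _
    rw [e, map_zsmul, hH]
    simp only [LinearMap.comp_apply, LinearMap.rTensor_tmul, LinearEquiv.coe_coe,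
      hR.map_oprod (α := d ∘ c) hg, map_zsmul, TensorProduct.lid_tmul, LinearMap.mulLeft_apply]
    rw [oprod_succ]
    simp only [Fin.cons_zero, Fin.cons_succ, smul_assoc, Function.comp_apply]
  have h0 := h (∑ i, z i) (sum_mem fun i _ => hzd i) (sum_mem fun i _ => hzf i)
  have h1 : H (expSum (n + 1) (extend (Cube.parity K D) t φ) (∑ i, z i)) = 0 := by
    rw [hH, LinearMap.comp_apply, LinearMap.comp_apply, LinearMap.comp_apply, h0, map_zero, map_zero]
  have hsum : ∀ m, H (extend (Cube.parity K D) t φ m fun _ => ∑ i, z i) =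
      ∑ c : Fin m → Fin n, H (extend (Cube.parity K D) t φ m (z ∘ c)) := by
    intro m
    rw [MultilinearMap.map_sum, map_sum]
    rfl
  have hsurj : ∀ {m : ℕ} (c : Fin m → Fin n), ¬ Function.Surjective c →
      H (extend (Cube.parity K D) t φ m (z ∘ c)) = 0 := by
    intro m c hc
    rw [hHz, Cube.topCoeff_oprod_gen_of_not_surjective, zero_smul, smul_zero, smul_zero]
    intro h'
    refine hc fun i => ?_
    obtain ⟨p, hp⟩ := h' i.succ
    revert hp
    refine Fin.cases ?_ (fun p => ?_) p
    · intro hp; exact absurd hp.symm (Fin.succ_ne_zero i)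
    · intro hp; exact ⟨p, Fin.succ_injective _ hp⟩
  -- Only the term with `n` arguments contributes: each generator has to occur exactly once.
  rw [expSum, map_sum, Finset.sum_eq_single n] at h1
  · rw [map_smul, hsum, Finset.sum_congr rfl (g := fun c => if Function.Surjective c then
      H (extend (Cube.parity K D) t φ n z) else 0), ← Finset.sum_filter, Finset.sum_const,
      ← Nat.cast_smul_eq_nsmul K] at h1
    · rw [smul_eq_zero, smul_eq_zero] at h1
      rcases h1 with h1 | h1 | h1
      · exact absurd h1 (inv_ne_zero (Nat.cast_ne_zero.2 n.factorial_ne_zero))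
      · rw [Nat.cast_eq_zero, Finset.card_eq_zero] at h1
        have : (id : Fin n → Fin n) ∈ Finset.univ.filter
            fun c : Fin n → Fin n => Function.Surjective c :=
          Finset.mem_filter.2 ⟨Finset.mem_univ _, Function.surjective_id⟩
        rw [h1] at this
        simp at this
      · have e := hHz (id : Fin n → Fin n)
        rw [Function.comp_id, h1] at e
        have e1 : (Fin.cons 0 fun i => (id i : Fin n).succ : Fin (n + 1) → Fin (n + 1)) = id := by
          funext p
          refine Fin.cases rfl (fun p => rfl) p
        rw [e1] at e
        simp only [id] at e
        rw [Cube.topCoeff_oprod_gen, one_smul] at e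
        have e2 := congrArg (fun v => sg (∑ i, d i) • extSign (d ∘ id) (d ∘ id) • v) e
        simp only [smul_smul, smul_zero] at e2
        rw [← mul_assoc (extSign _ _), extSign_mul_self, one_mul, sg_mul_self, one_smul] at e2
        exact e2.symm
    · intro c _
      split_ifs with hc
      · have hb : Function.Bijective c := (Finite.injective_iff_surjective.2 hc).bijective_of_finite
        exact congrArg H ((hφ.extend hR ht).isSymmOn n z hzd (Equiv.ofBijective c hb))
      · exact hsurj c hc
  · intro m hm hmn
    rw [map_smul, hsum, Finset.sum_eq_zero, smul_zero]
    intro c _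
    by_cases hc : Function.Surjective c
    · have hc' := Fintype.card_le_of_surjective c hc
      rw [Fintype.card_fin, Fintype.card_fin] at hc'
      have e1 : extend (Cube.parity K D) t φ m (z ∘ c) ∈ tensorFil (Cube.fil K D m) Y := by
        have := extend_mem_tensorFil hP (t := t) φ (m := fun _ : Fin m => 1) (x := z ∘ c)
          fun i => hzf (c i)
        rwa [Finset.sum_const, Finset.card_univ, Fintype.card_fin, smul_eq_mul, mul_one] at this
      have e2 := hP.eq_zero_of_mem (m := 1 + m) (by omega)
        (tensorFil_map (f := LinearMap.mulLeft K (Cube.gen K D 0))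
          (fun a ha => hP.mul_mem (Cube.gen_mem_fil K D 0) ha)
          (tensorFil_map (fun a ha => hP.parity_mem ha) e1))
      rw [hH, LinearMap.comp_apply, LinearMap.comp_apply, LinearMap.comp_apply, e2, map_zero,
        map_zero]
    · exact hsurj c hc
  · intro hn
    simp at hn

/-- The flow of `θ` consists of morphisms of `L∞` algebras. -/
theorem IsFlow.compat {T : Type v} [AddCommGroup T] [Module K T] {𝒯 : ℤ → Submodule K T}
    {t : T →ₗ[K] T} {ℓ ℓ' θ f : K → Components K T T} (hf : IsFlow 𝒯 t ℓ ℓ' θ f)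
    (ht : IsParity 𝒯 t) (z : K) {n : ℕ} {d : Fin n → ℤ} {x : Fin n → T}
    (hx : ∀ i, x i ∈ 𝒯 (d i)) :
    insertion t (f z) (ℓ 0) n x = comp t (ℓ z) (f z) n x := by
  have h1 := isGradedSymm_comp ht ht (ℓ z) (hf.degree z) (hf.symm z)
  have h2 := isGradedSymm_insert ht (hf.symm z) (hf.isLInfty 0).degree (hf.isLInfty 0).gradedSymm
  have h3 : IsGradedSymm 𝒯 fun n => comp t (ℓ z) (f z) n -
      insertion t (f z) (ℓ 0) n := fun n d x hx σ => by
    rw [sub_apply, sub_apply, smul_sub, ← h1 n d x hx σ,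
      ← h2 n d x hx σ]
  have h4 := eq_zero_of_expSum ht h3 hx fun y hy hy' => by
    have e := hf.expSum_eq ht (Cube.isGradedComm K _) (Cube.isFiltration _) (Nat.le_add_left 1 n)
      (e := Cube.gen K (Fin.cons (-1) d : Fin (n + 1) → ℤ) 0) (Cube.gen_mem K _ 0)
      (Cube.fil_anti (Nat.zero_le 1) (Cube.gen_mem_fil K _ 0)) hy hy' z
    rw [← sub_eq_zero, ← map_sub, ← map_sub] at e
    rw [← e]
    simp only [expSum, ← Finset.sum_sub_distrib, ← smul_sub, extend, map_sub, sub_apply]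
  rw [sub_apply, sub_eq_zero] at h4
  exact h4.symm

end Reduction

/-! ### Contraction with an element and twisting -/

section Contract

variable {K : Type u} [Field K] {X : Type v} [AddCommGroup X] [Module K X]
  {Y : Type w} [AddCommGroup Y] [Module K Y] {𝒳 : ℤ → Submodule K X} {𝒴 : ℤ → Submodule K Y}

theorem apply_subfamily_eq (φ : Components K X Y) {n m : ℕ} (x : Fin n → X) {S : Finset (Fin n)}
    (h : S.card = m) {g : Fin m → Fin n} (hg : StrictMono g) (hS : ∀ i, g i ∈ S) :
    φ S.card (subfamily x S) = φ m (x ∘ g) := by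
  subst h
  rw [Finset.orderEmbOfFin_unique rfl hS hg]
  rfl

theorem strictMono_cons_zero {m n : ℕ} {g : Fin m → Fin n} (hg : StrictMono g) :
    StrictMono (Fin.cons 0 fun i => (g i).succ : Fin (m + 1) → Fin (n + 1)) := by
  intro i j
  refine Fin.cases ?_ (fun i => ?_) i <;> refine Fin.cases ?_ (fun j => ?_) j
  · intro h; exact absurd h (lt_irrefl _)
  · intro _; exact Fin.succ_pos _
  · intro h; exact absurd h (Fin.not_lt_zero _)
  · intro h; exact Fin.succ_lt_succ_iff.2 (hg (Fin.succ_lt_succ_iff.1 h))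

theorem sum_finset_succ {M : Type*} [AddCommMonoid M] {n : ℕ} (F : Finset (Fin (n + 1)) → M) :
    ∑ S, F S = ∑ S : Finset (Fin n), F (S.map (Fin.succEmb n)) +
      ∑ S : Finset (Fin n), F (insert 0 (S.map (Fin.succEmb n))) := by
  classical
  have h0 : (0 : Fin (n + 1)) ∉ Finset.univ.map (Fin.succEmb n) := by simp
  have h1 : ∀ G : Finset (Fin (n + 1)) → M, ∑ S ∈ (Finset.univ.map (Fin.succEmb n)).powerset, G S =
      ∑ S : Finset (Fin n), G (S.map (Fin.succEmb n)) := by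
    intro G
    symm
    refine Finset.sum_bij (fun S _ => S.map (Fin.succEmb n)) (fun S _ => ?_) (fun S _ S' _ h => ?_)
      (fun S hS => ?_) fun S _ => rfl
    · exact Finset.mem_powerset.2 (Finset.map_subset_map.2 (Finset.subset_univ S))
    · exact Finset.map_injective _ h
    · obtain ⟨S', _, h⟩ := Finset.subset_map_iff.1 (Finset.mem_powerset.1 hS)
      exact ⟨S', Finset.mem_univ _, h.symm⟩
  rw [← Finset.powerset_univ, ← h1 F, ← h1 fun S => F (insert 0 S), ← Finset.sum_powerset_insert h0]
  congr 2
  ext i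
  refine Fin.cases (by simp) (fun i => by simp) i

/-- The insertion of `v` as first argument. -/
def contract (v : X) (φ : Components K X Y) : Components K X Y := fun n => (φ (n + 1)).curryLeft v

theorem contract_apply (v : X) (φ : Components K X Y) {n : ℕ} (x : Fin n → X) :
    contract v φ n x = φ (n + 1) (Fin.cons v x) := rfl

theorem IsGradedSymm.contract {φ : Components K X Y} (h : IsGradedSymm 𝒳 φ) {p : ℤ} {v : X}
    (hv : v ∈ 𝒳 p) : IsGradedSymm 𝒳 (contract v φ) := h.curryLeft hv

theorem cons_mem_grading {p : ℤ} {v : X} (hv : v ∈ 𝒳 p) {n : ℕ} {d : Fin n → ℤ} {x : Fin n → X}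
    (hx : ∀ i, x i ∈ 𝒳 (d i)) (i : Fin (n + 1)) :
    (Fin.cons v x : Fin (n + 1) → X) i ∈ 𝒳 ((Fin.cons p d : Fin (n + 1) → ℤ) i) :=
  Fin.cases hv hx i

theorem HasDegree.contract {p q : ℤ} {φ : Components K X Y} (h : HasDegree 𝒳 𝒴 p φ) {v : X}
    (hv : v ∈ 𝒳 q) : HasDegree 𝒳 𝒴 (p + q) (contract v φ) := by
  intro n d x hx
  have := h (n + 1) _ _ (cons_mem_grading hv hx)
  rw [Fin.sum_univ_succ] at this
  simp only [Fin.cons_zero, Fin.cons_succ] at this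
  rw [contract_apply]
  convert this using 2
  ring

theorem IsGradedSymm.swap {φ : Components K X Y} (h : IsGradedSymm 𝒳 φ) {p q : ℤ} {u v : X}
    (hu : u ∈ 𝒳 p) (hv : v ∈ 𝒳 q) {n : ℕ} {d : Fin n → ℤ} {x : Fin n → X}
    (hx : ∀ i, x i ∈ 𝒳 (d i)) :
    φ (n + 2) (Fin.cons u (Fin.cons v x)) = sg (p * q) • φ (n + 2) (Fin.cons v (Fin.cons u x)) := by
  have h01 : ∀ i : Fin n, Equiv.swap (0 : Fin (n + 2)) 1 i.succ.succ = i.succ.succ := fun i =>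
    Equiv.swap_apply_of_ne_of_ne (Fin.succ_ne_zero _) (fun h => Fin.succ_ne_zero i
      (Fin.succ_injective _ h))
  have h1 : Equiv.swap (0 : Fin (n + 2)) 1 (Fin.succ 0) = 0 := Equiv.swap_apply_right 0 1
  have e := h (n + 2) _ _ (cons_mem_grading hu (cons_mem_grading hv hx)) (Equiv.swap 0 1)
  have e1 : koszulSign (Fin.cons p (Fin.cons q d) : Fin (n + 2) → ℤ) (Equiv.swap 0 1).symm =
      sg (p * q) := by
    rw [Equiv.symm_swap, koszulSign_succ, koszulSign_succ]
    simp only [Fin.prod_univ_succ, h01, h1, Equiv.swap_apply_left, Fin.not_lt_zero, if_false,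
      Finset.prod_const_one, Fin.cons_succ, Fin.cons_zero, one_mul]
    rw [koszulSign_eq_one, mul_one, if_pos Fin.zero_lt_one, Finset.prod_eq_one, mul_one]
    · intro i _
      rw [if_neg]
      rw [Fin.lt_def, not_lt]
      simp
    · intro i j hij hji
      exact absurd hij (not_lt_of_gt (Fin.succ_lt_succ_iff.1 (Fin.succ_lt_succ_iff.1 hji)))
  rw [e, e1]
  congr 2
  funext i
  rw [Function.comp_apply]
  refine Fin.cases ?_ (fun i => Fin.cases ?_ (fun i => ?_) i) i
  · rw [Equiv.swap_apply_left]; rfl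
  · rw [h1]; rfl
  · rw [h01]; rfl

variable [CharZero K]

/-- Contraction is a derivation with respect to insertion: `v` is an argument either of the inner or
of the outer operation. -/
theorem contract_insert {t : X →ₗ[K] X} (ht : IsParity 𝒳 t) {φ : Components K X Y}
    {ψ : Components K X X} (hφ : IsGradedSymm 𝒳 φ) (hψ : HasDegree 𝒳 𝒳 (-1) ψ) {p : ℤ} {v : X}
    (hv : v ∈ 𝒳 p) {n : ℕ} {d : Fin n → ℤ} {x : Fin n → X} (hx : ∀ i, x i ∈ 𝒳 (d i)) :
    contract v (insertion t φ ψ) n x =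
      insertion t φ (contract v ψ) n x + sg p • insertion t (contract v φ) ψ n x := by
  classical
  rw [contract_apply, insertion_apply ht _ _ (cons_mem_grading hv hx), insertion_apply ht _ _ hx,
    insertion_apply ht _ _ hx, sum_finset_succ, add_comm, Finset.smul_sum]
  congr 1
  · refine Finset.sum_congr rfl fun S _ => ?_
    have e1 := apply_subfamily_eq ψ (Fin.cons v x : Fin (n + 1) → X) (m := S.card + 1)
      (S := insert 0 (S.map (Fin.succEmb n))) (by rw [Finset.card_insert_of_notMem (by simp)]; simp)
      (g := Fin.cons 0 fun i => (S.orderEmbOfFin rfl i).succ)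
      (strictMono_cons_zero (S.orderEmbOfFin rfl).strictMono)
      (fun i => by refine Fin.cases ?_ (fun i => ?_) i <;> simp)
    have e1' : (Fin.cons v x : Fin (n + 1) → X) ∘ (Fin.cons 0 fun i => (S.orderEmbOfFin rfl i).succ :
        Fin (S.card + 1) → Fin (n + 1)) = Fin.cons v (subfamily x S) := by
      funext i; refine Fin.cases rfl (fun i => rfl) i
    rw [e1'] at e1
    rw [e1]
    have e2 := apply_subfamily_eq (contract (contract v ψ S.card (subfamily x S)) φ)
      (Fin.cons v x : Fin (n + 1) → X) (m := Sᶜ.card)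
      (S := (insert 0 (S.map (Fin.succEmb n)))ᶜ) (by
        rw [Finset.card_compl, Finset.card_insert_of_notMem (by simp), Finset.card_map,
          Finset.card_compl, Fintype.card_fin, Fintype.card_fin]
        omega)
      (g := fun i => (Sᶜ.orderEmbOfFin rfl i).succ)
      (fun i j h => Fin.succ_lt_succ_iff.2 ((Sᶜ.orderEmbOfFin rfl).strictMono h))
      (fun i => by
        have := Finset.mem_compl.1 (Finset.orderEmbOfFin_mem Sᶜ rfl i)
        simpa using this)
    refine congrArg₂ (· • ·) ?_ e2
    rw [koszulSign_succ]
    simp only [Fin.cons_succ, Fin.cons_zero]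
    rw [Finset.prod_eq_one, one_mul]
    · exact koszulSign_congr_label _ fun i j => by simp
    · intro j _
      rw [if_neg]
      simp
  · refine Finset.sum_congr rfl fun S _ => ?_
    have e1 := apply_subfamily_eq ψ (Fin.cons v x : Fin (n + 1) → X) (m := S.card)
      (S := S.map (Fin.succEmb n)) (by simp) (g := fun i => (S.orderEmbOfFin rfl i).succ)
      (fun i j h => Fin.succ_lt_succ_iff.2 ((S.orderEmbOfFin rfl).strictMono h))
      (fun i => by simp)
    have e1' : (Fin.cons v x : Fin (n + 1) → X) ∘ (fun i => (S.orderEmbOfFin rfl i).succ) =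
        subfamily x S := rfl
    rw [e1'] at e1
    rw [e1]
    have hu := hψ S.card (subfamily d S) (subfamily x S) fun i => hx _
    rw [sum_subfamily] at hu
    have e2 := apply_subfamily_eq (contract (ψ S.card (subfamily x S)) φ)
      (Fin.cons v x : Fin (n + 1) → X) (m := Sᶜ.card + 1)
      (S := (S.map (Fin.succEmb n))ᶜ) (by
        have := Finset.card_le_univ S
        rw [Fintype.card_fin] at this
        rw [Finset.card_compl, Finset.card_map,
          Finset.card_compl, Fintype.card_fin, Fintype.card_fin]
        omega)
      (g := Fin.cons 0 fun i => (Sᶜ.orderEmbOfFin rfl i).succ)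
      (strictMono_cons_zero (Sᶜ.orderEmbOfFin rfl).strictMono)
      (fun i => by
        refine Fin.cases ?_ (fun i => ?_) i
        · simp
        · have := Finset.mem_compl.1 (Finset.orderEmbOfFin_mem Sᶜ rfl i)
          simpa using this)
    have e2' : (Fin.cons v x : Fin (n + 1) → X) ∘ (Fin.cons 0 fun i =>
        (Sᶜ.orderEmbOfFin rfl i).succ : Fin (Sᶜ.card + 1) → Fin (n + 1)) =
        Fin.cons v (subfamily x Sᶜ) := by
      funext i; refine Fin.cases rfl (fun i => rfl) i
    rw [e2'] at e2
    simp only [contract_apply] at e2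
    rw [e2, hφ.swap hu hv (x := subfamily x Sᶜ) (d := subfamily d Sᶜ) (fun i => hx _), smul_smul,
      smul_smul, contract_apply]
    congr 1
    rw [koszulSign_succ]
    simp only [Fin.cons_succ, Fin.cons_zero]
    have e3 : koszulSign d (fun i : Fin n => if i.succ ∈ S.map (Fin.succEmb n) then 0 else 1) =
        koszulSign d (fun i => if i ∈ S then 0 else 1) :=
      koszulSign_congr_label _ fun i j => by simp
    have e4 : (∏ j : Fin n, if (if j.succ ∈ S.map (Fin.succEmb n) then 0 else 1) <
        (if (0 : Fin (n + 1)) ∈ S.map (Fin.succEmb n) then 0 else 1) then sg (p * d j) else 1) =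
        sg (p * ∑ i ∈ S, d i) := by
      rw [Finset.mul_sum, sg_sum, ← Finset.prod_subset (Finset.subset_univ S)]
      · refine Finset.prod_congr rfl fun j hj => ?_
        simp [hj]
      · intro j _ hj
        simp [hj]
    rw [e3, e4, mul_right_comm, ← sg_add, mul_comm]
    rw [mul_comm]
    congr 1
    exact sg_congr ⟨p * ∑ i ∈ S, d i - p, by ring⟩

theorem iterate_contract_gradedSymm {φ : Components K X Y} (h : IsGradedSymm 𝒳 φ) {v : X}
    (hv : v ∈ 𝒳 0) (i : ℕ) : IsGradedSymm 𝒳 ((contract v)^[i] φ) := by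
  induction i with
  | zero => exact h
  | succ i ih => rw [Function.iterate_succ_apply']; exact ih.contract hv

theorem iterate_contract_hasDegree {p : ℤ} {φ : Components K X Y} (h : HasDegree 𝒳 𝒴 p φ) {v : X}
    (hv : v ∈ 𝒳 0) (i : ℕ) : HasDegree 𝒳 𝒴 p ((contract v)^[i] φ) := by
  induction i with
  | zero => exact h
  | succ i ih =>
    rw [Function.iterate_succ_apply']
    simpa using ih.contract hv

/-- The Leibniz rule for iterated contraction with an element of degree `0`. -/
theorem iterate_contract_insertion {t : X →ₗ[K] X} (ht : IsParity 𝒳 t) {φ : Components K X Y}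
    {ψ : Components K X X} (hφ : IsGradedSymm 𝒳 φ) (hψ : HasDegree 𝒳 𝒳 (-1) ψ) {v : X}
    (hv : v ∈ 𝒳 0) (m : ℕ) : ∀ {n : ℕ} {d : Fin n → ℤ} {x : Fin n → X} (_ : ∀ i, x i ∈ 𝒳 (d i)),
      (contract v)^[m] (insertion t φ ψ) n x = ∑ p ∈ Finset.HasAntidiagonal.antidiagonal m,
        m.choose p.1 • insertion t ((contract v)^[p.1] φ) ((contract v)^[p.2] ψ) n x := by
  induction m with
  | zero => intro n d x _; simp
  | succ m ih =>
    intro n d x hx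
    rw [Function.iterate_succ_apply', contract_apply, ih (cons_mem_grading hv hx),
      Finset.sum_antidiagonal_choose_succ_nsmul fun i j =>
        insertion t ((contract v)^[i] φ) ((contract v)^[j] ψ) n x, ← Finset.sum_add_distrib]
    refine Finset.sum_congr rfl fun p hp => ?_
    rw [← contract_apply, contract_insert ht (iterate_contract_gradedSymm hφ hv _)
      (iterate_contract_hasDegree hψ hv _) hv hx, sg_zero, one_smul, smul_add,
      Function.iterate_succ_apply', Function.iterate_succ_apply']
    congr 2
    rw [Finset.HasAntidiagonal.mem_antidiagonal] at hp
    rw [Nat.choose_symm_of_eq_add hp.symm]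

/-- The twisting of a family of operations by an element, truncated after `N` terms. -/
def twistBy (N : ℕ) (v : X) (φ : Components K X Y) : Components K X Y := fun n =>
  ∑ i ∈ Finset.range N, ((i.factorial : K))⁻¹ • (contract v)^[i] φ n

theorem twistBy_apply (N : ℕ) (v : X) (φ : Components K X Y) {n : ℕ} (x : Fin n → X) :
    twistBy N v φ n x = ∑ i ∈ Finset.range N, ((i.factorial : K))⁻¹ • (contract v)^[i] φ n x := by
  simp only [twistBy, sum_apply, smul_apply]

theorem apply_eq_of_cast (φ : Components K X Y) {m n : ℕ} (h : m = n) {y : Fin m → X}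
    {z : Fin n → X} (hyz : ∀ i, y i = z (Fin.cast h i)) : φ m y = φ n z := by
  subst h
  exact congrArg _ (funext hyz)

theorem iterate_contract_apply (v : X) (φ : Components K X Y) (i : ℕ) {n : ℕ} (x : Fin n → X) :
    (contract v)^[i] φ n x = φ (i + n) (Fin.append (fun _ => v) x) := by
  induction i generalizing n with
  | zero =>
    refine apply_eq_of_cast φ (Nat.zero_add n).symm fun p => ?_
    rw [← Fin.natAdd_zero, Fin.append_right]
  | succ i ih =>
    rw [Function.iterate_succ_apply', contract_apply, ih]
    refine apply_eq_of_cast φ (by omega) fun p => ?_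
    refine Fin.addCases (fun p => ?_) (fun p => ?_) p
    · have : Fin.cast (by omega) (Fin.castAdd (n + 1) p) = Fin.castAdd n p.castSucc :=
        Fin.ext rfl
      rw [Fin.append_left, this, Fin.append_left]
    · refine Fin.cases ?_ (fun p => ?_) p
      · have : Fin.cast (by omega) (Fin.natAdd i (0 : Fin (n + 1))) =
            Fin.castAdd n (Fin.last i) := Fin.ext rfl
        rw [Fin.append_right, this, Fin.append_left]
        rfl
      · have : Fin.cast (by omega) (Fin.natAdd i p.succ) = Fin.natAdd (i + 1) p :=
          Fin.ext (by simp; omega)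
        rw [Fin.append_right, this, Fin.append_right]
        rfl

/-- Twisting by a Maurer-Cartan element: the Jacobi identities of order `m` in `v` are the `m`-fold
contraction of those of `ℓ`, and the Maurer-Cartan equation removes the bracket without arguments. -/
theorem IsLInfty.twistBy {t : X →ₗ[K] X} (ht : IsParity 𝒳 t) {ℓ : Brackets K X}
    (hℓ : IsLInfty 𝒳 ℓ) {v : X} (hv : v ∈ 𝒳 0) {N : ℕ}
    (hN : ∀ i, N ≤ i → ∀ (n : ℕ) (x : Fin n → X), (contract v)^[i] ℓ n x = 0)
    (hMC : ∑ i ∈ Finset.range N, ((i.factorial : K))⁻¹ • ℓ i (fun _ => v) = 0) :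
    IsLInfty 𝒳 (twistBy N v ℓ) where
  zero x := by
    rw [twistBy_apply, ← hMC]
    refine Finset.sum_congr rfl fun i _ => ?_
    rw [iterate_contract_apply]
    congr 1
    refine apply_eq_of_cast ℓ (Nat.add_zero i) fun p => ?_
    refine Fin.addCases (fun p => ?_) (fun p => p.elim0) p
    rw [Fin.append_left]
  degree n d x hx := by
    rw [twistBy_apply]
    exact sum_mem fun i _ => Submodule.smul_mem _ _
      (iterate_contract_hasDegree hℓ.degree hv i n d x hx)
  symm n d x hx σ := by
    rw [twistBy_apply, twistBy_apply, Finset.smul_sum]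
    refine Finset.sum_congr rfl fun i _ => ?_
    rw [iterate_contract_gradedSymm hℓ.gradedSymm hv i n d x hx σ, smul_comm]
  jacobi n d x hx := by
    -- The terms of the double sum are grouped by the total number of contractions.
    have h1 : ∀ S : Finset (Fin n), MCTwist.twistBy N v ℓ (Sᶜ.card + 1)
        (Fin.cons (MCTwist.twistBy N v ℓ S.card (subfamily x S)) (subfamily x Sᶜ)) =
        ∑ p ∈ Finset.range N ×ˢ Finset.range N, (((p.1.factorial : K))⁻¹ * ((p.2.factorial : K))⁻¹) •
          (contract v)^[p.1] ℓ (Sᶜ.card + 1) (Fin.cons ((contract v)^[p.2] ℓ S.card (subfamily x S))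
            (subfamily x Sᶜ)) := by
      intro S
      rw [twistBy_apply, Finset.sum_product]
      refine Finset.sum_congr rfl fun i _ => ?_
      rw [twistBy_apply, ← MultilinearMap.curryLeft_apply, map_sum, sum_apply, Finset.smul_sum]
      refine Finset.sum_congr rfl fun j _ => ?_
      rw [map_smul, smul_apply, smul_smul, MultilinearMap.curryLeft_apply]
    simp only [h1, Finset.smul_sum]
    rw [Finset.sum_comm]
    have h2 : ∀ p : ℕ × ℕ, ∑ S : Finset (Fin n), koszulSign d (fun i => if i ∈ S then 0 else 1) •
        (((p.1.factorial : K))⁻¹ * ((p.2.factorial : K))⁻¹) •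
          (contract v)^[p.1] ℓ (Sᶜ.card + 1) (Fin.cons ((contract v)^[p.2] ℓ S.card (subfamily x S))
            (subfamily x Sᶜ)) = (((p.1.factorial : K))⁻¹ * ((p.2.factorial : K))⁻¹) •
        insertion t ((contract v)^[p.1] ℓ) ((contract v)^[p.2] ℓ) n x := by
      intro p
      rw [insertion_apply ht _ _ hx, Finset.smul_sum]
      exact Finset.sum_congr rfl fun S _ => smul_comm _ _ _
    rw [Finset.sum_congr rfl fun p _ => h2 p,
      ← Finset.sum_fiberwise_of_maps_to (t := Finset.range (2 * N)) (g := fun p => p.1 + p.2)]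
    · refine Finset.sum_eq_zero fun m _ => ?_
      rw [Finset.sum_subset (s₂ := Finset.HasAntidiagonal.antidiagonal m)]
      · have h3 := iterate_contract_insertion ht hℓ.gradedSymm hℓ.degree hv m hx
        have h4 : ∀ (m : ℕ) {n : ℕ} {d : Fin n → ℤ} {x : Fin n → X} (_ : ∀ i, x i ∈ 𝒳 (d i)),
            (contract v)^[m] (insertion t ℓ ℓ) n x = 0 := by
          intro m
          induction m with
          | zero =>
            intro n d x hx
            rw [Function.iterate_zero, id, insertion_apply ht _ _ hx, hℓ.jacobi n d x hx]
          | succ m ih =>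
            intro n d x hx
            rw [Function.iterate_succ_apply', contract_apply]
            exact ih (cons_mem_grading hv hx)
        rw [h4 m hx] at h3
        have h5 := congrArg (fun y => ((m.factorial : K))⁻¹ • y) h3
        simp only [smul_zero, Finset.smul_sum] at h5
        rw [h5]
        refine Finset.sum_congr rfl fun p hp => ?_
        rw [Finset.HasAntidiagonal.mem_antidiagonal] at hp
        subst hp
        rw [← Nat.cast_smul_eq_nsmul K, smul_smul, Nat.cast_add_choose]
        congr 1
        have : ((p.1 + p.2).factorial : K) ≠ 0 := Nat.cast_ne_zero.2 (Nat.factorial_ne_zero _)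
        field_simp
      · intro p hp
        rw [Finset.HasAntidiagonal.mem_antidiagonal]
        exact (Finset.mem_filter.1 hp).2
      · intro p hp hp'
        rw [Finset.HasAntidiagonal.mem_antidiagonal] at hp
        have h6 : N ≤ p.1 ∨ N ≤ p.2 := by
          by_contra! h
          exact hp' (by simp [h.1, h.2, hp])
        rw [insertion_apply ht _ _ hx, Finset.sum_eq_zero, smul_zero]
        intro S _
        rcases h6 with h6 | h6
        · rw [hN _ h6, smul_zero]
        · rw [hN _ h6, MultilinearMap.map_coord_zero _ 0 (Fin.cons_zero _ _), smul_zero]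
    · intro p hp
      simp at hp ⊢
      omega

/-- The derivative of the iterated contraction with a varying element of degree `0`. -/
theorem hasPolyDeriv_iterate_contract {φ : Components K X Y} (hφ : IsGradedSymm 𝒳 φ) {ξ ξ' : K → X}
    (hξ : HasPolyDeriv ξ ξ') (h0 : ∀ z, ξ z ∈ 𝒳 0) (h0' : ∀ z, ξ' z ∈ 𝒳 0) (i : ℕ) :
    ∃ G : K → Components K X Y, (∀ n, HasPolyDeriv (fun z => (contract (ξ z))^[i] φ n)
      (fun z => G z n)) ∧ ∀ (z : K) (n : ℕ) (d : Fin n → ℤ) (x : Fin n → X),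
        (∀ i, x i ∈ 𝒳 (d i)) →
          G z n x = (i : K) • contract (ξ' z) ((contract (ξ z))^[i - 1] φ) n x := by
  induction i with
  | zero => exact ⟨fun _ _ => 0, fun n => HasPolyDeriv.const _, fun z n d x _ => by simp⟩
  | succ i ih =>
    obtain ⟨G, hG, hG'⟩ := ih
    refine ⟨fun z n => (G z (n + 1)).curryLeft (ξ z) +
      ((contract (ξ z))^[i] φ (n + 1)).curryLeft (ξ' z), fun n => ?_, fun z n d x hx => ?_⟩
    · simp only [Function.iterate_succ_apply']
      exact HasPolyDeriv.bilin
        (multilinearCurryLeftEquiv K (fun _ : Fin (n + 1) => X) Y).toLinearMap (hG (n + 1)) hξ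
    · rw [add_apply, MultilinearMap.curryLeft_apply, hG' z _ _ _ (cons_mem_grading (h0 z) hx),
        Nat.add_sub_cancel, Nat.cast_add, Nat.cast_one, add_smul, one_smul]
      congr 1
      rcases i with _ | i
      · simp
      · rw [Nat.add_sub_cancel, Function.iterate_succ_apply', contract_apply, contract_apply,
          contract_apply, (iterate_contract_gradedSymm hφ (h0 z) i).swap (h0' z) (h0 z) hx, mul_zero,
          sg_zero, one_smul]

/-- The family of operations `φ` without the operation that has no arguments. -/
def dropZero (φ : Components K X Y) : Components K X Y
  | 0 => 0
  | n + 1 => φ (n + 1)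

theorem insertion_dropZero {t : X →ₗ[K] X} (ht : IsParity 𝒳 t) (φ : Components K X Y)
    (ψ : Components K X X) {n : ℕ} {d : Fin n → ℤ} {x : Fin n → X} (hx : ∀ i, x i ∈ 𝒳 (d i)) :
    insertion t φ ψ n x =
      φ (n + 1) (Fin.cons (ψ 0 ![]) x) + insertion t φ (dropZero ψ) n x := by
  rw [← sub_eq_iff_eq_add, insertion_apply ht _ _ hx, insertion_apply ht _ _ hx,
    ← Finset.sum_sub_distrib, Finset.sum_eq_single ∅]
  · have e1 := apply_subfamily_eq (contract (ψ 0 ![]) φ) x (S := (∅ : Finset (Fin n))ᶜ) (m := n)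
      (by simp) (g := id) strictMono_id (fun i => by simp)
    have e2 : ψ (∅ : Finset (Fin n)).card (subfamily x ∅) = ψ 0 ![] :=
      congrArg (ψ 0) (Subsingleton.elim _ _)
    have e3 : dropZero ψ (∅ : Finset (Fin n)).card (subfamily x ∅) = 0 := rfl
    rw [e2, e3, MultilinearMap.map_coord_zero _ 0 (Fin.cons_zero _ _), smul_zero, sub_zero,
      koszulSign_eq_one (by simp), one_smul]
    exact e1
  · intro S _ hS
    have e : ∀ m, m ≠ 0 → dropZero ψ m = ψ m := by
      intro m hm
      obtain ⟨m, rfl⟩ := Nat.exists_eq_succ_of_ne_zero hm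
      rfl
    rw [e _ (by simpa using hS), sub_self]
  · intro h; exact absurd (Finset.mem_univ _) h

theorem insertion_dropZero_left {t : X →ₗ[K] X} (ht : IsParity 𝒳 t) (φ : Components K X Y)
    (ψ : Components K X X) {n : ℕ} {d : Fin n → ℤ} {x : Fin n → X} (hx : ∀ i, x i ∈ 𝒳 (d i)) :
    insertion t (dropZero φ) ψ n x = insertion t φ ψ n x := by
  rw [insertion_apply ht _ _ hx, insertion_apply ht _ _ hx]
  rfl

/-- The Jacobi identities with one argument `v` of degree `1` express the commutator of the brackets
with the contraction by `v`. The constant term `ℓ 1 v` of the contraction is split off, and becomes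
the direction in which the brackets change. -/
theorem IsLInfty.bracket_contract {t : X →ₗ[K] X} (ht : IsParity 𝒳 t) {ℓ : Brackets K X}
    (hℓ : IsLInfty 𝒳 ℓ) {v : X} (hv : v ∈ 𝒳 1) {n : ℕ} {d : Fin n → ℤ} {x : Fin n → X}
    (hx : ∀ i, x i ∈ 𝒳 (d i)) :
    ℓ (n + 1) (Fin.cons (ℓ 1 fun _ => v) x) + insertion t ℓ (dropZero (contract v ℓ)) n x =
      insertion t (dropZero (contract v ℓ)) ℓ n x := by
  have h := contract_insert ht hℓ.gradedSymm hℓ.degree hv hx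
  rw [contract_apply, insertion_apply ht _ _ (cons_mem_grading hv hx),
    hℓ.jacobi _ _ _ (cons_mem_grading hv hx), insertion_dropZero ht _ _ hx, sg_one, neg_one_smul,
    eq_comm, add_neg_eq_zero] at h
  rw [insertion_dropZero_left ht _ _ hx, ← h]
  congr 3
  rw [contract_apply]
  exact congrArg (ℓ 1) (funext fun i => by rw [Subsingleton.elim i 0]; rfl)

end Contract

/-! ### Existence of flows -/

section Existence

variable {K : Type u} [Field K] {X : Type v} [AddCommGroup X] [Module K X]
  {Y : Type w} [AddCommGroup Y] [Module K Y] {Z : Type x} [AddCommGroup Z] [Module K Z]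

theorem IsPolyFun.sum {ι : Type*} (S : Finset ι) {f : ι → K → X} (h : ∀ i ∈ S, IsPolyFun (f i)) :
    IsPolyFun fun z => ∑ i ∈ S, f i z := by
  classical
  choose! f' hf' using h
  exact (HasPolyDeriv.sum S hf').isPolyFun

theorem IsPolyFun.map (L : X →ₗ[K] Y) {f : K → X} (h : IsPolyFun f) : IsPolyFun fun z => L (f z) := by
  obtain ⟨_, h⟩ := h
  exact (h.map L).isPolyFun

theorem IsPolyFun.exists_sum {f : K → X} (h : IsPolyFun f) :
    ∃ (R : ℕ) (a : ℕ → X), ∀ z, f z = ∑ r ∈ Finset.range R, z ^ r • a r := by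
  obtain ⟨f', h⟩ := h
  refine h.induction (p := fun f _ => ∃ (R : ℕ) (a : ℕ → X), ∀ z, f z =
    ∑ r ∈ Finset.range R, z ^ r • a r) (fun r x => ?_) ⟨0, 0, by simp⟩
    (fun f f' g g' h1 h2 => ?_) (fun c f f' h1 => ?_)
  · refine ⟨r + 1, fun i => if i = r then x else 0, fun z => ?_⟩
    simp
  · obtain ⟨R, a, h1⟩ := h1
    obtain ⟨R', a', h2⟩ := h2
    have key : ∀ (R R' : ℕ) (a : ℕ → X) (z : K), R ≤ R' → ∑ r ∈ Finset.range R, z ^ r • a r =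
        ∑ r ∈ Finset.range R', z ^ r • if r < R then a r else 0 := by
      intro R R' a z hR
      rw [← Finset.sum_subset (Finset.range_mono hR)]
      · refine Finset.sum_congr rfl fun r hr => ?_
        rw [if_pos (Finset.mem_range.1 hr)]
      · intro r _ hr
        rw [if_neg (by simpa using hr), smul_zero]
    refine ⟨max R R', fun r => (if r < R then a r else 0) + (if r < R' then a' r else 0),
      fun z => ?_⟩
    simp only [smul_add, Finset.sum_add_distrib, Pi.add_apply]
    rw [h1, h2, key R _ a z (le_max_left R R'), key R' _ a' z (le_max_right R R')]
  · obtain ⟨R, a, h1⟩ := h1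
    refine ⟨R, fun r => c • a r, fun z => ?_⟩
    simp only [Pi.smul_apply, h1, Finset.smul_sum, smul_comm c]

theorem isPolyFun_blockComp {n k : ℕ} (b : Fin n → Fin k)
    {ψ : K → MultilinearMap K (fun _ : Fin k => Y) Z} {φ : K → Components K X Y}
    (hψ : IsPolyFun ψ) (hφ : ∀ m, IsPolyFun fun z => φ z m) :
    IsPolyFun fun z => blockComp b (ψ z) (φ z) := by
  obtain ⟨Q, ψ₀, hψ⟩ := hψ.exists_sum
  choose R a hφ using fun m => (hφ m).exists_sum
  have h : (fun z => blockComp b (ψ z) (φ z)) = fun z => ∑ q ∈ Finset.range Q,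
      ∑ ρ ∈ Fintype.piFinset (fun c => Finset.range (R (fiber b c).card)),
        z ^ (q + ∑ c, ρ c) • ((ψ₀ q).compMultilinearMap
          fun c => a (fiber b c).card (ρ c)).domDomCongr (fiberEquiv b) := by
    funext z
    ext x
    rw [blockComp_apply, hψ]
    simp only [sum_apply, smul_apply, hφ]
    refine Finset.sum_congr rfl fun q _ => ?_
    rw [MultilinearMap.map_sum_finset, Finset.smul_sum]
    refine Finset.sum_congr rfl fun ρ _ => ?_
    rw [MultilinearMap.map_smul_univ, smul_smul, pow_add, Finset.prod_pow_eq_pow_sum]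
    rfl
  rw [h]
  exact IsPolyFun.sum _ fun q _ => IsPolyFun.sum _ fun ρ _ => (HasPolyDeriv.mono _ _).isPolyFun

theorem isPolyFun_signTwist (t : X →ₗ[K] X) {n k : ℕ} (b : Fin n → Fin k)
    {M : K → MultilinearMap K (fun _ : Fin n => X) Z} (hM : IsPolyFun M) :
    IsPolyFun fun z => signTwist t b (M z) :=
  hM.map
    { toFun := signTwist t b
      map_add' := fun M M' => by
        ext x
        simp [signTwist, Finset.sum_add_distrib]
      map_smul' := fun c M => by
        ext x
        simp only [signTwist, sum_apply, smul_apply, MultilinearMap.compLinearMap_apply,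
          RingHom.id_apply, Finset.smul_sum]
        exact Finset.sum_congr rfl fun p _ => smul_comm _ _ _ }

theorem isPolyFun_comp (t : X →ₗ[K] X) {ψ : K → Components K Y Z} {φ : K → Components K X Y}
    (hψ : ∀ k, IsPolyFun fun z => ψ z k) (hφ : ∀ m, IsPolyFun fun z => φ z m) (n : ℕ) :
    IsPolyFun fun z => comp t (ψ z) (φ z) n := by
  refine IsPolyFun.sum _ fun k _ => ?_
  obtain ⟨_, h⟩ := IsPolyFun.sum Finset.univ fun (b : Fin n → Fin k) _ =>
    isPolyFun_signTwist t b (isPolyFun_blockComp b (hψ k) hφ)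
  exact (h.smul _).isPolyFun

/-- The arguments are exchanged one after the other. -/
theorem multilinear_sub_mem {k : ℕ} (M : MultilinearMap K (fun _ : Fin k => Y) Z)
    {P : Submodule K Y} {Q : Submodule K Z} (h : ∀ y i, y i ∈ P → M y ∈ Q) {a b : Fin k → Y}
    (hab : ∀ i, a i - b i ∈ P) : M a - M b ∈ Q := by
  classical
  have key : ∀ S : Finset (Fin k), M (S.piecewise a b) - M b ∈ Q := by
    intro S
    induction S using Finset.induction_on with
    | empty => simp
    | insert i S hi ih =>
      have e : M (S.piecewise a b) = M (Function.update (S.piecewise a b) i (b i)) := by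
        congr 1
        rw [eq_comm, Function.update_eq_self_iff, Finset.piecewise_eq_of_notMem _ _ _ hi]
      rw [Finset.piecewise_insert, ← sub_add_sub_cancel _ (M (S.piecewise a b))]
      refine add_mem ?_ ih
      rw [e, ← MultilinearMap.map_update_sub]
      exact h _ i (by rw [Function.update_self]; exact hab i)
  simpa using key Finset.univ

theorem signTwist_mem {t : X →ₗ[K] X} {n k : ℕ} (b : Fin n → Fin k)
    {M : MultilinearMap K (fun _ : Fin n => X) Z} {Q : Submodule K Z} (h : ∀ x, M x ∈ Q)
    (x : Fin n → X) : signTwist t b M x ∈ Q := by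
  rw [signTwist, sum_apply]
  exact sum_mem fun p _ => zsmul_mem (h _) _

theorem comp_mem {t : X →ₗ[K] X} {ψ : Components K Y Z} {Q : Submodule K Z}
    (h : ∀ k y, ψ k y ∈ Q) (φ : Components K X Y) {n : ℕ} (x : Fin n → X) :
    comp t ψ φ n x ∈ Q := by
  simp only [comp, sum_apply, smul_apply]
  exact sum_mem fun k _ => Q.smul_mem _ (sum_mem fun b _ => signTwist_mem b (M := blockComp b (ψ k) φ) (fun _ => h k _) x)

theorem comp_sub_mem {t : X →ₗ[K] X} {ψ : Components K Y Z} {P : Submodule K Y}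
    {Q : Submodule K Z} (h : ∀ k y i, y i ∈ P → ψ k y ∈ Q) {φ φ' : Components K X Y}
    (hφ : ∀ m x, φ m x - φ' m x ∈ P) {n : ℕ} (x : Fin n → X) :
    comp t ψ φ n x - comp t ψ φ' n x ∈ Q := by
  simp only [comp, sum_apply, smul_apply, ← Finset.sum_sub_distrib, ← smul_sub]
  refine sum_mem fun k _ => Q.smul_mem _ (sum_mem fun b _ => ?_)
  have e : signTwist t b (blockComp b (ψ k) φ) x - signTwist t b (blockComp b (ψ k) φ') x =
      signTwist t b (blockComp b (ψ k) φ - blockComp b (ψ k) φ') x := by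
    simp only [signTwist, sum_apply, smul_apply, MultilinearMap.compLinearMap_apply, sub_apply,
      smul_sub, Finset.sum_sub_distrib]
  rw [e]
  exact signTwist_mem b (fun x => multilinear_sub_mem (ψ k) (h k) fun c => hφ _ _) x

theorem map_comp (t : X →ₗ[K] X) {Y' Z' : Type*} [AddCommGroup Y'] [Module K Y'] [AddCommGroup Z']
    [Module K Z'] {ψ : Components K Y Z} {ψ' : Components K Y' Z'} {g : Y →ₗ[K] Y'} {h : Z →ₗ[K] Z'}
    (H : ∀ k y, h (ψ k y) = ψ' k (fun i => g (y i))) (φ : Components K X Y) {n : ℕ} (x : Fin n → X) :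
    h (comp t ψ φ n x) = comp t ψ' (fun m => g.compMultilinearMap (φ m)) n x := by
  simp only [comp, signTwist, sum_apply, smul_apply, map_sum, map_smul, map_zsmul,
    MultilinearMap.compLinearMap_apply, blockComp_apply, H]
  rfl

theorem comp_map {X' : Type*} [AddCommGroup X'] [Module K X'] {t : X →ₗ[K] X} {t' : X' →ₗ[K] X'}
    {g : X →ₗ[K] X'} (hg : ∀ x, g (t x) = t' (g x)) (ψ : Components K Y Z) (φ : Components K X' Y)
    {n : ℕ} (x : Fin n → X) :
    comp t' ψ φ n (fun i => g (x i)) = comp t ψ (fun m => (φ m).compLinearMap fun _ => g) n x := by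
  have h1 : ∀ (p : Bool) (x : X), (if p then oddPart t' else evenPart t') (g x) =
      g ((if p then oddPart t else evenPart t) x) := by
    intro p x
    cases p <;> simp [evenPart, oddPart, hg]
  simp only [comp, signTwist, sum_apply, smul_apply, MultilinearMap.compLinearMap_apply,
    blockComp_apply, h1]
  rfl

/-- The components of the identity. -/
abbrev idComp (K : Type u) [Field K] (T : Type v) [AddCommGroup T] [Module K T] :
    Components K T T := unaryBracket LinearMap.id

variable [CharZero K] {T : Type v} [AddCommGroup T] [Module K T] {t : T →ₗ[K] T}
  {𝓕 : ℕ → Submodule K T} {N : ℕ} {θ : K → Components K T T}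

/-- Existence of the flow of a vector field that raises a finite filtration, by Picard iteration.
The values of the flow stay in every family `𝒮` of subspaces that is compatible with the
equation. -/
theorem exists_flow (h0 : 𝓕 0 = ⊤) (hN : 𝓕 N = ⊥) (hθ : ∀ n, IsPolyFun fun z => θ z n)
    (hF : ∀ z k y i m, y i ∈ 𝓕 m → θ z k y ∈ 𝓕 (m + 1))
    {𝒮 : ∀ n, Submodule K (MultilinearMap K (fun _ : Fin n => T) T)}
    (hid : ∀ n, idComp K T n ∈ 𝒮 n)
    (hcomp : ∀ z φ, (∀ m, φ m ∈ 𝒮 m) → ∀ n, comp t (θ z) φ n ∈ 𝒮 n) :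
    ∃ f : K → Components K T T, (∀ n, HasPolyDeriv (fun z => f z n)
      (fun z => comp t (θ z) (f z) n)) ∧ (∀ z n, f z n ∈ 𝒮 n) ∧ f 0 = idComp K T := by
  -- The `r`-th Picard iterate solves the equation modulo the `r`-th step of the filtration.
  have key : ∀ r, ∃ u u' : K → Components K T T, (∀ n, HasPolyDeriv (fun z => u z n)
      (fun z => u' z n)) ∧ (∀ z n, u z n ∈ 𝒮 n) ∧ u 0 = idComp K T ∧
      ∀ z n x, u' z n x - comp t (θ z) (u z) n x ∈ 𝓕 r := by
    intro r
    induction r with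
    | zero =>
      exact ⟨fun _ => idComp K T, fun _ _ => 0, fun n => HasPolyDeriv.const _, fun z n => hid n, rfl,
        fun z n x => h0 ▸ Submodule.mem_top⟩
    | succ r ih =>
      obtain ⟨u, u', hu, huS, hu0, hur⟩ := ih
      choose w hw hw0 using fun n =>
        (isPolyFun_comp t hθ (fun m => (hu m).isPolyFun) n).exists_integral
      have hv : ∀ n, HasPolyDeriv (fun z => idComp K T n + w n z)
          (fun z => comp t (θ z) (u z) n) := fun n => by
        simpa using (HasPolyDeriv.const (K := K) (idComp K T n)).add (hw n)
      refine ⟨fun z n => idComp K T n + w n z, fun z n => comp t (θ z) (u z) n, hv,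
        fun z n => (hv n).mem_of_deriv_mem ?_ (fun z => hcomp z (u z) (huS z) n) z, ?_,
        fun z n x => ?_⟩
      · simpa [hw0] using hid n
      · funext n
        change idComp K T n + w n 0 = _
        rw [hw0, add_zero]
      · refine comp_sub_mem (P := 𝓕 r) (fun k y i hi => hF z k y i r hi) (fun m x => ?_) x
        have h1 := ((hu m).sub (hv m)).map (evalAt x)
        refine h1.mem_of_deriv_mem ?_ (fun z => hur z m x) z
        rw [hu0, hw0, add_zero, sub_self, map_zero]
        exact zero_mem _
  obtain ⟨u, u', hu, huS, hu0, hur⟩ := key N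
  refine ⟨u, fun n => ?_, huS, hu0⟩
  have : (fun z => comp t (θ z) (u z) n) = fun z => u' z n := by
    funext z
    ext x
    have := hur z n x
    rw [hN, Submodule.mem_bot, sub_eq_zero] at this
    exact this.symm
  rw [this]
  exact hu n

/-- A flow is the identity modulo the values of the vector field. -/
theorem flow_sub_mem {Q : Submodule K T} {f : K → Components K T T} (hQ : ∀ z k y, θ z k y ∈ Q)
    (hf : ∀ n, HasPolyDeriv (fun z => f z n) (fun z => comp t (θ z) (f z) n))
    (hf0 : f 0 = idComp K T) (z : K) {n : ℕ} (x : Fin n → T) :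
    f z n x - idComp K T n x ∈ Q := by
  have h := ((hf n).sub (HasPolyDeriv.const (idComp K T n))).map (evalAt x)
  refine h.mem_of_deriv_mem ?_ (fun z => ?_) z
  · rw [hf0, sub_self, map_zero]
    exact zero_mem _
  · rw [sub_zero]
    exact comp_mem (hQ z) (f z) x

/-- Flows of related vector fields are related, since the flow is determined modulo each step of the
filtration. -/
theorem flow_natural {T' : Type*} [AddCommGroup T'] [Module K T'] {t' : T' →ₗ[K] T'}
    {θ' : K → Components K T' T'} {𝓕 : ℕ → Submodule K T'} (h0 : 𝓕 0 = ⊤) (hN : 𝓕 N = ⊥)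
    (hF : ∀ z k y i m, y i ∈ 𝓕 m → θ' z k y ∈ 𝓕 (m + 1)) {g : T →ₗ[K] T'}
    (hg : ∀ x, g (t x) = t' (g x)) (hθ : ∀ z k y, g (θ z k y) = θ' z k (fun i => g (y i)))
    {f : K → Components K T T} {f' : K → Components K T' T'}
    (hf : ∀ n, HasPolyDeriv (fun z => f z n) (fun z => comp t (θ z) (f z) n))
    (hf' : ∀ n, HasPolyDeriv (fun z => f' z n) (fun z => comp t' (θ' z) (f' z) n))
    (hf0 : f 0 = idComp K T) (hf0' : f' 0 = idComp K T') (z : K) {n : ℕ} (x : Fin n → T) :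
    g (f z n x) = f' z n (fun i => g (x i)) := by
  have key : ∀ r z n (x : Fin n → T), g (f z n x) - f' z n (fun i => g (x i)) ∈ 𝓕 r := by
    intro r
    induction r with
    | zero => intro z n x; rw [h0]; exact Submodule.mem_top
    | succ r ih =>
      intro z n x
      have h := (((hf n).map (evalAt x)).map g).sub ((hf' n).map (evalAt fun i => g (x i)))
      refine h.mem_of_deriv_mem ?_ (fun z => ?_) z
      · rw [hf0, hf0']
        change g (idComp K T n x) - idComp K T' n (fun i => g (x i)) ∈ _
        by_cases hn : n = 1
        · subst hn
          rw [unaryBracket_one, unaryBracket_one, LinearMap.id_apply, LinearMap.id_apply, sub_self]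
          exact zero_mem _
        · rw [unaryBracket_of_ne _ hn, unaryBracket_of_ne _ hn, map_zero, sub_zero]
          exact zero_mem _
      · change g (comp t (θ z) (f z) n x) - comp t' (θ' z) (f' z) n (fun i => g (x i)) ∈ _
        rw [map_comp t (hθ z), comp_map hg]
        exact comp_sub_mem (P := 𝓕 r) (fun k y i hi => hF z k y i r hi) (fun m x => ih z m x) x
  have h := key N z n x
  rwa [hN, Submodule.mem_bot, sub_eq_zero] at h

variable {𝒯 : ℤ → Submodule K T}

/-- The linear component of a composition is the composition of the linear components. -/
theorem comp_one (ht : IsParity 𝒯 t) (ψ φ : Components K T T) {d : ℤ} {x : T} (hx : x ∈ 𝒯 d) :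
    comp t ψ φ 1 (fun _ => x) = ψ 1 (fun _ => φ 1 fun _ => x) := by
  rw [comp_apply ht ψ φ (d := fun _ => d) fun _ => hx, Finset.sum_range_succ, Finset.sum_range_one]
  have h1 : ∀ b : Fin 1 → Fin 1, (fun a => φ (fiber b a).card
      (subfamily (fun _ => x) (fiber b a))) = fun _ => φ 1 fun _ => x := by
    intro b
    funext a
    have h2 : fiber b a = Finset.univ := by
      ext i
      simp [fiber, Subsingleton.elim (b i) a]
    refine apply_subfamily_eq φ (fun _ => x) ?_ (g := id) strictMono_id fun i => by
      rw [h2]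
      exact Finset.mem_univ _
    rw [h2]
    simp
  simp only [h1]
  simp [koszulSign]

/-- The linear component of a flow is the identity on the associated graded space. -/
theorem flow_one_sub_mem (ht : IsParity 𝒯 t) (h0 : 𝓕 0 = ⊤) (hanti : Antitone 𝓕)
    (hF : ∀ z k y i m, y i ∈ 𝓕 m → θ z k y ∈ 𝓕 (m + 1))
    {f : K → Components K T T}
    (hf : ∀ n, HasPolyDeriv (fun z => f z n) (fun z => comp t (θ z) (f z) n))
    (hf0 : f 0 = idComp K T) {d : ℤ} {m : ℕ} {x : T} (hx : x ∈ 𝒯 d) (hxm : x ∈ 𝓕 m) (z : K) :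
    f z 1 (fun _ => x) - x ∈ 𝓕 (m + 1) := by
  have key : ∀ r, r ≤ m + 1 → ∀ z, f z 1 (fun _ => x) - x ∈ 𝓕 r := by
    intro r
    induction r with
    | zero => intro _ z; rw [h0]; exact Submodule.mem_top
    | succ r ih =>
      intro hr z
      have h := ((hf 1).map (evalAt fun _ => x)).sub (HasPolyDeriv.const x)
      refine h.mem_of_deriv_mem ?_ (fun z => ?_) z
      · rw [hf0]
        change x - x ∈ _
        rw [sub_self]
        exact zero_mem _
      · rw [sub_zero]
        change comp t (θ z) (f z) 1 (fun _ => x) ∈ _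
        rw [comp_one ht _ _ hx]
        refine hF z 1 _ 0 r ?_
        have h1 := add_mem (ih (by omega) z) (hanti (show r ≤ m by omega) hxm)
        rwa [sub_add_cancel] at h1
  exact key (m + 1) le_rfl z

/-- A linear map that is the identity on the associated graded space of a finite filtration is
bijective. -/
theorem bijOn_of_sub_mem {g : T →ₗ[K] T} {D : Submodule K T} (h0 : 𝓕 0 = ⊤) (hN : 𝓕 N = ⊥)
    (hD : ∀ x ∈ D, g x ∈ D) (h : ∀ m, ∀ x ∈ D, x ∈ 𝓕 m → g x - x ∈ 𝓕 (m + 1)) :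
    Set.BijOn g D D := by
  refine ⟨hD, fun x hx y hy hxy => ?_, fun y hy => ?_⟩
  · have hg : g (x - y) = 0 := by rw [map_sub, hxy, sub_self]
    have key : ∀ m, x - y ∈ 𝓕 m := by
      intro m
      induction m with
      | zero => rw [h0]; exact Submodule.mem_top
      | succ m ih =>
        have := h m _ (sub_mem hx hy) ih
        rw [hg, zero_sub] at this
        simpa using neg_mem this
    have := key N
    rwa [hN, Submodule.mem_bot, sub_eq_zero] at this
  · have key : ∀ r, ∃ x ∈ D, y - g x ∈ 𝓕 r := by
      intro r
      induction r with
      | zero => exact ⟨0, zero_mem _, by rw [h0]; exact Submodule.mem_top⟩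
      | succ r ih =>
        obtain ⟨x, hx, hxr⟩ := ih
        have he : y - g x ∈ D := sub_mem hy (hD x hx)
        refine ⟨x + (y - g x), add_mem hx he, ?_⟩
        have := neg_mem (h r _ he hxr)
        rw [map_add]
        convert this using 1
        abel
    obtain ⟨x, hx, hxr⟩ := key N
    rw [hN, Submodule.mem_bot, sub_eq_zero] at hxr
    exact ⟨x, hx, hxr.symm⟩

end Existence

/-! ### Linearity over the ring of scalars -/

section Scalars

variable {K : Type u} [Field K] [CharZero K] {T : Type v} [AddCommGroup T] [Module K T]
  {𝒯 : ℤ → Submodule K T} {t E : T →ₗ[K] T} {m : ℤ}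

/-- The operations with more than `k` arguments commute up to the sign `(-1) ^ q` with the operator
`E` applied to the first argument. -/
def IsSlotLinear (𝒯 : ℤ → Submodule K T) (E : T →ₗ[K] T) (q : ℤ) (k : ℕ) (φ : Components K T T) :
    Prop :=
  ∀ n, k ≤ n → ∀ (e : ℤ) (d : Fin n → ℤ) (y : T) (x : Fin n → T), y ∈ 𝒯 e → (∀ i, x i ∈ 𝒯 (d i)) →
    φ (n + 1) (Fin.cons (E y) x) = sg q • E (φ (n + 1) (Fin.cons y x))

theorem IsSlotLinear.contract {φ : Components K T T} {q : ℤ} {k k' : ℕ}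
    (h : IsSlotLinear 𝒯 E q k φ) (hφ : IsGradedSymm 𝒯 φ)
    (hE : ∀ d, ∀ y ∈ 𝒯 d, E y ∈ 𝒯 (d - m)) {p : ℤ} {v : T} (hv : v ∈ 𝒯 p) (hk : k ≤ k' + 1) :
    IsSlotLinear 𝒯 E (q + p * m) k' (contract v φ) := by
  intro n hn e d y x hy hx
  rw [contract_apply, contract_apply, hφ.swap hv (hE e y hy) hx, hφ.swap hv hy hx,
    h (n + 1) (by omega) e _ y _ hy (cons_mem_grading hv hx), map_zsmul, smul_smul, smul_smul,
    ← sg_add, ← sg_add]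
  congr 1
  exact sg_congr ⟨-p * m, by ring⟩

theorem IsSlotLinear.iterate_contract {φ : Components K T T} {q : ℤ} {k : ℕ}
    (h : IsSlotLinear 𝒯 E q k φ) (hφ : IsGradedSymm 𝒯 φ)
    (hE : ∀ d, ∀ y ∈ 𝒯 d, E y ∈ 𝒯 (d - m)) {v : T} (hv : v ∈ 𝒯 0) (i : ℕ) :
    IsSlotLinear 𝒯 E q k ((MCTwist.contract v)^[i] φ) := by
  induction i with
  | zero => exact h
  | succ i ih =>
    rw [Function.iterate_succ_apply']
    simpa using ih.contract (iterate_contract_gradedSymm hφ hv i) hE hv (Nat.le_succ k)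

theorem IsSlotLinear.twistBy {φ : Components K T T} {q : ℤ} {k : ℕ}
    (h : IsSlotLinear 𝒯 E q k φ) (hφ : IsGradedSymm 𝒯 φ)
    (hE : ∀ d, ∀ y ∈ 𝒯 d, E y ∈ 𝒯 (d - m)) {v : T} (hv : v ∈ 𝒯 0) (N : ℕ) :
    IsSlotLinear 𝒯 E q k (MCTwist.twistBy N v φ) := by
  intro n hn e d y x hy hx
  rw [twistBy_apply, twistBy_apply, map_sum, Finset.smul_sum]
  refine Finset.sum_congr rfl fun i _ => ?_
  rw [h.iterate_contract hφ hE hv i n hn e d y x hy hx, map_smul, smul_comm]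

/-- Linearity in an arbitrary argument: for operations of degree `0`, the operator `E` of degree
`-m` only passes the preceding arguments. -/
theorem IsSlotLinear.update {φ : Components K T T} (h : IsSlotLinear 𝒯 E 0 0 φ)
    (hφ : IsGradedSymm 𝒯 φ) (hE : ∀ d, ∀ y ∈ 𝒯 d, E y ∈ 𝒯 (d - m)) {k : ℕ} {D : Fin k → ℤ}
    {y : Fin k → T} (hy : ∀ i, y i ∈ 𝒯 (D i)) (r : Fin k) :
    φ k (Function.update y r (E (y r))) =
      sg (∑ c, if c < r then m * D c else 0) • E (φ k y) := by
  have hy' : ∀ i, Function.update y r (E (y r)) i ∈ 𝒯 (Function.update D r (D r - m) i) := by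
    intro i
    by_cases hi : i = r
    · subst hi
      rw [Function.update_self, Function.update_self]
      exact hE _ _ (hy i)
    · rw [Function.update_of_ne hi, Function.update_of_ne hi]
      exact hy i
  have e1 : Function.update y r (E (y r)) ∘ consCompl r =
      Fin.cons (E (y r)) (subfamily y ({r}ᶜ : Finset (Fin k))) := by
    rw [← cons_subfamily_compl, Function.update_self]
    congr 1
    funext p
    have := Finset.orderEmbOfFin_mem ({r}ᶜ : Finset (Fin k)) rfl p
    exact Function.update_of_ne (fun h0 => by
      rw [h0, Finset.mem_compl] at this
      exact this (Finset.mem_singleton_self r)) _ _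
  rw [hφ.equiv (consCompl r) hy', e1,
    h _ (Nat.zero_le _) (D r) (MCTwist.subfamily D ({r}ᶜ : Finset (Fin k))) (y r)
      (MCTwist.subfamily y ({r}ᶜ : Finset (Fin k))) (hy r) fun i => hy _,
    hφ.equiv (consCompl r) hy, ← cons_subfamily_compl, map_zsmul, smul_smul, smul_smul, sg_zero,
    mul_one, koszulSign_consCompl, koszulSign_consCompl, sg_sum, ← Finset.prod_mul_distrib]
  congr 1
  refine Finset.prod_congr rfl fun c _ => ?_
  split_ifs with hc
  · rw [Function.update_self, Function.update_of_ne hc.ne, ← sg_add]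
    exact sg_congr ⟨-m * D c, by ring⟩
  · simp

theorem IsSlotLinear.subfamily {φ : Components K T T} (h : IsSlotLinear 𝒯 E 0 0 φ) {n : ℕ}
    {e : ℤ} {d : Fin n → ℤ} {y : T} {x : Fin n → T} (hy : y ∈ 𝒯 e) (hx : ∀ i, x i ∈ 𝒯 (d i))
    {S : Finset (Fin (n + 1))} (hS : 0 ∈ S) :
    φ S.card (MCTwist.subfamily (Fin.cons (E y) x) S) =
      E (φ S.card (MCTwist.subfamily (Fin.cons y x) S)) := by
  obtain ⟨c, hc⟩ := Nat.exists_eq_succ_of_ne_zero (Finset.card_ne_zero_of_mem hS)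
  have hg0 : S.orderEmbOfFin hc 0 = 0 := by
    have := Finset.orderEmbOfFin_zero hc (Nat.succ_pos c)
    rw [show (0 : Fin (c + 1)) = ⟨0, Nat.succ_pos c⟩ from rfl, this]
    exact le_antisymm (Finset.min'_le _ _ hS) (Fin.zero_le _)
  have hg1 : ∀ i : Fin c, ∃ p : Fin n, S.orderEmbOfFin hc i.succ = p.succ := fun i =>
    ⟨_, (Fin.succ_pred _ (by
      rw [← hg0]
      exact fun h => Fin.succ_ne_zero i ((S.orderEmbOfFin hc).injective h))).symm⟩
  choose g hg using hg1
  have key : ∀ y : T, (Fin.cons y x : Fin (n + 1) → T) ∘ S.orderEmbOfFin hc =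
      Fin.cons y fun i => x (g i) := by
    intro y
    funext i
    refine Fin.cases ?_ (fun i => ?_) i
    · rw [Function.comp_apply, hg0]
      rfl
    · rw [Function.comp_apply, hg]
      rfl
  rw [apply_subfamily_eq φ _ hc (S.orderEmbOfFin hc).strictMono fun i => S.orderEmbOfFin_mem hc i,
    apply_subfamily_eq φ _ hc (S.orderEmbOfFin hc).strictMono fun i => S.orderEmbOfFin_mem hc i,
    key, key, h c (Nat.zero_le _) e (fun i => d (g i)) y _ hy fun i => hx _, sg_zero, one_smul]

/-- Composition along partitions preserves linearity: the block of the first argument is moved to the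
front and back. -/
theorem IsSlotLinear.comp (ht : IsParity 𝒯 t) {θ φ : Components K T T}
    (hθ : IsSlotLinear 𝒯 E 0 0 θ) (hθs : IsGradedSymm 𝒯 θ) (hφ : IsSlotLinear 𝒯 E 0 0 φ)
    (hφd : HasDegree 𝒯 𝒯 0 φ) (hE : ∀ d, ∀ y ∈ 𝒯 d, E y ∈ 𝒯 (d - m)) :
    IsSlotLinear 𝒯 E 0 0 (MCTwist.comp t θ φ) := by
  classical
  intro n _ e d y x hy hx
  have hyx := cons_mem_grading hy hx
  rw [sg_zero, one_smul, comp_apply ht _ _ (cons_mem_grading (hE e y hy) hx),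
    comp_apply ht _ _ hyx, map_sum]
  refine Finset.sum_congr rfl fun k _ => ?_
  rw [map_smul, map_sum]
  congr 1
  refine Finset.sum_congr rfl fun b _ => ?_
  set F : Fin k → T := fun a => φ (fiber b a).card (MCTwist.subfamily (Fin.cons y x) (fiber b a))
  have hF : ∀ a, F a ∈ 𝒯 (∑ i ∈ fiber b a, (Fin.cons e d : Fin (n + 1) → ℤ) i) := by
    intro a
    have := hφd (fiber b a).card (MCTwist.subfamily (Fin.cons e d) (fiber b a)) _ fun i => hyx _
    rwa [sum_subfamily, add_zero] at this
  have e1 : (fun a => φ (fiber b a).card (MCTwist.subfamily (Fin.cons (E y) x) (fiber b a))) =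
      Function.update F (b 0) (E (F (b 0))) := by
    funext a
    by_cases ha : a = b 0
    · subst ha
      rw [Function.update_self]
      exact hφ.subfamily hy hx (by simp [fiber])
    · rw [Function.update_of_ne ha]
      refine congrArg (φ _) (funext fun i => ?_)
      have h1 := Finset.orderEmbOfFin_mem (fiber b a) rfl i
      have h2 : (fiber b a).orderEmbOfFin rfl i ≠ 0 := by
        intro h0
        rw [h0] at h1
        exact ha (by simpa [fiber, eq_comm] using h1)
      obtain ⟨p, hp⟩ := Fin.exists_succ_eq_of_ne_zero h2
      simp only [MCTwist.subfamily, ← hp, Fin.cons_succ]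
  rw [e1, hθ.update hθs hE hF, map_zsmul, smul_smul, koszulSign_succ, koszulSign_succ]
  simp only [Fin.cons_zero, Fin.cons_succ]
  rw [mul_right_comm]
  congr 2
  have e2 : (∑ c, if c < b 0 then m * ∑ i ∈ fiber b c, (Fin.cons e d : Fin (n + 1) → ℤ) i else 0) =
      ∑ j : Fin n, if b j.succ < b 0 then m * d j else 0 := by
    have h1 : ∀ c, (if c < b 0 then m * ∑ i ∈ fiber b c, (Fin.cons e d : Fin (n + 1) → ℤ) i else 0) =
        ∑ i ∈ fiber b c, if b i < b 0 then m * (Fin.cons e d : Fin (n + 1) → ℤ) i else 0 := by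
      intro c
      split_ifs with hc
      · rw [Finset.mul_sum]
        refine Finset.sum_congr rfl fun i hi => ?_
        rw [if_pos]
        rwa [show b i = c by simpa [fiber] using hi]
      · rw [Finset.sum_eq_zero]
        intro i hi
        rw [if_neg]
        rwa [show b i = c by simpa [fiber] using hi]
    simp only [h1, fiber]
    rw [Finset.sum_fiberwise, Fin.sum_univ_succ]
    simp
  rw [e2, sg_sum, ← Finset.prod_mul_distrib]
  refine Finset.prod_congr rfl fun j _ => ?_
  split_ifs
  · rw [← sg_add]
    exact sg_congr ⟨0, by ring⟩
  · simp

end Scalars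

/-! ### Paths of Maurer-Cartan elements -/

section Paths

variable {K : Type u} [Field K] [CharZero K] {T : Type v} [AddCommGroup T] [Module K T]
  {𝒯 : ℤ → Submodule K T} {t E : T →ₗ[K] T} {𝓕 : ℕ → Submodule K T} {N : ℕ}
  {L : Components K T T}

/-- The operations with at least `k` arguments are multiplicative with respect to the filtration `𝓕`
and raise it by `q`. -/
def RaisesFil (𝓕 : ℕ → Submodule K T) (q k : ℕ) (φ : Components K T T) : Prop :=
  ∀ n, k ≤ n → ∀ (m : Fin n → ℕ) (x : Fin n → T), (∀ j, x j ∈ 𝓕 (m j)) → φ n x ∈ 𝓕 (q + ∑ j, m j)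

theorem RaisesFil.contract {φ : Components K T T} {q k k' : ℕ} (h : RaisesFil 𝓕 q k φ) {v : T}
    (hv : v ∈ 𝓕 1) (hk : k ≤ k' + 1) : RaisesFil 𝓕 (q + 1) k' (contract v φ) := by
  intro n hn m x hx
  have := h (n + 1) (by omega) (Fin.cons 1 m) (Fin.cons v x) fun j => Fin.cases hv hx j
  rw [Fin.sum_univ_succ] at this
  rw [contract_apply]
  simpa [add_assoc] using this

theorem RaisesFil.iterate_contract {φ : Components K T T} {q k : ℕ} (h : RaisesFil 𝓕 q k φ) {v : T}
    (hv : v ∈ 𝓕 1) (i : ℕ) : RaisesFil 𝓕 (q + i) (k - i) ((MCTwist.contract v)^[i] φ) := by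
  induction i with
  | zero => exact h
  | succ i ih =>
    rw [Function.iterate_succ_apply']
    exact ih.contract hv (by omega)

theorem RaisesFil.mem_of_mem {φ : Components K T T} {q k : ℕ} (h : RaisesFil 𝓕 q k φ)
    (h0 : 𝓕 0 = ⊤) {n : ℕ} (hn : k ≤ n) {x : Fin n → T} {i : Fin n} {m : ℕ} (hx : x i ∈ 𝓕 m) :
    φ n x ∈ 𝓕 (q + m) := by
  have := h n hn (Pi.single i m) x fun j => by
    by_cases hj : j = i
    · subst hj
      rwa [Pi.single_eq_same]
    · rw [Pi.single_eq_of_ne hj, h0]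
      exact Submodule.mem_top
  simpa using this

theorem RaisesFil.mem {φ : Components K T T} {q k : ℕ} (h : RaisesFil 𝓕 q k φ)
    (h0 : 𝓕 0 = ⊤) {n : ℕ} (hn : k ≤ n) (x : Fin n → T) : φ n x ∈ 𝓕 q := by
  have := h n hn (fun _ => 0) x fun j => by
    rw [h0]
    exact Submodule.mem_top
  simpa using this

/-- An `L∞` structure with a complete filtration of length `N`. The unary bracket is only assumed to
preserve the first step, as the differential of a filtered algebra need not preserve the others. -/
structure IsFilteredLInfty (𝒯 : ℤ → Submodule K T) (𝓕 : ℕ → Submodule K T) (N : ℕ)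
    (L : Brackets K T) : Prop where
  isLInfty : IsLInfty 𝒯 L
  anti : Antitone 𝓕
  fil_zero : 𝓕 0 = ⊤
  fil_last : 𝓕 N = ⊥
  raises : RaisesFil 𝓕 0 2 L
  unary_mem : ∀ x ∈ 𝓕 1, L 1 (fun _ => x) ∈ 𝓕 1

/-- The exceptional case is `L 1 v`, which the filtration axioms only place in the first step. -/
theorem IsFilteredLInfty.iterate_contract_mem (hL : IsFilteredLInfty 𝒯 𝓕 N L) {v : T}
    (hv : v ∈ 𝓕 1) (i : ℕ) {n : ℕ} (x : Fin n → T) : (contract v)^[i] L n x ∈ 𝓕 i := by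
  have h := (hL.raises.iterate_contract hv i)
  rw [zero_add] at h
  by_cases hi : 2 - i ≤ n
  · exact h.mem hL.fil_zero hi x
  · obtain rfl | ⟨rfl, rfl⟩ : i = 0 ∨ i = 1 ∧ n = 0 := by omega
    · rw [hL.fil_zero]
      exact Submodule.mem_top
    · have := hL.unary_mem v hv
      convert this using 1
      exact congrArg (L 1) (funext fun i => by rw [Subsingleton.elim (α := Fin 1) i 0]; rfl)

theorem IsFilteredLInfty.eq_zero_of_mem (hL : IsFilteredLInfty 𝒯 𝓕 N L) {i : ℕ} (hi : N ≤ i) {y : T}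
    (hy : y ∈ 𝓕 i) : y = 0 := by
  have := hL.anti hi hy
  rwa [hL.fil_last, Submodule.mem_bot] at this

theorem IsFilteredLInfty.iterate_contract_eq_zero (hL : IsFilteredLInfty 𝒯 𝓕 N L) {v : T}
    (hv : v ∈ 𝓕 1) {i : ℕ} (hi : N ≤ i) {n : ℕ} (x : Fin n → T) : (contract v)^[i] L n x = 0 :=
  hL.eq_zero_of_mem hi (hL.iterate_contract_mem hv i x)

theorem IsFilteredLInfty.contract_iterate_contract_eq_zero (hL : IsFilteredLInfty 𝒯 𝓕 N L)
    {u v : T} (hu : u ∈ 𝓕 1) (hv : v ∈ 𝓕 1) {i : ℕ} (hi : N ≤ i + 1) {n : ℕ} (x : Fin n → T) :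
    contract u ((contract v)^[i] L) n x = 0 := by
  rcases i with _ | i
  · exact hL.eq_zero_of_mem hi (hL.iterate_contract_mem hu 1 x)
  · have h := (hL.raises.iterate_contract hv (i + 1)).contract (k' := 0) hu (by omega)
    rw [zero_add] at h
    exact hL.eq_zero_of_mem hi (h.mem hL.fil_zero (Nat.zero_le _) x)

/-- The twisting series ends after `N` terms. -/
theorem IsFilteredLInfty.twistBy_eq (hL : IsFilteredLInfty 𝒯 𝓕 N L) {v : T} (hv : v ∈ 𝓕 1) {M : ℕ}
    (hM : N ≤ M) {n : ℕ} (x : Fin n → T) : twistBy M v L n x = twistBy N v L n x := by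
  rw [twistBy_apply, twistBy_apply]
  symm
  refine Finset.sum_subset (Finset.range_mono hM) fun i _ hi => ?_
  rw [hL.iterate_contract_eq_zero hv (by simpa using hi), smul_zero]

theorem IsFilteredLInfty.twistBy_mem (hL : IsFilteredLInfty 𝒯 𝓕 N L) {v : T} (hv : v ∈ 𝓕 1) (M : ℕ)
    {n : ℕ} (hn : n ≠ 0) {x : Fin n → T} (hx : ∀ i, x i ∈ 𝓕 1) : twistBy M v L n x ∈ 𝓕 1 := by
  rw [twistBy_apply]
  refine sum_mem fun i _ => Submodule.smul_mem _ _ ?_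
  have h := hL.raises.iterate_contract hv i
  by_cases hi : 2 - i ≤ n
  · refine hL.anti ?_ (h n hi (fun _ => 1) x hx)
    simp
    omega
  · obtain ⟨rfl, rfl⟩ : i = 0 ∧ n = 1 := by omega
    have := hL.unary_mem (x 0) (hx 0)
    convert this using 1
    exact congrArg (L 1) (funext fun i => by rw [Subsingleton.elim i 0])

theorem IsFilteredLInfty.twistBy (ht : IsParity 𝒯 t) (hL : IsFilteredLInfty 𝒯 𝓕 N L) {v : T}
    (hv : v ∈ 𝒯 0) (hv' : v ∈ 𝓕 1)
    (hMC : ∑ i ∈ Finset.range N, ((i.factorial : K))⁻¹ • L i (fun _ => v) = 0) :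
    IsLInfty 𝒯 (MCTwist.twistBy N v L) :=
  hL.isLInfty.twistBy ht hv (fun _ hi _ x => hL.iterate_contract_eq_zero hv' hi x) hMC

/-- A polynomial path of Maurer-Cartan elements `p z` that moves along the gauge vector field given by
`q z`: its derivative is the twisted differential of `q z`. The degree of
`q` is `1`, as it is the coefficient of a form of homological degree `-1`. -/
structure IsMCPath (𝒯 : ℤ → Submodule K T) (𝓕 : ℕ → Submodule K T) (N : ℕ) (L : Brackets K T)
    (p q : K → T) : Prop where
  mem : ∀ z, p z ∈ 𝒯 0
  mem_fil : ∀ z, p z ∈ 𝓕 1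
  maurerCartan : ∀ z, ∑ i ∈ Finset.range N, ((i.factorial : K))⁻¹ • L i (fun _ => p z) = 0
  gauge_mem : ∀ z, q z ∈ 𝒯 1
  gauge_mem_fil : ∀ z, q z ∈ 𝓕 1
  gauge_isPolyFun : IsPolyFun q
  deriv : HasPolyDeriv p fun z => twistBy N (p z) L 1 fun _ => q z

/-- The components of the vector field on the formal manifold `T` that generates the gauge
transformation: the brackets twisted by `p`, contracted with `q`. The constant term is dropped, as it
is the derivative of `p` and is accounted for by the change of the twisted brackets. -/
def gaugeField (N : ℕ) (L : Brackets K T) (p q : T) : Components K T T :=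
  dropZero (contract q (twistBy N p L))

theorem HasPolyDeriv.deriv_mem {f f' : K → T} (h : HasPolyDeriv f f') {Q : Submodule K T}
    (hf : ∀ z, f z ∈ Q) (z : K) : f' z ∈ Q := by
  have := (h.map Q.mkQ).deriv_unique (HasPolyDeriv.const 0) (fun z => by simpa using hf z) z
  simpa using this

theorem hasDegree_dropZero {φ : Components K T T} {p : ℤ} (h : HasDegree 𝒯 𝒯 p φ) :
    HasDegree 𝒯 𝒯 p (dropZero φ)
  | 0, _, _, _ => zero_mem _
  | n + 1, d, x, hx => h (n + 1) d x hx

theorem isGradedSymm_dropZero {φ : Components K T T} (h : IsGradedSymm 𝒯 φ) :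
    IsGradedSymm 𝒯 (dropZero φ)
  | 0, _, _, _, _ => (smul_zero _).symm
  | n + 1, d, x, hx, σ => h (n + 1) d x hx σ

section

variable {p q : K → T}

theorem IsMCPath.isLInfty (h : IsMCPath 𝒯 𝓕 N L p q) (ht : IsParity 𝒯 t)
    (hL : IsFilteredLInfty 𝒯 𝓕 N L) (z : K) : IsLInfty 𝒯 (twistBy N (p z) L) :=
  hL.twistBy ht (h.mem z) (h.mem_fil z) (h.maurerCartan z)

theorem IsMCPath.gaugeField_hasDegree (h : IsMCPath 𝒯 𝓕 N L p q) (ht : IsParity 𝒯 t)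
    (hL : IsFilteredLInfty 𝒯 𝓕 N L) (z : K) : HasDegree 𝒯 𝒯 0 (gaugeField N L (p z) (q z)) :=
  hasDegree_dropZero (HasDegree.contract (p := -1) (h.isLInfty ht hL z).degree (h.gauge_mem z))

theorem IsMCPath.gaugeField_symm (h : IsMCPath 𝒯 𝓕 N L p q) (ht : IsParity 𝒯 t)
    (hL : IsFilteredLInfty 𝒯 𝓕 N L) (z : K) : IsGradedSymm 𝒯 (gaugeField N L (p z) (q z)) :=
  isGradedSymm_dropZero ((h.isLInfty ht hL z).gradedSymm.contract (h.gauge_mem z))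

theorem gaugeField_mem (hL : IsFilteredLInfty 𝒯 𝓕 N L) {p q : T} (hp : p ∈ 𝓕 1) (hq : q ∈ 𝓕 1)
    {k : ℕ} (y : Fin k → T) (i : Fin k) (m : ℕ) (hy : y i ∈ 𝓕 m) :
    gaugeField N L p q k y ∈ 𝓕 (m + 1) := by
  rcases k with _ | k
  · exact i.elim0
  change twistBy N p L (k + 2) (Fin.cons q y) ∈ _
  rw [twistBy_apply]
  refine sum_mem fun j _ => Submodule.smul_mem _ _ ?_
  have h1 := (hL.raises.iterate_contract hp j).contract (k' := 1) hq (by omega)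
  refine hL.anti ?_ (h1.mem_of_mem hL.fil_zero (by omega) hy)
  omega

theorem gaugeField_mem_one (hL : IsFilteredLInfty 𝒯 𝓕 N L) {p q : T} (hp : p ∈ 𝓕 1) (hq : q ∈ 𝓕 1)
    {k : ℕ} (y : Fin k → T) : gaugeField N L p q k y ∈ 𝓕 1 := by
  rcases k with _ | k
  · exact zero_mem _
  · refine gaugeField_mem hL hp hq y 0 0 ?_
    rw [hL.fil_zero]
    exact Submodule.mem_top

/-- The derivative of the brackets twisted by `p` is the contraction with the derivative of `p`. -/
theorem IsMCPath.exists_deriv_bracket (h : IsMCPath 𝒯 𝓕 N L p q)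
    (hL : IsFilteredLInfty 𝒯 𝓕 N L) : ∃ ℓ' : K → Components K T T,
      (∀ n, HasPolyDeriv (fun z => twistBy N (p z) L n) fun z => ℓ' z n) ∧
      ∀ (z : K) (n : ℕ) (d : Fin n → ℤ) (x : Fin n → T), (∀ i, x i ∈ 𝒯 (d i)) →
        ℓ' z n x = twistBy N (p z) L (n + 1)
          (Fin.cons (twistBy N (p z) L 1 fun _ => q z) x) := by
  have hp' : ∀ z, (twistBy N (p z) L 1 fun _ => q z) ∈ 𝒯 0 := h.deriv.deriv_mem h.mem
  have hp'' : ∀ z, (twistBy N (p z) L 1 fun _ => q z) ∈ 𝓕 1 := h.deriv.deriv_mem h.mem_fil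
  choose G hG hG' using hasPolyDeriv_iterate_contract hL.isLInfty.gradedSymm h.deriv h.mem hp'
  refine ⟨fun z n => ∑ i ∈ Finset.range N, ((i.factorial : K))⁻¹ • G i z n, fun n =>
    HasPolyDeriv.sum _ fun i _ => (hG i n).smul _, fun z n d x hx => ?_⟩
  rw [sum_apply, twistBy_apply]
  simp only [smul_apply, hG' _ z n d x hx, smul_smul]
  rcases N with _ | N
  · simp
  -- Differentiation shifts the twisting series by one, so that its last term, which vanishes, has to
  -- be removed on the right.
  rw [Finset.sum_range_succ', Finset.sum_range_succ (fun i => ((i.factorial : K))⁻¹ •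
    (contract (p z))^[i] L (n + 1) _), Nat.cast_zero, mul_zero, zero_smul, add_zero,
    ← contract_apply,
    hL.contract_iterate_contract_eq_zero (hp'' z) (h.mem_fil z) le_rfl, smul_zero, add_zero]
  refine Finset.sum_congr rfl fun i _ => ?_
  rw [contract_apply, Nat.add_sub_cancel, Nat.factorial_succ, Nat.cast_mul, mul_inv, mul_right_comm,
    inv_mul_cancel₀ (Nat.cast_ne_zero.2 (Nat.succ_ne_zero i)), one_mul]

/-- The operator `E` behaves like multiplication by a scalar of cohomological degree `m`. The unary
bracket is exempt from linearity, because of the differential of the ring of scalars. -/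
structure IsScalar (𝒯 : ℤ → Submodule K T) (L : Brackets K T) (m : ℤ) (E : T →ₗ[K] T) : Prop where
  mem : ∀ d, ∀ y ∈ 𝒯 d, E y ∈ 𝒯 (d - m)
  bracket : IsSlotLinear 𝒯 E m 1 L

theorem IsMCPath.gaugeField_slotLinear (h : IsMCPath 𝒯 𝓕 N L p q) (ht : IsParity 𝒯 t)
    (hL : IsFilteredLInfty 𝒯 𝓕 N L) {m : ℤ} (hE : IsScalar 𝒯 L m E) (z : K) :
    IsSlotLinear 𝒯 E 0 0 (gaugeField N L (p z) (q z)) := by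
  have h1 := (hE.bracket.twistBy hL.isLInfty.gradedSymm hE.mem (h.mem z) N).contract
    (h.isLInfty ht hL z).gradedSymm hE.mem (h.gauge_mem z) (k' := 0) le_rfl
  intro n hn e d y x hy hx
  have := h1 n hn e d y x hy hx
  -- The scalar passes the brackets, of degree `-1`, and the element `q`, of degree `1`.
  rwa [sg_congr (n := 0) ⟨m, by ring⟩] at this

/-- The graded symmetric operations of degree `0`, with at least one argument, that are linear over
all scalars. They form a linear subspace, in which the Picard iteration takes place. -/
def goodOps (𝒯 : ℤ → Submodule K T) (L : Brackets K T) :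
    ∀ n, Submodule K (MultilinearMap K (fun _ : Fin n => T) T)
  | 0 => ⊥
  | n + 1 =>
    { carrier := {M | (∀ (d : Fin (n + 1) → ℤ) (x : Fin (n + 1) → T), (∀ i, x i ∈ 𝒯 (d i)) →
        M x ∈ 𝒯 (∑ i, d i + 0) ∧ (∀ σ : Equiv.Perm (Fin (n + 1)),
          M x = koszulSign d σ.symm • M (x ∘ σ))) ∧
        ∀ (m : ℤ) (E : T →ₗ[K] T), IsScalar 𝒯 L m E → ∀ (e : ℤ) (d : Fin n → ℤ) (y : T)
          (x : Fin n → T), y ∈ 𝒯 e → (∀ i, x i ∈ 𝒯 (d i)) →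
            M (Fin.cons (E y) x) = sg 0 • E (M (Fin.cons y x))}
      zero_mem' := ⟨fun d x _ => ⟨zero_mem _, fun σ => by simp⟩, fun m E _ e d y x _ _ => by simp⟩
      add_mem' := fun {M M'} h h' => ⟨fun d x hx => ⟨add_mem (h.1 d x hx).1 (h'.1 d x hx).1, fun σ => by
        rw [add_apply, add_apply, smul_add, ← (h.1 d x hx).2 σ, ← (h'.1 d x hx).2 σ]⟩,
        fun m E hE e d y x hy hx => by
          rw [add_apply, add_apply, map_add, smul_add, h.2 m E hE e d y x hy hx,
            h'.2 m E hE e d y x hy hx]⟩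
      smul_mem' := fun c M h => ⟨fun d x hx => ⟨Submodule.smul_mem _ c (h.1 d x hx).1, fun σ => by
        rw [smul_apply, smul_apply, (h.1 d x hx).2 σ, smul_comm]⟩,
        fun m E hE e d y x hy hx => by
          rw [smul_apply, smul_apply, map_smul, h.2 m E hE e d y x hy hx, smul_comm]⟩ }

theorem mem_goodOps {φ : Components K T T} (h0 : φ 0 = 0) (hd : HasDegree 𝒯 𝒯 0 φ)
    (hs : IsGradedSymm 𝒯 φ) (hE : ∀ m E, IsScalar 𝒯 L m E → IsSlotLinear 𝒯 E 0 0 φ) :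
    ∀ n, φ n ∈ goodOps 𝒯 L n
  | 0 => (Submodule.mem_bot K).2 h0
  | n + 1 => ⟨fun d x hx => ⟨hd (n + 1) d x hx, hs (n + 1) d x hx⟩,
      fun m E h => hE m E h n (Nat.zero_le n)⟩

theorem hasDegree_of_mem_goodOps {φ : Components K T T} (h : ∀ n, φ n ∈ goodOps 𝒯 L n) :
    HasDegree 𝒯 𝒯 0 φ
  | 0, d, x, hx => by
    rw [(Submodule.mem_bot K).1 (h 0)]
    exact zero_mem _
  | n + 1, d, x, hx => ((h (n + 1)).1 d x hx).1

theorem isGradedSymm_of_mem_goodOps {φ : Components K T T} (h : ∀ n, φ n ∈ goodOps 𝒯 L n) :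
    IsGradedSymm 𝒯 φ
  | 0, d, x, hx, σ => by
    rw [(Submodule.mem_bot K).1 (h 0)]
    exact (smul_zero _).symm
  | n + 1, d, x, hx, σ => ((h (n + 1)).1 d x hx).2 σ

theorem isSlotLinear_of_mem_goodOps {φ : Components K T T} (h : ∀ n, φ n ∈ goodOps 𝒯 L n) {m : ℤ}
    (hE : IsScalar 𝒯 L m E) : IsSlotLinear 𝒯 E 0 0 φ :=
  fun n _ => (h (n + 1)).2 m E hE

theorem idComp_mem_goodOps (n : ℕ) : idComp K T n ∈ goodOps 𝒯 L n := by
  refine mem_goodOps (φ := idComp K T) rfl (fun n d x hx => ?_) (fun n d x hx σ => ?_)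
    (fun m E hE n _ e d y x hy hx => ?_) n
  · by_cases hn : n = 1
    · subst hn
      rw [unaryBracket_one]
      simpa using hx 0
    · rw [unaryBracket_of_ne _ hn]
      exact zero_mem _
  · by_cases hn : n = 1
    · subst hn
      rw [Subsingleton.elim σ 1, koszulSign_eq_one (fun i j hij => absurd hij (by simp [Subsingleton.elim i j])), one_smul]
      rfl
    · rw [unaryBracket_of_ne _ hn, unaryBracket_of_ne _ hn, smul_zero]
  · by_cases hn : n = 0
    · subst hn
      rw [sg_zero, one_smul]
      rfl
    · rw [unaryBracket_of_ne _ (by omega), unaryBracket_of_ne _ (by omega), map_zero, smul_zero]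

theorem comp_zero (θ φ : Components K T T) (h : θ 0 = 0) : comp t θ φ 0 = 0 := by
  ext x
  simp only [comp, signTwist, sum_apply, smul_apply, zero_apply,
    MultilinearMap.compLinearMap_apply, blockComp_apply]
  simp [h]

/-- The gauge transformation along a path of Maurer-Cartan elements, the flow of the gauge vector
field, relates the brackets twisted by the elements of the path. -/
theorem IsMCPath.exists_flow (h : IsMCPath 𝒯 𝓕 N L p q) (ht : IsParity 𝒯 t)
    (hL : IsFilteredLInfty 𝒯 𝓕 N L) : ∃ (ℓ' f : K → Components K T T),
      IsFlow 𝒯 t (fun z => MCTwist.twistBy N (p z) L) ℓ' (fun z => gaugeField N L (p z) (q z)) f ∧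
      f 0 = idComp K T ∧ ∀ z m E, IsScalar 𝒯 L m E → IsSlotLinear 𝒯 E 0 0 (f z) := by
  obtain ⟨ℓ', hℓ', hℓ''⟩ := h.exists_deriv_bracket hL
  have hpoly : ∀ n, IsPolyFun fun z => gaugeField N L (p z) (q z) n := by
    rintro (_ | n)
    · exact (HasPolyDeriv.const 0).isPolyFun
    · obtain ⟨_, hq⟩ := h.gauge_isPolyFun
      exact (HasPolyDeriv.bilin (multilinearCurryLeftEquiv K (fun _ : Fin (n + 2) => T) T).toLinearMap
        (hℓ' (n + 2)) hq).isPolyFun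
  obtain ⟨f, hf, hS, hf0⟩ := MCTwist.exists_flow (t := t) hL.fil_zero hL.fil_last hpoly
    (fun z k y i m hy => gaugeField_mem hL (h.mem_fil z) (h.gauge_mem_fil z) y i m hy)
    (𝒮 := goodOps 𝒯 L) idComp_mem_goodOps fun z φ hφ => by
      have h1 := hasDegree_of_mem_goodOps hφ
      have h2 := h.gaugeField_symm ht hL z
      have h3 := isGradedSymm_of_mem_goodOps hφ
      refine mem_goodOps (comp_zero _ _ rfl) (fun n d x hx => ?_)
        (isGradedSymm_comp ht ht _ h1 h3)
        fun m E hE => (h.gaugeField_slotLinear ht hL hE z).comp ht h2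
          (isSlotLinear_of_mem_goodOps hφ hE) h1 hE.mem
      rw [comp_apply ht _ _ hx]
      refine sum_mem fun k _ => Submodule.smul_mem _ _ (sum_mem fun b _ => zsmul_mem ?_ _)
      have := h.gaugeField_hasDegree ht hL z k _ _ fun a =>
        h1 (fiber b a).card (subfamily d (fiber b a)) (subfamily x (fiber b a)) fun i => hx _
      simp only [sum_subfamily, add_zero] at this ⊢
      rwa [show ∑ a, ∑ i ∈ fiber b a, d i = ∑ i, d i from
        Finset.sum_fiberwise Finset.univ b d] at this
  refine ⟨ℓ', f, ?_, hf0, fun z m E hE => isSlotLinear_of_mem_goodOps (hS z) hE⟩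
  exact
    { isLInfty := h.isLInfty ht hL
      deriv_bracket := hℓ'
      bracket := fun z n d x hx => by
        rw [hℓ'' z n d x hx]
        exact (h.isLInfty ht hL z).bracket_contract ht (h.gauge_mem z) hx
      field_zero := fun z x => rfl
      field_degree := h.gaugeField_hasDegree ht hL
      field_symm := h.gaugeField_symm ht hL
      field_isPolyFun := hpoly
      zero := fun z x => by rw [(Submodule.mem_bot K).1 (hS z 0)]; rfl
      degree := fun z => hasDegree_of_mem_goodOps (hS z)
      symm := fun z => isGradedSymm_of_mem_goodOps (hS z)
      comp_symm := fun z => isGradedSymm_comp ht ht _ (hasDegree_of_mem_goodOps (hS z))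
        (isGradedSymm_of_mem_goodOps (hS z))
      deriv := hf
      initial_one := fun x => by rw [hf0]; rfl
      initial_of_ne := fun n hn => by
        rw [hf0]
        ext x
        exact unaryBracket_of_ne _ hn x }

end

end Paths

/-! ### Parity and filtration of an augmented cdga -/

section Levels

variable {K : Type u} [Field K] [CharZero K]

theorem signMap_apply {M : Type v} [AddCommGroup M] [Module K M] (𝒲 : ℤ → Submodule K M)
    [DirectSum.Decomposition 𝒲] (ε : ℤ → ℤˣ) {i : ℤ} {a : M} (ha : a ∈ 𝒲 i) :
    signMap 𝒲 ε a = (ε i : ℤ) • a := by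
  rw [signMap, LinearMap.comp_apply, LinearEquiv.coe_coe, DirectSum.decomposeLinearEquiv_apply,
    DirectSum.decompose_of_mem 𝒲 ha]
  exact DirectSum.toModule_lof K i _

variable {V : Type v} [AddCommGroup V] [Module K V]

theorem LInftyAlgebra.isParity (L : LInftyAlgebra K V) : IsParity (susp L.grading) L.parity := by
  intro i a ha
  rw [LInftyAlgebra.parity, signMap_apply L.grading _ ha, sub_add_cancel]
  rfl

theorem CDGA.isGradedComm (B : CDGA.{u, w} K) : IsGradedComm B.grading B.parity where
  one_mem := SetLike.GradedOne.one_mem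
  mul_mem ha hb := SetLike.GradedMul.mul_mem ha hb
  comm ha hb := B.graded_comm _ _ _ _ ha hb
  parity ha := signMap_apply B.grading _ ha

theorem CDGA.isDifferential (B : CDGA.{u, w} K) : IsDifferential B.grading B.d where
  mem ha := B.d_mem _ _ ha
  sq := B.d_d
  leibniz b ha := B.leibniz _ _ b ha

theorem CDGA.isParity (B : CDGA.{u, w} K) : IsParity B.grading B.parity :=
  fun _ _ ha => B.isGradedComm.parity ha

/-- Two linear maps that agree on homogeneous elements are equal. -/
theorem CDGA.linearMap_ext (B : CDGA.{u, w} K) {Y : Type*} [AddCommGroup Y] [Module K Y]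
    {f g : B.carrier →ₗ[K] Y} (h : ∀ i, ∀ a ∈ B.grading i, f a = g a) : f = g := by
  ext a
  induction a using DirectSum.Decomposition.inductionOn B.grading with
  | zero => simp
  | homogeneous a => exact h _ _ a.2
  | add a b h1 h2 => rw [map_add, map_add, h1, h2]

theorem CDGA.parity_one (B : CDGA.{u, w} K) : B.parity 1 = 1 := by
  simpa using B.isGradedComm.parity B.isGradedComm.one_mem

theorem CDGA.parity_mul (B : CDGA.{u, w} K) (a b : B.carrier) :
    B.parity (a * b) = B.parity a * B.parity b := by
  have h : B.parity ∘ₗ LinearMap.mulRight K b = LinearMap.mulRight K (B.parity b) ∘ₗ B.parity := by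
    refine B.linearMap_ext fun i a ha => ?_
    have h : B.parity ∘ₗ LinearMap.mulLeft K a = LinearMap.mulLeft K (B.parity a) ∘ₗ B.parity := by
      refine B.linearMap_ext fun j b hb => ?_
      simp only [LinearMap.comp_apply, LinearMap.mulLeft_apply, B.isGradedComm.parity hb,
        B.isGradedComm.parity ha, B.isGradedComm.parity (B.isGradedComm.mul_mem ha hb), sg_add,
        smul_mul_smul_comm]
    exact LinearMap.congr_fun h b
  exact LinearMap.congr_fun h a

/-- The parity involution is an automorphism of algebras. -/
def CDGA.parityHom (B : CDGA.{u, w} K) : B.carrier →ₐ[K] B.carrier :=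
  AlgHom.ofLinearMap B.parity B.parity_one B.parity_mul

theorem CDGA.parity_natural {B B' : CDGA.{u, w} K} (f : B.carrier →ₐ[K] B'.carrier)
    (hf : ∀ i, ∀ a ∈ B.grading i, f a ∈ B'.grading i) (a : B.carrier) :
    f (B.parity a) = B'.parity (f a) := by
  have h : f.toLinearMap ∘ₗ B.parity = B'.parity ∘ₗ f.toLinearMap := by
    refine B.linearMap_ext fun i a ha => ?_
    simp only [LinearMap.comp_apply, AlgHom.toLinearMap_apply, B.isGradedComm.parity ha,
      B'.isGradedComm.parity (hf i a ha), map_zsmul]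
  exact LinearMap.congr_fun h a

namespace FormalCDGA

variable (A : FormalCDGA.{u, w, x} K) (j : A.Index)

/-- The augmentation ideal `A_j`. -/
def augIdeal : Submodule K (A.level j).carrier := LinearMap.ker (A.aug j).toLinearMap

/-- The powers of the augmentation ideal; the factor `⊤` makes the zeroth one the whole algebra. -/
def augPow (m : ℕ) : Submodule K (A.level j).carrier := ⊤ * A.augIdeal j ^ m

variable {A j}

theorem mem_augIdeal {a : (A.level j).carrier} : a ∈ A.augIdeal j ↔ A.aug j a = 0 := Iff.rfl

theorem aug_parity (a : (A.level j).carrier) : A.aug j ((A.level j).parity a) = A.aug j a := by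
  have h : (A.aug j).toLinearMap ∘ₗ (A.level j).parity = (A.aug j).toLinearMap := by
    refine (A.level j).linearMap_ext fun i a ha => ?_
    rw [LinearMap.comp_apply, (A.level j).isGradedComm.parity ha]
    by_cases hi : i = 0
    · simp [hi]
    · have := A.aug_grading j i a hi ha
      simp [this]
  exact LinearMap.congr_fun h a

theorem top_mul_augIdeal_le : ⊤ * A.augIdeal j ≤ A.augIdeal j :=
  Submodule.mul_le.2 fun a _ b hb => by
    rw [mem_augIdeal] at hb ⊢
    rw [map_mul, hb, mul_zero]

theorem augIdeal_mul_top_le : A.augIdeal j * ⊤ ≤ A.augIdeal j :=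
  Submodule.mul_le.2 fun a ha b _ => by
    rw [mem_augIdeal] at ha ⊢
    rw [map_mul, ha, zero_mul]

theorem le_top_mul (P : Submodule K (A.level j).carrier) : P ≤ ⊤ * P := fun a ha => by
  simpa using Submodule.mul_mem_mul (Submodule.mem_top (x := (1 : (A.level j).carrier))) ha

theorem augPow_zero : A.augPow j 0 = ⊤ := by
  refine top_unique ?_
  rw [augPow, pow_zero, mul_one]

theorem augPow_one : A.augPow j 1 = A.augIdeal j := by
  rw [augPow, pow_one]
  exact le_antisymm top_mul_augIdeal_le (le_top_mul _)

theorem augIdeal_pow_mul_top_le (m : ℕ) : A.augIdeal j ^ m * ⊤ ≤ ⊤ * A.augIdeal j ^ m := by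
  induction m with
  | zero => rw [pow_zero, one_mul, mul_one]
  | succ m ih =>
    rw [pow_succ', mul_assoc, ← mul_assoc ⊤]
    refine (mul_le_mul' le_rfl ih).trans ?_
    rw [← mul_assoc]
    exact mul_le_mul' (augIdeal_mul_top_le.trans (le_top_mul _)) le_rfl

theorem augIdeal_pow_nilp : A.augIdeal j ^ A.nilp j = ⊥ := by
  rw [Submodule.pow_eq_span_pow_set, Submodule.span_eq_bot]
  intro a ha
  obtain ⟨f, rfl⟩ := Set.mem_pow.1 ha
  exact A.nilpotent j _ fun r => (f r).2

theorem augPow_nilp : A.augPow j (A.nilp j) = ⊥ := by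
  rw [augPow, augIdeal_pow_nilp, Submodule.mul_bot]

theorem augPow_anti : Antitone (A.augPow j) := antitone_nat_of_succ_le fun m => by
  rw [augPow, augPow, pow_succ', ← mul_assoc]
  exact mul_le_mul' le_top le_rfl

theorem isFiltration_augPow : IsFiltration (A.level j).parity (A.augPow j) (A.nilp j) where
  one_mem := by
    rw [augPow_zero]
    exact Submodule.mem_top
  mul_mem {p q a b} ha hb := by
    have h : A.augPow j p * A.augPow j q ≤ A.augPow j (p + q) := by
      calc A.augPow j p * A.augPow j q
          = ⊤ * ((A.augIdeal j ^ p * ⊤) * A.augIdeal j ^ q) := by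
            simp only [augPow, mul_assoc]
        _ ≤ ⊤ * ((⊤ * A.augIdeal j ^ p) * A.augIdeal j ^ q) :=
            mul_le_mul' le_rfl (mul_le_mul' (augIdeal_pow_mul_top_le p) le_rfl)
        _ = (⊤ * ⊤) * (A.augIdeal j ^ p * A.augIdeal j ^ q) := by simp only [mul_assoc]
        _ ≤ ⊤ * (A.augIdeal j ^ p * A.augIdeal j ^ q) := mul_le_mul' le_top le_rfl
        _ = A.augPow j (p + q) := by rw [augPow, pow_add]
    exact h (Submodule.mul_mem_mul ha hb)
  parity_mem {m a} ha := by
    have h1 : (A.augIdeal j).map (A.level j).parityHom.toLinearMap ≤ A.augIdeal j := by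
      rintro _ ⟨a, ha, rfl⟩
      rw [SetLike.mem_coe, mem_augIdeal] at ha
      exact (aug_parity a).trans ha
    have h : (A.augPow j m).map (A.level j).parityHom.toLinearMap ≤ A.augPow j m := by
      rw [augPow, Submodule.map_mul, Submodule.map_pow]
      exact mul_le_mul' le_top (pow_le_pow_left' h1 m)
    exact h ⟨a, ha, rfl⟩
  anti h := augPow_anti h
  eq_zero {m} hm {a} ha := by
    have := augPow_anti hm.le ha
    rwa [augPow_nilp, Submodule.mem_bot] at this

variable {W : Type v} [AddCommGroup W] [Module K W]

/-- The first step of the filtration is the kernel of the augmentation. -/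
theorem mem_tensorFil_one_iff {x : (A.level j).carrier ⊗[K] W} :
    x ∈ tensorFil (A.augPow j 1) W ↔ (A.aug j).toLinearMap.rTensor W x = 0 := by
  rw [augPow_one]
  constructor
  · intro hx
    induction hx using Submodule.span_induction with
    | mem x hx =>
      obtain ⟨a, ha, w, rfl⟩ := hx
      rw [mem_augIdeal] at ha
      rw [LinearMap.rTensor_tmul, AlgHom.toLinearMap_apply, ha, TensorProduct.zero_tmul]
    | zero => simp
    | add x y _ _ h1 h2 => rw [map_add, h1, h2, add_zero]
    | smul c x _ h => rw [map_smul, h, smul_zero]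
  · intro hx
    have h : ∀ x : (A.level j).carrier ⊗[K] W,
        x - (Algebra.linearMap K (A.level j).carrier).rTensor W
          ((A.aug j).toLinearMap.rTensor W x) ∈ tensorFil (A.augIdeal j) W := by
      intro x
      induction x using TensorProduct.induction_on with
      | zero => simp
      | tmul a w =>
        simp only [LinearMap.rTensor_tmul, ← TensorProduct.sub_tmul]
        refine tmul_mem_tensorFil ?_ w
        rw [mem_augIdeal]
        simp
      | add x y h1 h2 =>
        simp only [map_add]
        rw [add_sub_add_comm]
        exact add_mem h1 h2
    have := h x
    rwa [hx, map_zero, sub_zero] at this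

theorem extendBrackets_apply (B : CDGA.{u, w} K) (t : W →ₗ[K] W) (ℓ : Brackets K W) {n : ℕ}
    (x : Fin n → B.carrier ⊗[K] W) : extendBrackets B t ℓ n x =
      B.parity.rTensor W (extend B.parity t ℓ n x) + unaryBracket (B.d.rTensor W) n x := rfl

/-- Extension of scalars to a level of a formal cdga is filtered by the powers of the augmentation
ideal. -/
theorem isFilteredLInfty (A : FormalCDGA.{u, w, x} K) (j : A.Index) {𝒲 : ℤ → Submodule K W}
    {t : W →ₗ[K] W} (ht : IsParity 𝒲 t) {ℓ : Brackets K W} (hℓ : IsLInfty 𝒲 ℓ) :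
    IsFilteredLInfty (tensorGrading (A.level j).grading 𝒲) (fun m => tensorFil (A.augPow j m) W)
      (A.nilp j) (extendBrackets (A.level j) t ℓ) := by
  have hP := isFiltration_augPow (A := A) (j := j)
  have hodd : ∀ (n : ℕ) (m : Fin n → ℕ) (x : Fin n → (A.level j).carrier ⊗[K] W),
      (∀ i, x i ∈ tensorFil (A.augPow j (m i)) W) →
      (A.level j).parity.rTensor W (extend (A.level j).parity t ℓ n x) ∈
        tensorFil (A.augPow j (∑ i, m i)) W := fun n m x hx =>
    tensorFil_map (fun a ha => hP.parity_mem ha) (extend_mem_tensorFil hP ℓ hx)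
  refine ⟨hℓ.extBrackets (A.level j).isGradedComm (A.level j).isDifferential ht,
    fun m n h => tensorFil_mono (augPow_anti h), ?_, ?_, fun n hn m x hx => ?_, fun x hx => ?_⟩
  · refine top_unique fun x _ => ?_
    rw [augPow_zero]
    clear * -
    induction x using TensorProduct.induction_on with
    | zero => exact zero_mem _
    | tmul a w => exact tmul_mem_tensorFil Submodule.mem_top w
    | add x y h1 h2 => exact add_mem h1 h2
  · rw [augPow_nilp]
    refine bot_unique (Submodule.span_le.2 ?_)
    rintro _ ⟨a, ha, w, rfl⟩
    rw [(Submodule.mem_bot K).1 ha, TensorProduct.zero_tmul]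
    exact zero_mem _
  · rw [extendBrackets_apply, unaryBracket_of_ne _ (by omega), add_zero, zero_add]
    exact hodd n m x hx
  · rw [extendBrackets_apply, unaryBracket_one]
    refine add_mem (by simpa using hodd 1 (fun _ => 1) (fun _ => x) fun _ => hx) ?_
    rw [augPow_one] at hx ⊢
    refine tensorFil_map (fun a _ => ?_) hx
    rw [mem_augIdeal]
    exact A.aug_d j a

/-- Homogeneous elements of a level are scalars for the extended brackets. -/
theorem isScalar_smul (A : FormalCDGA.{u, w, x} K) (j : A.Index) (𝒲 : ℤ → Submodule K W)
    (t : W →ₗ[K] W) (ℓ : Brackets K W) {m : ℤ} {a : (A.level j).carrier}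
    (ha : a ∈ (A.level j).grading m) :
    IsScalar (tensorGrading (A.level j).grading 𝒲) (extendBrackets (A.level j) t ℓ) m
      ((LinearMap.mulLeft K a).rTensor W) where
  mem d y hy := by
    refine tensorGrading_linear_mem (fun α ω b w hb hw h => ?_) hy
    rw [LinearMap.rTensor_tmul]
    exact tmul_mem_tensorGrading ((A.level j).isGradedComm.mul_mem ha hb) hw (by omega)
  bracket := by
    intro n hn e d y x _ _
    rw [extendBrackets_apply, extendBrackets_apply, unaryBracket_of_ne _ (by omega),
      unaryBracket_of_ne _ (by omega), add_zero, add_zero, extend, mulLeft_extend]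
    have h : (A.level j).parity.rTensor W ∘ₗ (LinearMap.mulLeft K a).rTensor W =
        (sg m • (LinearMap.mulLeft K a).rTensor W) ∘ₗ (A.level j).parity.rTensor W := by
      refine TensorProduct.ext' fun b w => ?_
      simp only [LinearMap.comp_apply, LinearMap.rTensor_tmul, LinearMap.mulLeft_apply,
        LinearMap.smul_apply, (A.level j).parity_mul, (A.level j).isGradedComm.parity ha,
        smul_mul_assoc, TensorProduct.smul_tmul']
    exact LinearMap.congr_fun h _

theorem smul_eq_rTensor (a : (A.level j).carrier) (x : (A.level j).carrier ⊗[K] W) :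
    a • x = (LinearMap.mulLeft K a).rTensor W x := by
  induction x using TensorProduct.induction_on with
  | zero => simp
  | tmul b w => rfl
  | add x y h1 h2 => rw [smul_add, h1, h2, map_add]

theorem trans_extendBrackets {i : A.Index} (h : i ≤ j) (t : W →ₗ[K] W) (ℓ : Brackets K W) {n : ℕ}
    (x : Fin n → (A.level j).carrier ⊗[K] W) :
    (A.trans h).toLinearMap.rTensor W (extendBrackets (A.level j) t ℓ n x) =
      extendBrackets (A.level i) t ℓ n fun r => (A.trans h).toLinearMap.rTensor W (x r) := by
  have hs : ∀ a, A.trans h ((A.level j).parity a) = (A.level i).parity (A.trans h a) :=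
    CDGA.parity_natural (A.trans h) (A.trans_grading h)
  rw [extendBrackets_apply, extendBrackets_apply, map_add]
  congr 1
  · have e := extendMultilinear_natural (s := (A.level j).parity) (s' := (A.level i).parity) (t := t)
      (t' := t) (A.trans h) hs LinearMap.id (fun _ => rfl) (h := LinearMap.id) (φ := ℓ n)
      (φ' := ℓ n) (fun _ => rfl) x
    rw [extend, ← LinearMap.comp_apply, ← LinearMap.rTensor_comp]
    have h1 : (A.trans h).toLinearMap ∘ₗ (A.level j).parity =
        (A.level i).parity ∘ₗ (A.trans h).toLinearMap := LinearMap.ext hs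
    rw [h1, LinearMap.rTensor_comp, LinearMap.comp_apply]
    exact congrArg _ e
  · by_cases hn : n = 1
    · subst hn
      rw [unaryBracket_one, unaryBracket_one, ← LinearMap.comp_apply, ← LinearMap.comp_apply,
        ← LinearMap.rTensor_comp, ← LinearMap.rTensor_comp]
      congr 2
      exact LinearMap.ext (A.trans_d h)
    · rw [unaryBracket_of_ne _ hn, unaryBracket_of_ne _ hn, map_zero]

theorem trans_mem {i : A.Index} (h : i ≤ j) {𝒲 : ℤ → Submodule K W} {n : ℤ}
    {x : (A.level j).carrier ⊗[K] W} (hx : x ∈ tensorGrading (A.level j).grading 𝒲 n) :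
    (A.trans h).toLinearMap.rTensor W x ∈ tensorGrading (A.level i).grading 𝒲 n := by
  refine tensorGrading_linear_mem (fun α ω b w hb hw h' => ?_) hx
  exact tmul_mem_tensorGrading (A.trans_grading h α b hb) hw (by omega)

theorem trans_tensorParity {i : A.Index} (h : i ≤ j) (t : W →ₗ[K] W)
    (x : (A.level j).carrier ⊗[K] W) :
    (A.trans h).toLinearMap.rTensor W (TensorProduct.map (A.level j).parity t x) =
      TensorProduct.map (A.level i).parity t ((A.trans h).toLinearMap.rTensor W x) := by
  induction x using TensorProduct.induction_on with
  | zero => simp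
  | tmul b w =>
    simp only [TensorProduct.map_tmul, LinearMap.rTensor_tmul, AlgHom.toLinearMap_apply]
    rw [CDGA.parity_natural (A.trans h) (A.trans_grading h)]
  | add x y h1 h2 => simp only [map_add, h1, h2]

end FormalCDGA

end Levels

/-! ### Forms on the interval as polynomial families -/

section Interval

variable {K : Type u} [Field K] [CharZero K] {V : Type v} [AddCommGroup V] [Module K V]

theorem HasPolyDeriv.eval_smul (p : Polynomial K) (v : V) : HasPolyDeriv (fun z => p.eval z • v)
    (fun z => p.derivative.eval z • v) := by
  induction p using Polynomial.induction_on' with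
  | add p q h1 h2 => simpa [add_smul] using h1.add h2
  | monomial n a =>
    have h := HasPolyDeriv.mono (K := K) n (a • v)
    simpa [Polynomial.derivative_monomial, smul_smul, mul_comm, mul_assoc, mul_left_comm] using h

/-- The value of a form at `z = c`, `dz = 0`. -/
def valueForms (c : K) : (interval K).carrier →ₗ[K] K := evalForms K c

/-- The coefficient of `dz` at `z = c`. -/
def coeffForms (c : K) : (interval K).carrier →ₗ[K] K where
  toFun f := (TrivSqZeroExt.snd f : Polynomial K).eval c
  map_add' f g := by
    change (TrivSqZeroExt.snd f + TrivSqZeroExt.snd g).eval c = _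
    rw [Polynomial.eval_add]
  map_smul' r f := by
    change (r • TrivSqZeroExt.snd f).eval c = _
    rw [Polynomial.eval_smul]
    rfl

/-- The coefficient of `dz` at `z = c`, on `K[z, dz] ⊗ W`. -/
def coeffTensor (W : Type v) [AddCommGroup W] [Module K W] (c : K) :
    (interval K).carrier ⊗[K] W →ₗ[K] W :=
  (TensorProduct.lid K W).toLinearMap ∘ₗ LinearMap.rTensor W (coeffForms c)

theorem evalTensor_tmul (c : K) (f : (interval K).carrier) (v : V) :
    evalTensor V c (f ⊗ₜ v) = valueForms c f • v := rfl

theorem coeffTensor_tmul (c : K) (f : (interval K).carrier) (v : V) :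
    coeffTensor V c (f ⊗ₜ v) = coeffForms c f • v := rfl

/-- The evaluation at a point as a morphism of algebras. -/
def evalHom (c : K) : (interval K).carrier →ₐ[K] K :=
  (Polynomial.aeval c).comp (TrivSqZeroExt.fstHom K (Polynomial K) (Polynomial K))

theorem evalHom_apply (c : K) (f : (interval K).carrier) : evalHom c f = valueForms c f :=
  congrFun (Polynomial.coe_aeval_eq_eval c) (TrivSqZeroExt.fst f : Polynomial K)

theorem valueForms_of_ne {c : K} {i : ℤ} {f : (interval K).carrier}
    (hf : f ∈ (interval K).grading i) (hi : i ≠ 0) : valueForms c f = 0 := by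
  change (TrivSqZeroExt.fst f : Polynomial K).eval c = 0
  rw [hf.1 hi, Polynomial.eval_zero]

theorem coeffForms_of_ne {c : K} {i : ℤ} {f : (interval K).carrier}
    (hf : f ∈ (interval K).grading i) (hi : i ≠ 1) : coeffForms c f = 0 := by
  change (TrivSqZeroExt.snd f : Polynomial K).eval c = 0
  rw [hf.2 hi, Polynomial.eval_zero]

theorem valueForms_d (c : K) (f : (interval K).carrier) :
    valueForms c ((interval K).d f) = 0 := by
  change (TrivSqZeroExt.fst (formsD K f) : Polynomial K).eval c = 0
  simp [formsD]

theorem coeffForms_d (c : K) (f : (interval K).carrier) : coeffForms c ((interval K).d f) =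
    (Polynomial.derivative (TrivSqZeroExt.fst f : Polynomial K)).eval c := by
  change (TrivSqZeroExt.snd (formsD K f) : Polynomial K).eval c = _
  simp [formsD]

theorem valueForms_parity (c : K) (f : (interval K).carrier) :
    valueForms c ((interval K).parity f) = valueForms c f := by
  have h : valueForms c ∘ₗ (interval K).parity =
      valueForms c := by
    refine (interval K).linearMap_ext fun i a ha => ?_
    rw [LinearMap.comp_apply, (interval K).isGradedComm.parity ha, map_zsmul]
    by_cases hi : i = 0
    · simp [hi]
    · rw [valueForms_of_ne ha hi, smul_zero]
  exact LinearMap.congr_fun h f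

theorem valueForms_mul (c : K) (f g : (interval K).carrier) :
    valueForms c (f * g) = valueForms c f * valueForms c g := by
  rw [← evalHom_apply, map_mul, evalHom_apply, evalHom_apply]

theorem valueForms_one (c : K) : valueForms c (1 : (interval K).carrier) = 1 := by
  rw [← evalHom_apply, map_one]

theorem coeffForms_mul (c : K) (f g : (interval K).carrier) : coeffForms c (f * g) =
    valueForms c f * coeffForms c g + coeffForms c f * valueForms c g := by
  have h := congrArg (Polynomial.eval c) (TrivSqZeroExt.snd_mul (R := Polynomial K) f g)
  simp only [Polynomial.eval_add, smul_eq_mul, MulOpposite.smul_eq_mul_unop, MulOpposite.unop_op,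
    Polynomial.eval_mul] at h
  exact h

theorem coeffForms_one (c : K) : coeffForms c (1 : (interval K).carrier) = 0 := by
  change (TrivSqZeroExt.snd (1 : Forms K) : Polynomial K).eval c = 0
  simp

theorem valueForms_oprod (c : K) {n : ℕ} (a : Fin n → (interval K).carrier) :
    valueForms c (oprod a) = ∏ i, valueForms c (a i) := by
  induction n with
  | zero => rw [oprod_zero, valueForms_one]; simp
  | succ n ih => rw [oprod_succ, valueForms_mul, ih, Fin.prod_univ_succ]

/-- The coefficient of `dz` is a derivation over the evaluation. -/
theorem coeffForms_oprod (c : K) {n : ℕ} (a : Fin n → (interval K).carrier) :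
    coeffForms c (oprod a) =
      ∑ r, ∏ i, if i = r then coeffForms c (a i) else valueForms c (a i) := by
  induction n with
  | zero => rw [oprod_zero, coeffForms_one]; simp
  | succ n ih =>
    rw [oprod_succ, coeffForms_mul, ih, valueForms_oprod, Fin.sum_univ_succ, add_comm]
    congr 1
    · simp [Fin.prod_univ_succ]
    · rw [Finset.mul_sum]
      refine Finset.sum_congr rfl fun r _ => ?_
      simp [Fin.prod_univ_succ, (Fin.succ_ne_zero r).symm]

variable {𝒲 : ℤ → Submodule K V} {t : V →ₗ[K] V}

theorem evalTensor_mem (c : K) {n : ℤ} {x : (interval K).carrier ⊗[K] V}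
    (hx : x ∈ tensorGrading (interval K).grading 𝒲 n) : evalTensor V c x ∈ 𝒲 n := by
  refine tensorGrading_linear_mem (fun α ω a w ha hw h => ?_) hx
  rw [evalTensor_tmul]
  by_cases hα : α = 0
  · subst hα
    rw [h, sub_zero]
    exact Submodule.smul_mem _ _ hw
  · rw [valueForms_of_ne ha hα, zero_smul]
    exact zero_mem _

theorem coeffTensor_mem (c : K) {n : ℤ} {x : (interval K).carrier ⊗[K] V}
    (hx : x ∈ tensorGrading (interval K).grading 𝒲 n) : coeffTensor V c x ∈ 𝒲 (n + 1) := by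
  refine tensorGrading_linear_mem (fun α ω a w ha hw h => ?_) hx
  rw [coeffTensor_tmul]
  by_cases hα : α = 1
  · subst hα
    rw [h, sub_add_cancel]
    exact Submodule.smul_mem _ _ hw
  · rw [coeffForms_of_ne ha hα, zero_smul]
    exact zero_mem _

theorem lid_extendMultilinear {U : Type y} [AddCommGroup U] [Module K U] {n : ℕ}
    (φ : MultilinearMap K (fun _ : Fin n => V) U) (x : Fin n → K ⊗[K] V) :
    TensorProduct.lid K U (extendMultilinear LinearMap.id t U n φ x) =
      φ fun i => TensorProduct.lid K V (x i) := by
  induction n with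
  | zero =>
    rw [extendMultilinear_zero, TensorProduct.lid_tmul, one_smul]
    exact congrArg φ (Subsingleton.elim _ _)
  | succ n ih =>
    obtain ⟨u, x, rfl⟩ : ∃ u y, x = Fin.cons u y := ⟨x 0, Fin.tail x, (Fin.cons_self_tail x).symm⟩
    have hc : ∀ u, (fun i => TensorProduct.lid K V ((Fin.cons u x : Fin (n + 1) → _) i)) =
        Fin.cons (TensorProduct.lid K V u) fun i => TensorProduct.lid K V (x i) := by
      intro u
      funext i
      refine Fin.cases rfl (fun i => rfl) i
    rw [hc]
    induction u using TensorProduct.induction_on with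
    | zero =>
      rw [map_zero, MultilinearMap.map_coord_zero _ 0 (Fin.cons_zero _ _),
        MultilinearMap.map_coord_zero _ 0 (Fin.cons_zero _ _), map_zero]
    | tmul a w =>
      have h1 : ∀ y : K ⊗[K] U, TensorProduct.lid K U ((LinearMap.mulLeft K a).rTensor U y) =
          a • TensorProduct.lid K U y := by
        intro y
        induction y using TensorProduct.induction_on with
        | zero => simp
        | tmul b u => simp [mul_smul]
        | add y z h1 h2 => simp only [map_add, smul_add, h1, h2]
      have h2 : evenPart t w + oddPart t w = w := by
        simp only [evenPart, oddPart, LinearMap.smul_apply, LinearMap.add_apply,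
          LinearMap.sub_apply, LinearMap.id_apply, ← smul_add]
        rw [add_add_sub_cancel, ← two_smul K w, smul_smul, inv_mul_cancel₀ two_ne_zero, one_smul]
      rw [extendMultilinear_succ_cons_tmul, h1, map_add, LinearMap.rTensor_id, LinearMap.id_apply,
        ih, ih, MultilinearMap.curryLeft_apply, MultilinearMap.curryLeft_apply,
        ← MultilinearMap.cons_add, h2, TensorProduct.lid_tmul, MultilinearMap.cons_smul]
    | add u v h1 h2 => rw [MultilinearMap.cons_add, map_add, map_add, MultilinearMap.cons_add, h1, h2]

/-- The evaluation at a point is a strict morphism of `L∞` algebras. -/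
theorem evalTensor_bracket (c : K) (ℓ : Brackets K V) {n : ℕ}
    (x : Fin n → (interval K).carrier ⊗[K] V) :
    evalTensor V c (extendBrackets (interval K) t ℓ n x) = ℓ n fun i => evalTensor V c (x i) := by
  have he : ∀ y : (interval K).carrier ⊗[K] V, evalTensor V c y =
      TensorProduct.lid K V (TensorProduct.map (evalHom c).toLinearMap LinearMap.id y) := by
    intro y
    induction y using TensorProduct.induction_on with
    | zero => simp
    | tmul f v =>
      rw [evalTensor_tmul, TensorProduct.map_tmul, TensorProduct.lid_tmul, ← evalHom_apply]
      rfl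
    | add y z h1 h2 => rw [map_add, map_add, map_add, h1, h2]
  have hs : ∀ y : (interval K).carrier ⊗[K] V,
      evalTensor V c ((interval K).parity.rTensor V y) = evalTensor V c y := by
    intro y
    induction y using TensorProduct.induction_on with
    | zero => simp
    | tmul f v => rw [LinearMap.rTensor_tmul, evalTensor_tmul, evalTensor_tmul, valueForms_parity]
    | add y z h1 h2 => rw [map_add, map_add, map_add, h1, h2]
  have hd : ∀ y : (interval K).carrier ⊗[K] V,
      evalTensor V c ((interval K).d.rTensor V y) = 0 := by
    intro y
    induction y using TensorProduct.induction_on with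
    | zero => simp
    | tmul f v => rw [LinearMap.rTensor_tmul, evalTensor_tmul, valueForms_d, zero_smul]
    | add y z h1 h2 => rw [map_add, map_add, h1, h2, add_zero]
  rw [FormalCDGA.extendBrackets_apply, map_add, hs]
  have h2 : evalTensor V c (unaryBracket ((interval K).d.rTensor V) n x) = 0 := by
    by_cases hn : n = 1
    · subst hn
      rw [unaryBracket_one, hd]
    · rw [unaryBracket_of_ne _ hn, map_zero]
  rw [h2, add_zero, he, extend, extendMultilinear_natural (s' := LinearMap.id) (t' := t) (evalHom c)
    (fun a => by rw [evalHom_apply, valueForms_parity, evalHom_apply]; rfl) LinearMap.id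
    (fun _ => rfl) (h := LinearMap.id) (φ' := ℓ n) (fun _ => rfl), lid_extendMultilinear]
  simp only [he]

/-- The coefficient of `dz` is a derivation over the evaluation, up to sign. -/
theorem coeffTensor_bracket (ht : IsParity 𝒲 t) (c : K) (ℓ : Brackets K V) {n : ℕ} {D : Fin n → ℤ}
    {x : Fin n → (interval K).carrier ⊗[K] V}
    (hx : ∀ i, x i ∈ tensorGrading (interval K).grading 𝒲 (D i)) :
    coeffTensor V c (oddExt (interval K).parity t ℓ n x) =
      -∑ r, sg (∑ i, if i < r then D i else 0) •
        ℓ n fun i => if i = r then coeffTensor V c (x i) else evalTensor V c (x i) := by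
  have e := tensorGrading_multilinear_eq
    (M := (coeffTensor V c).compMultilinearMap (oddExt (interval K).parity t ℓ n))
    (N := -∑ r, sg (∑ i, if i < r then D i else 0) • (ℓ n).compLinearMap fun i =>
      if i = r then coeffTensor V c else evalTensor V c) (fun α ω a w ha hw hD => ?_) hx
  · rw [LinearMap.compMultilinearMap_apply] at e
    rw [e, neg_apply, sum_apply]
    refine congrArg _ (Finset.sum_congr rfl fun r _ => ?_)
    rw [smul_apply, MultilinearMap.compLinearMap_apply]
    congr 2
    funext i
    split_ifs <;> rfl
  · have hR := (interval K).isGradedComm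
    rw [LinearMap.compMultilinearMap_apply, LinearMap.compMultilinearMap_apply,
      extendMultilinear_tmul hR _ ha fun i => ht (hw i), map_zsmul, LinearMap.rTensor_tmul,
      hR.map_oprod ha, ← TensorProduct.smul_tmul', map_zsmul, map_zsmul, coeffTensor_tmul,
      coeffForms_oprod, smul_smul, Finset.sum_smul, neg_apply, sum_apply, Finset.smul_sum,
      ← Finset.sum_neg_distrib]
    refine Finset.sum_congr rfl fun r _ => ?_
    rw [smul_apply, MultilinearMap.compLinearMap_apply]
    have h1 : (fun i => (if i = r then coeffTensor V c else evalTensor V c) (a i ⊗ₜ[K] w i)) =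
        fun i => (if i = r then coeffForms c (a i) else valueForms c (a i)) • w i := by
      funext i
      split_ifs <;> rfl
    rw [h1, MultilinearMap.map_smul_univ]
    by_cases hα : α r = 1 ∧ ∀ i, i ≠ r → α i = 0
    · rw [← neg_smul]
      congr 1
      have h2 : α = Pi.single r 1 := by
        funext i
        by_cases hi : i = r
        · subst hi; rw [Pi.single_eq_same, hα.1]
        · rw [Pi.single_eq_of_ne hi, hα.2 i hi]
      have h3 : extSign α ω = sg (∑ i, if i < r then D i else 0) := by
        rw [sg_sum, extSign]
        refine Finset.prod_congr rfl fun i _ => ?_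
        rw [Finset.prod_eq_single r]
        · split_ifs with hi
          · rw [hα.1, hD, hα.2 i hi.ne, mul_one, sub_zero]
          · simp
        · intro k _ hk
          rw [hα.2 k hk, mul_zero, sg_zero, ite_self]
        · intro h; exact absurd (Finset.mem_univ _) h
      rw [h3, h2]
      simp
    · have h2 : (∏ i, if i = r then coeffForms c (a i) else valueForms c (a i)) = 0 := by
        by_cases hr : α r = 1
        · obtain ⟨i, hi, hi'⟩ : ∃ i, i ≠ r ∧ α i ≠ 0 := by
            by_contra! h
            exact hα ⟨hr, h⟩
          refine Finset.prod_eq_zero (Finset.mem_univ i) ?_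
          rw [if_neg hi, valueForms_of_ne (ha i) hi']
        · refine Finset.prod_eq_zero (Finset.mem_univ r) ?_
          rw [if_pos rfl, coeffForms_of_ne (ha r) hr]
      rw [h2, zero_smul, smul_zero, smul_zero, neg_zero]

end Interval

/-! ### Homotopies as paths of Maurer-Cartan elements -/

section Homotopy

variable {K : Type u} [Field K] [CharZero K] {V : Type v} [AddCommGroup V] [Module K V]
  {𝒲 : ℤ → Submodule K V} {t : V →ₗ[K] V} (B : CDGA.{u, w} K)

/-- The value at `z = c` of an element of `B[z, dz] ⊗ V`. -/
abbrev pathValue (c : K) : B.carrier ⊗[K] ((interval K).carrier ⊗[K] V) →ₗ[K] B.carrier ⊗[K] V :=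
  (evalTensor V c).lTensor B.carrier

/-- The coefficient of `dz` at `z = c` of an element of `B[z, dz] ⊗ V`, up to the sign of moving `dz`
past `B`. -/
abbrev pathVelocity (c : K) : B.carrier ⊗[K] ((interval K).carrier ⊗[K] V) →ₗ[K] B.carrier ⊗[K] V :=
  TensorProduct.map B.parity (coeffTensor V c)

variable {B}

theorem pathValue_mem (c : K) {n : ℤ} {x : B.carrier ⊗[K] ((interval K).carrier ⊗[K] V)}
    (hx : x ∈ tensorGrading B.grading (tensorGrading (interval K).grading 𝒲) n) :
    pathValue B c x ∈ tensorGrading B.grading 𝒲 n := by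
  refine tensorGrading_linear_mem (fun β D b y hb hy h => ?_) hx
  rw [LinearMap.lTensor_tmul]
  exact tmul_mem_tensorGrading hb (evalTensor_mem c hy) (by omega)

theorem pathVelocity_mem (c : K) {n : ℤ} {x : B.carrier ⊗[K] ((interval K).carrier ⊗[K] V)}
    (hx : x ∈ tensorGrading B.grading (tensorGrading (interval K).grading 𝒲) n) :
    pathVelocity B c x ∈ tensorGrading B.grading 𝒲 (n + 1) := by
  refine tensorGrading_linear_mem (fun β D b y hb hy h => ?_) hx
  rw [TensorProduct.map_tmul, B.isGradedComm.parity hb, ← TensorProduct.smul_tmul']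
  exact zsmul_mem (tmul_mem_tensorGrading hb (coeffTensor_mem c hy) (by omega)) _

/-- The value at `z = c` is a strict morphism. -/
theorem pathValue_bracket (c : K) (ℓ : Brackets K V) {n : ℕ}
    (x : Fin n → B.carrier ⊗[K] ((interval K).carrier ⊗[K] V)) :
    pathValue B c (extendBrackets B (TensorProduct.map (interval K).parity t)
      (extendBrackets (interval K) t ℓ) n x) =
      extendBrackets B t ℓ n fun i => pathValue B c (x i) := by
  have ht : ∀ y : (interval K).carrier ⊗[K] V,
      evalTensor V c (TensorProduct.map (interval K).parity t y) = t (evalTensor V c y) := by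
    intro y
    induction y using TensorProduct.induction_on with
    | zero => simp
    | tmul f v =>
      rw [TensorProduct.map_tmul, evalTensor_tmul, evalTensor_tmul, valueForms_parity, map_smul]
    | add y z h1 h2 => simp only [map_add, h1, h2]
  rw [FormalCDGA.extendBrackets_apply, FormalCDGA.extendBrackets_apply, map_add]
  have hcomm : ∀ (f : B.carrier →ₗ[K] B.carrier)
      (y : B.carrier ⊗[K] ((interval K).carrier ⊗[K] V)),
      pathValue B c (f.rTensor _ y) = f.rTensor V (pathValue B c y) := by
    intro f y
    induction y using TensorProduct.induction_on with
    | zero => simp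
    | tmul b u => rfl
    | add y z h1 h2 => simp only [map_add, h1, h2]
  congr 1
  · rw [hcomm]
    exact congrArg _ (extendMultilinear_natural (s := B.parity) (s' := B.parity)
      (AlgHom.id K B.carrier) (fun _ => rfl) (evalTensor V c) ht (h := evalTensor V c)
      (φ' := ℓ n) (evalTensor_bracket c ℓ) x)
  · by_cases hn : n = 1
    · subst hn
      rw [unaryBracket_one, unaryBracket_one, hcomm]
    · rw [unaryBracket_of_ne _ hn, unaryBracket_of_ne _ hn, map_zero]

theorem sg_sum_split_at {n : ℕ} (β : Fin n → ℤ) (r : Fin n) :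
    sg (∑ i, if i < r then β i else 0) * sg (∑ i, if r < i then β i else 0) * sg (β r) =
      sg (∑ i, β i) := by
  rw [← sg_add, ← sg_add]
  congr 1
  rw [← Finset.sum_add_distrib]
  have h : ∀ i, β i = (if i < r then β i else 0) + (if r < i then β i else 0) +
      if i = r then β i else 0 := by
    intro i
    rcases lt_trichotomy i r with h | h | h
    · simp [h, h.not_gt, h.ne]
    · simp [h]
    · simp [h, h.not_gt, h.ne']
  conv_rhs => rw [Finset.sum_congr rfl fun i _ => h i, Finset.sum_add_distrib]
  simp

theorem extSign_update_right {n : ℕ} (α ω : Fin n → ℤ) (r : Fin n) :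
    extSign α (Function.update ω r (ω r + 1)) =
      extSign α ω * sg (∑ j, if r < j then α j else 0) := by
  have h : sg (∑ j, if r < j then α j else 0) =
      ∏ i, if i = r then sg (∑ j, if r < j then α j else 0) else 1 := by
    rw [Finset.prod_ite_eq' Finset.univ r, if_pos (Finset.mem_univ r)]
  rw [h, extSign, extSign, ← Finset.prod_mul_distrib]
  refine Finset.prod_congr rfl fun i _ => ?_
  split_ifs with hi
  · subst hi
    rw [sg_sum, ← Finset.prod_mul_distrib]
    refine Finset.prod_congr rfl fun j _ => ?_
    split_ifs
    · rw [Function.update_self, add_mul, sg_add, one_mul]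
    · simp
  · simp only [Function.update_of_ne hi, mul_one]

/-- The velocity is a derivation over the value with respect to the part of the brackets without
differentials. -/
theorem pathVelocity_oddExt (ht : IsParity 𝒲 t) (c : K) (ℓ : Brackets K V) {n : ℕ}
    {x : Fin n → B.carrier ⊗[K] ((interval K).carrier ⊗[K] V)}
    (hx : ∀ i, x i ∈ tensorGrading B.grading (tensorGrading (interval K).grading 𝒲) 0) :
    pathVelocity B c (oddExt B.parity (TensorProduct.map (interval K).parity t)
      (oddExt (interval K).parity t ℓ) n x) =
      -∑ r, oddExt B.parity t ℓ n
        fun i => if i = r then pathVelocity B c (x i) else pathValue B c (x i) := by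
  have hR := B.isGradedComm
  have ht' := tensorGrading_parity (interval K).isParity ht
  have e := tensorGrading_multilinear_eq (D := fun _ => 0)
    (M := (pathVelocity B c).compMultilinearMap (oddExt B.parity
      (TensorProduct.map (interval K).parity t) (oddExt (interval K).parity t ℓ) n))
    (N := -∑ r, (oddExt B.parity t ℓ n).compLinearMap fun i =>
      if i = r then pathVelocity B c else pathValue B c) (fun β D b u hb hu hD => ?_) hx
  · rw [LinearMap.compMultilinearMap_apply] at e
    rw [e, neg_apply, sum_apply]
    refine congrArg _ (Finset.sum_congr rfl fun r _ => ?_)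
    rw [MultilinearMap.compLinearMap_apply]
    congr 1
    funext i
    split_ifs <;> rfl
  · have hDβ : D = β := funext fun i => by have := hD i; omega
    subst hDβ
    rw [LinearMap.compMultilinearMap_apply, LinearMap.compMultilinearMap_apply,
      extendMultilinear_tmul hR _ hb fun i => ht' (hu i), map_zsmul, LinearMap.rTensor_tmul,
      hR.map_oprod hb, ← TensorProduct.smul_tmul', map_zsmul, map_zsmul, TensorProduct.map_tmul,
      hR.map_oprod hb, coeffTensor_bracket ht c ℓ hu, ← TensorProduct.smul_tmul', smul_smul,
      smul_smul, mul_assoc, sg_mul_self, mul_one, TensorProduct.tmul_neg, smul_neg, neg_apply,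
      sum_apply, TensorProduct.tmul_sum, Finset.smul_sum]
    refine congrArg _ (Finset.sum_congr rfl fun r _ => ?_)
    rw [MultilinearMap.compLinearMap_apply, TensorProduct.tmul_smul, smul_smul]
    have h1 : (fun i => (if i = r then pathVelocity B c else pathValue B c) (b i ⊗ₜ[K] u i)) =
        fun i => ((if i = r then sg (D i) else 1 : ℤ) : K) • (b i ⊗ₜ[K]
          if i = r then coeffTensor V c (u i) else evalTensor V c (u i)) := by
      funext i
      split_ifs with hi
      · rw [TensorProduct.map_tmul, hR.parity (hb i), ← TensorProduct.smul_tmul']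
        exact (Int.cast_smul_eq_zsmul K _ _).symm
      · simp
    have h2 : ∀ i, t (if i = r then coeffTensor V c (u i) else evalTensor V c (u i)) =
        sg (Function.update D r (D r + 1) i) •
          (if i = r then coeffTensor V c (u i) else evalTensor V c (u i)) := by
      intro i
      split_ifs with hi
      · subst hi
        rw [Function.update_self]
        exact ht (coeffTensor_mem c (hu i))
      · rw [Function.update_of_ne hi]
        exact ht (evalTensor_mem c (hu i))
    rw [h1, MultilinearMap.map_smul_univ, LinearMap.compMultilinearMap_apply,
      extendMultilinear_tmul hR _ hb h2, map_zsmul, LinearMap.rTensor_tmul, hR.map_oprod hb,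
      ← TensorProduct.smul_tmul', smul_smul, ← Int.cast_prod, Int.cast_smul_eq_zsmul K, smul_smul,
      extSign_update_right, Finset.prod_ite_eq', if_pos (Finset.mem_univ r), ← sg_sum_split_at D r]
    congr 1
    have e1 := sg_mul_self (∑ i, if r < i then D i else 0)
    have e2 := sg_mul_self (D r)
    linear_combination (-(extSign D D * sg (∑ i, if i < r then D i else 0))) * e1 -
      (extSign D D * sg (∑ i, if i < r then D i else 0) *
        sg (∑ i, if r < i then D i else 0) * sg (∑ i, if r < i then D i else 0)) * e2

/-- The velocity of the differential of `K[z, dz]` is the derivative of the value. -/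
theorem pathVelocity_unary (ht : IsParity 𝒲 t) (c : K)
    {x : Fin 1 → B.carrier ⊗[K] ((interval K).carrier ⊗[K] V)}
    (hx : ∀ i, x i ∈ tensorGrading B.grading (tensorGrading (interval K).grading 𝒲) 0) :
    pathVelocity B c (oddExt B.parity (TensorProduct.map (interval K).parity t)
      (unaryBracket ((interval K).d.rTensor V)) 1 x) =
      (coeffTensor V c ∘ₗ (interval K).d.rTensor V).lTensor B.carrier (x 0) := by
  have hR := B.isGradedComm
  have ht' := tensorGrading_parity (interval K).isParity ht
  refine tensorGrading_multilinear_eq (D := fun _ => 0)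
    (M := (pathVelocity B c).compMultilinearMap (oddExt B.parity
      (TensorProduct.map (interval K).parity t) (unaryBracket ((interval K).d.rTensor V)) 1))
    (N := MultilinearMap.ofSubsingleton K _ _ (0 : Fin 1)
      ((coeffTensor V c ∘ₗ (interval K).d.rTensor V).lTensor B.carrier))
    (fun β D b u hb hu hD => ?_) hx
  rw [LinearMap.compMultilinearMap_apply, LinearMap.compMultilinearMap_apply,
    extendMultilinear_tmul hR _ hb fun i => ht' (hu i), map_zsmul, LinearMap.rTensor_tmul,
    hR.map_oprod hb, ← TensorProduct.smul_tmul', map_zsmul, map_zsmul, TensorProduct.map_tmul,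
    hR.map_oprod hb, ← TensorProduct.smul_tmul', smul_smul, smul_smul, mul_assoc, sg_mul_self,
    mul_one]
  have h1 : extSign β D = 1 := by simp [extSign]
  rw [h1, one_smul, unaryBracket_one, oprod_succ, oprod_zero, mul_one]
  rfl

/-- The sign arises as the parity of `B` and the differential of `B` anticommute. -/
theorem pathVelocity_d (c : K) {n : ℤ} {x : B.carrier ⊗[K] ((interval K).carrier ⊗[K] V)}
    (hx : x ∈ tensorGrading B.grading (tensorGrading (interval K).grading 𝒲) n) :
    pathVelocity B c (B.d.rTensor _ x) = -B.d.rTensor V (pathVelocity B c x) := by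
  refine tensorGrading_linear_eq (f := pathVelocity B c ∘ₗ B.d.rTensor _)
    (g := -(B.d.rTensor V ∘ₗ pathVelocity B c)) (fun β D b u hb hu hD => ?_) hx
  simp only [LinearMap.comp_apply, LinearMap.neg_apply, LinearMap.rTensor_tmul,
    TensorProduct.map_tmul, B.isGradedComm.parity hb,
    B.isGradedComm.parity (B.isDifferential.mem hb), map_zsmul, sg_add, sg_one, mul_neg, mul_one,
    neg_smul, TensorProduct.neg_tmul]

/-- The velocity of a bracket of elements of degree `0`. -/
theorem pathVelocity_bracket (ht : IsParity 𝒲 t) (c : K) (ℓ : Brackets K V) {n : ℕ}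
    {h : B.carrier ⊗[K] ((interval K).carrier ⊗[K] V)}
    (hh : h ∈ tensorGrading B.grading (tensorGrading (interval K).grading 𝒲) 0) :
    pathVelocity B c (extendBrackets B (TensorProduct.map (interval K).parity t)
      (extendBrackets (interval K) t ℓ) n fun _ => h) =
      -(∑ r, extendBrackets B t ℓ n
        fun i => if i = r then pathVelocity B c h else pathValue B c h) +
      if n = 1 then (coeffTensor V c ∘ₗ (interval K).d.rTensor V).lTensor B.carrier h else 0 := by
  have e1 : extend B.parity (TensorProduct.map (interval K).parity t)
      (extendBrackets (interval K) t ℓ) n =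
      extend B.parity (TensorProduct.map (interval K).parity t) (oddExt (interval K).parity t ℓ) n +
      extend B.parity (TensorProduct.map (interval K).parity t)
        (unaryBracket ((interval K).d.rTensor V)) n := map_add _ _ _
  have e2 := pathVelocity_oddExt (B := B) ht c ℓ (n := n) (x := fun _ => h) fun _ => hh
  simp only [LinearMap.compMultilinearMap_apply] at e2
  rw [FormalCDGA.extendBrackets_apply, e1, add_apply, map_add, map_add, map_add]
  erw [e2]
  simp only [FormalCDGA.extendBrackets_apply, Finset.sum_add_distrib]
  by_cases hn : n = 1
  · subst hn
    have e3 := pathVelocity_unary (B := B) ht c (x := fun _ => h) fun _ => hh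
    simp only [LinearMap.compMultilinearMap_apply] at e3
    erw [e3]
    simp only [unaryBracket_one, pathVelocity_d c hh, Finset.univ_unique, Finset.sum_singleton,
      Fin.default_eq_zero, if_true]
    abel
  · have e3 : unaryBracket ((interval K).d.rTensor V) n = 0 := by
      ext x
      exact unaryBracket_of_ne _ hn x
    simp only [unaryBracket_of_ne _ hn, if_neg hn, extend, e3, map_zero, zero_apply, add_zero,
      Finset.sum_const_zero]

end Homotopy

section HomotopyPath

variable {K : Type u} [Field K] [CharZero K] {V : Type v} [AddCommGroup V] [Module K V]
  {𝒲 : ℤ → Submodule K V} {t : V →ₗ[K] V}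

theorem hasPolyDeriv_evalTensor (u : (interval K).carrier ⊗[K] V) :
    HasPolyDeriv (fun c => evalTensor V c u)
      fun c => coeffTensor V c ((interval K).d.rTensor V u) := by
  induction u using TensorProduct.induction_on with
  | zero => simpa using HasPolyDeriv.const (K := K) (0 : V)
  | tmul f v =>
    have h := HasPolyDeriv.eval_smul (TrivSqZeroExt.fst f : Polynomial K) v
    refine (congrArg (HasPolyDeriv _) (funext fun c => ?_)).mpr h
    rw [LinearMap.rTensor_tmul, coeffTensor_tmul, coeffForms_d]
  | add u u' h1 h2 => simpa only [map_add] using h1.add h2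

theorem isPolyFun_coeffTensor (u : (interval K).carrier ⊗[K] V) :
    IsPolyFun fun c => coeffTensor V c u := by
  induction u using TensorProduct.induction_on with
  | zero => simpa using (HasPolyDeriv.const (K := K) (0 : V)).isPolyFun
  | tmul f v => exact (HasPolyDeriv.eval_smul (TrivSqZeroExt.snd f : Polynomial K) v).isPolyFun
  | add u u' h1 h2 =>
    obtain ⟨_, h1⟩ := h1
    obtain ⟨_, h2⟩ := h2
    simpa only [map_add] using (h1.add h2).isPolyFun

theorem hasPolyDeriv_pathValue (B : CDGA.{u, w} K)
    (h : B.carrier ⊗[K] ((interval K).carrier ⊗[K] V)) :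
    HasPolyDeriv (fun c => pathValue B c h)
      fun c => (coeffTensor V c ∘ₗ (interval K).d.rTensor V).lTensor B.carrier h := by
  induction h using TensorProduct.induction_on with
  | zero => simpa using HasPolyDeriv.const (K := K) (0 : B.carrier ⊗[K] V)
  | tmul b u => exact (hasPolyDeriv_evalTensor u).map (TensorProduct.mk K B.carrier V b)
  | add u u' h1 h2 => simpa only [map_add] using h1.add h2

theorem isPolyFun_pathVelocity (B : CDGA.{u, w} K)
    (h : B.carrier ⊗[K] ((interval K).carrier ⊗[K] V)) :
    IsPolyFun fun c => pathVelocity B c h := by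
  induction h using TensorProduct.induction_on with
  | zero => simpa using (HasPolyDeriv.const (K := K) (0 : B.carrier ⊗[K] V)).isPolyFun
  | tmul b u =>
    exact (isPolyFun_coeffTensor u).map (TensorProduct.mk K B.carrier V (B.parity b))
  | add u u' h1 h2 =>
    obtain ⟨_, h1⟩ := h1
    obtain ⟨_, h2⟩ := h2
    simpa only [map_add] using (h1.add h2).isPolyFun

theorem rTensor_pathValue {B B' : CDGA.{u, w} K} (f : B.carrier →ₗ[K] B'.carrier) (c : K)
    (y : B.carrier ⊗[K] ((interval K).carrier ⊗[K] V)) :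
    f.rTensor V (pathValue B c y) = pathValue B' c (f.rTensor _ y) := by
  induction y using TensorProduct.induction_on with
  | zero => simp
  | tmul b u => rfl
  | add y z h1 h2 => simp only [map_add, h1, h2]

/-- The position of the distinguished argument is irrelevant if the other arguments have degree
`0`. -/
theorem IsGradedSymm.single_arg {X : Type v} [AddCommGroup X] [Module K X]
    {𝒳 : ℤ → Submodule K X} {φ : Components K X X} (h : IsGradedSymm 𝒳 φ) {p : ℤ} {u y : X}
    (hu : u ∈ 𝒳 p) (hy : y ∈ 𝒳 0) {n : ℕ} (r : Fin (n + 1)) :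
    φ (n + 1) (fun i => if i = r then u else y) = φ (n + 1) (Fin.cons u fun _ => y) := by
  have hm : ∀ i, (if i = r then u else y) ∈ 𝒳 (if i = r then p else 0) := by
    intro i
    split_ifs
    · exact hu
    · exact hy
  rw [h.equiv_of_even (consCompl r) hm]
  · refine apply_eq_of_cast φ (by simp [Finset.card_compl]) fun i => ?_
    refine Fin.cases ?_ (fun i => ?_) i
    · simp
    · have h1 := Finset.orderEmbOfFin_mem ({r}ᶜ : Finset (Fin (n + 1))) rfl i
      rw [Finset.mem_compl, Finset.mem_singleton] at h1
      rw [Function.comp_apply, consCompl_succ, if_neg h1]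
      have : Fin.cast (by simp [Finset.card_compl]) i.succ =
          (Fin.cast (by simp [Finset.card_compl]) i : Fin n).succ := Fin.ext rfl
      rw [this, Fin.cons_succ]
  · intro i j hij _
    by_cases hi : i = r
    · have hj : j ≠ r := fun hj => hij.ne (hi.trans hj.symm)
      simp [hj]
    · simp [hi]

end HomotopyPath

namespace FormalCDGA

variable {K : Type u} [Field K] [CharZero K] {V : Type v} [AddCommGroup V] [Module K V]
  {𝒲 : ℤ → Submodule K V} {t : V →ₗ[K] V} {ℓ : Brackets K V} {A : FormalCDGA.{u, w, x} K}

theorem pathValue_mem_fil {j : A.Index} {c : K}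
    {y : (A.level j).carrier ⊗[K] ((interval K).carrier ⊗[K] V)}
    (hy : (A.aug j).toLinearMap.rTensor _ y = 0) :
    pathValue (A.level j) c y ∈ tensorFil (A.augPow j 1) V := by
  rw [← mem_tensorFil_one_iff, augPow_one] at hy
  rw [augPow_one]
  induction hy using Submodule.span_induction with
  | mem x hx =>
    obtain ⟨a, ha, w, rfl⟩ := hx
    exact tmul_mem_tensorFil ha _
  | zero => simp
  | add x y _ _ h1 h2 => rw [map_add]; exact add_mem h1 h2
  | smul c x _ h => rw [map_smul]; exact Submodule.smul_mem _ _ h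

theorem pathVelocity_mem_fil {j : A.Index} {c : K}
    {y : (A.level j).carrier ⊗[K] ((interval K).carrier ⊗[K] V)}
    (hy : (A.aug j).toLinearMap.rTensor _ y = 0) :
    pathVelocity (A.level j) c y ∈ tensorFil (A.augPow j 1) V := by
  rw [← mem_tensorFil_one_iff, augPow_one] at hy
  rw [augPow_one]
  induction hy using Submodule.span_induction with
  | mem x hx =>
    obtain ⟨a, ha, w, rfl⟩ := hx
    refine tmul_mem_tensorFil ?_ _
    rw [mem_augIdeal] at ha ⊢
    rw [aug_parity, ha]
  | zero => simp
  | add x y _ _ h1 h2 => rw [map_add]; exact add_mem h1 h2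
  | smul c x _ h => rw [map_smul]; exact Submodule.smul_mem _ _ h

theorem brackets_apply (t : V →ₗ[K] V) (ℓ : Brackets K V) {n : ℕ} (x : Fin n → A.Tensor V)
    (j : A.Index) : A.brackets t ℓ n x j = extendBrackets (A.level j) t ℓ n fun r => x r j := rfl

/-- A Maurer-Cartan element with coefficients in `A[z, dz]` is, in each level, a polynomial path of
Maurer-Cartan elements that moves along the gauge vector field: the coefficient of `dz` in the
Maurer-Cartan equation is the differential equation of the path. -/
theorem IsMC.isMCPath (ht : IsParity 𝒲 t) (hℓ : IsLInfty 𝒲 ℓ)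
    {h : A.Tensor ((interval K).carrier ⊗[K] V)}
    (hh : A.IsMC (tensorGrading (interval K).grading 𝒲) (TensorProduct.map (interval K).parity t)
      (extendBrackets (interval K) t ℓ) h) (j : A.Index) :
    IsMCPath (tensorGrading (A.level j).grading 𝒲) (fun m => tensorFil (A.augPow j m) V)
      (A.nilp j) (extendBrackets (A.level j) t ℓ) (fun c => pathValue (A.level j) c (h j))
      (fun c => pathVelocity (A.level j) c (h j)) := by
  have ht' := tensorGrading_parity (interval K).isParity ht
  have hℓ' : IsLInfty (tensorGrading (interval K).grading 𝒲) (extendBrackets (interval K) t ℓ) :=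
    hℓ.extBrackets (interval K).isGradedComm (interval K).isDifferential ht
  have hL := A.isFilteredLInfty j ht hℓ
  have hL' := A.isFilteredLInfty j ht' hℓ'
  obtain ⟨⟨⟨h1, -⟩, h2⟩, h3⟩ := hh
  have h1 := h1 j
  have h2 : (A.aug j).toLinearMap.rTensor _ (h j) = 0 := by
    have := Submodule.mem_iInf _ |>.1 h2 j
    exact this
  have h3 := h3 j
  simp only [brackets_apply] at h3
  have hv : ∀ c, pathValue (A.level j) c (h j) ∈ tensorGrading (A.level j).grading 𝒲 0 :=
    fun c => pathValue_mem c h1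
  have hq : ∀ c, pathVelocity (A.level j) c (h j) ∈ tensorGrading (A.level j).grading 𝒲 1 :=
    fun c => by simpa using pathVelocity_mem c h1
  refine ⟨hv, fun c => pathValue_mem_fil h2, fun c => ?_, hq, fun c => pathVelocity_mem_fil h2,
    isPolyFun_pathVelocity _ _, ?_⟩
  · have := congrArg (pathValue (A.level j) c) h3
    rw [map_sum, map_zero] at this
    rw [← this]
    refine Finset.sum_congr rfl fun i _ => ?_
    rw [map_smul, pathValue_bracket]
  · refine (congrArg (HasPolyDeriv _) (funext fun c => ?_)).mpr (hasPolyDeriv_pathValue _ (h j))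
    -- Two more terms of the Maurer-Cartan equation, which vanish, separate the unary bracket.
    have h4 : ∑ i ∈ Finset.range (A.nilp j + 2), ((i.factorial : K))⁻¹ •
        extendBrackets (A.level j) (TensorProduct.map (interval K).parity t)
          (extendBrackets (interval K) t ℓ) i (fun _ => h j) = 0 := by
      rw [← h3]
      symm
      refine Finset.sum_subset (Finset.range_mono (by omega)) fun i _ hi => ?_
      have h5 := hL'.iterate_contract_eq_zero (v := h j) (mem_tensorFil_one_iff.2 h2)
        (i := i) (by simpa using hi) (n := 0) ![]
      rw [iterate_contract_apply] at h5
      refine (congrArg _ (Eq.trans ?_ h5)).trans (smul_zero _)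
      refine apply_eq_of_cast (extendBrackets (A.level j)
        (TensorProduct.map (interval K).parity t) (extendBrackets (interval K) t ℓ))
        (Nat.add_zero i).symm fun p => ?_
      have : Fin.cast (Nat.add_zero i).symm p = Fin.castAdd 0 p := Fin.ext rfl
      rw [this, Fin.append_left]
    have h5 := congrArg (pathVelocity (A.level j) c) h4
    rw [map_sum, map_zero] at h5
    simp only [map_smul, pathVelocity_bracket ht c ℓ h1, smul_add, smul_neg,
      Finset.sum_add_distrib, Finset.sum_neg_distrib, smul_ite, smul_zero] at h5
    rw [Finset.sum_ite_eq' (Finset.range (A.nilp j + 2)) 1, if_pos (by simp), Nat.factorial_one,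
      Nat.cast_one, inv_one, one_smul, neg_add_eq_zero] at h5
    rw [← h5, ← hL.twistBy_eq (pathValue_mem_fil h2) (Nat.le_succ _), twistBy_apply,
      Finset.sum_range_succ' (n := A.nilp j + 1), Finset.univ_eq_empty, Finset.sum_empty, smul_zero,
      add_zero]
    refine Finset.sum_congr rfl fun i _ => ?_
    have hs := hL.isLInfty.gradedSymm
    simp only [hs.single_arg (hq c) (hv c), Finset.sum_const, Finset.card_univ, Fintype.card_fin]
    rw [← Nat.cast_smul_eq_nsmul K, smul_smul, iterate_contract_apply]
    have h6 : (Fin.append (fun _ => pathValue (A.level j) c (h j))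
        (fun _ => pathVelocity (A.level j) c (h j)) : Fin (i + 1) → _) =
        fun k => if k = Fin.natAdd i 0 then pathVelocity (A.level j) c (h j) else
          pathValue (A.level j) c (h j) := by
      funext k
      refine Fin.addCases (fun k => ?_) (fun k => ?_) k
      · rw [Fin.append_left, if_neg]
        intro hk
        have := congrArg Fin.val hk
        simp at this
        omega
      · rw [Fin.append_right, if_pos]
        rw [Subsingleton.elim k 0]
    rw [h6, hs.single_arg (hq c) (hv c), Nat.factorial_succ, Nat.cast_mul, mul_inv, mul_right_comm,
      inv_mul_cancel₀ ((Nat.cast_ne_zero (R := K)).2 (Nat.succ_ne_zero i)), one_mul]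

end FormalCDGA

/-! ### Passage to the inverse limit -/

namespace FormalCDGA

variable {K : Type u} [Field K] [CharZero K] {V : Type v} [AddCommGroup V] [Module K V]
  {𝒲 : ℤ → Submodule K V} {t : V →ₗ[K] V} {ℓ : Brackets K V} {A : FormalCDGA.{u, w, x} K}

theorem cons_level {n : ℕ} (y : A.Tensor V) (x : Fin n → A.Tensor V) (j : A.Index) :
    (fun r => (Fin.cons y x : Fin (n + 1) → A.Tensor V) r j) =
      Fin.cons (y j) fun r => x r j := by
  funext r
  refine Fin.cases rfl (fun r => rfl) r

/-- Brackets on the inverse limit that are `L∞` structures in all levels. -/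
theorem isLInfty_of_levels {𝒯 : ℤ → Submodule K (A.Tensor V)}
    (h𝒯 : ∀ d, ∀ x ∈ 𝒯 d, ∀ j, x j ∈ tensorGrading (A.level j).grading 𝒲 d)
    {b : Brackets K (A.Tensor V)} {c : ∀ j, Brackets K ((A.level j).carrier ⊗[K] V)}
    (hb : ∀ n x j, b n x j = c j n fun r => x r j)
    (hc : ∀ j, IsLInfty (tensorGrading (A.level j).grading 𝒲) (c j))
    (hd : ∀ (n : ℕ) (d : Fin n → ℤ) (x : Fin n → A.Tensor V), (∀ i, x i ∈ 𝒯 (d i)) →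
      b n x ∈ 𝒯 ((∑ i, d i) - 1)) : IsLInfty 𝒯 b where
  zero x := by
    funext j
    rw [hb, (hc j).zero]
    rfl
  degree := hd
  symm n d x hx σ := by
    funext j
    rw [Pi.smul_apply, hb, hb]
    exact (hc j).symm n d (fun r => x r j) (fun r => h𝒯 _ _ (hx r) j) σ
  jacobi n d x hx := by
    funext j
    rw [Finset.sum_apply, Pi.zero_apply,
      ← (hc j).jacobi n d (fun r => x r j) fun r => h𝒯 _ _ (hx r) j]
    refine Finset.sum_congr rfl fun S _ => ?_
    rw [Pi.smul_apply, hb, cons_level, hb]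
    rfl

/-- Components on the inverse limit that are `L∞` morphisms in all levels. -/
theorem isLInftyHom_of_levels {𝒯 : ℤ → Submodule K (A.Tensor V)}
    (h𝒯 : ∀ d, ∀ x ∈ 𝒯 d, ∀ j, x j ∈ tensorGrading (A.level j).grading 𝒲 d)
    {b b' : Brackets K (A.Tensor V)} {c c' : ∀ j, Brackets K ((A.level j).carrier ⊗[K] V)}
    {φ : Components K (A.Tensor V) (A.Tensor V)}
    {f : ∀ j, Components K ((A.level j).carrier ⊗[K] V) ((A.level j).carrier ⊗[K] V)}
    (hb : ∀ n x j, b n x j = c j n fun r => x r j) (hb' : ∀ n x j, b' n x j = c' j n fun r => x r j)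
    (hφ : ∀ n x j, φ n x j = f j n fun r => x r j)
    (hf : ∀ j, IsLInftyHom (tensorGrading (A.level j).grading 𝒲) (c j)
      (tensorGrading (A.level j).grading 𝒲) (c' j) (f j))
    (hd : ∀ (n : ℕ) (d : Fin n → ℤ) (x : Fin n → A.Tensor V), (∀ i, x i ∈ 𝒯 (d i)) →
      φ n x ∈ 𝒯 (∑ i, d i)) : IsLInftyHom 𝒯 b 𝒯 b' φ where
  zero x := by
    funext j
    rw [hφ, (hf j).zero]
    rfl
  degree := hd
  symm n d x hx σ := by
    funext j
    rw [Pi.smul_apply, hφ, hφ]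
    exact (hf j).symm n d (fun r => x r j) (fun r => h𝒯 _ _ (hx r) j) σ
  compat n d x hx := by
    funext j
    have h := (hf j).compat n d (fun r => x r j) fun r => h𝒯 _ _ (hx r) j
    rw [Finset.sum_apply, Finset.sum_apply]
    refine (Finset.sum_congr rfl fun S _ => ?_).trans (h.trans
      (Finset.sum_congr rfl fun k _ => ?_))
    · rw [Pi.smul_apply, hφ, cons_level, hb]
      rfl
    · rw [Pi.smul_apply, Finset.sum_apply]
      refine congrArg _ (Finset.sum_congr rfl fun p _ => ?_)
      rw [Pi.smul_apply, hb']
      simp only [hφ]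
      rfl

/-- A flow gives an `L∞` morphism. -/
theorem isLInftyHom_of_flow {T : Type v} [AddCommGroup T] [Module K T]
    {𝒯 : ℤ → Submodule K T} {s : T →ₗ[K] T} {c c' θ f : K → Components K T T}
    (hf : IsFlow 𝒯 s c c' θ f) (hs : IsParity 𝒯 s) (z : K) :
    IsLInftyHom 𝒯 (c 0) 𝒯 (c z) (f z) where
  zero := hf.zero z
  degree n d x hx := by simpa using hf.degree z n d x hx
  symm := hf.symm z
  compat n d x hx := by
    have h := hf.compat hs z hx
    rwa [insertion_apply hs _ _ hx, comp_apply hs _ _ hx] at h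

theorem twist_apply (t : V →ₗ[K] V) (ℓ : Brackets K V) (ξ : A.Tensor V) {n : ℕ}
    (x : Fin n → A.Tensor V) (j : A.Index) : A.twist t ℓ ξ n x j =
      twistBy (A.nilp j) (ξ j) (extendBrackets (A.level j) t ℓ) n fun r => x r j := by
  rw [twistBy_apply, twist, MultilinearMap.pi_apply, sum_apply]
  refine Finset.sum_congr rfl fun i _ => ?_
  rw [iterate_contract_apply, smul_apply]
  congr 1
  change A.brackets t ℓ (i + n) _ j = _
  rw [brackets_apply]
  congr 1
  funext p
  refine Fin.addCases (fun p => ?_) (fun p => ?_) p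
  · rw [Fin.append_left]
    simp
  · rw [Fin.append_right]
    simp

/-- The transition maps preserve twisting. The twisting series of the two levels are truncated at
different places, but the additional terms vanish. -/
theorem trans_twistBy (ht : IsParity 𝒲 t) (hℓ : IsLInfty 𝒲 ℓ) {i j : A.Index} (h : i ≤ j)
    {y : (A.level j).carrier ⊗[K] V} (hy : y ∈ tensorFil (A.augPow j 1) V)
    (hy' : (A.trans h).toLinearMap.rTensor V y ∈ tensorFil (A.augPow i 1) V) {n : ℕ}
    (x : Fin n → (A.level j).carrier ⊗[K] V) :
    (A.trans h).toLinearMap.rTensor V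
      (twistBy (A.nilp j) y (extendBrackets (A.level j) t ℓ) n x) =
      twistBy (A.nilp i) ((A.trans h).toLinearMap.rTensor V y) (extendBrackets (A.level i) t ℓ) n
        fun r => (A.trans h).toLinearMap.rTensor V (x r) := by
  rw [← (A.isFilteredLInfty j ht hℓ).twistBy_eq hy (le_max_left _ (A.nilp i)),
    ← (A.isFilteredLInfty i ht hℓ).twistBy_eq hy' (le_max_right (A.nilp j) _), twistBy_apply,
    twistBy_apply, map_sum]
  refine Finset.sum_congr rfl fun k _ => ?_
  rw [map_smul, iterate_contract_apply, iterate_contract_apply, trans_extendBrackets]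
  congr 2
  funext p
  refine Fin.addCases (fun p => ?_) (fun p => ?_) p
  · rw [Fin.append_left, Fin.append_left]
  · rw [Fin.append_right, Fin.append_right]

end FormalCDGA

namespace FormalCDGA

variable {K : Type u} [Field K] [CharZero K] {V : Type v} [AddCommGroup V] [Module K V]
  {𝒲 : ℤ → Submodule K V} {t : V →ₗ[K] V} {ℓ : Brackets K V} {A : FormalCDGA.{u, w, x} K}

theorem trans_pathVelocity {i j : A.Index} (h : i ≤ j) (c : K)
    (y : (A.level j).carrier ⊗[K] ((interval K).carrier ⊗[K] V)) :
    (A.trans h).toLinearMap.rTensor V (pathVelocity (A.level j) c y) =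
      pathVelocity (A.level i) c ((A.trans h).toLinearMap.rTensor _ y) := by
  induction y using TensorProduct.induction_on with
  | zero => simp
  | tmul b u =>
    simp only [TensorProduct.map_tmul, LinearMap.rTensor_tmul, AlgHom.toLinearMap_apply]
    rw [CDGA.parity_natural (A.trans h) (A.trans_grading h)]
  | add y z h1 h2 => simp only [map_add, h1, h2]

/-- A family of `L∞` isomorphisms `f j` from `b j` to `b' j` that are linear over the levels,
compatible with the transition maps, and the identity modulo the augmentation ideals. -/
structure IsLevelIso (𝒲 : ℤ → Submodule K V)
    (b b' : ∀ j, Brackets K ((A.level j).carrier ⊗[K] V))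
    (f : ∀ j, Components K ((A.level j).carrier ⊗[K] V) ((A.level j).carrier ⊗[K] V)) : Prop where
  hom : ∀ j, IsLInftyHom (tensorGrading (A.level j).grading 𝒲) (b j)
    (tensorGrading (A.level j).grading 𝒲) (b' j) (f j)
  bijOn : ∀ j d, Set.BijOn (fun y => f j 1 fun _ => y) (tensorGrading (A.level j).grading 𝒲 d)
    (tensorGrading (A.level j).grading 𝒲 d)
  linear : ∀ j m, ∀ a ∈ (A.level j).grading m, IsSlotLinear (tensorGrading (A.level j).grading 𝒲)
    ((LinearMap.mulLeft K a).rTensor V) 0 0 (f j)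
  trans : ∀ (i j : A.Index) (h : i ≤ j) (n : ℕ) (x : Fin n → (A.level j).carrier ⊗[K] V),
    (A.trans h).toLinearMap.rTensor V (f j n x) =
      f i n fun r => (A.trans h).toLinearMap.rTensor V (x r)
  sub_mem : ∀ j n x, f j n x - idComp K _ n x ∈ tensorFil (A.augPow j 1) V

/-- The gauge transformations along a homotopy, in all levels: the flows at time `1`. -/
theorem IsMC.exists_levelIso (ht : IsParity 𝒲 t) (hℓ : IsLInfty 𝒲 ℓ)
    {h : A.Tensor ((interval K).carrier ⊗[K] V)}
    (hh : A.IsMC (tensorGrading (interval K).grading 𝒲) (TensorProduct.map (interval K).parity t)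
      (extendBrackets (interval K) t ℓ) h) :
    ∃ f, IsLevelIso (A := A) 𝒲
      (fun j => twistBy (A.nilp j) (pathValue (A.level j) 0 (h j)) (extendBrackets (A.level j) t ℓ))
      (fun j => twistBy (A.nilp j) (pathValue (A.level j) 1 (h j)) (extendBrackets (A.level j) t ℓ))
      f := by
  have hp := fun j => IsMC.isMCPath ht hℓ hh j
  have hL := fun j => A.isFilteredLInfty j ht hℓ
  have hT := fun j => tensorGrading_parity (A.level j).isParity ht
  choose b' f hf hf0 hlin using fun j => (hp j).exists_flow (hT j) (hL j)
  refine ⟨fun j => f j 1, fun j => isLInftyHom_of_flow (hf j) (hT j) 1, fun j d => ?_,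
    fun j m a ha => hlin j 1 m _ (A.isScalar_smul j 𝒲 t ℓ ha), fun i j hij n x => ?_,
    fun j n x => ?_⟩
  · set g : (A.level j).carrier ⊗[K] V →ₗ[K] (A.level j).carrier ⊗[K] V :=
      (MultilinearMap.ofSubsingleton K _ _ (0 : Fin 1)).symm (f j 1 1)
    have hg : ∀ y, g y = f j 1 1 fun _ => y := fun y => rfl
    refine bijOn_of_sub_mem (𝓕 := fun m => tensorFil (A.augPow j m) V) (g := g) (hL j).fil_zero (hL j).fil_last (fun y hy => ?_)
      fun m y hy hym => ?_
    · have := (hf j).degree 1 1 (fun _ => d) (fun _ => y) fun _ => hy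
      rw [hg]
      simpa using this
    · exact flow_one_sub_mem (hT j) (hL j).fil_zero (hL j).anti
        (fun z k y i m hy => gaugeField_mem (hL j) ((hp j).mem_fil z) ((hp j).gauge_mem_fil z) y i m hy)
        (hf j).deriv (hf0 j) hy hym 1
  · refine flow_natural (hL i).fil_zero (hL i).fil_last
      (fun z k y r m hy => gaugeField_mem (hL i) ((hp i).mem_fil z) ((hp i).gauge_mem_fil z) y r m hy)
      (trans_tensorParity hij t) (fun z k y => ?_) (hf j).deriv (hf i).deriv (hf0 j) (hf0 i) 1 x
    rcases k with _ | k
    · exact map_zero _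
    · have hhij := hh.1.1.2 i j hij
      have e1 : (A.trans hij).toLinearMap.rTensor V (pathValue (A.level j) z (h j)) =
          pathValue (A.level i) z (h i) := by rw [rTensor_pathValue, hhij]
      have e2 : (A.trans hij).toLinearMap.rTensor V (pathVelocity (A.level j) z (h j)) =
          pathVelocity (A.level i) z (h i) := by rw [trans_pathVelocity, hhij]
      have e3 := trans_twistBy ht hℓ hij ((hp j).mem_fil z) (e1.symm ▸ (hp i).mem_fil z)
        (Fin.cons (pathVelocity (A.level j) z (h j)) y)
      refine e3.trans ?_
      rw [e1]
      refine congrArg _ (funext fun r => ?_)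
      refine Fin.cases ?_ (fun r => ?_) r
      · exact e2
      · rfl
  · exact flow_sub_mem (fun z k y => gaugeField_mem_one (hL j) ((hp j).mem_fil z)
      ((hp j).gauge_mem_fil z) y) (hf j).deriv (hf0 j) 1 x

/-- The components on the inverse limit that are given by components on the levels. -/
def limitComponents
    (f : ∀ j, Components K ((A.level j).carrier ⊗[K] V) ((A.level j).carrier ⊗[K] V)) :
    Components K (A.Tensor V) (A.Tensor V) := fun n =>
  MultilinearMap.pi fun j => (f j n).compLinearMap fun _ => LinearMap.proj j

theorem limitComponents_apply
    (f : ∀ j, Components K ((A.level j).carrier ⊗[K] V) ((A.level j).carrier ⊗[K] V)) {n : ℕ}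
    (x : Fin n → A.Tensor V) (j : A.Index) :
    limitComponents f n x j = f j n fun r => x r j := rfl

theorem mem_tensor_iff {x : A.Tensor V} {d : ℤ} :
    x ∈ A.tensor 𝒲 d ↔ x ∈ A.unitalTensor 𝒲 d ∧ ∀ j, x j ∈ tensorFil (A.augPow j 1) V := by
  simp only [tensor, Submodule.mem_inf, Submodule.mem_iInf, mem_tensorFil_one_iff]
  rfl

variable {f : ∀ j, Components K ((A.level j).carrier ⊗[K] V) ((A.level j).carrier ⊗[K] V)}
  {b b' : ∀ j, Brackets K ((A.level j).carrier ⊗[K] V)}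

theorem IsLevelIso.map_mem (hf : IsLevelIso 𝒲 b b' f) {n : ℕ} {d : Fin n → ℤ}
    {x : Fin n → A.Tensor V} (hx : ∀ i, x i ∈ A.unitalTensor 𝒲 (d i)) :
    limitComponents f n x ∈ A.unitalTensor 𝒲 (∑ i, d i) := by
  refine ⟨fun j => (hf.hom j).degree n d _ fun r => (hx r).1 j, fun i j h => ?_⟩
  rw [limitComponents_apply, hf.trans, limitComponents_apply]
  exact congrArg _ (funext fun r => (hx r).2 i j h)

theorem IsLevelIso.map_mem_tensor (hf : IsLevelIso 𝒲 b b' f) {n : ℕ} {d : Fin n → ℤ}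
    {x : Fin n → A.Tensor V} (hx : ∀ i, x i ∈ A.tensor 𝒲 (d i)) :
    limitComponents f n x ∈ A.tensor 𝒲 (∑ i, d i) := by
  rw [mem_tensor_iff]
  refine ⟨hf.map_mem fun i => (mem_tensor_iff.1 (hx i)).1, fun j => ?_⟩
  have h1 : idComp K _ n (fun r => x r j) ∈ tensorFil (A.augPow j 1) V := by
    by_cases hn : n = 1
    · subst hn
      exact (mem_tensor_iff.1 (hx 0)).2 j
    · rw [unaryBracket_of_ne _ hn]
      exact zero_mem _
  have h2 := add_mem (hf.sub_mem j n fun r => x r j) h1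
  rwa [sub_add_cancel] at h2

/-- Isomorphisms of the levels induce an isomorphism of the inverse limits. -/
theorem IsLevelIso.areIsomorphic (hf : IsLevelIso 𝒲 b b' f) {𝒯 : ℤ → Submodule K (A.Tensor V)}
    (h𝒯 : ∀ d, 𝒯 d ≤ A.unitalTensor 𝒲 d) {c c' : Brackets K (A.Tensor V)}
    (hc : ∀ n x j, c n x j = b j n fun r => x r j) (hc' : ∀ n x j, c' n x j = b' j n fun r => x r j)
    (hI : IsLInfty 𝒯 c) (hI' : IsLInfty 𝒯 c')
    (hmem : ∀ (n : ℕ) (d : Fin n → ℤ) (x : Fin n → A.Tensor V), (∀ i, x i ∈ 𝒯 (d i)) →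
      limitComponents f n x ∈ 𝒯 (∑ i, d i))
    (hsurj : ∀ d, ∀ x ∈ A.unitalTensor 𝒲 d, limitComponents f 1 (fun _ => x) ∈ 𝒯 d → x ∈ 𝒯 d) :
    A.AreIsomorphic 𝒯 c c' := by
  have hlev : ∀ d, ∀ x ∈ 𝒯 d, ∀ j, x j ∈ tensorGrading (A.level j).grading 𝒲 d :=
    fun d x hx => (h𝒯 d hx).1
  refine ⟨hI, hI', limitComponents f, ⟨isLInftyHom_of_levels hlev hc hc'
    (fun _ => limitComponents_apply f) hf.hom hmem, fun d => ⟨fun x hx => ?_, fun x hx y hy hxy => ?_,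
      fun y hy => ?_⟩⟩, fun n m a ha d x hx => ?_, fun n j => ⟨j, fun d x hx h => ?_⟩,
    fun j => ⟨j, fun d x hx h => ?_⟩⟩
  · simpa using hmem 1 (fun _ => d) (fun _ => x) fun _ => hx
  · funext j
    exact (hf.bijOn j d).injOn (hlev d x hx j) (hlev d y hy j) (congrFun hxy j)
  · -- The preimages in the levels are unique, and hence compatible with the transition maps.
    choose z hz hzy using fun j => (hf.bijOn j d).surjOn (hlev d y hy j)
    have hzu : z ∈ A.unitalTensor 𝒲 d := by
      refine ⟨hz, fun i j h => (hf.bijOn i d).injOn (trans_mem h (hz j)) (hz i) ?_⟩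
      have e1 := hf.trans i j h 1 fun _ => z j
      have e2 : f j 1 (fun _ => z j) = y j := hzy j
      rw [e2, (h𝒯 d hy).2 i j h] at e1
      exact e1.symm.trans (hzy i).symm
    have e : limitComponents f 1 (fun _ => z) = y := funext hzy
    exact ⟨z, hsurj d z hzu (e.symm ▸ hy), e⟩
  · funext j
    rw [limitComponents_apply, limitComponents_apply]
    have e : (fun r => Function.update x 0 (fun j => a j • x 0 j) r j) =
        Fin.cons ((LinearMap.mulLeft K (a j)).rTensor V (x 0 j)) fun r => x r.succ j := by
      funext r
      refine Fin.cases ?_ (fun r => ?_) r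
      · rw [Function.update_self, smul_eq_rTensor]
        rfl
      · rw [Function.update_of_ne (Fin.succ_ne_zero r)]
        rfl
    have e' : (fun r => x r j) = Fin.cons (x 0 j) fun r => x r.succ j := by
      funext r
      refine Fin.cases rfl (fun r => rfl) r
    rw [e, e', smul_eq_rTensor]
    have := hf.linear j m (a j) (ha.1 j) n (Nat.zero_le n) (d 0) (fun r => d r.succ) (x 0 j)
      (fun r => x r.succ j) (hlev _ _ (hx 0) j) fun r => hlev _ _ (hx _) j
    rwa [sg_zero, one_smul] at this
  · obtain ⟨r, hr⟩ := h
    exact (f j n).map_coord_zero r hr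
  · refine (hf.bijOn j d).injOn (hlev d x hx j) (zero_mem _) ?_
    refine Eq.trans h ((f j 1).map_coord_zero 0 rfl).symm

theorem twist_mem (ht : IsParity 𝒲 t) (hℓ : IsLInfty 𝒲 ℓ) {ξ : A.Tensor V} (hξ : A.IsMC 𝒲 t ℓ ξ)
    {n : ℕ} {d : Fin n → ℤ} {x : Fin n → A.Tensor V} (hx : ∀ i, x i ∈ A.unitalTensor 𝒲 (d i)) :
    A.twist t ℓ ξ n x ∈ A.unitalTensor 𝒲 (∑ i, d i - 1) := by
  have hξ1 := mem_tensor_iff.1 hξ.1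
  refine ⟨fun j => ?_, fun i j h => ?_⟩
  · rw [twist_apply, twistBy_apply]
    exact sum_mem fun i _ => Submodule.smul_mem _ _ (iterate_contract_hasDegree
      (A.isFilteredLInfty j ht hℓ).isLInfty.degree (hξ1.1.1 j) i n d _ fun r => (hx r).1 j)
  · have e := hξ1.1.2 i j h
    rw [twist_apply, twist_apply, trans_twistBy ht hℓ h (hξ1.2 j) (e.symm ▸ hξ1.2 i), e]
    exact congrArg _ (funext fun r => (hx r).2 i j h)

theorem IsMC.isLInfty_level (ht : IsParity 𝒲 t) (hℓ : IsLInfty 𝒲 ℓ) {ξ : A.Tensor V}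
    (hξ : A.IsMC 𝒲 t ℓ ξ) (j : A.Index) : IsLInfty (tensorGrading (A.level j).grading 𝒲)
      (twistBy (A.nilp j) (ξ j) (extendBrackets (A.level j) t ℓ)) :=
  (A.isFilteredLInfty j ht hℓ).twistBy (tensorGrading_parity (A.level j).isParity ht)
    (hξ.1.1.1 j) ((mem_tensor_iff.1 hξ.1).2 j) (hξ.2 j)

/-- The twisted brackets on `Ã ⊗ W` form an `L∞` structure. -/
theorem IsMC.isLInfty_unital (ht : IsParity 𝒲 t) (hℓ : IsLInfty 𝒲 ℓ) {ξ : A.Tensor V}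
    (hξ : A.IsMC 𝒲 t ℓ ξ) : IsLInfty (A.unitalTensor 𝒲) (A.twist t ℓ ξ) :=
  isLInfty_of_levels (𝒯 := A.unitalTensor 𝒲) (fun _ _ hx => hx.1) (fun _ x j => twist_apply t ℓ ξ x j)
    (IsMC.isLInfty_level ht hℓ hξ) fun _ _ _ hx => twist_mem ht hℓ hξ hx

/-- The twisted brackets restrict to an `L∞` structure on `A ⊗ W`. -/
theorem IsMC.isLInfty_tensor (ht : IsParity 𝒲 t) (hℓ : IsLInfty 𝒲 ℓ) {ξ : A.Tensor V}
    (hξ : A.IsMC 𝒲 t ℓ ξ) : IsLInfty (A.tensor 𝒲) (A.twist t ℓ ξ) := by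
  refine isLInfty_of_levels (fun _ _ hx => (mem_tensor_iff.1 hx).1.1)
    (fun n x j => twist_apply t ℓ ξ x j) (IsMC.isLInfty_level ht hℓ hξ) fun n d x hx =>
      mem_tensor_iff.2 ⟨twist_mem ht hℓ hξ fun i => (mem_tensor_iff.1 (hx i)).1, fun j => ?_⟩
  rw [twist_apply]
  by_cases hn : n = 0
  · subst hn
    rw [(IsMC.isLInfty_level ht hℓ hξ j).zero]
    exact zero_mem _
  · exact (A.isFilteredLInfty j ht hℓ).twistBy_mem ((mem_tensor_iff.1 hξ.1).2 j) _ hn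
      fun i => (mem_tensor_iff.1 (hx i)).2 j

end FormalCDGA

end

end MCTwist

theorem mainTheorem6 {K : Type u} [Field K] [CharZero K]
    {V : Type v} [AddCommGroup V] [Module K V] (L : MCTwist.LInftyAlgebra K V)
    (A : MCTwist.FormalCDGA.{u, w, x} K)
    (ξ η : A.Tensor V) (hξ : ξ ∈ L.MC A) (hη : η ∈ L.MC A) (h : L.Homotopic A ξ η) :
    A.AreIsomorphic (A.unitalTensor (MCTwist.susp L.grading)) (L.twisted A ξ) (L.twisted A η) ∧
    A.AreIsomorphic (A.tensor (MCTwist.susp L.grading)) (L.twisted A ξ) (L.twisted A η) := by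
  have ht := L.isParity
  have hℓ := L.isLInfty
  obtain ⟨H, hH, h0, h1⟩ := h
  obtain ⟨f, hf⟩ := MCTwist.FormalCDGA.IsMC.exists_levelIso ht hℓ hH
  have hc0 : ∀ n x j, L.twisted A ξ n x j = MCTwist.twistBy (A.nilp j)
      (MCTwist.pathValue (A.level j) 0 (H j)) (MCTwist.extendBrackets (A.level j) L.parity L.bracket)
      n fun r => x r j := fun n x j => by
    rw [MCTwist.pathValue, h0]
    exact MCTwist.FormalCDGA.twist_apply _ _ _ x j
  have hc1 : ∀ n x j, L.twisted A η n x j = MCTwist.twistBy (A.nilp j)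
      (MCTwist.pathValue (A.level j) 1 (H j)) (MCTwist.extendBrackets (A.level j) L.parity L.bracket)
      n fun r => x r j := fun n x j => by
    rw [MCTwist.pathValue, h1]
    exact MCTwist.FormalCDGA.twist_apply _ _ _ x j
  refine ⟨hf.areIsomorphic (fun _ => le_rfl) hc0 hc1
    (MCTwist.FormalCDGA.IsMC.isLInfty_unital ht hℓ hξ)
    (MCTwist.FormalCDGA.IsMC.isLInfty_unital ht hℓ hη) (fun n d x hx => hf.map_mem hx)
    fun d x hx _ => hx, hf.areIsomorphic (fun _ => inf_le_left) hc0 hc1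
    (MCTwist.FormalCDGA.IsMC.isLInfty_tensor ht hℓ hξ)
    (MCTwist.FormalCDGA.IsMC.isLInfty_tensor ht hℓ hη) (fun n d x hx => hf.map_mem_tensor hx)
    fun d x hx hy => ?_⟩
  -- The isomorphism is the identity modulo the augmentation ideal.
  refine MCTwist.FormalCDGA.mem_tensor_iff.2 ⟨hx, fun j => ?_⟩
  have h2 := sub_mem ((MCTwist.FormalCDGA.mem_tensor_iff.1 hy).2 j) (hf.sub_mem j 1 fun _ => x j)
  rw [MCTwist.FormalCDGA.limitComponents_apply, sub_sub_cancel] at h2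
  exact h2
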